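/- **Setting.** Let $(X,\mathfrak F,\mu)$ be a $\sigma$-finite, separable measure space (i.e. $L^2(X,\mu)$ is separable) with a measurable time function $t:X\to\mathbb R_+$ all of whose level sets are $\mu$-null (in particular this holds if $\mu$ is absolutely continuous with respect to $t$). Put $X^t=\{x: t(x)<t\}$. A chain is a finite set $\varkappa=\{x_1,\dots,x_n\}\subset X$ with $t(x_1)<\dots<t(x_n)$; on the space $\mathcal X$ of chains let $d\varkappa=\prod_{x\in\varkappa}dx$, with mass $1$ at $\emptyset$, and let $\mathcal X^t=\{\varkappa\subset X^t\}$. Let $(\mathrm K_x)_{x\in X}$ be a measurable field of Hilbert spaces (given by a fundamental sequence of sections) and $\mathrm K^\otimes(\varkappa)=\bigotimes_{x\in\varkappa}\mathrm K_x$. Functions on $X$ are extended multiplicatively to chains, $p(\varkappa)=\prod_{x\in\varkappa}p(x)$. Let $\mathcal P_0$ be an additive semigroup, containing $0$, of essentially measurable functions $X\to[0,\infty)$, and $\mathcal P_1=1+\mathcal P_0$. For a weight $p$, $\mathrm F(p)$ is the space of essentially measurable $f:\varkappa\mapsto f(\varkappa)\in\mathrm K^\otimes(\varkappa)$ with $\|f\|(p)=(\int\|f(\varkappa)\|^2p(\varkappa)\,d\varkappa)^{1/2}<\infty$;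 $\mathrm F^+=\bigcap_{p\in\mathcal P_1}\mathrm F(p)$ with the projective, and $\mathrm F_-=\bigcup_{p\in\mathcal P_1}\mathrm F(1/p)$ with the inductive topology; $\langle f|h\rangle=\int\langle f(\varkappa)|h(\varkappa)\rangle d\varkappa$. For an operator $A$ from $\mathrm F(p)$ to $\mathrm F(1/p)$, possibly with additional tensor factors $\mathrm K^\otimes(\sigma)$, $\mathrm K^\otimes(\tau)$ on the two sides, $\|A\|_p$ is its operator norm. **Multiple integral.** For (almost all) tables $\boldsymbol\vartheta=\begin{pmatrix}\vartheta^-_+&\vartheta^-_\circ\\ \vartheta^\circ_+&\vartheta^\circ_\circ\end{pmatrix}$ of chains let $$B(\boldsymbol\vartheta):\mathrm F(p)\otimes\mathrm K^\otimes(\vartheta^-_\circ)\otimes\mathrm K^\otimes(\vartheta^\circ_\circ)\to\mathrm F(1/p)\otimes\mathrm K^\otimes(\vartheta^\circ_\circ)\otimes\mathrm K^\otimes(\vartheta^\circ_+)$$ be bounded operators, depending measurably on $\boldsymbol\vartheta$ (as a measurable field of operators with measurable norm), where $p\in\mathcal P_1$. Suppose that $B$ is locally integrable: there are $r,s>0$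 with $r^{-1},s^{-1}\in\mathcal P_0$ such that for all $t<\infty$ $$\|B\|^s_{p,t}(r)=\int_{\mathcal X^t}\Big(\int_{\mathcal X^t}\int_{\mathcal X^t}\operatorname*{ess\,sup}_{\vartheta^\circ_\circ\in\mathcal X^t}\big(s(\vartheta^\circ_\circ)\|B(\boldsymbol\vartheta)\|_p\big)^2\,r(\vartheta^\circ_+\sqcup\vartheta^-_\circ)\,d\vartheta^\circ_+\,d\vartheta^-_\circ\Big)^{1/2}d\vartheta^-_+<\infty .$$ With $\dot h(\vartheta)(\varkappa)=h(\varkappa\sqcup\vartheta)$ define $$[\iota_0^t(B)h](\varkappa)=\sum_{\vartheta^\circ_\circ\sqcup\vartheta^\circ_+\subseteq\varkappa\cap X^t}\int_{\mathcal X^t}\int_{\mathcal X^t}[B(\boldsymbol\vartheta)\dot h(\vartheta^-_\circ\sqcup\vartheta^\circ_\circ)](\varkappa\setminus\vartheta^\circ_\circ\setminus\vartheta^\circ_+)\,d\vartheta^-_+\,d\vartheta^-_\circ ,$$ and by the same formula for kernels with additional tensor factors (a jointly measurable version of the integrand is used). **Theorem.** Let $t<\infty$, and let $q\in\mathcal P_1$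 be arbitrary with $q\ge r^{-1}+p+s^{-1}$. 1. $T_t=\iota_0^t(B)$ is a continuous operator $\mathrm F^+\to\mathrm F_-$. The integral converges (absolutely, for almost every $\varkappa$) for every $h\in\mathrm F(q)$ and defines a bounded operator $\mathrm F(q)\to\mathrm F(1/q)$ with $\|T_t\|_q\le\|B\|^s_{p,t}(r)$. 2. Let $B^\star(\boldsymbol\vartheta)=B(\boldsymbol\vartheta')^*$, where $\boldsymbol\vartheta'$ is $\boldsymbol\vartheta$ with $\vartheta^-_\circ$ and $\vartheta^\circ_+$ exchanged. Then $B^\star$ is locally integrable, $\|B^\star\|^s_{p,t}(r)=\|B\|^s_{p,t}(r)$, $\iota_0^t(B^\star)$ is continuous $\mathrm F^+\to\mathrm F_-$, converges on $\mathrm F(q)$, and is the adjoint of $\iota_0^t(B)$: $\langle\iota_0^t(B^\star)f|h\rangle=\langle f|\iota_0^t(B)h\rangle$ for $f,h\in\mathrm F(q)$. 3. Let $\mathbf x^\mu_\nu$ ($\mu\in\{-,\circ\}$, $\nu\in\{\circ,+\}$) be the table with $\vartheta^\mu_\nu=\{x\}$ and the other entries empty, $\dot B(\mathbf x,\boldsymbol\vartheta)=B(\boldsymbol\vartheta\sqcup\mathbf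 x)$ and $D^\mu_\nu(x)=\iota_0^{t(x)}(\dot B(\mathbf x^\mu_\nu))$. For almost every $x$ these integrals converge on, and are bounded operators between, the spaces $$D^-_+(x):\mathrm F(q)\to\mathrm F(1/q),\quad D^-_\circ(x):\mathrm F(q)\otimes\mathrm K_x\to\mathrm F(1/q),\quad D^\circ_+(x):\mathrm F(q)\to\mathrm F(1/q)\otimes\mathrm K_x,\quad D^\circ_\circ(x):\mathrm F(q)\otimes\mathrm K_x\to\mathrm F(1/q)\otimes\mathrm K_x,$$ their norms are measurable in $x$, and $$\int_{X^t}\|D^-_+(x)\|_q\,dx\le\|B\|^s_{p,t}(r),\qquad \Big(\int_{X^t}\|D(x)\|_q^2\,r(x)\,dx\Big)^{1/2}\le\|B\|^s_{p,t}(r)\ \ (D=D^-_\circ,\,D^\circ_+),\qquad \operatorname*{ess\,sup}_{x\in X^t}s(x)\|D^\circ_\circ(x)\|_q\le\|B\|^s_{p,t}(r).$$ 4. For every $h\in\mathrm F^+$ the integrals below exist and $\iota_0^t(B)h=B(\emptyset)h+i_0^t(\mathbf D)h$, where $$[i_0^t(\mathbf D)h](\varkappa)=\int_{X^t}[D^-_+(x)h+D^-_\circ(x)\dot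 h(x)](\varkappa)\,dx+\sum_{x\in\varkappa\cap X^t}[D^\circ_+(x)h+D^\circ_\circ(x)\dot h(x)](\varkappa\setminus x).$$ -/

import Mathlib

open MeasureTheory
open scoped NNReal ENNReal

namespace FockScale
section Tensor

open scoped ComplexOrder in
theorem posSemidef_gram {n H : Type*} [NormedAddCommGroup H] [InnerProductSpace ℂ H] (v : n → H) :
    (Matrix.of fun i j => inner ℂ (v i) (v j) : Matrix n n ℂ).PosSemidef := by
  refine ⟨by ext i j; simp [Matrix.conjTranspose], fun x => ?_⟩
  have h : (x.sum fun i xi => x.sum fun j xj =>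
      star xi * (Matrix.of fun i j => inner ℂ (v i) (v j) : Matrix n n ℂ) i j * xj) =
      inner ℂ (x.sum fun i xi => xi • v i) (x.sum fun i xi => xi • v i) := by
    simp only [Finsupp.sum, sum_inner]
    refine Finset.sum_congr rfl fun i _ => ?_
    rw [inner_sum]
    refine Finset.sum_congr rfl fun j _ => ?_
    simp only [RCLike.star_def, inner_smul_left, inner_smul_right, Matrix.of_apply]
    ring
  rw [h, inner_self_eq_norm_sq_to_K]
  positivity

variable {ι : Type*} [Fintype ι] (E : ι → Type*) [∀ i, NormedAddCommGroup (E i)]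
  [∀ i, InnerProductSpace ℂ (E i)]

open scoped ComplexOrder in
theorem posSemidef_prod_inner :
    (Matrix.of fun v w : (∀ i, E i) => ∏ i, inner ℂ (v i) (w i)).PosSemidef := by
  classical
  have key : ∀ s : Finset ι,
      (Matrix.of fun v w : (∀ i, E i) => ∏ i ∈ s, inner ℂ (v i) (w i)).PosSemidef := by
    intro s
    induction s using Finset.induction_on with
    | empty =>
      have h := posSemidef_gram (fun _ : (∀ i, E i) => (1 : ℂ))
      have e : (Matrix.of fun v w : (∀ i, E i) => ∏ i ∈ (∅ : Finset ι), inner ℂ (v i) (w i)) =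
          Matrix.of fun _ _ : (∀ i, E i) => inner ℂ (1 : ℂ) (1 : ℂ) := by
        ext v w
        simp
      rw [e]
      exact h
    | insert a s ha ih =>
      have h := (posSemidef_gram (fun v : (∀ i, E i) => v a)).hadamard ih
      have e : (Matrix.of fun v w : (∀ i, E i) => ∏ i ∈ insert a s, inner ℂ (v i) (w i)) =
          Matrix.hadamard (Matrix.of fun v w : (∀ i, E i) => inner ℂ (v a) (w a))
            (Matrix.of fun v w : (∀ i, E i) => ∏ i ∈ s, inner ℂ (v i) (w i)) := by
        ext v w
        simp [Matrix.hadamard, Finset.prod_insert ha]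
      rw [e]
      exact h
  exact key Finset.univ

/-- The kernel `(v, w) ↦ ∏ i, ⟨v i, w i⟩`, its values being read as operators on `ℂ`. -/
noncomputable def tensorKernel : Matrix (∀ i, E i) (∀ i, E i) (ℂ →L[ℂ] ℂ) :=
  Matrix.of fun v w => (∏ i, inner ℂ (v i) (w i)) • ContinuousLinearMap.id ℂ ℂ

open scoped ComplexOrder in
theorem posSemidef_tensorKernel : (tensorKernel E).PosSemidef := by
  have hiff := (RKHS.posSemidef_tfae (K := tensorKernel E)).out 0 2
  refine hiff.mpr ⟨?_, fun vv => ?_⟩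
  · ext v w
    simp [tensorKernel, Matrix.conjTranspose, ContinuousLinearMap.star_eq_adjoint,
      ContinuousLinearMap.adjoint_id]
  · have h := (posSemidef_prod_inner E).2 vv
    have h2 := (RCLike.nonneg_iff.mp h).1
    convert h2 using 2
    refine Finset.sum_congr rfl fun v _ => Finset.sum_congr rfl fun w _ => ?_
    simp [tensorKernel, map_prod]
    ring

instance : Fact (tensorKernel E).PosSemidef := ⟨posSemidef_tensorKernel E⟩

/-- The Hilbert space tensor product `⨂ i, E i` of a finite family of Hilbert spaces: the Hilbert
space generated by product vectors `⊗ i, v i` with `⟨⊗ v, ⊗ w⟩ = ∏ i, ⟨v i, w i⟩`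
(see `HilbertTensor.inner_tprod` and `HilbertTensor.span_tprod`). -/
def HilbertTensor : Type _ := RKHS.OfKernel (tensorKernel E)

noncomputable instance : NormedAddCommGroup (HilbertTensor E) :=
  inferInstanceAs (NormedAddCommGroup (RKHS.OfKernel (tensorKernel E)))
noncomputable instance : InnerProductSpace ℂ (HilbertTensor E) :=
  inferInstanceAs (InnerProductSpace ℂ (RKHS.OfKernel (tensorKernel E)))
instance : CompleteSpace (HilbertTensor E) :=
  inferInstanceAs (CompleteSpace (RKHS.OfKernel (tensorKernel E)))

variable {E}
/-- The product vector `⊗ i, v i`. -/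
noncomputable def HilbertTensor.tprod (v : ∀ i, E i) : HilbertTensor E :=
  RKHS.kerFun (RKHS.OfKernel (tensorKernel E)) v (1 : ℂ)

theorem HilbertTensor.inner_tprod (v w : ∀ i, E i) :
    inner ℂ (HilbertTensor.tprod v) (HilbertTensor.tprod w) = ∏ i, inner ℂ (v i) (w i) := by
  have h := RKHS.kernel_inner (RKHS.OfKernel (tensorKernel E)) w v (1 : ℂ) (1 : ℂ)
  rw [RKHS.OfKernel.kernel_ofKernel] at h
  refine Eq.trans h.symm ?_
  simp [tensorKernel, map_prod]

theorem HilbertTensor.span_tprod :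
    (Submodule.span ℂ (Set.range (HilbertTensor.tprod (E := E)))).topologicalClosure = ⊤ := by
  have h := RKHS.kerFun_dense (RKHS.OfKernel (tensorKernel E))
  have h' : (Submodule.span ℂ (Set.range fun v : (∀ i, E i) =>
      RKHS.kerFun (RKHS.OfKernel (tensorKernel E)) v (1 : ℂ))).topologicalClosure = ⊤ := by
    refine top_le_iff.mp (h.symm.le.trans ?_)
    refine Submodule.topologicalClosure_mono (Submodule.span_le.mpr ?_)
    rintro _ ⟨v, c, rfl⟩
    have : RKHS.kerFun (RKHS.OfKernel (tensorKernel E)) v c =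
        c • RKHS.kerFun (RKHS.OfKernel (tensorKernel E)) v (1 : ℂ) := by
      rw [← map_smul]; simp
    rw [SetLike.mem_coe, this]
    exact Submodule.smul_mem _ _ (Submodule.subset_span ⟨v, rfl⟩)
  exact h'

end Tensor

/-! ### Chains -/
section Chains

variable {X : Type*} [MeasurableSpace X] (μ : Measure X) (tm : X → ℝ≥0)

/-- The space of finite chains: increasing tuples `tm x₁ < ⋯ < tm xₙ`, `n = 0, 1, 2, …`. -/
abbrev Chain : Type _ := Σ n : ℕ, {x : Fin n → X // StrictMono (tm ∘ x)}

/-- The measure `dϰ = ∏ dx` on chains: on `n`-point chains it is the restriction of the product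
measure; the empty chain has mass `1`. -/
noncomputable def chainMeasure : Measure (Chain tm) :=
  Measure.sum fun n => ((Measure.pi fun _ : Fin n => μ).comap Subtype.val).map (Sigma.mk n)

variable {tm} in
/-- A chain as a finite subset of `X`. -/
def pts (ϰ : Chain tm) : Finset X :=
  Finset.univ.map ⟨ϰ.2.1, fun _ _ h => ϰ.2.2.injective (congrArg tm h)⟩

/-- The chains contained in `X^T = {x | tm x < T}`. -/
def before (T : ℝ≥0) : Set (Chain tm) := {ϰ | ∀ x ∈ pts ϰ, tm x < T}

/-- Integration `dϰ` over the chains contained in `X^T`. -/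
noncomputable def chainMeasureBefore (T : ℝ≥0) : Measure (Chain tm) :=
  (chainMeasure μ tm).restrict (before tm T)

/-- The multiplicative extension `p(ϰ) = ∏ x ∈ ϰ, p x` of a weight. -/
def wt {X : Type*} (p : X → ℝ≥0) (ω : Finset X) : ℝ≥0 := ∏ x ∈ ω, p x

end Chains

/-! ### Weights -/

/-- The weights `1 + u` with `u` in the semigroup `P0`. -/
def P1 {X : Type*} (P0 : AddSubmonoid (X → ℝ≥0)) : Set (X → ℝ≥0) := {p | ∃ u ∈ P0, p = 1 + u}

/-! ### Fields of Hilbert spaces and sections over chains -/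
section Sections

variable {X : Type*} [MeasurableSpace X] (μ : Measure X) (tm : X → ℝ≥0)
  {K : X → Type*} [∀ x, NormedAddCommGroup (K x)] [∀ x, InnerProductSpace ℂ (K x)]
  (e : ℕ → ∀ x, K x)

/-- `e` is a fundamental sequence, making `x ↦ K x` a measurable field of Hilbert spaces. -/
structure IsFundamental : Prop where
  measurable_inner : ∀ i j, Measurable fun x => (inner ℂ (e i x) (e j x) : ℂ)
  total : ∀ x, (Submodule.span ℂ (Set.range fun i => e i x)).topologicalClosure = ⊤

/-- The measurable vector fields `x ↦ k x ∈ K x`. -/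
def IsMeasurableField (k : ∀ x, K x) : Prop :=
  ∀ i, Measurable fun x => (inner ℂ (e i x) (k x) : ℂ)

variable (K) in
/-- Functions `ω ↦ f ω` with `f ω ∈ K^⊗(ω) = ⨂ x ∈ ω, K x` of finite sets `ω` of points. -/
abbrev Sec : Type _ := ∀ ω : Finset X, HilbertTensor fun x : ω => K x

/-- The product vector `k^⊗(ω) = ⊗ x ∈ ω, k x`. -/
noncomputable def prodVec (k : ∀ x, K x) : Sec K := fun ω => HilbertTensor.tprod fun x : ω => k x

/-- Essential measurability with respect to `ν` of a family `F y ∈ K^⊗(ω y)`: all its inner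
products with the product vectors of measurable vector fields are a.e. measurable. -/
def IsEssMeasurable {Y : Type*} [MeasurableSpace Y] (ν : Measure Y) (ω : Y → Finset X)
    (F : ∀ y, HilbertTensor fun x : ω y => K x) : Prop :=
  ∀ k : ∀ x, K x, IsMeasurableField e k →
    AEMeasurable (fun y => (inner ℂ (prodVec k (ω y)) (F y) : ℂ)) ν

open scoped Classical in
/-- The norm of `F(p) ⊗ K^⊗(σ)`. An element of this space is a function `f` with values
`f(ϰ ⊔ σ) ∈ K^⊗(ϰ) ⊗ K^⊗(σ) = K^⊗(ϰ ⊔ σ)`; its norm is `(∫ ‖f(ϰ ⊔ σ)‖² p(ϰ) dϰ)^{1/2}`. In this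
form the derivative `ϰ ↦ h(ϰ ⊔ σ)` of `h` at `σ` is `h` itself, read as such an element. -/
noncomputable def fockNorm (p : X → ℝ≥0) (σ : Finset X) (f : Sec K) : ℝ≥0∞ :=
  (∫⁻ ϰ, ‖f (pts ϰ ∪ σ)‖ₑ ^ 2 * (wt p (pts ϰ) : ℝ≥0∞) ∂chainMeasure μ tm) ^ (1 / 2 : ℝ)

open scoped Classical in
/-- Membership in `F(p) ⊗ K^⊗(σ)`; for `σ = ∅` this is the Fock space `F(p)`. -/
def MemFock (p : X → ℝ≥0) (σ : Finset X) (f : Sec K) : Prop :=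
  IsEssMeasurable e (chainMeasure μ tm) (fun ϰ => pts ϰ ∪ σ) (fun ϰ => f (pts ϰ ∪ σ)) ∧
    fockNorm μ tm p σ f < ∞

open scoped Classical in
/-- Equality of elements of `F(p) ⊗ K^⊗(σ)`. -/
def EqFock (σ : Finset X) (f g : Sec K) : Prop :=
  ∀ᵐ ϰ ∂chainMeasure μ tm, f (pts ϰ ∪ σ) = g (pts ϰ ∪ σ)

open scoped Classical in
/-- The pairing `⟨f | h⟩ = ∫ ⟨f(ϰ ⊔ σ) | h(ϰ ⊔ σ)⟩ dϰ` of `F(p⁻¹) ⊗ K^⊗(σ)` and `F(p) ⊗ K^⊗(σ)`. -/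
noncomputable def pairing (σ : Finset X) (f h : Sec K) : ℂ :=
  ∫ ϰ, inner ℂ (f (pts ϰ ∪ σ)) (h (pts ϰ ∪ σ)) ∂chainMeasure μ tm

/-- The norm `‖A‖_p = sup ‖A h‖(p⁻¹) / ‖h‖(p)` of `A : F(p) ⊗ K^⊗(σ) → F(p⁻¹) ⊗ K^⊗(τ)`. -/
noncomputable def opNorm (p : X → ℝ≥0) (σ τ : Finset X) (A : Sec K → Sec K) : ℝ≥0∞ :=
  ⨆ h : Sec K, ⨆ _ : MemFock μ tm e p σ h, fockNorm μ tm p⁻¹ τ (A h) / fockNorm μ tm p σ h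

/-- `A` represents a bounded linear operator `F(p) ⊗ K^⊗(σ) → F(p⁻¹) ⊗ K^⊗(τ)`. Linearity is meant
up to a.e. equality; with boundedness, `A` then respects a.e. equality. -/
structure IsOperator (p : X → ℝ≥0) (σ τ : Finset X) (A : Sec K → Sec K) : Prop where
  maps : ∀ h, MemFock μ tm e p σ h → MemFock μ tm e p⁻¹ τ (A h)
  add : ∀ f h, MemFock μ tm e p σ f → MemFock μ tm e p σ h → EqFock μ tm τ (A (f + h)) (A f + A h)
  smul : ∀ (c : ℂ) h, MemFock μ tm e p σ h → EqFock μ tm τ (A (c • h)) (c • A h)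
  bounded : opNorm μ tm e p σ τ A < ∞

open scoped Classical in
/-- The adjoint `A^* : F(p) ⊗ K^⊗(τ) → F(p⁻¹) ⊗ K^⊗(σ)` of an operator
`A : F(p) ⊗ K^⊗(σ) → F(p⁻¹) ⊗ K^⊗(τ)`, determined (a.e.) by `⟨A^* f | h⟩ = ⟨f | A h⟩`. -/
noncomputable def opAdjoint (p : X → ℝ≥0) (σ τ : Finset X) (A : Sec K → Sec K) (f : Sec K) :
    Sec K :=
  if H : ∃ g, MemFock μ tm e p⁻¹ σ g ∧
      ∀ h, MemFock μ tm e p σ h → pairing μ tm σ g h = pairing μ tm τ f (A h)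
  then H.choose else 0

/-- Membership in `F⁺ = ⋂ F(p)`, `p ∈ P1`. -/
def MemPlus (P0 : AddSubmonoid (X → ℝ≥0)) (h : Sec K) : Prop := ∀ p ∈ P1 P0, MemFock μ tm e p ∅ h

/-- Membership in `F₋ = ⋃ F(p⁻¹)`, `p ∈ P1`. -/
def MemMinus (P0 : AddSubmonoid (X → ℝ≥0)) (h : Sec K) : Prop :=
  ∃ p ∈ P1 P0, MemFock μ tm e p⁻¹ ∅ h

/-- `A` represents a continuous linear operator `F⁺ → F₋`, where `F⁺` has the projective topology
(given by the directed family of norms `‖·‖(p)`) and `F₋` the inductive one: a neighbourhood `U` of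
zero in `F₋` contains a ball of each `F(p⁻¹)`. (Convexity of `U` is not even required.) -/
structure IsContinuousOperator (P0 : AddSubmonoid (X → ℝ≥0)) (A : Sec K → Sec K) : Prop where
  maps : ∀ h, MemPlus μ tm e P0 h → MemMinus μ tm e P0 (A h)
  add : ∀ f h, MemPlus μ tm e P0 f → MemPlus μ tm e P0 h → EqFock μ tm ∅ (A (f + h)) (A f + A h)
  smul : ∀ (c : ℂ) h, MemPlus μ tm e P0 h → EqFock μ tm ∅ (A (c • h)) (c • A h)
  continuous : ∀ U : Set (Sec K),
    (∀ p ∈ P1 P0, ∃ δ > 0, ∀ g, MemFock μ tm e p⁻¹ ∅ g → fockNorm μ tm p⁻¹ ∅ g < δ → g ∈ U) →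
    ∃ q ∈ P1 P0, ∃ ε > 0, ∀ h, MemPlus μ tm e P0 h → fockNorm μ tm q ∅ h < ε → A h ∈ U

end Sections

/-! ### Tables and multi-integrants -/

/-- Tables `(ϑ_+^-, ϑ_∘^-; ϑ_+^∘, ϑ_∘^∘)` of finite subsets of `X`: `mp = ϑ_+^-`, `mo = ϑ_∘^-`,
`op = ϑ_+^∘`, `oo = ϑ_∘^∘`. -/
structure Table (X : Type*) where
  mp : Finset X
  mo : Finset X
  op : Finset X
  oo : Finset X

namespace Table
variable {X : Type*}

open scoped Classical in
/-- The union of two tables. -/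
noncomputable def union (a b : Table X) : Table X :=
  ⟨a.mp ∪ b.mp, a.mo ∪ b.mo, a.op ∪ b.op, a.oo ∪ b.oo⟩

/-- The empty table. -/
def empty : Table X := ⟨∅, ∅, ∅, ∅⟩
/-- The atomic table of `x` in position `ϑ_+^-`. -/
def atomMP (x : X) : Table X := ⟨{x}, ∅, ∅, ∅⟩
/-- The atomic table of `x` in position `ϑ_∘^-`. -/
def atomMO (x : X) : Table X := ⟨∅, {x}, ∅, ∅⟩
/-- The atomic table of `x` in position `ϑ_+^∘`. -/
def atomOP (x : X) : Table X := ⟨∅, ∅, {x}, ∅⟩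
/-- The atomic table of `x` in position `ϑ_∘^∘`. -/
def atomOO (x : X) : Table X := ⟨∅, ∅, ∅, {x}⟩

/-- The transposed table, with `ϑ_∘^-` and `ϑ_+^∘` exchanged. -/
def transpose (a : Table X) : Table X := ⟨a.mp, a.op, a.mo, a.oo⟩

open scoped Classical in
/-- `ϑ_∘^- ⊔ ϑ_∘^∘`. -/
noncomputable def inp (a : Table X) : Finset X := a.mo ∪ a.oo
open scoped Classical in
/-- `ϑ_+^∘ ⊔ ϑ_∘^∘`. -/
noncomputable def out (a : Table X) : Finset X := a.op ∪ a.oo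

/-- The table of a quadruple of chains `(ϑ_+^-, ϑ_∘^-, ϑ_+^∘, ϑ_∘^∘)`. -/
def ofChains {tm : X → ℝ≥0} (z : Chain tm × Chain tm × Chain tm × Chain tm) : Table X :=
  ⟨pts z.1, pts z.2.1, pts z.2.2.1, pts z.2.2.2⟩

end Table

section Integrals

variable {X : Type*} [MeasurableSpace X] (μ : Measure X) (tm : X → ℝ≥0)
  {K : X → Type*} [∀ x, NormedAddCommGroup (K x)] [∀ x, InnerProductSpace ℂ (K x)]
  (e : ℕ → ∀ x, K x)

/-- The fourfold product of a measure on chains, for integration over tables. -/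
noncomputable def tableMeasure (m : Measure (Chain tm)) :
    Measure (Chain tm × Chain tm × Chain tm × Chain tm) := m.prod (m.prod (m.prod m))

variable (K) in
/-- Operator functions of tables; `B ϑ` acts from `F(p) ⊗ K^⊗(ϑ_∘^- ⊔ ϑ_∘^∘)` to
`F(p⁻¹) ⊗ K^⊗(ϑ_+^∘ ⊔ ϑ_∘^∘)`. -/
abbrev Kernel : Type _ := Table X → Sec K → Sec K

open scoped Classical in
/-- Essential measurability of a function `ϑ ↦ Φ ϑ`, where `Φ ϑ` is a function of the sets
`ϰ ⊔ ρ ϑ`, jointly in the table `ϑ` (distributed as `m⁴`) and the chain `ϰ`. -/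
def IsJointlyMeasurable (m : Measure (Chain tm)) (ρ : Table X → Finset X) (Φ : Table X → Sec K) :
    Prop :=
  IsEssMeasurable e ((tableMeasure tm m).prod (chainMeasure μ tm))
    (fun z => pts z.2 ∪ ρ (Table.ofChains z.1))
    (fun z => Φ (Table.ofChains z.1) (pts z.2 ∪ ρ (Table.ofChains z.1)))

/-- `ϑ ↦ B ϑ` is an (a.e. defined) measurable field of bounded operators: it maps measurable fields
of vectors to measurable fields of vectors. -/
structure IsMeasurableKernel (p : X → ℝ≥0) (B : Kernel K) : Prop where
  isOperator : ∀ᵐ z ∂tableMeasure tm (chainMeasure μ tm),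
    IsOperator μ tm e p (Table.ofChains z).inp (Table.ofChains z).out (B (Table.ofChains z))
  measurable : ∀ H : Table X → Sec K,
    IsJointlyMeasurable μ tm e (chainMeasure μ tm) Table.inp H →
    (∀ᵐ z ∂tableMeasure tm (chainMeasure μ tm),
      MemFock μ tm e p (Table.ofChains z).inp (H (Table.ofChains z))) →
    ∃ Φ : Table X → Sec K, IsJointlyMeasurable μ tm e (chainMeasure μ tm) Table.out Φ ∧
      ∀ᵐ z ∂tableMeasure tm (chainMeasure μ tm), EqFock μ tm (Table.ofChains z).out
        (Φ (Table.ofChains z)) (B (Table.ofChains z) (H (Table.ofChains z)))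

open scoped Classical in
/-- `‖B‖_{p,T}^s(r) = ∫ dϑ_+^- (∫∫ ess sup_{ϑ_∘^∘} (s(ϑ_∘^∘) ‖B ϑ‖_p)² r(ϑ_+^∘ ⊔ ϑ_∘^-)
dϑ_+^∘ dϑ_∘^-)^{1/2}`, all chains being contained in `X^T`. -/
noncomputable def multiNorm (p r s : X → ℝ≥0) (T : ℝ≥0) (B : Kernel K) : ℝ≥0∞ :=
  ∫⁻ a, (∫⁻ b, ∫⁻ c,
      essSup (fun d => ((wt s (pts d) : ℝ≥0∞) *
        opNorm μ tm e p (Table.ofChains (a, b, c, d)).inp (Table.ofChains (a, b, c, d)).out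
          (B (Table.ofChains (a, b, c, d)))) ^ 2) (chainMeasureBefore μ tm T) *
        (wt r (pts c ∪ pts b) : ℝ≥0∞)
      ∂chainMeasureBefore μ tm T ∂chainMeasureBefore μ tm T) ^ (1 / 2 : ℝ)
    ∂chainMeasureBefore μ tm T

/-- `B` is locally integrable: `‖B‖_{p,T}^s(r) < ∞` for all `T < ∞`. -/
structure IsLocallyIntegrable (p r s : X → ℝ≥0) (B : Kernel K) : Prop where
  measurable : IsMeasurableKernel μ tm e p B
  measurable_norm : AEMeasurable (fun z => opNorm μ tm e p (Table.ofChains z).inp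
    (Table.ofChains z).out (B (Table.ofChains z))) (tableMeasure tm (chainMeasure μ tm))
  finite : ∀ T : ℝ≥0, multiNorm μ tm e p r s T B < ∞

/-- The kernel `B^⋆ ϑ = (B ϑ')^*`, `ϑ'` being the transpose of `ϑ`. -/
noncomputable def starKernel (p : X → ℝ≥0) (B : Kernel K) : Kernel K := fun ϑ =>
  opAdjoint μ tm e p ϑ.transpose.inp ϑ.transpose.out (B ϑ.transpose)

/-- The pointwise derivative `Ḃ(a, ϑ) = B(ϑ ⊔ a)` at a table `a`. -/
noncomputable def derivKernel (B : Kernel K) (a : Table X) : Kernel K := fun ϑ => B (ϑ.union a)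

open scoped Classical in
/-- `g` is the multiple integral `ι_0^T(B) h`: for almost every chain `ϰ`
`g(ϰ) = ∑_{ϑ_∘^∘ ⊔ ϑ_+^∘ ⊆ ϰ^T} ∫∫ [B(ϑ) ḣ(ϑ_∘^- ⊔ ϑ_∘^∘)](ϰ ∖ ϑ_∘^∘ ∖ ϑ_+^∘) dϑ_+^- dϑ_∘^-`
with absolutely convergent integrals over chains in `X^T`. As an element of a tensor product the
integrand is a function `Φ ϑ` evaluated at `ϰ`, where `Φ` is a jointly measurable
version of `ϑ ↦ B ϑ h`. The set `τ` carries extra tensor factors of the values: if `B ϑ` takes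
values in `F(p⁻¹) ⊗ K^⊗(out ϑ ⊔ τ)`, then the integral takes values in `F₋ ⊗ K^⊗(τ)`
(and extra factors of the argument of `B ϑ` need not be displayed); the plain integral has
`τ = ∅`. -/
def HasMultiIntegral (T : ℝ≥0) (τ : Finset X) (B : Kernel K) (h g : Sec K) : Prop :=
  ∃ Φ : Table X → Sec K,
    IsJointlyMeasurable μ tm e (chainMeasureBefore μ tm T) (fun ϑ => ϑ.out ∪ τ) Φ ∧
    (∀ᵐ z ∂tableMeasure tm (chainMeasureBefore μ tm T),
      EqFock μ tm ((Table.ofChains z).out ∪ τ) (Φ (Table.ofChains z))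
        (B (Table.ofChains z) h)) ∧
    ∀ᵐ ϰ ∂chainMeasure μ tm,
      (∀ c d : Finset X, c ⊆ pts ϰ → d ⊆ pts ϰ → (∀ x ∈ c ∪ d, tm x < T) → Disjoint c d →
        Integrable (fun y : Chain tm × Chain tm => Φ ⟨pts y.1, pts y.2, c, d⟩ (pts ϰ ∪ τ))
          ((chainMeasureBefore μ tm T).prod (chainMeasureBefore μ tm T))) ∧
      g (pts ϰ ∪ τ) =
        ∑ cd ∈ (((pts ϰ).filter fun x => tm x < T).powerset ×ˢ
            ((pts ϰ).filter fun x => tm x < T).powerset).filter fun cd => Disjoint cd.1 cd.2,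
          ∫ y : Chain tm × Chain tm, Φ ⟨pts y.1, pts y.2, cd.1, cd.2⟩ (pts ϰ ∪ τ)
            ∂((chainMeasureBefore μ tm T).prod (chainMeasureBefore μ tm T))

open scoped Classical in
/-- The multiple integral `ι_0^T(B)` as an operator (zero where it does not exist). -/
noncomputable def multiIntegral (T : ℝ≥0) (τ : Finset X) (B : Kernel K) (h : Sec K) : Sec K :=
  if H : ∃ g, HasMultiIntegral μ tm e T τ B h g then H.choose else 0

/-! ### Single integrals -/

/-- `g = Λ(D, Δ) h` for the preservation and annihilation integrals:
`g(ϰ) = ∫_Δ [D(x) h](ϰ) dx`, with a jointly measurable version `Φ` of `x ↦ D x h`. -/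
def HasTimeIntegral (Δ : Set X) (D : X → Sec K → Sec K) (h g : Sec K) : Prop :=
  ∃ Φ : X → Sec K,
    IsEssMeasurable e ((μ.restrict Δ).prod (chainMeasure μ tm)) (fun z => pts z.2)
      (fun z => Φ z.1 (pts z.2)) ∧
    (∀ᵐ x ∂μ.restrict Δ, EqFock μ tm ∅ (Φ x) (D x h)) ∧
    ∀ᵐ ϰ ∂chainMeasure μ tm, IntegrableOn (fun x => Φ x (pts ϰ)) Δ μ ∧
      g (pts ϰ) = ∫ x in Δ, Φ x (pts ϰ) ∂μ

open scoped Classical in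
/-- `g = Λ(D, Δ) h` for the creation and exchange integrals:
`g(ϰ) = ∑_{x ∈ Δ ∩ ϰ} [D(x) h](ϰ ∖ x)`, the summand being an element of `K^⊗(ϰ ∖ x) ⊗ K x`,
with a jointly measurable version `Φ` of `x ↦ D x h`. -/
def HasPointSum (Δ : Set X) (D : X → Sec K → Sec K) (h g : Sec K) : Prop :=
  ∃ Φ : X → Sec K,
    IsEssMeasurable e ((μ.restrict Δ).prod (chainMeasure μ tm)) (fun z => pts z.2 ∪ {z.1})
      (fun z => Φ z.1 (pts z.2 ∪ {z.1})) ∧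
    (∀ᵐ x ∂μ.restrict Δ, EqFock μ tm {x} (Φ x) (D x h)) ∧
    ∀ᵐ ϰ ∂chainMeasure μ tm, g (pts ϰ) = ∑ x ∈ (pts ϰ).filter (fun x => x ∈ Δ), Φ x (pts ϰ)

open scoped Classical in
/-- The preservation or annihilation integral as an operator. -/
noncomputable def timeIntegral (Δ : Set X) (D : X → Sec K → Sec K) (h : Sec K) : Sec K :=
  if H : ∃ g, HasTimeIntegral μ tm e Δ D h g then H.choose else 0

open scoped Classical in
/-- The creation or exchange integral as an operator. -/
noncomputable def pointSum (Δ : Set X) (D : X → Sec K → Sec K) (h : Sec K) : Sec K :=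
  if H : ∃ g, HasPointSum μ tm e Δ D h g then H.choose else 0

variable (K) in
/-- Quadruples `D = (D_ν^μ)` of operator functions on `X`:
`mp x = D_+^-(x) : F(q) → F(q⁻¹)`, `mo x = D_∘^-(x) : F(q) ⊗ K x → F(q⁻¹)`,
`op x = D_+^∘(x) : F(q) → F(q⁻¹) ⊗ K x`, `oo x = D_∘^∘(x) : F(q) ⊗ K x → F(q⁻¹) ⊗ K x`. -/
structure Quadruple where
  mp : X → Sec K → Sec K
  mo : X → Sec K → Sec K
  op : X → Sec K → Sec K
  oo : X → Sec K → Sec K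

/-- All four parts of the single integral `i_0^T(D) h` exist. -/
structure HasSingleIntegral (T : ℝ≥0) (D : Quadruple K) (h : Sec K) : Prop where
  mp : ∃ g, HasTimeIntegral μ tm e {x | tm x < T} D.mp h g
  mo : ∃ g, HasTimeIntegral μ tm e {x | tm x < T} D.mo h g
  op : ∃ g, HasPointSum μ tm e {x | tm x < T} D.op h g
  oo : ∃ g, HasPointSum μ tm e {x | tm x < T} D.oo h g

/-- The quantum stochastic integral `i_0^T(D) = ∑ Λ(D_ν^μ, X^T)`. -/
noncomputable def singleIntegral (T : ℝ≥0) (D : Quadruple K) (h : Sec K) : Sec K :=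
  timeIntegral μ tm e {x | tm x < T} D.mp h + pointSum μ tm e {x | tm x < T} D.op h +
    timeIntegral μ tm e {x | tm x < T} D.mo h + pointSum μ tm e {x | tm x < T} D.oo h

/-- The quantum stochastic derivatives `D_ν^μ(x) = ι_0^{tm x}(Ḃ(x_ν^μ))` of `T ↦ ι_0^T(B)`. -/
noncomputable def qsDeriv (B : Kernel K) : Quadruple K where
  mp x := multiIntegral μ tm e (tm x) ∅ (derivKernel B (Table.atomMP x))
  mo x := multiIntegral μ tm e (tm x) ∅ (derivKernel B (Table.atomMO x))
  op x := multiIntegral μ tm e (tm x) {x} (derivKernel B (Table.atomOP x))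
  oo x := multiIntegral μ tm e (tm x) {x} (derivKernel B (Table.atomOO x))

/-- `‖D‖_{q,T}^{(1)} = ∫_{X^T} ‖D(x)‖_q dx` for `D(x) : F(q) ⊗ K^⊗(σ x) → F(q⁻¹) ⊗ K^⊗(τ x)`. -/
noncomputable def normOne (q : X → ℝ≥0) (T : ℝ≥0) (σ τ : X → Finset X) (D : X → Sec K → Sec K) :
    ℝ≥0∞ :=
  ∫⁻ x in {x | tm x < T}, opNorm μ tm e q (σ x) (τ x) (D x) ∂μ

/-- `‖D‖_{q,T}^{(2)}(r) = (∫_{X^T} ‖D(x)‖_q² r(x) dx)^{1/2}`. -/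
noncomputable def normTwo (q r : X → ℝ≥0) (T : ℝ≥0) (σ τ : X → Finset X)
    (D : X → Sec K → Sec K) : ℝ≥0∞ :=
  (∫⁻ x in {x | tm x < T}, opNorm μ tm e q (σ x) (τ x) (D x) ^ 2 * (r x : ℝ≥0∞) ∂μ) ^ (1 / 2 : ℝ)

/-- `‖D‖_{q,T}^{(∞)}(s) = ess sup_{X^T} s(x) ‖D(x)‖_q`. -/
noncomputable def normInf (q s : X → ℝ≥0) (T : ℝ≥0) (σ τ : X → Finset X)
    (D : X → Sec K → Sec K) : ℝ≥0∞ :=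
  essSup (fun x => (s x : ℝ≥0∞) * opNorm μ tm e q (σ x) (τ x) (D x)) (μ.restrict {x | tm x < T})

/-- For almost every `x`, `D x` is a bounded operator `F(q) ⊗ K^⊗(σ x) → F(q⁻¹) ⊗ K^⊗(τ x)` given
by the multiple integral of `C x` up to time `tm x`, convergent on the whole of
`F(q) ⊗ K^⊗(σ x)`; and the norm `‖D(x)‖_q` is a measurable function of `x`. -/
structure IsDerivative (q : X → ℝ≥0) (σ τ : X → Finset X) (C : X → Kernel K)
    (D : X → Sec K → Sec K) : Prop where
  converges : ∀ᵐ x ∂μ, ∀ h, MemFock μ tm e q (σ x) h →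
    HasMultiIntegral μ tm e (tm x) (τ x) (C x) h (D x h)
  isOperator : ∀ᵐ x ∂μ, IsOperator μ tm e q (σ x) (τ x) (D x)
  measurable_norm : AEMeasurable (fun x => opNorm μ tm e q (σ x) (τ x) (D x)) μ

end Integrals

end FockScale

open FockScale

/-!
A chain divided into two subchains is the same thing as a pair of chains, provided that no two
points are simultaneous, which is almost surely the case because the time has null level sets. Hence
the sum-integral formula `∫ ∑_{α ⊔ β = ϰ} F(α, β) dϰ = ∫∫ F(α, β) dα dβ` (`prod_chainMeasure`,
`integral_prod_chain`). Weights are multiplicative, so the sum over all splittings of a product of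
weights is the product of the sum of the weights (`wt_add`). This is where `r⁻¹ + p + s⁻¹` comes
from: the derivatives of `h ∈ F(q)` at the chains `ϑ_∘^-` and `ϑ_∘^∘` lie in `F(p)` and are square
integrable with the weights `r⁻¹` and `s⁻¹` (`scalarNorm_sections`).

*The estimate.* By the sum-integral formula a matrix element `⟨f | ι(B) h⟩` is the integral over all
tables of `⟨f | B(ϑ) h⟩`, in which `f` is differentiated at the output `ϑ_+^∘ ⊔ ϑ_∘^∘` and `h` at
the input `ϑ_∘^- ⊔ ϑ_∘^∘` (`HasMultiIntegral.pairing_eq`). The essential supremum of the kernel in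
`ϑ_∘^∘` and the Cauchy-Schwarz inequality in `ϑ_∘^∘`, `ϑ_+^∘` and `ϑ_∘^-`, in this order, bound it by
the product of the three norms (`lintegral_kernel_le`). The same bound with
absolute values, tested against all scalar functions of chains (`lintegral_sq_div_le_of_dual`),
gives absolute convergence and the operator norm. Exchanging `ϑ_∘^-` and `ϑ_+^∘` in the matrix
elements gives the adjoint.

*The derivatives.* Fixing a point `x` of a table and admitting only chains before `x` turns the norm
of `B` into the norms of the derived kernels; since integration over chains before `t` contains the
integration over chains with a last point `x` (`lintegral_lastPoint`), the norms of the derivatives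
have the integrability that belongs to their position in the table. In the positions `ϑ_∘^-` and
`ϑ_+^∘` this uses the Minkowski inequality.

*The differential.* A nonempty table before `t` has a last point, which lies in exactly one of the
four entries (`integral_lastPoint_table`). For matrix elements this is the asserted formula: the
four parts are the matrix elements of the single integrals of the derivatives, and the empty table
gives `B(∅) h`. Elements of the scale are determined by their matrix elements
(`eqFock_of_pairing`). Splitting off a point from `f` or `h` costs another `r⁻¹` or `s⁻¹`, so the
formula is proved one step further up the scale, which is harmless for `h ∈ F⁺`.

*Measurability.* The spaces `K^⊗(σ)` have no common frame in which a field could be called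
measurable. Over chains, however, the product vectors of countably many step functions in time with
values in the fundamental sequence are total, for distinct times can be separated by rational
intervals (`exists_stepSeq_eq`). Their orthonormalization embeds all fibres measurably in `ℓ²`, and
all spaces `F(w) ⊗ K^⊗(σ)` in the one space `L²(𝒳; ℓ²)`, which is separable because `L²(X)` is. A
measurable field of operators becomes a strongly measurable function with values in the operators of
this space (`IsOpField`); norms, adjoints and jointly measurable versions of images are obtained
there.
-/

namespace FockScale

set_option linter.unusedSectionVars false

/-! ### Chains and finite sets of distinct times -/
section ChainSets

open scoped Classical

variable {X : Type*} {tm : X → ℝ≥0}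

theorem mem_pts {ϰ : Chain tm} {x : X} : x ∈ pts ϰ ↔ ∃ i, ϰ.2.1 i = x := by
  simp only [pts, Finset.mem_map, Finset.mem_univ, true_and]
  rfl

theorem card_pts (ϰ : Chain tm) : (pts ϰ).card = ϰ.1 := by
  simp [pts]

theorem injOn_pts (ϰ : Chain tm) : Set.InjOn tm (pts ϰ : Set X) := by
  intro x hx y hy h
  obtain ⟨i, rfl⟩ := mem_pts.1 hx
  obtain ⟨j, rfl⟩ := mem_pts.1 hy
  rw [ϰ.2.2.injective h]

theorem pts_injective : Function.Injective (pts : Chain tm → Finset X) := by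
  rintro ⟨n, x⟩ ⟨m, y⟩ h
  obtain rfl : n = m := by simpa [card_pts] using congrArg Finset.card h
  have hr : Set.range x.1 = Set.range y.1 := by
    ext z
    have := Finset.ext_iff.1 h z
    simpa [mem_pts] using this
  have ht : tm ∘ x.1 = tm ∘ y.1 := by
    refine (StrictMono.range_inj x.2 y.2).1 ?_
    rw [Set.range_comp, Set.range_comp, hr]
  have hxy : x = y := by
    refine Subtype.ext (funext fun i => ?_)
    obtain ⟨j, hj⟩ : x.1 i ∈ Set.range y.1 := hr ▸ Set.mem_range_self i
    have h1 : tm (y.1 j) = tm (y.1 i) := by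
      rw [hj]; exact congrFun ht i
    rw [← hj, y.2.injective h1]
  rw [hxy]

theorem exists_pts_eq {σ : Finset X} (h : Set.InjOn tm σ) : ∃ ϰ : Chain tm, pts ϰ = σ := by
  classical
  have hc : (σ.image tm).card = σ.card := Finset.card_image_of_injOn h
  have hm : ∀ i, ∃ x ∈ σ, tm x = (σ.image tm).orderEmbOfFin hc i := fun i => by
    exact Finset.mem_image.1 (Finset.orderEmbOfFin_mem (σ.image tm) hc i)
  choose x hx hxt using hm
  have hmono : StrictMono (tm ∘ x) := fun i j hij => by
    simp only [Function.comp, hxt]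
    exact ((σ.image tm).orderEmbOfFin hc).strictMono hij
  refine ⟨⟨σ.card, x, hmono⟩, ?_⟩
  refine Finset.eq_of_subset_of_card_le (fun y hy => ?_) (by simp [card_pts])
  obtain ⟨i, rfl⟩ := mem_pts.1 hy
  exact hx i

/-- The empty chain. -/
def emptyChain (tm : X → ℝ≥0) : Chain tm := ⟨0, Fin.elim0, fun i => i.elim0⟩

@[simp] theorem pts_emptyChain : pts (emptyChain tm) = ∅ := by
  rw [← Finset.card_eq_zero, card_pts]; rfl

/-- The one-point chain. -/
def sing (tm : X → ℝ≥0) (x : X) : Chain tm := ⟨1, fun _ => x, Subsingleton.strictMono _⟩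

@[simp] theorem pts_sing (x : X) : pts (sing tm x) = {x} := by
  ext y; simp [mem_pts, sing, eq_comm]

/-- The chain of a finite set of points with distinct times, a left inverse of `pts`; sets with
coinciding times are sent to the empty chain. -/
noncomputable def chainOf (tm : X → ℝ≥0) (σ : Finset X) : Chain tm :=
  if h : ∃ ϰ : Chain tm, pts ϰ = σ then h.choose else emptyChain tm

@[simp] theorem chainOf_pts (ϰ : Chain tm) : chainOf tm (pts ϰ) = ϰ := by
  have h : ∃ ϰ' : Chain tm, pts ϰ' = pts ϰ := ⟨ϰ, rfl⟩
  rw [chainOf, dif_pos h]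
  exact pts_injective h.choose_spec

theorem pts_chainOf {σ : Finset X} (h : Set.InjOn tm σ) : pts (chainOf tm σ) = σ := by
  obtain ⟨ϰ, rfl⟩ := exists_pts_eq h
  simp

/-- No point of `σ` is simultaneous with a point of `τ`. -/
def Apart (tm : X → ℝ≥0) (σ τ : Finset X) : Prop := ∀ x ∈ σ, ∀ y ∈ τ, tm x ≠ tm y

theorem Apart.symm {σ τ : Finset X} (h : Apart tm σ τ) : Apart tm τ σ :=
  fun x hx y hy e => h y hy x hx e.symm

theorem Apart.disjoint {σ τ : Finset X} (h : Apart tm σ τ) : Disjoint σ τ :=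
  Finset.disjoint_left.2 fun x hx hx' => h x hx x hx' rfl

theorem injOn_union {σ τ : Finset X} (h1 : Set.InjOn tm σ) (h2 : Set.InjOn tm τ)
    (h : Apart tm σ τ) : Set.InjOn tm ((σ ∪ τ : Finset X) : Set X) := by
  intro x hx y hy e
  rcases Finset.mem_union.1 hx with hx | hx <;> rcases Finset.mem_union.1 hy with hy | hy
  exacts [h1 hx hy e, (h x hx y hy e).elim, (h y hy x hx e.symm).elim, h2 hx hy e]

theorem wt_union (p : X → ℝ≥0) {σ τ : Finset X} (h : Apart tm σ τ) :
    wt p (σ ∪ τ) = wt p σ * wt p τ := Finset.prod_union h.disjoint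

end ChainSets

/-! ### Splitting a chain into two -/
section Split

open scoped Classical

variable {X : Type*} {tm : X → ℝ≥0}

/-- The type of increasing `n`-tuples. -/
abbrev Incr (tm : X → ℝ≥0) (n : ℕ) : Type _ := {x : Fin n → X // StrictMono (tm ∘ x)}

/-- The subchain with positions in `S`. -/
def subChain {n k : ℕ} (S : Finset (Fin n)) (h : S.card = k) (x : Incr tm n) : Incr tm k :=
  ⟨x.1 ∘ S.orderEmbOfFin h, x.2.comp (S.orderEmbOfFin h).strictMono⟩

theorem pts_subChain {n k : ℕ} (S : Finset (Fin n)) (h : S.card = k) (x : Incr tm n) :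
    pts (tm := tm) ⟨k, subChain S h x⟩ =
      S.map ⟨x.1, fun _ _ e => x.2.injective (congrArg tm e)⟩ := by
  ext y
  simp only [mem_pts, Finset.mem_map, subChain, Function.comp]
  constructor
  · rintro ⟨i, rfl⟩
    exact ⟨_, Finset.orderEmbOfFin_mem S h i, rfl⟩
  · rintro ⟨j, hj, rfl⟩
    have : j ∈ Set.range (S.orderEmbOfFin h) := by rw [Finset.range_orderEmbOfFin]; exact hj
    obtain ⟨i, rfl⟩ := this
    exact ⟨i, rfl⟩

/-- The pair of complementary subchains with positions in `S` and off `S`. -/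
def splitAt {n k l : ℕ} (S : Finset (Fin n)) (h : S.card = k) (h' : Sᶜ.card = l)
    (x : Incr tm n) : Incr tm k × Incr tm l := (subChain S h x, subChain Sᶜ h' x)

/-- `splitAt` as a pair of chains. -/
def split {n : ℕ} (S : Finset (Fin n)) (x : Incr tm n) : Chain tm × Chain tm :=
  (⟨_, subChain S rfl x⟩, ⟨_, subChain Sᶜ rfl x⟩)

theorem pts_split_union {n : ℕ} (S : Finset (Fin n)) (x : Incr tm n) :
    pts (split S x).1 ∪ pts (split S x).2 = pts (tm := tm) ⟨n, x⟩ := by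
  rw [split, pts_subChain, pts_subChain, ← Finset.map_union, Finset.union_compl]
  rfl

theorem pts_split_snd {n : ℕ} (S : Finset (Fin n)) (x : Incr tm n) :
    pts (split S x).2 = pts (tm := tm) ⟨n, x⟩ \ pts (split S x).1 := by
  rw [split, pts_subChain, pts_subChain]
  ext y
  simp only [Finset.mem_map, Finset.mem_compl, Finset.mem_sdiff, mem_pts]
  constructor
  · rintro ⟨i, hi, rfl⟩
    refine ⟨⟨i, rfl⟩, ?_⟩
    rintro ⟨j, hj, e⟩
    exact hi (x.2.injective (congrArg tm e) ▸ hj)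
  · rintro ⟨⟨i, rfl⟩, h⟩
    exact ⟨i, fun hi => h ⟨i, hi, rfl⟩, rfl⟩

/-- Summation over the patterns `S` of a chain is summation over the subsets of its points. -/
theorem sum_split {M : Type*} [AddCommMonoid M] {n : ℕ} (x : Incr tm n)
    (F : Finset X → Finset X → M) :
    ∑ S : Finset (Fin n), F (pts (split S x).1) (pts (split S x).2) =
      ∑ A ∈ (pts (tm := tm) ⟨n, x⟩).powerset, F A (pts (tm := tm) ⟨n, x⟩ \ A) := by
  simp only [pts_split_snd]
  have hp : pts (tm := tm) ⟨n, x⟩ = Finset.univ.map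
      ⟨x.1, fun _ _ e => x.2.injective (congrArg tm e)⟩ := rfl
  refine Finset.sum_bij (fun S _ => pts (split S x).1) (fun S _ => ?_) (fun S _ S' _ h => ?_)
    (fun A hA => ?_) (fun S _ => rfl)
  · rw [Finset.mem_powerset, ← pts_split_union S x]; exact Finset.subset_union_left
  · simp only [split, pts_subChain] at h
    exact Finset.map_injective _ h
  · rw [Finset.mem_powerset, hp, Finset.subset_map_iff] at hA
    obtain ⟨S, -, rfl⟩ := hA
    exact ⟨S, Finset.mem_univ _, by simp only [split, pts_subChain]⟩

theorem splitAt_injective {n k l : ℕ} {S S' : Finset (Fin n)}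
    {h : S.card = k} {h' : Sᶜ.card = l} {h1 : S'.card = k} {h1' : S'ᶜ.card = l}
    {x y : Incr tm n} (e : splitAt S h h' x = splitAt S' h1 h1' y) : S = S' ∧ x = y := by
  classical
  have e1 := congrArg (fun z => pts (tm := tm) ⟨k, z.1⟩) e
  have e2 := congrArg (fun z => pts (tm := tm) ⟨l, z.2⟩) e
  simp only [splitAt, pts_subChain] at e1 e2
  have hxy : (⟨n, x⟩ : Chain tm) = ⟨n, y⟩ := by
    refine pts_injective ?_
    rw [← pts_split_union S x, ← pts_split_union S' y]
    simp only [split, pts_subChain, e1, e2]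
  have hxy' : x = y := by simpa using hxy
  subst hxy'
  exact ⟨Finset.map_injective _ e1, rfl⟩

theorem exists_splitAt_eq {k l : ℕ} (a : Incr tm k) (b : Incr tm l)
    (hab : Apart tm (pts (tm := tm) ⟨k, a⟩) (pts (tm := tm) ⟨l, b⟩)) :
    ∃ (S : Finset (Fin (k + l))) (h : S.card = k) (h' : Sᶜ.card = l) (x : Incr tm (k + l)),
      splitAt S h h' x = (a, b) := by
  classical
  obtain ⟨⟨n, x⟩, hx⟩ := exists_pts_eq (injOn_union (injOn_pts (⟨k, a⟩ : Chain tm))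
    (injOn_pts (⟨l, b⟩ : Chain tm)) hab)
  have hn : n = k + l := by
    have := congrArg Finset.card hx
    rw [Finset.card_union_of_disjoint hab.disjoint] at this
    simpa [card_pts] using this
  subst hn
  have hp : pts (tm := tm) ⟨k + l, x⟩ = Finset.univ.map
      ⟨x.1, fun _ _ e => x.2.injective (congrArg tm e)⟩ := rfl
  have hsub : pts (tm := tm) ⟨k, a⟩ ⊆ pts (tm := tm) ⟨k + l, x⟩ := hx ▸ Finset.subset_union_left
  rw [hp, Finset.subset_map_iff] at hsub
  obtain ⟨S, -, hS⟩ := hsub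
  have h : S.card = k := by
    have := congrArg Finset.card hS
    simpa [card_pts] using this.symm
  have h' : Sᶜ.card = l := by rw [Finset.card_compl, Fintype.card_fin, h]; omega
  have e1 : (⟨k, subChain S h x⟩ : Chain tm) = ⟨k, a⟩ := pts_injective (by
    rw [pts_subChain, hS])
  have e2 : (⟨l, subChain Sᶜ h' x⟩ : Chain tm) = ⟨l, b⟩ := pts_injective (by
    have h3 := pts_split_snd S x
    simp only [split, pts_subChain] at h3
    rw [pts_subChain, h3, hx, ← hS, Finset.union_sdiff_cancel_left hab.disjoint])
  refine ⟨S, h, h', x, Prod.ext ?_ ?_⟩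
  · simpa [splitAt] using e1
  · simpa [splitAt] using e2

end Split

/-! ### The sum-integral formula as an identity of measures -/
section SumIntegral

open scoped Classical

variable {X : Type*} [MeasurableSpace X] (μ : Measure X) {tm : X → ℝ≥0}

variable (tm) in
/-- A measurable time function all of whose level sets are null. -/
structure IsTime : Prop where
  measurable : Measurable tm
  null : ∀ c : ℝ≥0, μ {x | tm x = c} = 0

/-- The measure on increasing `n`-tuples. -/
noncomputable def incrMeasure (tm : X → ℝ≥0) (n : ℕ) : Measure (Incr tm n) :=
  (Measure.pi fun _ : Fin n => μ).comap Subtype.val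

theorem chainMeasure_eq : chainMeasure μ tm =
    Measure.sum fun n => (incrMeasure μ tm n).map (Sigma.mk n) := rfl

theorem measurable_sigmaMk (n : ℕ) : Measurable (Sigma.mk n : Incr tm n → Chain tm) := by
  intro s hs
  exact (MeasurableSpace.measurableSet_iInf.1 hs n)

theorem measurableSet_chain {s : Set (Chain tm)} :
    MeasurableSet s ↔ ∀ n, MeasurableSet ((Sigma.mk n : Incr tm n → Chain tm) ⁻¹' s) :=
  MeasurableSpace.measurableSet_iInf

theorem measurableEmbedding_sigmaMk (n : ℕ) :
    MeasurableEmbedding (Sigma.mk n : Incr tm n → Chain tm) := by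
  refine ⟨sigma_mk_injective, measurable_sigmaMk n, fun s hs => ?_⟩
  refine measurableSet_chain.2 fun k => ?_
  by_cases h : n = k
  · subst h
    rwa [Set.preimage_image_eq _ sigma_mk_injective]
  · convert MeasurableSet.empty
    ext x
    simp only [Set.mem_preimage, Set.mem_image, Set.mem_empty_iff_false, iff_false]
    rintro ⟨y, -, e⟩
    exact h (congrArg Sigma.fst e)

theorem measurableSet_strictMono (htm : Measurable tm) (n : ℕ) :
    MeasurableSet {x : Fin n → X | StrictMono (tm ∘ x)} := by
  have : {x : Fin n → X | StrictMono (tm ∘ x)} = ⋂ i, ⋂ j, {x | i < j → tm (x i) < tm (x j)} := by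
    ext x; simp [StrictMono]
  rw [this]
  refine MeasurableSet.iInter fun i => MeasurableSet.iInter fun j => ?_
  by_cases h : i < j
  · simp only [h, true_imp_iff]
    exact measurableSet_lt (htm.comp (measurable_pi_apply i)) (htm.comp (measurable_pi_apply j))
  · simp [h]

theorem measurableEmbedding_val (htm : Measurable tm) (n : ℕ) :
    MeasurableEmbedding (Subtype.val : Incr tm n → Fin n → X) :=
  MeasurableEmbedding.subtype_coe (measurableSet_strictMono htm n)

theorem measurable_subChain {n k : ℕ} (S : Finset (Fin n)) (h : S.card = k) :
    Measurable (subChain S h : Incr tm n → Incr tm k) := by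
  refine Measurable.subtype_mk (measurable_pi_lambda _ fun i => ?_)
  exact (measurable_pi_apply _).comp measurable_subtype_coe

theorem measurable_splitAt {n k l : ℕ} (S : Finset (Fin n)) (h : S.card = k) (h' : Sᶜ.card = l) :
    Measurable (splitAt S h h' : Incr tm n → Incr tm k × Incr tm l) :=
  (measurable_subChain S h).prodMk (measurable_subChain Sᶜ h')

theorem measurable_split {n : ℕ} (S : Finset (Fin n)) :
    Measurable (split S : Incr tm n → Chain tm × Chain tm) :=
  ((measurable_sigmaMk _).comp (measurable_subChain S rfl)).prodMk
    ((measurable_sigmaMk _).comp (measurable_subChain Sᶜ rfl))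

theorem map_val_incrMeasure (htm : Measurable tm) (n : ℕ) : (incrMeasure μ tm n).map Subtype.val =
      (Measure.pi fun _ : Fin n => μ).restrict {x | StrictMono (tm ∘ x)} := by
  rw [incrMeasure, (measurableEmbedding_val htm n).map_comap, Subtype.range_coe_subtype]

theorem incrMeasure_preimage_le {n : ℕ} {s : Set (Fin n → X)} (hs : MeasurableSet s) :
    incrMeasure μ tm n (Subtype.val ⁻¹' s) ≤ Measure.pi (fun _ : Fin n => μ) s :=
  (Measure.comap_apply_le _ _ (measurable_subtype_coe hs).nullMeasurableSet).trans
    (measure_mono (Set.image_preimage_subset _ _))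

instance [SigmaFinite μ] (n : ℕ) : SigmaFinite (incrMeasure μ tm n) := by
  refine ⟨⟨⟨fun N => Subtype.val ⁻¹' spanningSets (Measure.pi fun _ : Fin n => μ) N,
    fun _ => trivial, fun N => ?_, ?_⟩⟩⟩
  · exact (incrMeasure_preimage_le μ (measurableSet_spanningSets _ N)).trans_lt
      (measure_spanningSets_lt_top _ N)
  · rw [← Set.preimage_iUnion, iUnion_spanningSets, Set.preimage_univ]

instance [SigmaFinite μ] : SigmaFinite (chainMeasure μ tm) := by
  let A : ℕ × ℕ → Set (Chain tm) := fun i =>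
    Sigma.mk i.1 '' (spanningSets (incrMeasure μ tm i.1) i.2)
  refine Measure.sigmaFinite_of_countable (S := Set.range A) (Set.countable_range A) ?_ ?_
  · rintro _ ⟨⟨n, N⟩, rfl⟩
    have hA : MeasurableSet (A (n, N)) := by
      refine measurableSet_chain.2 fun k => ?_
      by_cases h : n = k
      · subst h
        rw [Set.preimage_image_eq _ sigma_mk_injective]
        exact measurableSet_spanningSets _ _
      · convert MeasurableSet.empty
        ext x
        simp only [A, Set.mem_preimage, Set.mem_image, Set.mem_empty_iff_false, iff_false]
        rintro ⟨y, -, e⟩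
        exact h (congrArg Sigma.fst e)
    rw [chainMeasure_eq, Measure.sum_apply _ hA, tsum_eq_single n]
    · rw [Measure.map_apply (measurable_sigmaMk n) hA, Set.preimage_image_eq _ sigma_mk_injective]
      exact measure_spanningSets_lt_top _ N
    · intro k hk
      rw [Measure.map_apply (measurable_sigmaMk k) hA]
      convert measure_empty (μ := incrMeasure μ tm k)
      ext x
      simp only [A, Set.mem_preimage, Set.mem_image, Set.mem_empty_iff_false, iff_false]
      rintro ⟨y, -, e⟩
      exact hk (congrArg Sigma.fst e).symm
  · refine Set.eq_univ_of_forall fun ϰ => ?_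
    obtain ⟨n, x⟩ := ϰ
    obtain ⟨N, hN⟩ := Set.mem_iUnion.1 ((iUnion_spanningSets (incrMeasure μ tm n)).symm ▸
      Set.mem_univ x)
    exact ⟨_, ⟨(n, N), rfl⟩, x, hN, rfl⟩

instance [SigmaFinite μ] (T : ℝ≥0) : SigmaFinite (chainMeasureBefore μ tm T) := by
  rw [chainMeasureBefore]; infer_instance

/-- Reindexing `X ^ n` along a subset `S` of the indices. -/
noncomputable def reindex (X : Type*) [MeasurableSpace X] {n k l : ℕ} (S : Finset (Fin n))
    (h : S.card = k) (h' : Sᶜ.card = l) : (Fin n → X) ≃ᵐ (Fin k → X) × (Fin l → X) :=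
  (MeasurableEquiv.piCongrLeft (fun _ => X) (finSumEquivOfFinset h h')).symm.trans
    (MeasurableEquiv.sumPiEquivProdPi fun _ => X)

theorem reindex_apply {n k l : ℕ} (S : Finset (Fin n))
    (h : S.card = k) (h' : Sᶜ.card = l) (x : Fin n → X) :
    reindex X S h h' x = (x ∘ S.orderEmbOfFin h, x ∘ Sᶜ.orderEmbOfFin h') := by
  refine Prod.ext (funext fun i => ?_) (funext fun i => ?_) <;>
  simp [reindex, MeasurableEquiv.piCongrLeft, MeasurableEquiv.sumPiEquivProdPi,
    Equiv.piCongrLeft, Equiv.sumPiEquivProdPi]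

theorem measurePreserving_reindex [SigmaFinite μ] {n k l : ℕ} (S : Finset (Fin n))
    (h : S.card = k) (h' : Sᶜ.card = l) :
    MeasurePreserving (reindex X S h h') (Measure.pi fun _ => μ)
      ((Measure.pi fun _ => μ).prod (Measure.pi fun _ => μ)) :=
  ((measurePreserving_piCongrLeft (fun _ => μ) (finSumEquivOfFinset h h')).symm _).trans
    (measurePreserving_sumPiEquivProdPi fun _ => μ)

theorem val_splitAt {n k l : ℕ} (S : Finset (Fin n)) (h : S.card = k) (h' : Sᶜ.card = l) :
    (Prod.map Subtype.val Subtype.val : Incr tm k × Incr tm l → _) ∘ splitAt S h h' =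
      reindex X S h h' ∘ Subtype.val := by
  ext1 x
  simp [splitAt, subChain, reindex_apply]

theorem measurableEmbedding_splitAt (htm : Measurable tm) {n k l : ℕ} (S : Finset (Fin n))
    (h : S.card = k) (h' : Sᶜ.card = l) :
    MeasurableEmbedding (splitAt S h h' : Incr tm n → Incr tm k × Incr tm l) := by
  have hval : MeasurableEmbedding (Prod.map Subtype.val Subtype.val :
      Incr tm k × Incr tm l → (Fin k → X) × (Fin l → X)) :=
    (measurableEmbedding_val htm k).prodMap (measurableEmbedding_val htm l)
  have hemb : MeasurableEmbedding ((Prod.map Subtype.val Subtype.val :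
      Incr tm k × Incr tm l → _) ∘ (splitAt S h h' : Incr tm n → _)) := by
    rw [val_splitAt]
    exact (reindex X S h h').measurableEmbedding.comp (measurableEmbedding_val htm n)
  refine ⟨hemb.injective.of_comp, measurable_splitAt S h h', fun s hs => ?_⟩
  rw [← Set.preimage_image_eq (splitAt S h h' '' s) hval.injective, ← Set.image_comp]
  exact hval.measurable (hemb.measurableSet_image.2 hs)

/-- On each pattern the product measure is the image of the measure on merged chains. -/
theorem map_splitAt [SigmaFinite μ] (htm : Measurable tm) {n k l : ℕ} (S : Finset (Fin n))
    (h : S.card = k) (h' : Sᶜ.card = l) :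
    MeasurableSet (Set.range (splitAt S h h' : Incr tm n → Incr tm k × Incr tm l)) ∧
    (incrMeasure μ tm n).map (splitAt S h h') =
      ((incrMeasure μ tm k).prod (incrMeasure μ tm l)).restrict (Set.range (splitAt S h h')) := by
  have hval : MeasurableEmbedding (Prod.map Subtype.val Subtype.val :
      Incr tm k × Incr tm l → (Fin k → X) × (Fin l → X)) :=
    (measurableEmbedding_val htm k).prodMap (measurableEmbedding_val htm l)
  have hcomm := val_splitAt (tm := tm) S h h'
  have hemb : MeasurableEmbedding (reindex X S h h' ∘ (Subtype.val : Incr tm n → _)) :=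
    (reindex X S h h').measurableEmbedding.comp (measurableEmbedding_val htm n)
  have hrange : Set.range (splitAt S h h' : Incr tm n → Incr tm k × Incr tm l) =
      Prod.map Subtype.val Subtype.val ⁻¹'
        (Set.range (reindex X S h h' ∘ (Subtype.val : Incr tm n → _))) := by
    rw [← hcomm, Set.range_comp, Set.preimage_image_eq _ hval.injective]
  refine ⟨(measurableEmbedding_splitAt htm S h h').measurableSet_range, ?_⟩
  have key : ((incrMeasure μ tm n).map (splitAt S h h')).map (Prod.map Subtype.val Subtype.val) =
      (((incrMeasure μ tm k).prod (incrMeasure μ tm l)).restrict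
        (Set.range (splitAt S h h'))).map (Prod.map Subtype.val Subtype.val) := by
    rw [Measure.map_map hval.measurable (measurable_splitAt S h h'), hcomm,
      ← Measure.map_map (reindex X S h h').measurable measurable_subtype_coe,
      map_val_incrMeasure μ htm, hrange, ← hval.restrict_map,
      ← Measure.map_prod_map _ _ measurable_subtype_coe measurable_subtype_coe,
      map_val_incrMeasure μ htm, map_val_incrMeasure μ htm, Measure.prod_restrict,
      Measure.restrict_restrict hemb.measurableSet_range]
    rw [Set.inter_eq_left.2, ← (measurePreserving_reindex μ S h h').map_eq,
      (reindex X S h h').measurableEmbedding.restrict_map]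
    · congr 2
      rw [Set.range_comp, Set.preimage_image_eq _ (reindex X S h h').injective,
        Subtype.range_coe_subtype]
    · rw [← hcomm]
      rintro _ ⟨x, rfl⟩
      exact ⟨(splitAt S h h' x).1.2, (splitAt S h h' x).2.2⟩
  rw [← hval.comap_map ((incrMeasure μ tm n).map (splitAt S h h')), key, hval.comap_map]

theorem ae_chain_iff {P : Chain tm → Prop} : (∀ᵐ ϰ ∂chainMeasure μ tm, P ϰ) ↔
    ∀ n, ∀ᵐ ϰ ∂(incrMeasure μ tm n).map (Sigma.mk n), P ϰ := by
  rw [chainMeasure_eq, Measure.ae_sum_iff]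

theorem measurable_fiberwise {Y : Type*} [MeasurableSpace Y] {s : Set (Chain tm × Y)}
    (h : ∀ n, MeasurableSet {z : Incr tm n × Y | (⟨n, z.1⟩, z.2) ∈ s}) : MeasurableSet s := by
  have : s = ⋃ n, Prod.map (Sigma.mk n) id '' {z : Incr tm n × Y | (⟨n, z.1⟩, z.2) ∈ s} := by
    ext ⟨⟨n, x⟩, y⟩
    simp only [Set.mem_iUnion, Set.mem_image, Set.mem_ofPred_eq, Prod.exists, Prod.map_apply, id]
    constructor
    · intro h
      exact ⟨n, x, y, h, rfl⟩
    · rintro ⟨k, a, b, h, e⟩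
      exact e ▸ h
  rw [this]
  refine MeasurableSet.iUnion fun n => ?_
  exact ((measurableEmbedding_sigmaMk n).prodMap MeasurableEmbedding.id).measurableSet_image.2 (h n)

/-- The relation `P x y` for all `x ∈ pts ϰ`, `y`. -/
theorem measurableSet_forall_pts {Y : Type*} [MeasurableSpace Y] {P : X → Y → Prop}
    (h : MeasurableSet {z : X × Y | P z.1 z.2}) :
    MeasurableSet {z : Chain tm × Y | ∀ x ∈ pts z.1, P x z.2} := by
  refine measurable_fiberwise fun n => ?_
  have : {z : Incr tm n × Y | (⟨n, z.1⟩, z.2) ∈ {z : Chain tm × Y | ∀ x ∈ pts z.1, P x z.2}} =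
      ⋂ i, {z : Incr tm n × Y | P (z.1.1 i) z.2} := by
    ext z
    simp [mem_pts]
  rw [this]
  refine MeasurableSet.iInter fun i => ?_
  have hm : Measurable fun z : Incr tm n × Y => (z.1.1 i, z.2) :=
    ((measurable_pi_apply i).comp (measurable_subtype_coe.comp measurable_fst)).prodMk
      measurable_snd
  exact hm h

theorem measurableSet_apart (htm : Measurable tm) :
    MeasurableSet {z : Chain tm × Chain tm | Apart tm (pts z.1) (pts z.2)} := by
  refine measurableSet_forall_pts (P := fun x ϰ => ∀ y ∈ pts ϰ, tm x ≠ tm y) ?_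
  refine measurable_swap (measurableSet_forall_pts (P := fun y x => tm x ≠ tm y) ?_)
  exact (measurableSet_eq_fun (htm.comp measurable_snd) (htm.comp measurable_fst)).compl

theorem ae_apart_const [SigmaFinite μ] (ht : IsTime μ tm)
    (σ : Finset X) : ∀ᵐ ϰ ∂chainMeasure μ tm, Apart tm (pts ϰ) σ := by
  rw [ae_chain_iff]
  intro n
  have h : ∀ᵐ x ∂(Measure.pi fun _ : Fin n => μ), ∀ i, ∀ y ∈ σ, tm (x i) ≠ tm y := by
    rw [ae_all_iff]
    intro i
    have : ∀ᵐ x ∂μ, ∀ y ∈ σ, tm x ≠ tm y := by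
      refine (ae_ball_iff (S := (σ : Set X)) σ.countable_toSet).2 fun y _ => ?_
      exact measure_mono_null (fun x hx => not_not.1 hx) (ht.null (tm y))
    exact (Measure.quasiMeasurePreserving_eval (fun _ : Fin n => μ) i).ae this
  have h2 : ∀ᵐ x ∂(incrMeasure μ tm n), ∀ i, ∀ y ∈ σ, tm (x.1 i) ≠ tm y := by
    have h3 := ae_restrict_of_ae (s := {x | StrictMono (tm ∘ x)}) h
    rw [← map_val_incrMeasure μ ht.measurable] at h3
    exact ae_of_ae_map measurable_subtype_coe.aemeasurable h3
  have hmeas : MeasurableSet {ϰ : Chain tm | Apart tm (pts ϰ) σ} := by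
    have := (measurable_id.prodMk (measurable_const (a := ()))) (measurableSet_forall_pts (tm := tm)
      (P := fun x (_ : Unit) => ∀ y ∈ σ, tm x ≠ tm y) (by
        have : {z : X × Unit | ∀ y ∈ σ, tm z.1 ≠ tm y} = ⋂ y ∈ σ, {z | tm z.1 = tm y}ᶜ := by
          ext; simp
        rw [this]
        exact Finset.measurableSet_biInter _ fun y _ =>
          (measurableSet_eq_fun (ht.measurable.comp measurable_fst) measurable_const).compl))
    exact this
  rw [ae_map_iff (measurable_sigmaMk n).aemeasurable hmeas]
  filter_upwards [h2] with x hx y hy z hz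
  obtain ⟨i, rfl⟩ := mem_pts.1 hy
  exact hx i z hz

/-- Almost all pairs of chains have no simultaneous points, because the level sets of the time are
null. -/
theorem ae_apart [SigmaFinite μ] (ht : IsTime μ tm) :
    ∀ᵐ z ∂(chainMeasure μ tm).prod (chainMeasure μ tm), Apart tm (pts z.1) (pts z.2) := by
  rw [Measure.ae_prod_iff_ae_ae (measurableSet_apart ht.measurable)]
  refine .of_forall fun a => ?_
  filter_upwards [ae_apart_const μ ht (pts a)] with b hb using hb.symm

/-- Up to simultaneous points, the pairs of an increasing `k`-tuple and an increasing `l`-tuple are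
classified by the pattern of the first in the merged tuple. -/
theorem prod_incrMeasure [SigmaFinite μ] (ht : IsTime μ tm) (k l : ℕ) (s : Set (Chain tm × Chain tm))
    (hs : MeasurableSet s) :
    ((incrMeasure μ tm k).map (Sigma.mk k)).prod ((incrMeasure μ tm l).map (Sigma.mk l)) s =
      ∑ S ∈ Finset.powersetCard k (Finset.univ : Finset (Fin (k + l))),
        (incrMeasure μ tm (k + l)).map (split S) s := by
  classical
  have hm2 : Measurable (Prod.map (Sigma.mk k) (Sigma.mk l) :
      Incr tm k × Incr tm l → Chain tm × Chain tm) :=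
    (measurable_sigmaMk k).prodMap (measurable_sigmaMk l)
  set s' : Set (Incr tm k × Incr tm l) := Prod.map (Sigma.mk k) (Sigma.mk l) ⁻¹' s with hs'
  have hms' : MeasurableSet s' := hm2 hs
  rw [Measure.map_prod_map _ _ (measurable_sigmaMk k) (measurable_sigmaMk l),
    Measure.map_apply hm2 hs, ← hs']
  have hcard : ∀ S ∈ Finset.powersetCard k (Finset.univ : Finset (Fin (k + l))),
      S.card = k ∧ Sᶜ.card = l := fun S hS => by
    have h := (Finset.mem_powersetCard.1 hS).2
    exact ⟨h, by rw [Finset.card_compl, Fintype.card_fin, h]; omega⟩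
  -- the pairs with pattern `S` in the merged tuple
  let R : Finset (Fin (k + l)) → Set (Incr tm k × Incr tm l) := fun S =>
    if h : S.card = k ∧ Sᶜ.card = l then Set.range (splitAt S h.1 h.2) else ∅
  have hR : ∀ S, MeasurableSet (R S) := fun S => by
    by_cases h : S.card = k ∧ Sᶜ.card = l
    · simp only [R, dif_pos h]; exact (map_splitAt μ ht.measurable S h.1 h.2).1
    · simp only [R, dif_neg h]; exact MeasurableSet.empty
  have hsum : ∀ S ∈ Finset.powersetCard k (Finset.univ : Finset (Fin (k + l))),
      (incrMeasure μ tm (k + l)).map (split S) s =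
        ((incrMeasure μ tm k).prod (incrMeasure μ tm l)) (s' ∩ R S) := fun S hS => by
    have h := hcard S hS
    have e : split S = Prod.map (Sigma.mk k) (Sigma.mk l) ∘
        (splitAt S h.1 h.2 : Incr tm (k + l) → _) := by
      ext1 x
      exact Prod.ext (pts_injective (by simp [split, splitAt, pts_subChain]))
        (pts_injective (by simp [split, splitAt, pts_subChain]))
    rw [e, ← Measure.map_map hm2 (measurable_splitAt S h.1 h.2), Measure.map_apply hm2 hs, ← hs',
      (map_splitAt μ ht.measurable S h.1 h.2).2, Measure.restrict_apply hms']
    simp only [R, dif_pos h]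
  rw [Finset.sum_congr rfl hsum, ← measure_biUnion_finset]
  · refine measure_congr ?_
    -- tuples without simultaneous points can be merged, with exactly one pattern
    have hap := ae_apart μ ht
    have hap2 : ∀ᵐ z ∂(incrMeasure μ tm k).prod (incrMeasure μ tm l),
        Apart tm (pts (tm := tm) ⟨k, z.1⟩) (pts (tm := tm) ⟨l, z.2⟩) := by
      rw [chainMeasure_eq, Measure.prod_sum, Measure.ae_sum_iff] at hap
      have := hap (k, l)
      rw [Measure.map_prod_map _ _ (measurable_sigmaMk k) (measurable_sigmaMk l)] at this
      exact ae_of_ae_map hm2.aemeasurable this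
    filter_upwards [hap2] with z hz
    refine propext ⟨fun h => ?_, fun h => ?_⟩
    · obtain ⟨S, h1, h2, x, hx⟩ := exists_splitAt_eq z.1 z.2 hz
      refine Set.mem_biUnion (Finset.mem_powersetCard.2 ⟨Finset.subset_univ _, h1⟩) ⟨h, ?_⟩
      simp only [R, dif_pos (And.intro h1 h2)]
      exact ⟨x, hx⟩
    · obtain ⟨S, -, h⟩ := Set.mem_iUnion₂.1 h
      exact h.1
  · intro S hS S' hS' hne
    refine Set.disjoint_left.2 fun z hz hz' => hne ?_
    have h := hcard S hS
    have h' := hcard S' hS'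
    have h1 := hz.2
    have h2 := hz'.2
    simp only [R, dif_pos h] at h1
    simp only [R, dif_pos h'] at h2
    obtain ⟨x, rfl⟩ := h1
    obtain ⟨y, hy⟩ := h2
    exact (splitAt_injective hy).1.symm
  · exact fun S _ => hms'.inter (hR S)

/-- The sum-integral formula as an identity of measures: the square of the chain measure is the sum
of its images under all splittings. -/
theorem prod_chainMeasure [SigmaFinite μ] (ht : IsTime μ tm) :
    (chainMeasure μ tm).prod (chainMeasure μ tm) =
      Measure.sum fun i : Σ n : ℕ, Finset (Fin n) => (incrMeasure μ tm i.1).map (split i.2) := by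
  ext s hs
  rw [chainMeasure_eq, Measure.prod_sum, Measure.sum_apply _ hs, Measure.sum_apply _ hs,
    ENNReal.tsum_sigma', ← Finset.HasAntidiagonal.sigmaAntidiagonalEquivProd.tsum_eq,
    ENNReal.tsum_sigma']
  congr 1
  ext1 n
  rw [tsum_fintype, tsum_fintype]
  have h1 : ∀ (c : Finset.HasAntidiagonal.antidiagonal n),
      ((incrMeasure μ tm c.1.1).map (Sigma.mk c.1.1)).prod
        ((incrMeasure μ tm c.1.2).map (Sigma.mk c.1.2)) s =
      ∑ S ∈ Finset.powersetCard c.1.1 (Finset.univ : Finset (Fin n)),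
        (incrMeasure μ tm n).map (split S) s := by
    rintro ⟨⟨k, l⟩, h⟩
    obtain rfl := Finset.HasAntidiagonal.mem_antidiagonal.1 h
    exact prod_incrMeasure μ ht k l s hs
  refine (Finset.sum_congr rfl fun c _ => h1 c).trans ?_
  rw [Finset.sum_coe_sort (Finset.HasAntidiagonal.antidiagonal n) fun c : ℕ × ℕ =>
    ∑ S ∈ Finset.powersetCard c.1 (Finset.univ : Finset (Fin n)),
        (incrMeasure μ tm n).map (split S) s]
  rw [Finset.Nat.sum_antidiagonal_eq_sum_range_succ_mk]
  have := Finset.sum_powerset (Finset.univ : Finset (Fin n))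
    fun S => (incrMeasure μ tm n).map (split S) s
  rw [Finset.powerset_univ] at this
  simp only [this, Finset.card_univ, Fintype.card_fin]

end SumIntegral

/-! ### Consequences of the sum-integral formula -/
section Consequences

open scoped Classical

variable {X : Type*} [MeasurableSpace X] (μ : Measure X) [SigmaFinite μ] {tm : X → ℝ≥0}
  {Y : Type*} [MeasurableSpace Y] (ν : Measure Y) [SFinite ν]

local notation "𝔪" => chainMeasure μ tm

theorem prod_chainMeasure_right : ν.prod 𝔪 =
    Measure.sum fun n => (ν.prod (incrMeasure μ tm n)).map (Prod.map id (Sigma.mk n)) := by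
  rw [chainMeasure_eq, Measure.prod_sum_right]
  congr 1
  ext1 n
  rw [← Measure.map_prod_map _ _ measurable_id (measurable_sigmaMk n), Measure.map_id]

theorem prod_prod_chainMeasure (ht : IsTime μ tm) : ν.prod ((𝔪).prod 𝔪) =
      Measure.sum fun i : Σ n : ℕ, Finset (Fin n) =>
        (ν.prod (incrMeasure μ tm i.1)).map (Prod.map id (split i.2)) := by
  rw [prod_chainMeasure μ ht, Measure.prod_sum_right]
  congr 1
  ext1 i
  rw [← Measure.map_prod_map _ _ measurable_id (measurable_split i.2), Measure.map_id]

theorem measurable_idSigmaMk (n : ℕ) :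
    Measurable (Prod.map id (Sigma.mk n) : Y × Incr tm n → Y × Chain tm) :=
  measurable_id.prodMap (measurable_sigmaMk n)

theorem measurable_idSplit {n : ℕ} (S : Finset (Fin n)) :
    Measurable (Prod.map id (split S) : Y × Incr tm n → Y × (Chain tm × Chain tm)) :=
  measurable_id.prodMap (measurable_split S)

theorem measurableEmbedding_idSigmaMk (n : ℕ) :
    MeasurableEmbedding (Prod.map id (Sigma.mk n) : Y × Incr tm n → Y × Chain tm) :=
  MeasurableEmbedding.id.prodMap (measurableEmbedding_sigmaMk n)

theorem lintegral_chain {f : Y × Chain tm → ℝ≥0∞} (hf : AEMeasurable f (ν.prod 𝔪)) :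
    ∫⁻ z, f z ∂ν.prod 𝔪 = ∑' n, ∫⁻ z, f (z.1, ⟨n, z.2⟩) ∂ν.prod (incrMeasure μ tm n) := by
  rw [prod_chainMeasure_right] at hf ⊢
  rw [lintegral_sum_measure]
  congr 1
  ext1 n
  exact lintegral_map' (hf.mono_measure (Measure.le_sum _ n)) (measurable_idSigmaMk n).aemeasurable

theorem integral_chain {E : Type*} [NormedAddCommGroup E] [NormedSpace ℝ E]
    {f : Y × Chain tm → E} (hf : Integrable f (ν.prod 𝔪)) :
    ∫ z, f z ∂ν.prod 𝔪 = ∑' n, ∫ z, f (z.1, ⟨n, z.2⟩) ∂ν.prod (incrMeasure μ tm n) := by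
  rw [prod_chainMeasure_right] at hf ⊢
  rw [integral_sum_measure hf]
  congr 1
  ext1 n
  exact integral_map (measurable_idSigmaMk n).aemeasurable (hf.mono_measure (Measure.le_sum _ n)).1

theorem aestronglyMeasurable_chain_iff {E : Type*} [TopologicalSpace E]
    [TopologicalSpace.PseudoMetrizableSpace E] {f : Y × Chain tm → E} :
    AEStronglyMeasurable f (ν.prod 𝔪) ↔
      ∀ n, AEStronglyMeasurable (fun z => f (z.1, ⟨n, z.2⟩)) (ν.prod (incrMeasure μ tm n)) := by
  rw [prod_chainMeasure_right, aestronglyMeasurable_sum_measure_iff]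
  exact forall_congr' fun n => (measurableEmbedding_idSigmaMk n).aestronglyMeasurable_map_iff

theorem measurableEmbedding_split (htm : Measurable tm) {n : ℕ} (S : Finset (Fin n)) :
    MeasurableEmbedding (split S : Incr tm n → Chain tm × Chain tm) :=
  ((measurableEmbedding_sigmaMk _).prodMap (measurableEmbedding_sigmaMk _)).comp
    (measurableEmbedding_splitAt htm S rfl rfl)

theorem apart_split {n : ℕ} (S : Finset (Fin n)) (x : Incr tm n) :
    Apart tm (pts (split S x).1) (pts (split S x).2) := by
  classical
  intro y hy z hz e
  have hu := pts_split_union S x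
  have h1 : y ∈ pts (tm := tm) ⟨n, x⟩ := hu ▸ Finset.mem_union_left _ hy
  have h2 : z ∈ pts (tm := tm) ⟨n, x⟩ := hu ▸ Finset.mem_union_right _ hz
  have := injOn_pts (⟨n, x⟩ : Chain tm) h1 h2 e
  subst this
  rw [pts_split_snd] at hz
  exact (Finset.mem_sdiff.1 hz).2 hy

theorem aestronglyMeasurable_sum_powerset (ht : IsTime μ tm)
    {E : Type*} [TopologicalSpace E] [AddCommMonoid E] [ContinuousAdd E]
    [TopologicalSpace.PseudoMetrizableSpace E] {F : Y → Finset X → Finset X → E}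
    (hF : AEStronglyMeasurable (fun z : Y × (Chain tm × Chain tm) => F z.1 (pts z.2.1) (pts z.2.2))
      (ν.prod ((𝔪).prod 𝔪))) :
    AEStronglyMeasurable (fun z => ∑ A ∈ (pts z.2).powerset, F z.1 A (pts z.2 \ A)) (ν.prod 𝔪) := by
  rw [prod_prod_chainMeasure μ ν ht] at hF
  refine (aestronglyMeasurable_chain_iff μ ν).2 fun n => ?_
  simp only [← sum_split]
  exact Finset.aestronglyMeasurable_fun_sum _ fun S _ =>
    (hF.mono_measure (Measure.le_sum _ ⟨n, S⟩)).comp_measurable (measurable_idSplit S)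

/-- The sum-integral formula: integration over pairs of chains is integration over their union, of
the sum over all ways to split it. -/
theorem lintegral_prod_chain (ht : IsTime μ tm) {F : Y → Finset X → Finset X → ℝ≥0∞}
    (hF : AEMeasurable (fun z : Y × (Chain tm × Chain tm) => F z.1 (pts z.2.1) (pts z.2.2))
      (ν.prod ((𝔪).prod 𝔪))) : ∫⁻ z, F z.1 (pts z.2.1) (pts z.2.2) ∂ν.prod ((𝔪).prod 𝔪) =
      ∫⁻ z, ∑ A ∈ (pts z.2).powerset, F z.1 A (pts z.2 \ A) ∂ν.prod 𝔪 := by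
  have h0 := (aestronglyMeasurable_sum_powerset μ ν ht hF.aestronglyMeasurable).aemeasurable
  set G : Y × (Chain tm × Chain tm) → ℝ≥0∞ := fun z => F z.1 (pts z.2.1) (pts z.2.2) with hG
  have h1 : ∀ n (S : Finset (Fin n)), AEMeasurable G
      ((ν.prod (incrMeasure μ tm n)).map (Prod.map id (split S))) := fun n S => by
    rw [prod_prod_chainMeasure μ ν ht] at hF
    exact hF.mono_measure (Measure.le_sum (fun i : Σ n : ℕ, Finset (Fin n) =>
      (ν.prod (incrMeasure μ tm i.1)).map (Prod.map id (split i.2))) (Sigma.mk n S))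
  rw [lintegral_chain μ ν h0, prod_prod_chainMeasure μ ν ht, lintegral_sum_measure,
    ENNReal.tsum_sigma']
  congr 1
  ext1 n
  have h2 : ∀ z : Y × Incr tm n, ∑ A ∈ (pts (tm := tm) ⟨n, z.2⟩).powerset,
      F z.1 A (pts (tm := tm) ⟨n, z.2⟩ \ A) =
        ∑ S : Finset (Fin n), G (Prod.map id (split S) z) := fun z => by
    rw [← sum_split]; rfl
  simp only [h2]
  rw [lintegral_finsetSum' (f := fun S z => G (Prod.map id (split S) z)) _ fun S _ => (h1 n S).comp_measurable (measurable_idSplit S),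
    tsum_fintype]
  exact Finset.sum_congr rfl fun S _ => lintegral_map' (h1 n S) (measurable_idSplit S).aemeasurable

/-- The sum-integral formula for Bochner integrals. -/
theorem integral_prod_chain (ht : IsTime μ tm)
    {E : Type*} [NormedAddCommGroup E] [NormedSpace ℝ E] [CompleteSpace E]
    {F : Y → Finset X → Finset X → E}
    (hF : Integrable (fun z : Y × (Chain tm × Chain tm) => F z.1 (pts z.2.1) (pts z.2.2))
      (ν.prod ((𝔪).prod 𝔪))) :
    Integrable (fun z => ∑ A ∈ (pts z.2).powerset, F z.1 A (pts z.2 \ A)) (ν.prod 𝔪) ∧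
    ∫ z, F z.1 (pts z.2.1) (pts z.2.2) ∂ν.prod ((𝔪).prod 𝔪) =
      ∫ z, ∑ A ∈ (pts z.2).powerset, F z.1 A (pts z.2 \ A) ∂ν.prod 𝔪 := by
  have h0 : Integrable (fun z => ∑ A ∈ (pts z.2).powerset, F z.1 A (pts z.2 \ A)) (ν.prod 𝔪) := by
    refine ⟨aestronglyMeasurable_sum_powerset μ ν ht hF.1, ?_⟩
    have h := lintegral_prod_chain μ ν ht (F := fun y a b => ‖F y a b‖ₑ) hF.1.enorm
    have h2 := hF.2
    rw [HasFiniteIntegral, h] at h2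
    exact lt_of_le_of_lt (lintegral_mono fun z => enorm_sum_le _ _) h2
  refine ⟨h0, ?_⟩
  set G : Y × (Chain tm × Chain tm) → E := fun z => F z.1 (pts z.2.1) (pts z.2.2) with hG
  have hF' := hF
  rw [prod_prod_chainMeasure μ ν ht] at hF'
  have h1 : ∀ n (S : Finset (Fin n)), Integrable G
      ((ν.prod (incrMeasure μ tm n)).map (Prod.map id (split S))) := fun n S =>
    hF'.mono_measure (Measure.le_sum (fun i : Σ n : ℕ, Finset (Fin n) =>
      (ν.prod (incrMeasure μ tm i.1)).map (Prod.map id (split i.2))) (Sigma.mk n S))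
  have hs := (hasSum_integral_measure hF').summable
  rw [integral_chain μ ν h0, prod_prod_chainMeasure μ ν ht, integral_sum_measure hF', hs.tsum_sigma]
  congr 1
  ext1 n
  have h2 : ∀ z : Y × Incr tm n, ∑ A ∈ (pts (tm := tm) ⟨n, z.2⟩).powerset,
      F z.1 A (pts (tm := tm) ⟨n, z.2⟩ \ A) =
        ∑ S : Finset (Fin n), G (Prod.map id (split S) z) := fun z => by
    rw [← sum_split]; rfl
  simp only [h2]
  rw [integral_finsetSum (f := fun S z => G (Prod.map id (split S) z)) _ fun S _ => (h1 n S).comp_measurable (measurable_idSplit S),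
    tsum_fintype]
  exact Finset.sum_congr rfl fun S _ => integral_map (measurable_idSplit S).aemeasurable (h1 n S).1

/-- A property of almost all pairs of chains holds for all splittings of almost all chains. -/
theorem ae_split (ht : IsTime μ tm) {P : Y → Finset X → Finset X → Prop}
    (h : ∀ᵐ z ∂ν.prod ((𝔪).prod 𝔪), P z.1 (pts z.2.1) (pts z.2.2)) :
    ∀ᵐ z ∂ν.prod 𝔪, ∀ A ⊆ pts z.2, P z.1 A (pts z.2 \ A) := by
  rw [prod_prod_chainMeasure μ ν ht, Measure.ae_sum_iff] at h
  rw [prod_chainMeasure_right, Measure.ae_sum_iff]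
  intro n
  have h1 : ∀ᵐ z ∂ν.prod (incrMeasure μ tm n), ∀ S : Finset (Fin n),
      P z.1 (pts (split S z.2).1) (pts (split S z.2).2) :=
    ae_all_iff.2 fun S => ae_of_ae_map (measurable_idSplit S).aemeasurable (h ⟨n, S⟩)
  rw [(measurableEmbedding_idSigmaMk n).ae_map_iff]
  filter_upwards [h1] with z hz A hA
  obtain ⟨y, x⟩ := z
  have hp : pts (tm := tm) ⟨n, x⟩ = Finset.univ.map
      ⟨x.1, fun _ _ e => x.2.injective (congrArg tm e)⟩ := rfl
  simp only [Prod.map_apply, id] at hA ⊢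
  rw [hp, Finset.subset_map_iff] at hA
  obtain ⟨S, -, rfl⟩ := hA
  have := hz S
  rw [pts_split_snd] at this
  simpa only [split, pts_subChain] using this

/-- Adding a trivial parameter. -/
theorem measurableEmbedding_unit {Z : Type*} [MeasurableSpace Z] :
    MeasurableEmbedding (Prod.mk () : Z → Unit × Z) :=
  (MeasurableEquiv.punitProd (α := Z)).symm.measurableEmbedding

theorem aestronglyMeasurable_sum_powerset' (ht : IsTime μ tm)
    {E : Type*} [TopologicalSpace E] [AddCommMonoid E] [ContinuousAdd E]
    [TopologicalSpace.PseudoMetrizableSpace E] {F : Finset X → Finset X → E}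
    (hF : AEStronglyMeasurable (fun z : Chain tm × Chain tm => F (pts z.1) (pts z.2))
      ((𝔪).prod 𝔪)) :
    AEStronglyMeasurable (fun ϰ => ∑ A ∈ (pts ϰ).powerset, F A (pts ϰ \ A)) 𝔪 := by
  have h := aestronglyMeasurable_sum_powerset μ (Measure.dirac ()) ht (F := fun _ => F)
  rw [Measure.dirac_prod, Measure.dirac_prod, measurableEmbedding_unit.aestronglyMeasurable_map_iff,
    measurableEmbedding_unit.aestronglyMeasurable_map_iff] at h
  exact h hF

theorem lintegral_prod_chain' (ht : IsTime μ tm) {F : Finset X → Finset X → ℝ≥0∞}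
    (hF : AEMeasurable (fun z : Chain tm × Chain tm => F (pts z.1) (pts z.2)) ((𝔪).prod 𝔪)) :
    ∫⁻ z, F (pts z.1) (pts z.2) ∂(𝔪).prod 𝔪 = ∫⁻ ϰ, ∑ A ∈ (pts ϰ).powerset, F A (pts ϰ \ A) ∂𝔪 := by
  have h := lintegral_prod_chain μ (Measure.dirac ()) ht (F := fun _ => F)
  rw [Measure.dirac_prod, Measure.dirac_prod, measurableEmbedding_unit.aemeasurable_map_iff,
    measurableEmbedding_unit.lintegral_map, measurableEmbedding_unit.lintegral_map] at h
  exact h hF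

theorem integral_prod_chain' (ht : IsTime μ tm)
    {E : Type*} [NormedAddCommGroup E] [NormedSpace ℝ E] [CompleteSpace E]
    {F : Finset X → Finset X → E}
    (hF : Integrable (fun z : Chain tm × Chain tm => F (pts z.1) (pts z.2)) ((𝔪).prod 𝔪)) :
    Integrable (fun ϰ => ∑ A ∈ (pts ϰ).powerset, F A (pts ϰ \ A)) 𝔪 ∧
    ∫ z, F (pts z.1) (pts z.2) ∂(𝔪).prod 𝔪 = ∫ ϰ, ∑ A ∈ (pts ϰ).powerset, F A (pts ϰ \ A) ∂𝔪 := by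
  have h := integral_prod_chain μ (Measure.dirac ()) ht (F := fun _ => F)
  rw [Measure.dirac_prod, Measure.dirac_prod, measurableEmbedding_unit.integrable_map_iff,
    measurableEmbedding_unit.integrable_map_iff,
    measurableEmbedding_unit.integral_map, measurableEmbedding_unit.integral_map] at h
  exact h hF

theorem ae_split' (ht : IsTime μ tm) {P : Finset X → Finset X → Prop}
    (h : ∀ᵐ z ∂(𝔪).prod 𝔪, P (pts z.1) (pts z.2)) : ∀ᵐ ϰ ∂𝔪, ∀ A ⊆ pts ϰ, P A (pts ϰ \ A) := by
  have h' := ae_split μ (Measure.dirac ()) ht (P := fun _ => P)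
  rw [Measure.dirac_prod, Measure.dirac_prod, measurableEmbedding_unit.ae_map_iff,
    measurableEmbedding_unit.ae_map_iff] at h'
  exact h' h

/-- The union of two chains without simultaneous points, as a chain; other pairs are sent to the
empty chain. -/
noncomputable def merge (z : Chain tm × Chain tm) : Chain tm :=
  if Apart tm (pts z.1) (pts z.2) then chainOf tm (pts z.1 ∪ pts z.2) else emptyChain tm

theorem pts_merge {z : Chain tm × Chain tm} (h : Apart tm (pts z.1) (pts z.2)) :
    pts (merge z) = pts z.1 ∪ pts z.2 := by
  rw [merge, if_pos h, pts_chainOf (injOn_union (injOn_pts _) (injOn_pts _) h)]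

theorem merge_split {n : ℕ} (S : Finset (Fin n)) (x : Incr tm n) : merge (split S x) = ⟨n, x⟩ := by
  classical
  refine pts_injective ?_
  rw [pts_merge (apart_split S x), pts_split_union]

theorem measurable_merge (htm : Measurable tm) :
    Measurable (merge : Chain tm × Chain tm → Chain tm) := by
  classical
  intro s hs
  have : merge ⁻¹' s = (⋃ i : Σ n : ℕ, Finset (Fin n), split i.2 '' (Sigma.mk i.1 ⁻¹' s)) ∪
      ({z | Apart tm (pts z.1) (pts z.2)}ᶜ ∩ {_z | emptyChain tm ∈ s}) := by
    ext z
    simp only [Set.mem_preimage, Set.mem_union, Set.mem_iUnion, Set.mem_image, Set.mem_inter_iff,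
      Set.mem_compl_iff, Set.mem_ofPred_eq]
    by_cases hz : Apart tm (pts z.1) (pts z.2)
    · simp only [hz, not_true_eq_false, false_and, or_false]
      constructor
      · intro hm
        obtain ⟨S, h, h', x, e⟩ := exists_splitAt_eq z.1.2 z.2.2 hz
        have e' : split S x = z := by
          refine Prod.ext (pts_injective ?_) (pts_injective ?_)
          · have := congrArg (fun w => pts (tm := tm) ⟨_, w.1⟩) e
            simpa [splitAt, split, pts_subChain] using this
          · have := congrArg (fun w => pts (tm := tm) ⟨_, w.2⟩) e
            simpa [splitAt, split, pts_subChain] using this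
        refine ⟨⟨_, S⟩, x, ?_, e'⟩
        rw [← merge_split S x, e']
        exact hm
      · rintro ⟨⟨n, S⟩, x, hx, rfl⟩
        rw [merge_split]
        exact hx
    · have hm : merge z = emptyChain tm := if_neg hz
      rw [hm]
      simp only [hz, not_false_eq_true, true_and]
      refine ⟨Or.inr, ?_⟩
      rintro (⟨⟨n, S⟩, x, -, rfl⟩ | h)
      · exact (hz (apart_split S x)).elim
      · exact h
  rw [this]
  refine (MeasurableSet.iUnion fun i => ?_).union
    ((measurableSet_apart htm).compl.inter (MeasurableSet.const _))
  exact (measurableEmbedding_split htm i.2).measurableSet_image.2 (measurable_sigmaMk _ hs)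

theorem quasiMeasurePreserving_merge (ht : IsTime μ tm) :
    Measure.QuasiMeasurePreserving (merge : Chain tm × Chain tm → Chain tm) ((𝔪).prod 𝔪) 𝔪 := by
  refine ⟨measurable_merge ht.measurable, Measure.AbsolutelyContinuous.mk fun s hs h0 => ?_⟩
  rw [Measure.map_apply (measurable_merge ht.measurable) hs, prod_chainMeasure μ ht,
    Measure.sum_apply _ (measurable_merge ht.measurable hs), ENNReal.tsum_eq_zero]
  rintro ⟨n, S⟩
  rw [Measure.map_apply (measurable_split S) (measurable_merge ht.measurable hs), ← Set.preimage_comp]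
  have e : (merge ∘ split S : Incr tm n → Chain tm) = Sigma.mk n := funext (merge_split S)
  rw [e, ← Measure.map_apply (measurable_sigmaMk n) hs]
  exact le_antisymm (h0 ▸ Measure.le_sum _ n s) zero_le

/-! ### One-point chains -/

theorem measurable_sing : Measurable (sing tm) :=
  (measurable_sigmaMk 1).comp (Measurable.subtype_mk (measurable_pi_lambda _ fun _ => measurable_id))

theorem map_sing (htm : Measurable tm) : μ.map (sing tm) = (𝔪).restrict {ϰ | ϰ.1 = 1} := by
  have h1 := map_val_incrMeasure μ htm 1
  have hu : {x : Fin 1 → X | StrictMono (tm ∘ x)} = Set.univ :=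
    Set.eq_univ_of_forall fun x => Subsingleton.strictMono _
  rw [hu, Measure.restrict_univ] at h1
  have h2 : (Measure.pi fun _ : Fin 1 => μ).map (MeasurableEquiv.funUnique (Fin 1) X) = μ := by
    convert (measurePreserving_funUnique μ (Fin 1)).map_eq
  have h3 : μ.map (sing tm) = (incrMeasure μ tm 1).map (Sigma.mk 1) := by
    calc μ.map (sing tm) = ((Measure.pi fun _ : Fin 1 => μ).map
          (MeasurableEquiv.funUnique (Fin 1) X)).map (sing tm) := by rw [h2]
      _ = _ := by
        rw [← h1, Measure.map_map (MeasurableEquiv.measurable _) measurable_subtype_coe,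
          Measure.map_map measurable_sing
            ((MeasurableEquiv.measurable _).comp measurable_subtype_coe)]
        congr 1
        ext1 x
        refine pts_injective ?_
        ext y
        simp [mem_pts, sing, MeasurableEquiv.funUnique]
  have hm : MeasurableSet {ϰ : Chain tm | ϰ.1 = 1} :=
    measurableSet_chain.2 fun n => MeasurableSet.const (n = 1)
  rw [h3, chainMeasure_eq, Measure.restrict_sum _ hm]
  ext s hs
  rw [Measure.sum_apply _ hs, tsum_eq_single 1]
  · rw [Measure.restrict_apply hs, Measure.map_apply (measurable_sigmaMk 1) hs,
      Measure.map_apply (measurable_sigmaMk 1) (hs.inter hm)]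
    congr 1
    ext x
    simp
  · intro n hn
    rw [Measure.restrict_apply hs, Measure.map_apply (measurable_sigmaMk n) (hs.inter hm)]
    convert measure_empty (μ := incrMeasure μ tm n)
    ext x
    simp [hn]

theorem quasiMeasurePreserving_sing (htm : Measurable tm) :
    Measure.QuasiMeasurePreserving (sing tm) μ 𝔪 :=
  ⟨measurable_sing, by
    rw [map_sing μ htm]
    exact Measure.absolutelyContinuous_of_le Measure.restrict_le_self⟩

theorem measurableSet_before (htm : Measurable tm) :
    MeasurableSet {z : Chain tm × ℝ≥0 | z.1 ∈ before tm z.2} :=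
  measurableSet_forall_pts (P := fun x T => tm x < T)
    (measurableSet_lt (htm.comp measurable_fst) measurable_snd)

theorem measurableSet_before_const (htm : Measurable tm) (T : ℝ≥0) : MeasurableSet (before tm T) :=
  (measurable_id.prodMk measurable_const) (measurableSet_before htm)

/-- The kernel of the decomposition of a chain before `T` at its last point `S = {x}`. -/
theorem sum_lastPoint {M : Type*} [AddCommMonoid M] (T : ℝ≥0) (k : Finset X → M) (ϰ : Chain tm) :
    ∑ A ∈ (pts ϰ).powerset, (if A.card = 1 ∧ (∀ x ∈ A, tm x < T ∧ ∀ y ∈ pts ϰ \ A, tm y < tm x)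
      then k ((pts ϰ \ A) ∪ A) else 0) = if pts ϰ ≠ ∅ ∧ ϰ ∈ before tm T then k (pts ϰ) else 0 := by
  by_cases h0 : pts ϰ = ∅
  · rw [if_neg (by simp [h0])]
    refine Finset.sum_eq_zero fun A hA => if_neg ?_
    rw [h0, Finset.powerset_empty, Finset.mem_singleton] at hA
    simp [hA]
  obtain ⟨x, hx, hmax⟩ := Finset.exists_max_image (pts ϰ) tm (Finset.nonempty_iff_ne_empty.2 h0)
  have hlt : ∀ y ∈ pts ϰ \ {x}, tm y < tm x := fun y hy => by
    obtain ⟨hy1, hy2⟩ := Finset.mem_sdiff.1 hy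
    refine lt_of_le_of_ne (hmax y hy1) fun e => hy2 ?_
    rw [Finset.mem_singleton]
    exact injOn_pts ϰ hy1 hx e
  -- only the singleton of the latest point contributes
  rw [Finset.sum_eq_single {x}]
  · by_cases hT : ϰ ∈ before tm T
    · rw [if_pos, if_pos ⟨h0, hT⟩, Finset.sdiff_union_of_subset (by simpa using hx)]
      refine ⟨Finset.card_singleton x, fun y hy => ?_⟩
      rw [Finset.mem_singleton] at hy
      subst hy
      exact ⟨hT y hx, hlt⟩
    · rw [if_neg, if_neg (fun h => hT h.2)]
      rintro ⟨-, h⟩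
      have hxT := (h x (Finset.mem_singleton_self x)).1
      exact hT fun y hy => (hmax y hy).trans_lt hxT
  · intro A hA hne
    refine if_neg ?_
    rintro ⟨hc, h⟩
    obtain ⟨y, rfl⟩ := Finset.card_eq_one.1 hc
    have hyϰ : y ∈ pts ϰ := by simpa using hA
    have hxy : x ≠ y := fun e => hne (by rw [e])
    have := (h y (Finset.mem_singleton_self y)).2 x (by simp [hx, hxy])
    exact absurd (hmax y hyϰ) (not_le.2 this)
  · intro h
    simp [hx] at h

end Consequences

/-! ### Decomposition of a chain at its last point -/
section LastPoint

open scoped Classical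

variable {X : Type*} [MeasurableSpace X] (μ : Measure X) [SigmaFinite μ] {tm : X → ℝ≥0}

local notation "𝔪" => chainMeasure μ tm

theorem mem_before_union {T : ℝ≥0} {ϰ : Chain tm} : ϰ ∈ before tm T ↔ ∀ x ∈ pts ϰ, tm x < T :=
  Iff.rfl

theorem measurableSet_pts_eq_empty : MeasurableSet {ϰ : Chain tm | pts ϰ = ∅} := by
  refine measurableSet_chain.2 fun n => ?_
  convert MeasurableSet.const (n = 0) using 1
  ext x
  simp [← Finset.card_eq_zero, card_pts]

theorem measure_pts_eq_empty : 𝔪 {ϰ | pts ϰ = ∅} = 1 := by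
  rw [chainMeasure_eq, Measure.sum_apply _ measurableSet_pts_eq_empty, tsum_eq_single 0]
  · rw [Measure.map_apply (measurable_sigmaMk 0) measurableSet_pts_eq_empty]
    have h : (Sigma.mk 0 ⁻¹' {ϰ : Chain tm | pts ϰ = ∅} : Set (Incr tm 0)) = Set.univ := by
      ext x
      simp [← Finset.card_eq_zero, card_pts]
    rw [h, incrMeasure, Measure.comap_apply _ Subtype.val_injective _ _ MeasurableSet.univ]
    · have hu : (Subtype.val '' (Set.univ : Set (Incr tm 0)) : Set (Fin 0 → X)) = Set.univ := by
        rw [Set.image_univ, Subtype.range_coe_subtype]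
        exact Set.eq_univ_of_forall fun x => Subsingleton.strictMono _
      rw [hu, Measure.pi_of_empty, Measure.dirac_apply_of_mem (Set.mem_univ _)]
    · intro s hs
      have hu : {x : Fin 0 → X | StrictMono (tm ∘ x)} = Set.univ :=
        Set.eq_univ_of_forall fun x => Subsingleton.strictMono _
      have hm : MeasurableSet {x : Fin 0 → X | StrictMono (tm ∘ x)} := hu ▸ MeasurableSet.univ
      exact (MeasurableEmbedding.subtype_coe hm).measurableSet_image.2 hs
  · intro n hn
    rw [Measure.map_apply (measurable_sigmaMk n) measurableSet_pts_eq_empty]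
    convert measure_empty (μ := incrMeasure μ tm n)
    ext x
    simp [← Finset.card_eq_zero, card_pts, hn]

/-- The empty chain is an atom of the chain measure. -/
theorem ae_emptyChain {P : Chain tm → Prop} (h : ∀ᵐ ϰ ∂𝔪, P ϰ) : P (emptyChain tm) := by
  by_contra hP
  have : 𝔪 {ϰ | pts ϰ = ∅} ≤ 0 := by
    rw [← ae_iff.1 h]
    refine measure_mono fun ϰ hϰ => ?_
    have : ϰ = emptyChain tm := pts_injective (by rw [pts_emptyChain]; exact hϰ)
    rw [this]
    exact hP
  rw [measure_pts_eq_empty] at this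
  simp at this

theorem aestronglyMeasurable_pts_union (ht : IsTime μ tm) {E : Type*} [TopologicalSpace E] {k : Finset X → E}
    (hk : AEStronglyMeasurable (fun ϰ : Chain tm => k (pts ϰ)) 𝔪) :
    AEStronglyMeasurable (fun z : Chain tm × Chain tm => k (pts z.1 ∪ pts z.2)) ((𝔪).prod 𝔪) := by
  refine (hk.comp_quasiMeasurePreserving (quasiMeasurePreserving_merge μ ht)).congr ?_
  filter_upwards [ae_apart μ ht] with z hz
  simp only [Function.comp, pts_merge hz]

/-- The summand of the decomposition of chains before `T` at their last point. -/
noncomputable def lastPointKernel {M : Type*} [Zero M] (tm : X → ℝ≥0) (T : ℝ≥0) (k : Finset X → M)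
    (A R : Finset X) : M :=
  if A.card = 1 ∧ ∀ x ∈ A, tm x < T ∧ ∀ y ∈ R, tm y < tm x then k (R ∪ A) else 0

theorem measurableSet_lastPoint (htm : Measurable tm) (T : ℝ≥0) :
    MeasurableSet {z : Chain tm × Chain tm | (pts z.1).card = 1 ∧
      ∀ x ∈ pts z.1, tm x < T ∧ ∀ y ∈ pts z.2, tm y < tm x} := by
  have h1 : MeasurableSet {ϰ : Chain tm | (pts ϰ).card = 1} := measurableSet_chain.2 fun n => by
      convert MeasurableSet.const (n = 1) using 1
      ext x
      simp [card_pts]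
  refine (measurable_fst h1).inter (measurableSet_forall_pts
    (P := fun x ϰ => tm x < T ∧ ∀ y ∈ pts ϰ, tm y < tm x) ?_)
  refine (measurableSet_lt (htm.comp measurable_fst) measurable_const).inter ?_
  exact measurable_swap (measurableSet_forall_pts (P := fun y x => tm y < tm x)
    (measurableSet_lt (htm.comp measurable_fst) (htm.comp measurable_snd)))

theorem aestronglyMeasurable_lastPointKernel (ht : IsTime μ tm) {E : Type*} [TopologicalSpace E] [Zero E]
    {k : Finset X → E} (T : ℝ≥0) (hk : AEStronglyMeasurable (fun ϰ : Chain tm => k (pts ϰ)) 𝔪) :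
    AEStronglyMeasurable (fun z : Chain tm × Chain tm => lastPointKernel tm T k (pts z.1) (pts z.2))
      ((𝔪).prod 𝔪) := by
  have h := (aestronglyMeasurable_pts_union μ ht hk).indicator
    (measurableSet_lastPoint ht.measurable T)
  refine h.congr (.of_forall fun z => ?_)
  simp only [Set.indicator_apply, lastPointKernel, Set.mem_ofPred_eq, Finset.union_comm (pts z.2)]

theorem lastPointKernel_sing {M : Type*} [Zero M] (T : ℝ≥0) (k : Finset X → M) (x : X)
    (b : Chain tm) : lastPointKernel tm T k (pts (sing tm x)) (pts b) = {x | tm x < T}.indicator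
        (fun x => (before tm (tm x)).indicator (fun b => k (pts b ∪ {x})) b) x := by
  simp only [lastPointKernel, pts_sing, Finset.card_singleton, Finset.mem_singleton, forall_eq,
    true_and, Set.indicator_apply, Set.mem_ofPred_eq, mem_before_union]
  split_ifs <;> tauto

theorem setOf_pts_card_one : {ϰ : Chain tm | ϰ.1 = 1} = {ϰ | (pts ϰ).card = 1} := by
  ext ϰ; simp [card_pts]

theorem measurableSet_card_one : MeasurableSet {ϰ : Chain tm | ϰ.1 = 1} :=
  measurableSet_chain.2 fun n => MeasurableSet.const (n = 1)

/-- This is an inequality, since the empty chain has no last point. -/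
theorem lintegral_lastPoint (ht : IsTime μ tm) (T : ℝ≥0) {k : Finset X → ℝ≥0∞}
    (hk : AEMeasurable (fun ϰ : Chain tm => k (pts ϰ)) 𝔪) :
    ∫⁻ x in {x | tm x < T}, ∫⁻ ϰ, k (pts ϰ ∪ {x}) ∂chainMeasureBefore μ tm (tm x) ∂μ ≤
      ∫⁻ ϰ, k (pts ϰ) ∂chainMeasureBefore μ tm T := by
  have hm := (aestronglyMeasurable_lastPointKernel μ ht T hk.aestronglyMeasurable).aemeasurable
  have hT : MeasurableSet {x | tm x < T} := measurableSet_lt ht.measurable measurable_const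
  have h1 := lintegral_prod_chain' μ ht hm
  have e1 : ∫⁻ z, lastPointKernel tm T k (pts z.1) (pts z.2) ∂(𝔪).prod 𝔪 =
      ∫⁻ x in {x | tm x < T}, ∫⁻ ϰ, k (pts ϰ ∪ {x}) ∂chainMeasureBefore μ tm (tm x) ∂μ := by
    rw [lintegral_prod _ hm]
    have h2 : AEMeasurable (fun a : Chain tm => ∫⁻ b, lastPointKernel tm T k (pts a) (pts b)
      ∂𝔪) 𝔪 := hm.lintegral_prod_right'
    have h3 : ∫⁻ a : Chain tm, ∫⁻ b : Chain tm, lastPointKernel tm T k (pts a) (pts b)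
        ∂𝔪 ∂𝔪 = ∫⁻ a, ∫⁻ b : Chain tm,
          lastPointKernel tm T k (pts a) (pts b) ∂𝔪 ∂μ.map (sing tm) := by
      rw [map_sing μ ht.measurable, ← lintegral_indicator measurableSet_card_one]
      refine lintegral_congr fun a => ?_
      rw [setOf_pts_card_one, Set.indicator_apply]
      split_ifs with ha
      · rfl
      · simp only [lastPointKernel]
        simp only [show ∀ b : Chain tm, ¬((pts a).card = 1 ∧ ∀ x ∈ pts a, tm x < T ∧
          ∀ y ∈ pts b, tm y < tm x) from fun b h => ha h.1, if_false, lintegral_zero]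
    rw [h3, lintegral_map' (by
      rw [map_sing μ ht.measurable]; exact h2.restrict) measurable_sing.aemeasurable,
      ← lintegral_indicator hT]
    refine lintegral_congr fun x => ?_
    simp only [lastPointKernel_sing]
    simp only [Set.indicator_apply]
    split_ifs with hx
    · rw [chainMeasureBefore, ← lintegral_indicator (measurableSet_before_const ht.measurable _)]
      rfl
    · simp
  rw [← e1, h1, chainMeasureBefore, ← lintegral_indicator (measurableSet_before_const ht.measurable T)]
  refine lintegral_mono fun ϰ => ?_
  have h2 := sum_lastPoint T k ϰ
  simp only [lastPointKernel]
  rw [h2, Set.indicator_apply]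
  split_ifs with h3 h4 h4
  exacts [le_rfl, (h4 h3.2).elim, zero_le, le_rfl]

/-- Integration over chains before `T` in terms of the last point. -/
theorem integral_lastPoint (ht : IsTime μ tm)
    (T : ℝ≥0) {E : Type*} [NormedAddCommGroup E] [NormedSpace ℝ E] [CompleteSpace E]
    {k : Finset X → E} (hk' : AEStronglyMeasurable (fun ϰ : Chain tm => k (pts ϰ)) 𝔪)
    (hk : Integrable (fun ϰ : Chain tm => k (pts ϰ)) (chainMeasureBefore μ tm T)) :
    Integrable (fun x => ∫ ϰ, k (pts ϰ ∪ {x}) ∂chainMeasureBefore μ tm (tm x))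
      (μ.restrict {x | tm x < T}) ∧ ∫ ϰ, k (pts ϰ) ∂chainMeasureBefore μ tm T =
      k ∅ + ∫ x in {x | tm x < T}, ∫ ϰ, k (pts ϰ ∪ {x}) ∂chainMeasureBefore μ tm (tm x) ∂μ := by
  have hm := aestronglyMeasurable_lastPointKernel μ ht T hk'
  have hT : MeasurableSet {x | tm x < T} := measurableSet_lt ht.measurable measurable_const
  have hB := measurableSet_before_const ht.measurable T
  have hint : Integrable (fun z : Chain tm × Chain tm => lastPointKernel tm T k (pts z.1) (pts z.2))
      ((𝔪).prod 𝔪) := by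
    refine ⟨hm, ?_⟩
    have h1 := lintegral_prod_chain' μ ht (F := fun A R => ‖lastPointKernel tm T k A R‖ₑ) hm.enorm
    rw [HasFiniteIntegral, h1]
    have h2 := hk.2
    rw [HasFiniteIntegral, chainMeasureBefore, ← lintegral_indicator hB] at h2
    refine lt_of_le_of_lt (lintegral_mono fun ϰ => ?_) h2
    have h3 := sum_lastPoint T (fun ω => ‖k ω‖ₑ) ϰ
    have h4 : ∀ A R, ‖lastPointKernel tm T k A R‖ₑ =
        lastPointKernel tm T (fun ω => ‖k ω‖ₑ) A R := fun A R => by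
      simp only [lastPointKernel]; split_ifs <;> simp
    simp only [h4]
    simp only [lastPointKernel]
    rw [h3, Set.indicator_apply]
    split_ifs with h5 h6 h6
    exacts [le_rfl, (h6 h5.2).elim, zero_le, le_rfl]
  -- the sum-integral formula for the pairs `({x}, R)` with `x` before `T` and later than `R`
  obtain ⟨hi, h1⟩ := integral_prod_chain' μ ht hint
  have hG := hint.integral_prod_left
  have hcard : ∀ a : Chain tm, a ∉ {ϰ : Chain tm | ϰ.1 = 1} →
      ∫ b, lastPointKernel tm T k (pts a) (pts b) ∂𝔪 = 0 := fun a ha => by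
    rw [setOf_pts_card_one] at ha
    simp only [lastPointKernel]
    simp only [show ∀ b : Chain tm, ¬((pts a).card = 1 ∧ ∀ x ∈ pts a, tm x < T ∧
      ∀ y ∈ pts b, tm y < tm x) from fun b h => ha h.1, if_false, integral_zero]
  have hpt : ∀ x, ∫ b, lastPointKernel tm T k (pts (sing tm x)) (pts b) ∂𝔪 =
      {x | tm x < T}.indicator
        (fun x => ∫ ϰ, k (pts ϰ ∪ {x}) ∂chainMeasureBefore μ tm (tm x)) x := fun x => by
    simp only [lastPointKernel_sing]
    simp only [Set.indicator_apply]
    split_ifs with hx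
    · rw [chainMeasureBefore, ← integral_indicator (measurableSet_before_const ht.measurable _)]
      rfl
    · simp
  have hGr : Integrable (fun a : Chain tm => ∫ b, lastPointKernel tm T k (pts a) (pts b)
      ∂𝔪) (μ.map (sing tm)) := by
    rw [map_sing μ ht.measurable]; exact hG.restrict
  have hGx := hGr.comp_measurable measurable_sing
  have e1 : ∫ z, lastPointKernel tm T k (pts z.1) (pts z.2) ∂(𝔪).prod 𝔪 =
      ∫ x in {x | tm x < T}, ∫ ϰ, k (pts ϰ ∪ {x}) ∂chainMeasureBefore μ tm (tm x) ∂μ := by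
    rw [integral_prod _ hint, ← integral_indicator hT]
    simp only [← hpt]
    rw [← integral_map (f := fun a : Chain tm => ∫ b, lastPointKernel tm T k (pts a) (pts b)
      ∂𝔪) measurable_sing.aemeasurable hGr.1, map_sing μ ht.measurable,
      ← integral_indicator measurableSet_card_one]
    refine integral_congr_ae (.of_forall fun a => ?_)
    simp only [Set.indicator_apply]
    split_ifs with ha
    exacts [rfl, hcard a ha]
  refine ⟨?_, ?_⟩
  · refine (integrable_indicator_iff hT).1 ?_
    exact hGx.congr (.of_forall hpt)
  rw [← e1, h1]
  simp only [lastPointKernel]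
  simp only [sum_lastPoint]
  -- the empty chain, of mass one, has no last point and contributes `k ∅`
  have h0 : ∫ ϰ : Chain tm, ({ϰ | pts ϰ = ∅}).indicator (fun ϰ => k (pts ϰ)) ϰ ∂𝔪 = k ∅ := by
    have : ({ϰ : Chain tm | pts ϰ = ∅}).indicator (fun ϰ => k (pts ϰ)) =
        ({ϰ : Chain tm | pts ϰ = ∅}).indicator (fun _ => k ∅) := by
      ext ϰ
      simp only [Set.indicator_apply, Set.mem_ofPred_eq]
      split_ifs with h
      exacts [by rw [h], rfl]
    rw [this, integral_indicator measurableSet_pts_eq_empty, setIntegral_const, measureReal_def,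
      measure_pts_eq_empty]
    simp
  have h0i : Integrable ({ϰ : Chain tm | pts ϰ = ∅}.indicator (fun ϰ => k (pts ϰ))) 𝔪 := by
    refine (integrable_indicator_iff measurableSet_pts_eq_empty).2 ?_
    refine IntegrableOn.congr_fun (f := fun _ => k ∅) ?_ (fun ϰ hϰ => ?_) measurableSet_pts_eq_empty
    · exact integrableOn_const (by rw [measure_pts_eq_empty]; simp)
    · rw [show pts ϰ = ∅ from hϰ]
  have hi' : Integrable (fun ϰ : Chain tm => if pts ϰ ≠ ∅ ∧ ϰ ∈ before tm T then k (pts ϰ) else 0)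
      𝔪 := by
    simpa only [lastPointKernel, sum_lastPoint] using hi
  conv_lhs => rw [chainMeasureBefore, ← integral_indicator hB]
  rw [← h0, ← integral_add h0i hi']
  refine integral_congr_ae (.of_forall fun ϰ => ?_)
  simp only [Set.indicator_apply, Set.mem_ofPred_eq]
  by_cases h : pts ϰ = ∅
  · have : ϰ ∈ before tm T := fun x hx => by simp [h] at hx
    simp [h, this]
  · simp [h]

theorem quasiMeasurePreserving_prodMap {α β γ δ : Type*} [MeasurableSpace α] [MeasurableSpace β]
    [MeasurableSpace γ] [MeasurableSpace δ] {μa : Measure α} {μb : Measure β} {μc : Measure γ}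
    {μd : Measure δ} [SFinite μa] [SFinite μb] [SFinite μc] [SFinite μd]
    {f : α → γ} {g : β → δ} (hf : Measure.QuasiMeasurePreserving f μa μc)
    (hg : Measure.QuasiMeasurePreserving g μb μd) :
    Measure.QuasiMeasurePreserving (Prod.map f g) (μa.prod μb) (μc.prod μd) := by
  refine ⟨hf.measurable.prodMap hg.measurable, ?_⟩
  rw [← Measure.map_prod_map _ _ hf.measurable hg.measurable]
  exact hf.absolutelyContinuous.prod hg.absolutelyContinuous

/-- Adjoining a point to a chain. -/
noncomputable def insertPt (z : X × Chain tm) : Chain tm := merge (z.2, sing tm z.1)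

theorem quasiMeasurePreserving_insertPt (ht : IsTime μ tm) :
    Measure.QuasiMeasurePreserving (insertPt : X × Chain tm → Chain tm) (μ.prod 𝔪) 𝔪 := by
  have h1 : Measure.QuasiMeasurePreserving (Prod.map (sing tm) id : X × Chain tm → _)
      (μ.prod 𝔪) ((𝔪).prod 𝔪) :=
    quasiMeasurePreserving_prodMap (quasiMeasurePreserving_sing μ ht.measurable) (Measure.QuasiMeasurePreserving.id _)
  have h2 : Measure.QuasiMeasurePreserving (Prod.swap : Chain tm × Chain tm → _) ((𝔪).prod 𝔪)
      ((𝔪).prod 𝔪) :=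
    Measure.measurePreserving_swap.quasiMeasurePreserving
  exact (quasiMeasurePreserving_merge μ ht).comp (h2.comp h1)

theorem pts_insertPt {x : X} {ϰ : Chain tm} (h : Apart tm (pts ϰ) {x}) :
    open scoped Classical in pts (insertPt (x, ϰ)) = pts ϰ ∪ {x} := by
  classical
  rw [insertPt, pts_merge (by simpa using h), pts_sing]

theorem ae_apart_point (ht : IsTime μ tm) : ∀ᵐ z ∂μ.prod 𝔪, Apart tm (pts z.2) {z.1} := by
  have := (quasiMeasurePreserving_prodMap (quasiMeasurePreserving_sing μ ht.measurable)
    (Measure.QuasiMeasurePreserving.id 𝔪)).ae (ae_apart μ ht)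
  filter_upwards [this] with z hz
  simpa using hz.symm

end LastPoint

/-! ### Product vectors -/
section TensorFacts

variable {ι : Type*} [Fintype ι] {E : ι → Type*} [∀ i, NormedAddCommGroup (E i)]
  [∀ i, InnerProductSpace ℂ (E i)]

theorem HilbertTensor.eq_zero_of_inner_tprod {f : HilbertTensor E}
    (h : ∀ v, inner ℂ (HilbertTensor.tprod v) f = 0) : f = 0 := by
  have hd : Dense (Submodule.span ℂ (Set.range (HilbertTensor.tprod (E := E))) :
      Set (HilbertTensor E)) := by
    rw [Submodule.dense_iff_topologicalClosure_eq_top]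
    exact HilbertTensor.span_tprod
  refine hd.eq_zero_of_inner_right ℂ fun v hv => ?_
  refine Submodule.span_induction (p := fun v _ => inner ℂ v f = 0) ?_ ?_ ?_ ?_ hv
  · rintro _ ⟨w, rfl⟩; exact h w
  · simp
  · intro x y _ _ hx hy; rw [inner_add_left, hx, hy, add_zero]
  · intro c x _ hx; rw [inner_smul_left, hx, mul_zero]

theorem HilbertTensor.ext_tprod {f g : HilbertTensor E}
    (h : ∀ v, inner ℂ (HilbertTensor.tprod v) f = inner ℂ (HilbertTensor.tprod v) g) : f = g := by
  rw [← sub_eq_zero]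
  exact HilbertTensor.eq_zero_of_inner_tprod fun v => by rw [inner_sub_right, h v, sub_self]

theorem HilbertTensor.norm_tprod (v : ∀ i, E i) : ‖HilbertTensor.tprod v‖ = ∏ i, ‖v i‖ := by
  have h := HilbertTensor.inner_tprod v v
  simp only [inner_self_eq_norm_sq_to_K] at h
  have h2 : ‖HilbertTensor.tprod v‖ ^ 2 = (∏ i, ‖v i‖) ^ 2 := by
    rw [← Finset.prod_pow]
    exact_mod_cast h
  exact (pow_left_inj₀ (norm_nonneg _) (Finset.prod_nonneg fun i _ => norm_nonneg _)
    two_ne_zero).1 h2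

variable [DecidableEq ι]

theorem HilbertTensor.inner_tprod_update (u v : ∀ i, E i) (a : ι) (w : E a) :
    inner ℂ (HilbertTensor.tprod u) (HilbertTensor.tprod (Function.update v a w)) =
      inner ℂ (u a) w * ∏ i ∈ Finset.univ.erase a, inner ℂ (u i) (v i) := by
  rw [HilbertTensor.inner_tprod, ← Finset.mul_prod_erase _ _ (Finset.mem_univ a)]
  congr 1
  · simp
  · refine Finset.prod_congr rfl fun i hi => ?_
    rw [Function.update_of_ne (Finset.ne_of_mem_erase hi)]

/-- A product vector as a bounded linear function of its factor at `a`. -/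
noncomputable def HilbertTensor.tprodUpdate (v : ∀ i, E i) (a : ι) : E a →L[ℂ] HilbertTensor E :=
  LinearMap.mkContinuous
    { toFun := fun w => HilbertTensor.tprod (Function.update v a w)
      map_add' := fun w w' => HilbertTensor.ext_tprod fun u => by
        simp only [inner_add_right, HilbertTensor.inner_tprod_update, add_mul]
      map_smul' := fun c w => HilbertTensor.ext_tprod fun u => by
        simp only [inner_smul_right, HilbertTensor.inner_tprod_update, mul_assoc,
          RingHom.id_apply] }
    (∏ i ∈ Finset.univ.erase a, ‖v i‖) fun w => by
      simp only [LinearMap.coe_mk, AddHom.coe_mk]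
      rw [HilbertTensor.norm_tprod, ← Finset.mul_prod_erase _ _ (Finset.mem_univ a), mul_comm]
      refine le_of_eq ?_
      congr 1
      · refine Finset.prod_congr rfl fun i hi => ?_
        rw [Function.update_of_ne (Finset.ne_of_mem_erase hi)]
      · simp

@[simp] theorem HilbertTensor.tprodUpdate_apply (v : ∀ i, E i) (a : ι) (w : E a) :
    HilbertTensor.tprodUpdate v a w = HilbertTensor.tprod (Function.update v a w) := rfl

/-- A vector orthogonal to all product vectors of factors from total families vanishes. -/
theorem HilbertTensor.eq_zero_of_total {J : Type*} (b : J → ∀ i, E i)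
    (hb : ∀ i, (Submodule.span ℂ (Set.range fun j => b j i)).topologicalClosure = ⊤)
    {f : HilbertTensor E}
    (h : ∀ j : ι → J, inner ℂ (HilbertTensor.tprod fun i => b (j i) i) f = 0) : f = 0 := by
  -- the factors are released from the total families one after another
  have key : ∀ s : Finset ι, ∀ v : ∀ i, E i, (∀ i ∉ s, ∃ j, v i = b j i) →
      inner ℂ (HilbertTensor.tprod v) f = 0 := by
    intro s
    induction s using Finset.induction_on with
    | empty =>
      intro v hv
      choose j hj using fun i => hv i (Finset.notMem_empty i)
      rw [funext hj]
      exact h j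
    | insert a s ha ih =>
      intro v hv
      have hker : (⊤ : Submodule ℂ (E a)) ≤
          LinearMap.ker ((innerSL ℂ f).comp (HilbertTensor.tprodUpdate v a) : E a →L[ℂ] ℂ).toLinearMap := by
        rw [← hb a]
        refine Submodule.topologicalClosure_minimal _ ?_
          (ContinuousLinearMap.isClosed_ker ((innerSL ℂ f).comp (HilbertTensor.tprodUpdate v a)))
        rw [Submodule.span_le]
        rintro _ ⟨j, rfl⟩
        have h0 := ih (Function.update v a (b j a)) fun i hi => by
          by_cases hia : i = a
          · subst hia; exact ⟨j, by simp⟩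
          · rw [Function.update_of_ne hia]
            exact hv i (by simp [hia, hi])
        simp only [SetLike.mem_coe, LinearMap.mem_ker]
        change inner ℂ f (HilbertTensor.tprod (Function.update v a (b j a))) = 0
        rw [← inner_conj_symm, h0, map_zero]
      have h1 := hker (Submodule.mem_top (x := v a))
      have h2 : inner ℂ f (HilbertTensor.tprod (Function.update v a (v a))) = 0 := h1
      rw [Function.update_eq_self] at h2
      rw [← inner_conj_symm, h2, map_zero]
  exact HilbertTensor.eq_zero_of_inner_tprod fun v => key Finset.univ v fun i hi => by simp at hi

end TensorFacts

/-! ### Coordinates -/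
section Coordinates

/-- The Hilbert space `ℓ²(ℕ)` of coordinate sequences. -/
abbrev SeqSpace : Type := lp (fun _ : ℕ => ℂ) 2

variable {H : Type*} [NormedAddCommGroup H] [InnerProductSpace ℂ H] [CompleteSpace H]

/-- The Parseval identity for the orthonormalization of a total sequence. The sequence may be
linearly dependent: the superfluous vectors are sent to `0`. -/
theorem hasSum_sq_gramSchmidtNormed {v : ℕ → H}
    (hv : ∀ f : H, (∀ n, inner ℂ (v n) f = 0) → f = 0) (f : H) :
    HasSum (fun n => ‖inner ℂ (InnerProductSpace.gramSchmidtNormed ℂ v n) f‖ ^ 2) (‖f‖ ^ 2) := by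
  set u := InnerProductSpace.gramSchmidtNormed ℂ v with hu
  have ho := InnerProductSpace.gramSchmidtNormed_orthonormal' (𝕜 := ℂ) v
  have hspan : (Submodule.span ℂ (Set.range fun i : {i | u i ≠ 0} => u i))ᗮ = ⊥ := by
    rw [Submodule.eq_bot_iff]
    intro g hg
    have h1 : ∀ n, inner ℂ (u n) g = 0 := fun n => by
      by_cases h : u n = 0
      · rw [h, inner_zero_left]
      · exact (Submodule.mem_orthogonal _ _).1 hg _ (Submodule.subset_span ⟨⟨n, h⟩, rfl⟩)
    refine hv g fun n => ?_
    have h2 : v n ∈ Submodule.span ℂ (Set.range u) := by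
      rw [hu, InnerProductSpace.span_gramSchmidtNormed_range, InnerProductSpace.span_gramSchmidt]
      exact Submodule.subset_span ⟨n, rfl⟩
    refine Submodule.span_induction (p := fun x _ => inner ℂ x g = 0) ?_ ?_ ?_ ?_ h2
    · rintro _ ⟨m, rfl⟩; exact h1 m
    · simp
    · intro x y _ _ hx hy; rw [inner_add_left, hx, hy, add_zero]
    · intro c x _ hx; rw [inner_smul_left, hx, mul_zero]
  let b := HilbertBasis.mkOfOrthogonalEqBot ho hspan
  have hb : ∀ i, b i = u i := fun i => by
    rw [HilbertBasis.coe_mkOfOrthogonalEqBot]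
  have h3 := Complex.reCLM.hasSum (b.hasSum_inner_mul_inner f f)
  have h4 : HasSum (fun i : {i | u i ≠ 0} => ‖inner ℂ (u i) f‖ ^ 2) (‖f‖ ^ 2) := by
    convert h3 using 1
    · ext1 i
      simp only [Complex.reCLM_apply, hb]
      have := inner_mul_symm_re_eq_norm (𝕜 := ℂ) f (u i)
      rw [RCLike.re_eq_complex_re] at this
      rw [this, norm_mul, norm_inner_symm, sq]
    · simp [inner_self_eq_norm_sq_to_K, ← Complex.ofReal_pow]
  rw [← Subtype.val_injective.hasSum_iff (f := fun n => ‖inner ℂ (u n) f‖ ^ 2)]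
  · exact h4
  · intro n hn
    have : u n = 0 := by
      by_contra h
      exact hn ⟨⟨n, h⟩, rfl⟩
    simp [this]

/-- Coordinates with respect to the orthonormalization of a total sequence. -/
noncomputable def coordinates (v : ℕ → H) (hv : ∀ f : H, (∀ n, inner ℂ (v n) f = 0) → f = 0) :
    H →ₗᵢ[ℂ] SeqSpace where
  toFun f := ⟨fun n => inner ℂ (InnerProductSpace.gramSchmidtNormed ℂ v n) f, by
    have h := (hasSum_sq_gramSchmidtNormed hv f).summable
    refine (memℓp_gen_iff (by norm_num)).2 ?_
    simpa using h⟩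
  map_add' f g := by
    ext n
    exact inner_add_right _ f g
  map_smul' c f := by
    ext n
    simp
  norm_map' f := by
    have h := (hasSum_sq_gramSchmidtNormed hv f).tsum_eq
    have h2 := lp.norm_rpow_eq_tsum (p := 2) (by norm_num)
      (⟨fun n => inner ℂ (InnerProductSpace.gramSchmidtNormed ℂ v n) f, by
        have h := (hasSum_sq_gramSchmidtNormed hv f).summable
        refine (memℓp_gen_iff (by norm_num)).2 ?_
        simpa using h⟩ : SeqSpace)
    simp only [ENNReal.toReal_ofNat, Real.rpow_ofNat, h] at h2
    exact (pow_left_inj₀ (norm_nonneg _) (norm_nonneg _) two_ne_zero).1 h2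

theorem coordinates_apply (v : ℕ → H) (hv : ∀ f : H, (∀ n, inner ℂ (v n) f = 0) → f = 0) (f : H)
    (n : ℕ) : coordinates v hv f n = inner ℂ (InnerProductSpace.gramSchmidtNormed ℂ v n) f := rfl

theorem aestronglyMeasurable_seqSpace {Y : Type*} [MeasurableSpace Y] {ν : Measure Y}
    {f : Y → SeqSpace} (hf : ∀ n, AEMeasurable (fun y => f y n) ν) : AEStronglyMeasurable f ν := by
  have h1 : ∀ N : ℕ, AEStronglyMeasurable
      (fun y => ∑ n ∈ Finset.range N, lp.single (E := fun _ : ℕ => ℂ) 2 n (f y n)) ν := fun N =>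
    Finset.aestronglyMeasurable_fun_sum _ fun n _ =>
      ((lp.singleContinuousLinearMap ℂ (fun _ : ℕ => ℂ) 2 n).continuous.comp_aestronglyMeasurable
        (hf n).aestronglyMeasurable)
  refine aestronglyMeasurable_of_tendsto_ae Filter.atTop h1 (.of_forall fun y => ?_)
  exact (lp.hasSum_single (by norm_num) (f y)).tendsto_sum_nat

end Coordinates

/-! ### Coordinates in the fibres over chains -/
section Fields

open scoped Classical

variable {X : Type*} [MeasurableSpace X] (tm : X → ℝ≥0)
  {K : X → Type*} [∀ x, NormedAddCommGroup (K x)] [∀ x, InnerProductSpace ℂ (K x)]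
  [∀ x, CompleteSpace (K x)] (e : ℕ → ∀ x, K x)

/-- The vector field `∑ 1_{a < tm < b} e i`, summed over the triples `(a, b, i)` of a list. -/
noncomputable def stepField (l : List (ℚ × ℚ × ℕ)) (x : X) : K x :=
  (l.map fun t => if (t.1 : ℝ) < tm x ∧ (tm x : ℝ) < t.2.1 then e t.2.2 x else 0).sum

/-- A countable family of measurable vector fields whose product vectors are total over all
chains. -/
noncomputable def stepSeq (n : ℕ) : ∀ x, K x := stepField tm e (Denumerable.ofNat _ n)

variable {tm e}

theorem measurableSet_timeInterval (htm : Measurable tm) (a b : ℝ) :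
    MeasurableSet {x | a < tm x ∧ (tm x : ℝ) < b} :=
  (measurableSet_lt measurable_const htm.coe_nnreal_real).inter
    (measurableSet_lt htm.coe_nnreal_real measurable_const)

theorem measurable_inner_stepField (htm : Measurable tm) (l : List (ℚ × ℚ × ℕ)) {k : ∀ x, K x}
    (hk : IsMeasurableField e k) : Measurable fun x => (inner ℂ (stepField tm e l x) (k x) : ℂ) := by
  induction l with
  | nil => simp [stepField]
  | cons t l ih =>
    have h : (fun x => (inner ℂ (stepField tm e (t :: l) x) (k x) : ℂ)) = fun x =>
        ({x | (t.1 : ℝ) < tm x ∧ (tm x : ℝ) < t.2.1}.indicator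
          (fun x => (inner ℂ (e t.2.2 x) (k x) : ℂ)) x) + inner ℂ (stepField tm e l x) (k x) := by
      ext x
      simp only [stepField, List.map_cons, List.sum_cons, inner_add_left, Set.indicator_apply,
        Set.mem_ofPred_eq]
      split_ifs <;> simp
    rw [h]
    exact ((hk _).indicator (measurableSet_timeInterval htm _ _)).add ih

theorem isMeasurableField_stepField (he : IsFundamental e) (htm : Measurable tm)
    (l : List (ℚ × ℚ × ℕ)) : IsMeasurableField e (stepField tm e l : ∀ x, K x) := fun i => by
  have h := (measurable_inner_stepField htm l (k := e i) fun j => he.measurable_inner j i)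
  have h2 : (fun x => (inner ℂ (e i x) (stepField tm e l x) : ℂ)) =
      fun x => starRingEnd ℂ (inner ℂ (stepField tm e l x) (e i x)) := by
    ext x; rw [inner_conj_symm]
  rw [h2]
  exact Complex.continuous_conj.measurable.comp h

/-- Over a set of distinct times, the values of the step fields include all choices of values of
the fundamental sequence. -/
theorem exists_stepSeq_eq {σ : Finset X} (h : Set.InjOn tm σ) (j : σ → ℕ) :
    ∃ n, ∀ x : σ, stepSeq tm e n x = e (j x) x := by
  -- rational intervals separate the time of each point from the other times
  have hsep : ∀ x : σ, ∃ ab : ℚ × ℚ, ((ab.1 : ℝ) < tm x ∧ (tm x : ℝ) < ab.2) ∧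
      ∀ y ∈ σ, y ≠ x → ¬((ab.1 : ℝ) < tm y ∧ (tm y : ℝ) < ab.2) := fun x => by
    have hf : Set.Finite ((fun y => (tm y : ℝ)) '' ((σ.erase x : Finset X) : Set X)) :=
      (Finset.finite_toSet _).image _
    have hx : (tm x : ℝ) ∈ ((fun y => (tm y : ℝ)) '' ((σ.erase x : Finset X) : Set X))ᶜ := by
      rintro ⟨y, hy, hyx⟩
      have hy' := Finset.mem_erase.1 (Finset.mem_coe.1 hy)
      exact hy'.1 (h hy'.2 x.2 (NNReal.coe_injective hyx))
    obtain ⟨l, u, hlu, hsub⟩ := mem_nhds_iff_exists_Ioo_subset.1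
      (hf.isClosed.isOpen_compl.mem_nhds hx)
    obtain ⟨a, ha1, ha2⟩ := exists_rat_btwn hlu.1
    obtain ⟨b, hb1, hb2⟩ := exists_rat_btwn hlu.2
    refine ⟨(a, b), ⟨ha2, hb1⟩, fun y hy hyx hab => ?_⟩
    exact hsub ⟨ha1.trans hab.1, hab.2.trans hb2⟩ ⟨y, by simp [hy, hyx], rfl⟩
  choose ab hab hab' using hsep
  obtain ⟨n, hn⟩ := (Denumerable.eqv (List (ℚ × ℚ × ℕ))).symm.surjective
    ((Finset.univ : Finset σ).toList.map fun x => ((ab x).1, (ab x).2, j x))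
  replace hn : Denumerable.ofNat (List (ℚ × ℚ × ℕ)) n = _ := hn
  refine ⟨n, fun x => ?_⟩
  rw [stepSeq, hn, stepField, List.map_map]
  have := Finset.sum_map_toList (Finset.univ : Finset σ) fun y : σ =>
    if ((ab y).1 : ℝ) < tm x ∧ (tm x : ℝ) < (ab y).2 then e (j y) (x : X) else 0
  refine Eq.trans ?_ (this.trans ?_)
  · rfl
  · rw [Finset.sum_eq_single x]
    · rw [if_pos (hab x)]
    · intro y _ hyx
      exact if_neg (hab' y x x.2 fun e => hyx (Subtype.ext e.symm))
    · simp

variable (tm e) in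
/-- A total sequence in `K^⊗(σ)`. Over chains it consists of the product vectors of the step
fields; over the other finite sets any total sequence will do. -/
noncomputable def totalSeq (σ : Finset X) (n : ℕ) : HilbertTensor fun x : σ => K x :=
  if Set.InjOn tm σ then prodVec (stepSeq tm e n) σ
  else HilbertTensor.tprod fun x => e ((exists_surjective_nat (σ → ℕ)).choose n x) x

theorem totalSeq_total (he : IsFundamental e) (σ : Finset X) (f : HilbertTensor fun x : σ => K x)
    (hf : ∀ n, inner ℂ (totalSeq tm e σ n) f = 0) : f = 0 := by
  classical
  refine HilbertTensor.eq_zero_of_total (fun j (x : σ) => e j x) (fun x => he.total x) fun j => ?_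
  by_cases h : Set.InjOn tm σ
  · obtain ⟨n, hn⟩ := exists_stepSeq_eq (e := e) h j
    have := hf n
    rw [totalSeq, if_pos h, prodVec] at this
    simpa only [hn] using this
  · obtain ⟨n, hn⟩ := (exists_surjective_nat (σ → ℕ)).choose_spec j
    have := hf n
    rw [totalSeq, if_neg h] at this
    simpa only [hn] using this

variable (tm) in
/-- The coordinate isometry `K^⊗(σ) → ℓ²`. -/
noncomputable def enc (he : IsFundamental e) (σ : Finset X) :
    (HilbertTensor fun x : σ => K x) →ₗᵢ[ℂ] SeqSpace :=
  coordinates (totalSeq tm e σ) (totalSeq_total he σ)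

variable (tm) in
/-- The adjoint of the coordinate isometry. -/
noncomputable def dec (he : IsFundamental e) (σ : Finset X) :
    SeqSpace →L[ℂ] (HilbertTensor fun x : σ => K x) :=
  ContinuousLinearMap.adjoint (enc tm he σ).toContinuousLinearMap

theorem inner_dec (he : IsFundamental e) (σ : Finset X) (f : HilbertTensor fun x : σ => K x)
    (c : SeqSpace) : inner ℂ f (dec tm he σ c) = inner ℂ (enc tm he σ f) c := by
  rw [dec, ContinuousLinearMap.adjoint_inner_right]; rfl

@[simp] theorem dec_enc (he : IsFundamental e) (σ : Finset X)
    (f : HilbertTensor fun x : σ => K x) : dec tm he σ (enc tm he σ f) = f := by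
  refine ext_inner_left ℂ fun g => ?_
  rw [inner_dec, LinearIsometry.inner_map_map]

theorem norm_dec_le (he : IsFundamental e) (σ : Finset X) (c : SeqSpace) :
    ‖dec tm he σ c‖ ≤ ‖c‖ := by
  have h : ‖dec tm he σ‖ ≤ 1 := by
    rw [dec, LinearIsometryEquiv.norm_map]
    exact LinearIsometry.norm_toContinuousLinearMap_le _
  simpa using (dec tm he σ).le_of_opNorm_le h c

/-! ### Essential measurability in coordinates -/

/-- `ω` is, up to a null set, a measurable function with values in the chains. -/
def ChainLike {Y : Type*} [MeasurableSpace Y] (ν : Measure Y) (tm : X → ℝ≥0) (ω : Y → Finset X) :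
    Prop := ∃ χ : Y → Chain tm, Measurable χ ∧ ∀ᵐ y ∂ν, ω y = pts (χ y)

variable {Y : Type*} [MeasurableSpace Y] {ν : Measure Y} {ω : Y → Finset X}

theorem measurable_prod_pts {g : X → ℂ} (hg : Measurable g) :
    Measurable fun ϰ : Chain tm => ∏ x ∈ pts ϰ, g x := by
  intro s hs
  refine measurableSet_chain.2 fun n => ?_
  have : Measurable fun x : Incr tm n => ∏ i, g (x.1 i) := Finset.measurable_fun_prod _ fun i _ =>
      hg.comp ((measurable_pi_apply i).comp measurable_subtype_coe)
  convert this hs using 1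
  ext x
  simp [pts]
  rfl

theorem ChainLike.aemeasurable_prod (hω : ChainLike ν tm ω) {g : X → ℂ} (hg : Measurable g) :
    AEMeasurable (fun y => ∏ x ∈ ω y, g x) ν := by
  obtain ⟨χ, hχ, h⟩ := hω
  refine ((measurable_prod_pts hg).comp hχ).aemeasurable.congr ?_
  filter_upwards [h] with y hy
  simp [hy]

theorem ChainLike.injOn (hω : ChainLike ν tm ω) : ∀ᵐ y ∂ν, Set.InjOn tm (ω y : Set X) := by
  obtain ⟨χ, hχ, h⟩ := hω
  filter_upwards [h] with y hy
  rw [hy]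
  exact injOn_pts _

theorem inner_prodVec (k k' : ∀ x, K x) (σ : Finset X) :
    inner ℂ (prodVec k σ) (prodVec k' σ) = ∏ x ∈ σ, inner ℂ (k x) (k' x) := by
  rw [prodVec, prodVec, HilbertTensor.inner_tprod]
  exact Finset.prod_coe_sort σ fun x => inner ℂ (k x) (k' x)

/-- The inner products with the product vectors of the step fields are measurable. -/
def StepMeasurable (tm : X → ℝ≥0) (e : ℕ → ∀ x, K x) (ν : Measure Y) (ω : Y → Finset X)
    (F : ∀ y, HilbertTensor fun x : ω y => K x) : Prop :=
  ∀ n, AEMeasurable (fun y => (inner ℂ (prodVec (stepSeq tm e n) (ω y)) (F y) : ℂ)) ν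

theorem stepMeasurable_prodVec (htm : Measurable tm) (hω : ChainLike ν tm ω) {k : ∀ x, K x}
    (hk : IsMeasurableField e k) : StepMeasurable tm e ν ω fun y => prodVec k (ω y) := fun n => by
  simp only [inner_prodVec]
  exact hω.aemeasurable_prod (measurable_inner_stepField htm _ hk)

theorem StepMeasurable.inner_totalSeq (hω : ChainLike ν tm ω)
    {F : ∀ y, HilbertTensor fun x : ω y => K x} (hF : StepMeasurable tm e ν ω F) (m : ℕ) :
    AEMeasurable (fun y => (inner ℂ (totalSeq tm e (ω y) m) (F y) : ℂ)) ν := by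
  refine (hF m).congr ?_
  filter_upwards [hω.injOn] with y hy
  rw [totalSeq, if_pos hy]

theorem stepMeasurable_totalSeq (he : IsFundamental e) (htm : Measurable tm)
    (hω : ChainLike ν tm ω) (m : ℕ) :
    StepMeasurable tm e ν ω fun y => totalSeq tm e (ω y) m := fun i => by
  refine (stepMeasurable_prodVec htm hω (isMeasurableField_stepField he htm
    (Denumerable.ofNat _ m)) i).congr ?_
  filter_upwards [hω.injOn] with y hy
  rw [totalSeq, if_pos hy]
  rfl

theorem stepMeasurable_of_inner_totalSeq (hω : ChainLike ν tm ω)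
    {F : ∀ y, HilbertTensor fun x : ω y => K x}
    (hF : ∀ m, AEMeasurable (fun y => (inner ℂ (F y) (totalSeq tm e (ω y) m) : ℂ)) ν) :
    StepMeasurable tm e ν ω F := fun m => by
  refine (Complex.continuous_conj.measurable.comp_aemeasurable (hF m)).congr ?_
  filter_upwards [hω.injOn] with y hy
  simp [totalSeq, if_pos hy]

/-- Measurability is preserved by the recursion of Gram and Schmidt, which only involves inner
products of the given vectors. -/
theorem aemeasurable_inner_gramSchmidt (he : IsFundamental e) (htm : Measurable tm)
    (hω : ChainLike ν tm ω) (n : ℕ) :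
    ∀ F : ∀ y, HilbertTensor fun x : ω y => K x, StepMeasurable tm e ν ω F →
      AEMeasurable (fun y => (inner ℂ
        (InnerProductSpace.gramSchmidt ℂ (totalSeq tm e (ω y)) n) (F y) : ℂ)) ν := by
  induction n using Nat.strong_induction_on with
  | _ n ih =>
    intro F hF
    have hstep := fun m => stepMeasurable_totalSeq (K := K) he htm hω m
    have hgs : ∀ i < n, StepMeasurable tm e ν ω fun y =>
        InnerProductSpace.gramSchmidt ℂ (totalSeq tm e (ω y)) i := fun i hi =>
      stepMeasurable_of_inner_totalSeq hω fun m => ih i hi _ (hstep m)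
    have hexp : ∀ y, (inner ℂ (InnerProductSpace.gramSchmidt ℂ (totalSeq tm e (ω y)) n) (F y) : ℂ) =
        inner ℂ (totalSeq tm e (ω y) n) (F y) - ∑ i ∈ Finset.Iio n, starRingEnd ℂ
          (inner ℂ (InnerProductSpace.gramSchmidt ℂ (totalSeq tm e (ω y)) i)
            (totalSeq tm e (ω y) n) /
          inner ℂ (InnerProductSpace.gramSchmidt ℂ (totalSeq tm e (ω y)) i)
            (InnerProductSpace.gramSchmidt ℂ (totalSeq tm e (ω y)) i)) *
          inner ℂ (InnerProductSpace.gramSchmidt ℂ (totalSeq tm e (ω y)) i) (F y) := fun y => by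
      have h := InnerProductSpace.gramSchmidt_def'' ℂ (totalSeq tm e (ω y)) n
      conv_rhs => rw [h]
      rw [inner_add_left, sum_inner]
      simp only [inner_smul_left, inner_self_eq_norm_sq_to_K]
      rw [← h]
      simp
    simp only [hexp]
    refine (hF.inner_totalSeq hω n).sub (Finset.aemeasurable_fun_sum _ fun i hi => ?_)
    have hi' := Finset.mem_Iio.1 hi
    exact (Complex.continuous_conj.measurable.comp_aemeasurable
      ((ih i hi' _ (hstep n)).div (ih i hi' _ (hgs i hi')))).mul (ih i hi' F hF)

theorem StepMeasurable.enc (he : IsFundamental e) (htm : Measurable tm)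
    (hω : ChainLike ν tm ω) {F : ∀ y, HilbertTensor fun x : ω y => K x}
    (hF : StepMeasurable tm e ν ω F) : AEStronglyMeasurable (fun y => enc tm he (ω y) (F y)) ν := by
  refine aestronglyMeasurable_seqSpace fun n => ?_
  have hgs : StepMeasurable tm e ν ω fun y =>
      InnerProductSpace.gramSchmidt ℂ (totalSeq tm e (ω y)) n :=
    stepMeasurable_of_inner_totalSeq hω fun m =>
      aemeasurable_inner_gramSchmidt he htm hω n _ (stepMeasurable_totalSeq he htm hω m)
  have hn : AEMeasurable (fun y => ‖InnerProductSpace.gramSchmidt ℂ (totalSeq tm e (ω y)) n‖) ν := by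
    have h := (aemeasurable_inner_gramSchmidt he htm hω n _ hgs).norm.sqrt
    refine h.congr (.of_forall fun y => ?_)
    simp only [inner_self_eq_norm_sq_to_K]
    simp
  simp only [FockScale.enc, coordinates_apply, InnerProductSpace.gramSchmidtNormed, inner_smul_left]
  refine AEMeasurable.mul ?_ (aemeasurable_inner_gramSchmidt he htm hω n _ hF)
  exact Complex.continuous_conj.measurable.comp_aemeasurable
    (Complex.measurable_ofReal.comp_aemeasurable hn).inv

/-- Essential measurability is measurability of the coordinate sequences. -/
theorem isEssMeasurable_iff (he : IsFundamental e) (htm : Measurable tm)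
    (hω : ChainLike ν tm ω) {F : ∀ y, HilbertTensor fun x : ω y => K x} :
    IsEssMeasurable e ν ω F ↔ AEStronglyMeasurable (fun y => enc tm he (ω y) (F y)) ν := by
  refine ⟨fun h => StepMeasurable.enc he htm hω fun n =>
    h _ (isMeasurableField_stepField he htm _), fun h k hk => ?_⟩
  have h1 := (StepMeasurable.enc he htm hω (stepMeasurable_prodVec htm hω hk)).inner h (𝕜 := ℂ)
  refine h1.aemeasurable.congr (.of_forall fun y => ?_)
  exact LinearIsometry.inner_map_map _ _ _

theorem aestronglyMeasurable_enc_dec (he : IsFundamental e) (htm : Measurable tm)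
    (hω : ChainLike ν tm ω) {c : Y → SeqSpace} (hc : AEStronglyMeasurable c ν) :
    AEStronglyMeasurable (fun y => enc tm he (ω y) (dec tm he (ω y) (c y))) ν := by
  rw [← isEssMeasurable_iff he htm hω]
  intro k hk
  have h1 := (StepMeasurable.enc he htm hω (stepMeasurable_prodVec htm hω hk)).inner hc (𝕜 := ℂ)
  refine h1.aemeasurable.congr (.of_forall fun y => ?_)
  exact (inner_dec he _ _ _).symm

end Fields

/-! ### Separability of the space of square integrable functions of chains -/
section Separable

open MeasurableSpace (generateFrom)

variable {X Y : Type*} [mX : MeasurableSpace X] {μ : Measure X} [mY : MeasurableSpace Y]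
  {ν : Measure Y}

/-- Up to null sets the `σ`-algebra is generated by the countable family `C`. For `σ`-finite
measures this is equivalent to separability of the measure, but it is inherited along countably
many nonsingular maps, hence by products and sums. -/
structure AEGenerates (ν : Measure Y) (C : Set (Set Y)) : Prop where
  countable : C.Countable
  measurable : ∀ c ∈ C, MeasurableSet c
  le : mY ≤ eventuallyMeasurableSpace (generateFrom C) (ae ν)

theorem exists_aeGenerates (μ : Measure X) [SigmaFinite μ] [IsSeparable μ] :
    ∃ C, AEGenerates μ C := by
  obtain ⟨C, hC, hd⟩ := exists_countable_measureDense μ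
  refine ⟨C, hC, hd.measurable, fun s hs => ?_⟩
  suffices H : ∀ N, MeasurableSet[eventuallyMeasurableSpace (generateFrom C) (ae μ)]
      (s ∩ spanningSets μ N) by
    rw [← Set.inter_univ s, ← iUnion_spanningSets μ, Set.inter_iUnion]
    exact MeasurableSet.iUnion H
  intro N
  set u := s ∩ spanningSets μ N
  have hu : μ u ≠ ∞ :=
    ((measure_mono Set.inter_subset_right).trans_lt (measure_spanningSets_lt_top μ N)).ne
  have happ : ∀ k : ℕ, ∃ t ∈ C, μ (symmDiff u t) < ENNReal.ofReal ((1 / 2) ^ k) := fun k =>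
    hd.approx u (hs.inter (measurableSet_spanningSets μ N)) hu _ (by positivity)
  choose t htC ht using happ
  have hsum : ∑' k, μ (symmDiff u (t k)) ≠ ∞ := by
    refine ((ENNReal.tsum_le_tsum fun k => (ht k).le).trans_lt ?_).ne
    rw [← ENNReal.ofReal_tsum_of_nonneg (fun k => by positivity) summable_geometric_two]
    exact ENNReal.ofReal_lt_top
  -- the lower limit of summably good approximations agrees with the set almost everywhere
  refine ⟨Filter.liminf t Filter.atTop, @MeasurableSet.measurableSet_liminf _ (generateFrom C) _
    fun k => MeasurableSpace.measurableSet_generateFrom (htC k), ?_⟩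
  filter_upwards [ae_eventually_notMem hsum] with x hx
  refine propext ?_
  change x ∈ u ↔ x ∈ Filter.liminf t Filter.atTop
  rw [Filter.mem_liminf_iff_eventually_mem]
  refine ⟨fun h => hx.mono fun k hk => ?_, fun h => ?_⟩
  · by_contra h'; exact hk (Or.inl ⟨h, h'⟩)
  · obtain ⟨k, hk, hk'⟩ := (hx.and h).exists
    by_contra h'; exact hk (Or.inr ⟨hk', h'⟩)

/-- The measure is separable on the countably generated `σ`-algebra, which contains every set up to
a null set. -/
theorem AEGenerates.isSeparable [SigmaFinite ν] {C : Set (Set Y)} (h : AEGenerates ν C) :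
    IsSeparable ν := by
  let C' := C ∪ Set.range (spanningSets ν)
  have hle : generateFrom C' ≤ mY := MeasurableSpace.generateFrom_le fun c hc =>
    hc.elim (h.measurable c) fun ⟨k, hk⟩ => hk ▸ measurableSet_spanningSets ν k
  have hS : ∀ k, MeasurableSet[generateFrom C'] (spanningSets ν k) := fun k =>
    MeasurableSpace.measurableSet_generateFrom (Or.inr ⟨k, rfl⟩)
  have hcg : @MeasurableSpace.CountablyGenerated Y (generateFrom C') :=
    @MeasurableSpace.CountablyGenerated.mk Y (generateFrom C')
      ⟨C', h.countable.union (Set.countable_range _), rfl⟩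
  have hfin : SigmaFinite (ν.trim hle) := ⟨⟨⟨spanningSets ν, fun _ => trivial, fun k => by
    rw [trim_measurableSet_eq hle (hS k)]; exact measure_spanningSets_lt_top ν k,
    iUnion_spanningSets ν⟩⟩⟩
  have hsep : @IsSeparable Y (generateFrom C') (ν.trim hle) :=
    @instIsSeparableOfCountablyGeneratedOfSFinite _ (generateFrom C') _ hcg
      (@instSFiniteOfSigmaFinite _ (generateFrom C') _ hfin)
  obtain ⟨A, hA, hd⟩ := @exists_countable_measureDense Y (generateFrom C') (ν.trim hle) hsep
  refine ⟨A, hA, fun s hs => hle _ (@Measure.MeasureDense.measurable _ (generateFrom C') _ _ hd s hs), fun s hs hsf ε hε => ?_⟩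
  obtain ⟨t, ht, hst⟩ := h.le s hs
  have ht' : MeasurableSet[generateFrom C'] t :=
    MeasurableSpace.generateFrom_mono Set.subset_union_left t ht
  obtain ⟨a, ha, hta⟩ := @Measure.MeasureDense.approx _ (generateFrom C') _ _ hd t ht'
    (by rwa [trim_measurableSet_eq hle ht', ← measure_congr hst]) ε hε
  refine ⟨a, ha, ?_⟩
  rwa [measure_congr (Filter.EventuallyEq.symmDiff hst (Filter.EventuallyEq.refl _ a)),
    ← trim_measurableSet_eq hle (@MeasurableSet.symmDiff _ (generateFrom C') _ _ ht'
      (@Measure.MeasureDense.measurable _ (generateFrom C') _ _ hd a ha))]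

theorem AEGenerates.of_maps {C : Set (Set X)} (h : AEGenerates μ C) {ι : Type*} [Countable ι]
    {f : ι → Y → X} (hf : ∀ i, Measure.QuasiMeasurePreserving (f i) ν μ)
    (hle : mY ≤ ⨆ i, mX.comap (f i)) : AEGenerates ν (⋃ i, Set.preimage (f i) '' C) where
  countable := Set.countable_iUnion fun i => h.countable.image _
  measurable c hc := by
    obtain ⟨i, a, ha, rfl⟩ := Set.mem_iUnion.1 hc
    exact (hf i).measurable (h.measurable a ha)
  le := by
    refine hle.trans (iSup_le fun i => ?_)
    rintro _ ⟨a, ha, rfl⟩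
    obtain ⟨t, ht, hat⟩ := h.le a ha
    refine ⟨f i ⁻¹' t, ?_, (hf i).preimage_ae_eq hat⟩
    have h1 : MeasurableSet[(generateFrom C).comap (f i)] (f i ⁻¹' t) := ⟨t, ht, rfl⟩
    rw [MeasurableSpace.comap_generateFrom] at h1
    exact MeasurableSpace.generateFrom_mono (Set.subset_iUnion _ i) _ h1

theorem exists_aeGenerates_chainMeasure (μ : Measure X) [SigmaFinite μ] [IsSeparable μ]
    (tm : X → ℝ≥0) : ∃ C, AEGenerates (chainMeasure μ tm) C := by
  obtain ⟨C, hC⟩ := exists_aeGenerates μ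
  have hI : ∀ n, ∃ D, AEGenerates (incrMeasure μ tm n) D := fun n => by
    refine ⟨_, hC.of_maps (f := fun (i : Fin n) (x : Incr tm n) => x.1 i) (fun i => ?_) ?_⟩
    · refine (Measure.quasiMeasurePreserving_eval (μ := fun _ => μ) i).comp
        ⟨measurable_subtype_coe, Measure.AbsolutelyContinuous.mk fun s hs h0 => ?_⟩
      rw [Measure.map_apply measurable_subtype_coe hs]
      exact le_antisymm ((incrMeasure_preimage_le μ hs).trans h0.le) zero_le
    · rw [Subtype.instMeasurableSpace, MeasurableSpace.pi, MeasurableSpace.comap_iSup]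
      exact iSup_mono fun i => by rw [MeasurableSpace.comap_comp]; rfl
  choose D hD using hI
  let φ : ∀ n, Incr tm n → Chain tm := fun n => Sigma.mk n
  have hφ : ∀ n, MeasurableEmbedding (φ n) := measurableEmbedding_sigmaMk
  let C' : Set (Set (Chain tm)) := ⋃ n, insert (Set.range (φ n)) (Set.image (φ n) '' D n)
  refine ⟨C', Set.countable_iUnion fun n => ((hD n).countable.image _).insert _, ?_, ?_⟩
  · rintro c hc
    obtain ⟨n, rfl | ⟨a, ha, rfl⟩⟩ := Set.mem_iUnion.1 hc
    · exact (hφ n).measurableSet_range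
    · exact (hφ n).measurableSet_image.2 ((hD n).measurable a ha)
  · intro s hs
    have h1 : ∀ n, ∃ t, MeasurableSet[generateFrom C'] t ∧ t ⊆ Set.range (φ n) ∧
        φ n ⁻¹' s =ᵐ[incrMeasure μ tm n] φ n ⁻¹' t := fun n => by
      obtain ⟨t, ht, hst⟩ := (hD n).le _ ((hφ n).measurable hs)
      have h2 : generateFrom (D n) ≤ (generateFrom C').comap (φ n) :=
        MeasurableSpace.generateFrom_le fun a ha => ⟨φ n '' a,
          MeasurableSpace.measurableSet_generateFrom (Set.mem_iUnion.2 ⟨n, Or.inr ⟨a, ha, rfl⟩⟩),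
          Set.preimage_image_eq a (hφ n).injective⟩
      obtain ⟨t', ht', rfl⟩ := h2 t ht
      refine ⟨t' ∩ Set.range (φ n), ht'.inter (MeasurableSpace.measurableSet_generateFrom
        (Set.mem_iUnion.2 ⟨n, Or.inl rfl⟩)), Set.inter_subset_right, ?_⟩
      rwa [Set.preimage_inter, Set.preimage_range, Set.inter_univ]
    choose t ht htr hst using h1
    refine ⟨⋃ n, t n, MeasurableSet.iUnion ht, ?_⟩
    change ∀ᵐ ϰ ∂chainMeasure μ tm, s ϰ = (⋃ n, t n) ϰ
    rw [chainMeasure_eq, Measure.ae_sum_iff]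
    intro n
    refine (hφ n).ae_map_iff.2 ((hst n).mono fun x hx => hx.trans (propext ⟨fun h =>
      Set.mem_iUnion.2 ⟨n, h⟩, fun h => ?_⟩))
    obtain ⟨k, hk⟩ := Set.mem_iUnion.1 h
    obtain ⟨y, hy⟩ := htr k hk
    obtain rfl : k = n := congrArg Sigma.fst hy
    exact hk

instance [SigmaFinite μ] [IsSeparable μ] {tm : X → ℝ≥0} : IsSeparable (chainMeasure μ tm) :=
  (exists_aeGenerates_chainMeasure μ tm).choose_spec.isSeparable

instance : TopologicalSpace.SeparableSpace SeqSpace := by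
  rw [← TopologicalSpace.isSeparable_univ_iff]
  have h1 : TopologicalSpace.IsSeparable (closure (Submodule.span ℂ
      (Set.range fun n : ℕ => lp.single (E := fun _ : ℕ => ℂ) 2 n (1 : ℂ)) : Set SeqSpace)) :=
    ((Set.countable_range _).isSeparable.span).closure
  refine h1.mono fun f _ => ?_
  have h2 := (lp.hasSum_single (p := 2) (E := fun _ : ℕ => ℂ) (by norm_num) f).tendsto_sum_nat
  refine mem_closure_of_tendsto h2 (.of_forall fun n => ?_)
  refine Submodule.sum_mem _ fun i _ => ?_
  have : lp.single (E := fun _ : ℕ => ℂ) 2 i (f i) =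
      f i • lp.single (E := fun _ : ℕ => ℂ) 2 i (1 : ℂ) := by
    rw [← lp.single_smul]; simp
  rw [this]
  exact Submodule.smul_mem _ _ (Submodule.subset_span ⟨i, rfl⟩)

end Separable

/-! ### Measurable families of square integrable functions -/
section VectorFamilies

/-- A weakly measurable function with values in a separable Hilbert space is measurable. -/
theorem aestronglyMeasurable_of_inner {H : Type*} [NormedAddCommGroup H] [InnerProductSpace ℂ H]
    [CompleteSpace H] [TopologicalSpace.SeparableSpace H] {Y : Type*} [MeasurableSpace Y]
    {ν : Measure Y} {G : Y → H} (hG : ∀ c : H, AEMeasurable (fun y => (inner ℂ c (G y) : ℂ)) ν) :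
    AEStronglyMeasurable G ν := by
  have htot : ∀ f : H, (∀ n, inner ℂ (TopologicalSpace.denseSeq H n) f = (0 : ℂ)) → f = 0 :=
    fun f hf => (TopologicalSpace.denseRange_denseSeq H).induction_on
      (p := fun b => (inner ℂ b f : ℂ) = 0) f (isClosed_eq (by fun_prop) continuous_const) hf |>
        inner_self_eq_zero.1
  let U := coordinates _ htot
  have h1 : AEStronglyMeasurable (fun y => U (G y)) ν := aestronglyMeasurable_seqSpace fun n => by
      simp only [U, coordinates_apply]
      exact hG _
  have h2 := (ContinuousLinearMap.adjoint U.toContinuousLinearMap).continuous.comp_aestronglyMeasurable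
    h1
  refine h2.congr (.of_forall fun y => ?_)
  refine ext_inner_left ℂ fun g => ?_
  beta_reduce
  rw [ContinuousLinearMap.adjoint_inner_right]
  exact U.inner_map_map _ _

variable {Y Ω S : Type*} [MeasurableSpace Y] [MeasurableSpace Ω] {m : Measure Ω}
  [NormedAddCommGroup S]

theorem lintegral_enorm_sq_Lp (c : Lp S 2 m) : ∫⁻ x, ‖c x‖ₑ ^ 2 ∂m = ‖c‖ₑ ^ 2 := by
  rw [Lp.enorm_def, eLpNorm_eq_lintegral_rpow_enorm_toReal two_ne_zero ENNReal.ofNat_ne_top,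
    ← ENNReal.rpow_natCast, ← ENNReal.rpow_mul]
  simp

theorem stronglyMeasurable_select {N : Y → ℕ} (hN : Measurable N) {g : ℕ → Ω → S}
    (hg : ∀ n, StronglyMeasurable (g n)) : StronglyMeasurable fun z : Y × Ω => g (N z.1) z.2 := by
  have h1 : ∀ M : ℕ, StronglyMeasurable fun z : Y × Ω =>
      ∑ n ∈ Finset.range M, (N ∘ Prod.fst ⁻¹' {n}).indicator (fun z : Y × Ω => g n z.2) z := fun M =>
    Finset.stronglyMeasurable_fun_sum _ fun n _ => ((hg n).comp_measurable measurable_snd).indicator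
        ((hN.comp measurable_fst) (measurableSet_singleton n))
  refine stronglyMeasurable_of_tendsto Filter.atTop h1 (tendsto_pi_nhds.2 fun z => ?_)
  refine tendsto_const_nhds.congr' ?_
  filter_upwards [Filter.eventually_gt_atTop (N z.1)] with M hM
  rw [Finset.sum_eq_single_of_mem (N z.1) (Finset.mem_range.2 hM)]
  · simp [Set.indicator]
  · intro n _ hn
    exact Set.indicator_of_notMem (fun h => hn (by simpa using h.symm)) _

/-- Fast convergence in `L²` implies convergence almost everywhere. -/
theorem ae_tendsto_of_norm_sub_lt {f : ℕ → Lp S 2 m} {g : Lp S 2 m}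
    (h : ∀ j, ‖f j - g‖ < (1 / 2) ^ j) :
    ∀ᵐ x ∂m, Filter.Tendsto (fun j => f j x) Filter.atTop (nhds (g x)) := by
  have hsum : ∫⁻ x, ∑' j, ‖(f j - g : Lp S 2 m) x‖ₑ ^ 2 ∂m ≠ ∞ := by
    rw [lintegral_tsum fun j => (Lp.aestronglyMeasurable _).enorm.pow_const 2]
    simp only [lintegral_enorm_sq_Lp]
    have hs : Summable fun j : ℕ => ((1 / 4 : ℝ≥0)) ^ j :=
      NNReal.summable_geometric (by rw [div_lt_one (by norm_num)]; norm_num)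
    refine ne_top_of_le_ne_top (ENNReal.tsum_coe_ne_top_iff_summable.2 hs)
      (ENNReal.tsum_le_tsum fun j => ?_)
    have h1 : ‖f j - g‖₊ ≤ (1 / 2) ^ j := by exact_mod_cast (h j).le
    have h2 : ‖f j - g‖₊ ^ 2 ≤ (1 / 4) ^ j := by
      calc ‖f j - g‖₊ ^ 2 ≤ ((1 / 2) ^ j) ^ 2 := by gcongr
        _ = ((1 / 2 : ℝ≥0) ^ 2) ^ j := by rw [← pow_mul, ← pow_mul, mul_comm]
        _ = _ := by norm_num [div_pow]
    rw [enorm_eq_nnnorm]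
    exact_mod_cast h2
  have hfin := ae_lt_top' (AEMeasurable.tsum fun j =>
    (Lp.aestronglyMeasurable (f j - g)).enorm.pow_const 2) hsum
  have hsub : ∀ᵐ x ∂m, ∀ j, (f j - g : Lp S 2 m) x = f j x - g x :=
    ae_all_iff.2 fun j => Lp.coeFn_sub _ _
  filter_upwards [hfin, hsub] with x hx hx2
  have h0 := ENNReal.tendsto_atTop_zero_of_tsum_ne_top hx.ne
  rw [tendsto_iff_edist_tendsto_0]
  have h1 := (ENNReal.continuous_rpow_const (y := (1 / 2 : ℝ))).tendsto 0 |>.comp h0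
  rw [ENNReal.zero_rpow_of_pos (by norm_num)] at h1
  refine h1.congr fun j => ?_
  rw [Function.comp_apply, ← ENNReal.rpow_natCast, ← ENNReal.rpow_mul, hx2, edist_eq_enorm_sub]
  norm_num

/-- A measurable family of square integrable functions has a jointly measurable version. -/
theorem exists_jointly_measurable_version [CompleteSpace S]
    [TopologicalSpace.SeparableSpace (Lp S 2 m)] {ν : Measure Y} {G : Y → Lp S 2 m}
    (hG : AEStronglyMeasurable G ν) :
    ∃ F : Y × Ω → S, StronglyMeasurable F ∧ ∀ᵐ y ∂ν, ∀ᵐ x ∂m, F (y, x) = G y x := by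
  classical
  let G' := hG.mk G
  have hG' : StronglyMeasurable G' := hG.stronglyMeasurable_mk
  let d := TopologicalSpace.denseSeq (Lp S 2 m)
  have hex : ∀ (j : ℕ) (y : Y), ∃ n, ‖d n - G' y‖ < (1 / 2) ^ j := fun j y => by
    obtain ⟨n, hn⟩ := (TopologicalSpace.denseRange_denseSeq (Lp S 2 m)).exists_dist_lt (G' y)
      (ε := (1 / 2 : ℝ) ^ j) (by positivity)
    exact ⟨n, by rwa [dist_comm, dist_eq_norm] at hn⟩
  -- the first member of a dense sequence that is close to `G y` is a measurable choice
  have hN : ∀ j, Measurable fun y => Nat.find (hex j y) := fun j =>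
    measurable_find _ fun k => measurableSet_lt ((stronglyMeasurable_const.sub hG').norm.measurable)
      measurable_const
  have hF := fun j => stronglyMeasurable_select (hN j) (fun n => Lp.stronglyMeasurable (d n))
  refine ⟨fun z => Filter.limUnder Filter.atTop fun j => d (Nat.find (hex j z.1)) z.2,
    StronglyMeasurable.limUnder (l := Filter.atTop) hF, ?_⟩
  filter_upwards [hG.ae_eq_mk] with y hy
  have h1 := ae_tendsto_of_norm_sub_lt (f := fun j => d (Nat.find (hex j y))) (g := G' y)
    fun j => Nat.find_spec (hex j y)
  filter_upwards [h1] with x hx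
  rw [hy]
  exact hx.limUnder_eq

/-- The `L²`-sections of a jointly measurable function form a measurable family. -/
theorem aestronglyMeasurable_sections [InnerProductSpace ℂ S] [CompleteSpace S] [SFinite m]
    [TopologicalSpace.SeparableSpace (Lp S 2 m)] {ν : Measure Y} {F : Y × Ω → S}
    (hF : AEStronglyMeasurable F (ν.prod m)) {G : Y → Lp S 2 m}
    (hG : ∀ᵐ y ∂ν, ∀ᵐ x ∂m, G y x = F (y, x)) : AEStronglyMeasurable G ν := by
  refine aestronglyMeasurable_of_inner fun c => ?_
  have h1 : AEStronglyMeasurable (fun z : Y × Ω => (inner ℂ (c z.2) (F z) : ℂ)) (ν.prod m) :=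
    ((Lp.aestronglyMeasurable c).comp_snd).inner hF
  refine h1.integral_prod_right'.aemeasurable.congr ?_
  filter_upwards [hG] with y hy
  rw [L2.inner_def]
  refine integral_congr_ae ?_
  filter_upwards [hy] with x hx
  rw [hx]

end VectorFamilies

noncomputable section FockSections

open scoped Classical
open FockScale.Table (ofChains)
open MeasureTheory.Measure (QuasiMeasurePreserving ae_ae_of_ae_prod quasiMeasurePreserving_fst
  quasiMeasurePreserving_snd)

variable {X : Type*} [MeasurableSpace X] {μ : Measure X} [SigmaFinite μ] {tm : X → ℝ≥0}
  {K : X → Type*} [∀ x, NormedAddCommGroup (K x)] [∀ x, InnerProductSpace ℂ (K x)]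
  [∀ x, CompleteSpace (K x)] {e : ℕ → ∀ x, K x} {σ : Finset X} {w : X → ℝ≥0} {h : Sec K}

local notation "𝔪" => chainMeasure μ tm
local notation "𝔪[" T "]" => chainMeasureBefore μ tm T
local notation "𝔱" => tableMeasure tm 𝔪
local notation "𝔱[" T "]" => tableMeasure tm 𝔪[T]
local notation "ℭ" => Chain tm
local notation "𝕋" => ℭ × ℭ × ℭ × ℭ

/-! ### Fock spaces in coordinates -/
section Fock

variable (μ tm e) in
/-- The standing assumptions on the time function and the fundamental sequence. -/
structure Regular : Prop where
  time : IsTime μ tm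
  field : IsFundamental e

variable (μ) in
/-- The positive weights. -/
structure IsWeight (w : X → ℝ≥0) : Prop where
  aemeasurable : AEMeasurable w μ
  pos : ∀ x, 0 < w x

theorem IsWeight.inv (h : IsWeight μ w) : IsWeight μ w⁻¹ :=
  ⟨h.aemeasurable.inv, fun x => inv_pos.2 (h.pos x)⟩

theorem IsWeight.wt_pos (h : IsWeight μ w) (ω : Finset X) : 0 < wt w ω :=
  Finset.prod_pos fun x _ => h.pos x

theorem wt_inv (w : X → ℝ≥0) (ω : Finset X) : wt w⁻¹ ω = (wt w ω)⁻¹ := by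
  simp [wt]

theorem ae_forall_pts (htm : Measurable tm) {P : X → Prop} (h : ∀ᵐ x ∂μ, P x) :
    ∀ᵐ ϰ ∂𝔪, ∀ x ∈ pts ϰ, P x := by
  rw [ae_chain_iff]
  intro n
  have h1 : ∀ᵐ x ∂(Measure.pi fun _ : Fin n => μ), ∀ i, P (x i) := ae_all_iff.2 fun i =>
    (Measure.quasiMeasurePreserving_eval (fun _ : Fin n => μ) i).ae h
  have h2 : ∀ᵐ x ∂(incrMeasure μ tm n), ∀ i, P (x.1 i) := by
    have h3 := ae_restrict_of_ae (s := {x | StrictMono (tm ∘ x)}) h1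
    rw [← map_val_incrMeasure μ htm] at h3
    exact ae_of_ae_map measurable_subtype_coe.aemeasurable h3
  rw [(measurableEmbedding_sigmaMk n).ae_map_iff]
  filter_upwards [h2] with x hx y hy
  obtain ⟨i, rfl⟩ := mem_pts.1 hy
  exact hx i

theorem measurable_wt (hw : Measurable w) : Measurable fun ϰ : ℭ => wt w (pts ϰ) := by
  intro s hs
  refine measurableSet_chain.2 fun n => ?_
  have : Measurable fun x : Incr tm n => ∏ i, w (x.1 i) := Finset.measurable_fun_prod _ fun i _ =>
      hw.comp ((measurable_pi_apply i).comp measurable_subtype_coe)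
  convert this hs using 1
  ext x
  simp [pts, wt]
  rfl

theorem aemeasurable_wt (htm : Measurable tm) (hw : AEMeasurable w μ) :
    AEMeasurable (fun ϰ : ℭ => wt w (pts ϰ)) 𝔪 := by
  refine ⟨fun ϰ => wt (hw.mk w) (pts ϰ), measurable_wt hw.measurable_mk, ?_⟩
  filter_upwards [ae_forall_pts htm hw.ae_eq_mk] with ϰ h
  exact Finset.prod_congr rfl h

/-- The factor `√w(ω)`, as a complex number. -/
def rt (w : X → ℝ≥0) (ω : Finset X) : ℂ := ((NNReal.sqrt (wt w ω) : ℝ) : ℂ)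

theorem enorm_rt_sq (w : X → ℝ≥0) (ω : Finset X) : ‖rt w ω‖ₑ ^ 2 = (wt w ω : ℝ≥0∞) := by
  have : ‖rt w ω‖ₑ = (NNReal.sqrt (wt w ω) : ℝ≥0∞) := by
    rw [rt, enorm_eq_nnnorm]; congr 1; ext; simp
  rw [this, ← ENNReal.coe_pow, NNReal.sq_sqrt]

theorem rt_ne_zero (h : IsWeight μ w) (ω : Finset X) : rt w ω ≠ 0 := by
  have : 0 < NNReal.sqrt (wt w ω) := NNReal.sqrt_pos.2 (h.wt_pos ω)
  rw [rt]
  exact_mod_cast this.ne'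

theorem rt_inv (w : X → ℝ≥0) (ω : Finset X) : rt w⁻¹ ω = (rt w ω)⁻¹ := by
  rw [rt, rt, wt_inv, NNReal.sqrt_inv]; simp

theorem conj_rt (w : X → ℝ≥0) (ω : Finset X) : starRingEnd ℂ (rt w ω) = rt w ω :=
  Complex.conj_ofReal _

theorem aemeasurable_rt (htm : Measurable tm) (hw : AEMeasurable w μ) :
    AEMeasurable (fun ϰ : ℭ => rt w (pts ϰ)) 𝔪 :=
  Complex.measurable_ofReal.comp_aemeasurable (measurable_coe_nnreal_real.comp_aemeasurable
    (NNReal.continuous_sqrt.measurable.comp_aemeasurable (aemeasurable_wt htm hw)))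

/-- A section in coordinates. -/
def ef (tm : X → ℝ≥0) (he : IsFundamental e) (f : Sec K) (ω : Finset X) : SeqSpace :=
  enc tm he ω (f ω)

section ef
variable (he : IsFundamental e) (f g : Sec K) (ω : Finset X)

theorem enorm_ef : ‖ef tm he f ω‖ₑ = ‖f ω‖ₑ := (enc tm he ω).enorm_map _
theorem ef_add : ef tm he (f + g) ω = ef tm he f ω + ef tm he g ω := map_add _ _ _
theorem ef_smul (c : ℂ) : ef tm he (c • f) ω = c • ef tm he f ω := (enc tm he ω).map_smul c (f ω)
theorem inner_ef : inner ℂ (ef tm he f ω) (ef tm he g ω) = inner ℂ (f ω) (g ω) :=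
  (enc tm he ω).inner_map_map _ _
theorem ef_inj {f g : Sec K} {ω : Finset X} : ef tm he f ω = ef tm he g ω ↔ f ω = g ω :=
  (enc tm he ω).injective.eq_iff
theorem dec_ef : dec tm he ω (ef tm he f ω) = f ω := dec_enc he ω _
end ef

/-- The weighted coordinate function of an element of `F(w) ⊗ K^⊗(σ)`. -/
def code (tm : X → ℝ≥0) (he : IsFundamental e) (w : X → ℝ≥0) (σ : Finset X)
    (f : Sec K) (ϰ : Chain tm) : SeqSpace :=
  rt w (pts ϰ) • ef tm he f (pts ϰ ∪ σ)

theorem chainLike_union_const (ht : IsTime μ tm) (hσ : Set.InjOn tm σ) :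
    ChainLike 𝔪 tm fun ϰ : ℭ => pts ϰ ∪ σ := by
  refine ⟨fun ϰ => merge (ϰ, chainOf tm σ), (measurable_merge ht.measurable).comp
    (measurable_id.prodMk measurable_const), ?_⟩
  filter_upwards [ae_apart_const μ ht σ] with ϰ h
  rw [pts_merge (by rwa [pts_chainOf hσ]), pts_chainOf hσ]

variable (R : Regular μ tm e)

theorem fockNorm_eq_eLpNorm (he : IsFundamental e) (w : X → ℝ≥0) (σ : Finset X) (f : Sec K) :
    fockNorm μ tm w σ f = eLpNorm (code tm he w σ f) 2 𝔪 := by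
  rw [eLpNorm_eq_lintegral_rpow_enorm_toReal two_ne_zero ENNReal.ofNat_ne_top, fockNorm]
  simp only [ENNReal.toReal_ofNat]
  congr 1
  refine lintegral_congr fun ϰ => ?_
  rw [code, enorm_smul, ← Nat.cast_ofNat (R := ℝ), ENNReal.rpow_natCast, mul_pow, enorm_rt_sq,
    enorm_ef, mul_comm]

theorem fockNorm_sq (w : X → ℝ≥0) (σ : Finset X) (f : Sec K) : fockNorm μ tm w σ f ^ 2 =
    ∫⁻ ϰ, ‖f (pts ϰ ∪ σ)‖ₑ ^ 2 * (wt w (pts ϰ) : ℝ≥0∞) ∂𝔪 := by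
  rw [fockNorm, ← ENNReal.rpow_natCast, ← ENNReal.rpow_mul]
  simp

theorem aestronglyMeasurable_code_iff (R : Regular μ tm e) (hw : IsWeight μ w)
    (hσ : Set.InjOn tm σ) {f : Sec K} : AEStronglyMeasurable (code tm R.field w σ f) 𝔪 ↔
      IsEssMeasurable e 𝔪 (fun ϰ => pts ϰ ∪ σ) (fun ϰ => f (pts ϰ ∪ σ)) := by
  rw [isEssMeasurable_iff R.field R.time.measurable (chainLike_union_const R.time hσ)]
  have hr := (aemeasurable_rt R.time.measurable hw.aemeasurable).aestronglyMeasurable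
  refine ⟨fun h => ?_, fun h => hr.smul h⟩
  refine ((aemeasurable_rt R.time.measurable hw.aemeasurable).inv.aestronglyMeasurable.smul h).congr
    (.of_forall fun ϰ => ?_)
  simp [code, ef, smul_smul, rt_ne_zero hw]

theorem memFock_iff (hw : IsWeight μ w) (hσ : Set.InjOn tm σ) {f : Sec K} :
    MemFock μ tm e w σ f ↔ MemLp (code tm R.field w σ f) 2 𝔪 := by
  rw [MemFock, MemLp, ← aestronglyMeasurable_code_iff R hw hσ, fockNorm_eq_eLpNorm R.field]

/-- The Hilbert space `L²(𝒳; ℓ²)` in which all the Fock spaces are represented. -/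
abbrev HS (μ : Measure X) (tm : X → ℝ≥0) : Type _ := Lp SeqSpace 2 (chainMeasure μ tm)

/-- The element of the Hilbert space that represents an element of `F(w) ⊗ K^⊗(σ)`. Sections
outside of this space are sent to `0`. -/
def vec (μ : Measure X) (tm : X → ℝ≥0) (he : IsFundamental e) (w : X → ℝ≥0)
    (σ : Finset X) (f : Sec K) : HS μ tm :=
  if h : MemLp (code tm he w σ f) 2 (chainMeasure μ tm) then h.toLp else 0

theorem coeFn_vec (hw : IsWeight μ w)
    (hσ : Set.InjOn tm σ) {f : Sec K} (hf : MemFock μ tm e w σ f) :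
    ∀ᵐ ϰ ∂𝔪, vec μ tm R.field w σ f ϰ = code tm R.field w σ f ϰ := by
  have h := (memFock_iff R hw hσ).1 hf
  rw [vec, dif_pos h]
  exact h.coeFn_toLp

theorem enorm_vec (hw : IsWeight μ w)
    (hσ : Set.InjOn tm σ) {f : Sec K} (hf : MemFock μ tm e w σ f) :
    ‖vec μ tm R.field w σ f‖ₑ = fockNorm μ tm w σ f := by
  have h := (memFock_iff R hw hσ).1 hf
  rw [vec, dif_pos h, Lp.enorm_toLp, fockNorm_eq_eLpNorm R.field]

theorem vec_eq_iff (hw : IsWeight μ w)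
    (hσ : Set.InjOn tm σ) {f g : Sec K} (hf : MemFock μ tm e w σ f) (hg : MemFock μ tm e w σ g) :
    vec μ tm R.field w σ f = vec μ tm R.field w σ g ↔ EqFock μ tm σ f g := by
  refine ⟨fun h => ?_, fun h => Lp.ext ?_⟩
  · have h1 := coeFn_vec R hw hσ hf
    rw [h] at h1
    filter_upwards [h1, coeFn_vec R hw hσ hg] with ϰ h1 h2
    rw [h2, code, code] at h1
    exact ((ef_inj R.field).1 (smul_right_injective _ (rt_ne_zero hw _) h1)).symm
  · filter_upwards [coeFn_vec R hw hσ hf, coeFn_vec R hw hσ hg, h] with ϰ h1 h2 h3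
    rw [h1, h2, code, code, (ef_inj R.field).2 h3]

theorem MemFock.add (R : Regular μ tm e) (hw : IsWeight μ w)
    (hσ : Set.InjOn tm σ) {f g : Sec K} (hf : MemFock μ tm e w σ f)
    (hg : MemFock μ tm e w σ g) : MemFock μ tm e w σ (f + g) := by
  rw [memFock_iff R hw hσ] at *
  have : code tm R.field w σ (f + g) = code tm R.field w σ f + code tm R.field w σ g := by
    ext1 ϰ; simp only [code, ef_add, smul_add, Pi.add_apply]
  rw [this]
  exact hf.add hg

theorem MemFock.smul (R : Regular μ tm e) (hw : IsWeight μ w)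
    (hσ : Set.InjOn tm σ) (c : ℂ) {f : Sec K} (hf : MemFock μ tm e w σ f) :
    MemFock μ tm e w σ (c • f) := by
  rw [memFock_iff R hw hσ] at *
  have : code tm R.field w σ (c • f) = c • code tm R.field w σ f := by
    ext1 ϰ; simp only [code, ef_smul, smul_comm c, Pi.smul_apply]
  rw [this]
  exact hf.const_smul c

theorem vec_add (hw : IsWeight μ w) (hσ : Set.InjOn tm σ) {f g : Sec K} (hf : MemFock μ tm e w σ f)
    (hg : MemFock μ tm e w σ g) : vec μ tm R.field w σ (f + g) =
      vec μ tm R.field w σ f + vec μ tm R.field w σ g := by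
  refine Lp.ext ?_
  filter_upwards [coeFn_vec R hw hσ hf, coeFn_vec R hw hσ hg, coeFn_vec R hw hσ (hf.add R hw hσ hg),
    Lp.coeFn_add (vec μ tm R.field w σ f) (vec μ tm R.field w σ g)] with ϰ h1 h2 h3 h4
  rw [h3, h4, Pi.add_apply, h1, h2, code, code, code, ef_add, smul_add]

theorem vec_smul (hw : IsWeight μ w)
    (hσ : Set.InjOn tm σ) (c : ℂ) {f : Sec K} (hf : MemFock μ tm e w σ f) :
    vec μ tm R.field w σ (c • f) = c • vec μ tm R.field w σ f := by
  refine Lp.ext ?_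
  filter_upwards [coeFn_vec R hw hσ hf, coeFn_vec R hw hσ (hf.smul R hw hσ c),
    Lp.coeFn_smul c (vec μ tm R.field w σ f)] with ϰ h1 h3 h4
  rw [h3, h4, Pi.smul_apply, h1, code, code, ef_smul, smul_comm]

/-- The pairing is the inner product of the representing vectors. -/
theorem pairing_eq_inner (hw : IsWeight μ w)
    (hσ : Set.InjOn tm σ) {f h : Sec K} (hf : MemFock μ tm e w⁻¹ σ f)
    (hh : MemFock μ tm e w σ h) : pairing μ tm σ f h =
      inner ℂ (vec μ tm R.field w⁻¹ σ f) (vec μ tm R.field w σ h) := by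
  rw [pairing, L2.inner_def]
  refine integral_congr_ae ?_
  filter_upwards [coeFn_vec R hw.inv hσ hf, coeFn_vec R hw hσ hh] with ϰ h1 h2
  rw [h1, h2, code, code, inner_smul_left, inner_smul_right, inner_ef, conj_rt, rt_inv,
    inv_mul_cancel_left₀ (rt_ne_zero hw _)]

theorem pairing_eq_inner' (hw : IsWeight μ w)
    (hσ : Set.InjOn tm σ) {f h : Sec K} (hf : MemFock μ tm e w σ f)
    (hh : MemFock μ tm e w⁻¹ σ h) : pairing μ tm σ f h =
      inner ℂ (vec μ tm R.field w σ f) (vec μ tm R.field w⁻¹ σ h) := by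
  have := pairing_eq_inner R hw.inv hσ (f := f) (h := h) (by rwa [inv_inv]) hh
  rwa [inv_inv] at this

theorem integrable_inner (R : Regular μ tm e) (hw : IsWeight μ w)
    (hσ : Set.InjOn tm σ) {f h : Sec K} (hf : MemFock μ tm e w σ f)
    (hh : MemFock μ tm e w⁻¹ σ h) : Integrable
      (fun ϰ => (inner ℂ (f (pts ϰ ∪ σ)) (h (pts ϰ ∪ σ)) : ℂ)) 𝔪 := by
  refine (L2.integrable_inner (𝕜 := ℂ) (vec μ tm R.field w σ f) (vec μ tm R.field w⁻¹ σ h)).congr ?_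
  filter_upwards [coeFn_vec R hw hσ hf, coeFn_vec R hw.inv hσ hh] with ϰ h1 h2
  rw [h1, h2, code, code, inner_smul_left, inner_smul_right, inner_ef, conj_rt, rt_inv,
    mul_inv_cancel_left₀ (rt_ne_zero hw _)]

/-- The section with given weighted coordinates. -/
def decode (tm : X → ℝ≥0) (he : IsFundamental e) (w : X → ℝ≥0) (σ : Finset X)
    (c : Chain tm → SeqSpace) : Sec K := fun ω =>
  dec tm he ω ((rt w (ω \ σ))⁻¹ • c (chainOf tm (ω \ σ)))

theorem decode_apply (he : IsFundamental e) (w : X → ℝ≥0) (c : ℭ → SeqSpace)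
    {ϰ : ℭ} (h : Apart tm (pts ϰ) σ) : decode tm he w σ c (pts ϰ ∪ σ) =
      dec tm he (pts ϰ ∪ σ) ((rt w (pts ϰ))⁻¹ • c ϰ) := by
  have : (pts ϰ ∪ σ) \ σ = pts ϰ := by
    rw [Finset.union_sdiff_right, Finset.sdiff_eq_self_of_disjoint h.disjoint]
  rw [decode, this, chainOf_pts]

theorem code_decode (he : IsFundamental e) (hw : IsWeight μ w)
    (c : ℭ → SeqSpace) {ϰ : ℭ} (h : Apart tm (pts ϰ) σ) : code tm he w σ (decode tm he w σ c) ϰ =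
      enc tm he (pts ϰ ∪ σ) (dec tm he (pts ϰ ∪ σ) (c ϰ)) := by
  rw [code, ef, decode_apply he w c h, map_smul, map_smul, smul_smul,
    mul_inv_cancel₀ (rt_ne_zero hw _), one_smul]

theorem memFock_decode (hw : IsWeight μ w) (hσ : Set.InjOn tm σ) (c : HS μ tm) :
    MemFock μ tm e w σ (decode tm R.field w σ c : Sec K) := by
  rw [memFock_iff R hw hσ]
  have h1 := aestronglyMeasurable_enc_dec (K := K) R.field R.time.measurable
    (chainLike_union_const R.time hσ) (Lp.aestronglyMeasurable c)
  have h2 : (fun ϰ => enc tm R.field (pts ϰ ∪ σ) (dec tm R.field (pts ϰ ∪ σ) (c ϰ)))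
      =ᵐ[𝔪] code tm R.field w σ (decode tm R.field w σ c : Sec K) := by
    filter_upwards [ae_apart_const μ R.time σ] with ϰ h
    exact (code_decode R.field hw c h).symm
  refine MemLp.ae_eq h2 ((Lp.memLp c).of_le h1 (.of_forall fun ϰ => ?_))
  rw [LinearIsometry.norm_map]
  exact norm_dec_le _ _ _

theorem coeFn_vec_decode (hw : IsWeight μ w) (hσ : Set.InjOn tm σ) (c : HS μ tm) : ∀ᵐ ϰ ∂𝔪,
    vec μ tm R.field w σ (decode tm R.field w σ c : Sec K) ϰ =
      enc tm R.field (K := K) (pts ϰ ∪ σ) (dec tm R.field (pts ϰ ∪ σ) (c ϰ)) := by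
  filter_upwards [coeFn_vec R hw hσ (memFock_decode R hw hσ c),
    ae_apart_const μ R.time σ] with ϰ h1 h
  rw [h1, code_decode R.field hw c h]

/-- Representing vectors are insensitive to the components that `decode` ignores. -/
theorem inner_vec_decode {w w' : X → ℝ≥0} (hw : IsWeight μ w) (hw' : IsWeight μ w')
    (hσ : Set.InjOn tm σ) (c : HS μ tm) {f : Sec K} (hf : MemFock μ tm e w' σ f) :
    inner ℂ (vec μ tm R.field w' σ f) (vec μ tm R.field w σ (decode tm R.field w σ c : Sec K)) =
      inner ℂ (vec μ tm R.field w' σ f) c := by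
  rw [L2.inner_def, L2.inner_def]
  refine integral_congr_ae ?_
  filter_upwards [coeFn_vec_decode (K := K) R hw hσ c, coeFn_vec R hw' hσ hf] with ϰ h1 h2
  rw [h1, h2, code, inner_smul_left, inner_smul_left, ef, LinearIsometry.inner_map_map, inner_dec]

theorem decode_vec (hw : IsWeight μ w)
    (hσ : Set.InjOn tm σ) {f : Sec K} (hf : MemFock μ tm e w σ f) :
    EqFock μ tm σ (decode tm R.field w σ (vec μ tm R.field w σ f)) f := by
  filter_upwards [coeFn_vec R hw hσ hf, ae_apart_const μ R.time σ] with ϰ h1 h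
  rw [decode_apply _ _ _ h, h1, code, smul_smul, inv_mul_cancel₀ (rt_ne_zero hw _), one_smul, dec_ef]

theorem norm_vec_decode_le (hw : IsWeight μ w) (hσ : Set.InjOn tm σ) (c : HS μ tm) :
    ‖vec μ tm R.field w σ (decode tm R.field w σ c : Sec K)‖ ≤ ‖c‖ := by
  refine Lp.norm_le_norm_of_ae_le ?_
  filter_upwards [coeFn_vec_decode (K := K) R hw hσ c] with ϰ h1
  rw [h1, LinearIsometry.norm_map]
  exact norm_dec_le _ _ _

theorem decode_add (c c' : HS μ tm) : EqFock μ tm σ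
    (decode tm R.field w σ (c + c' : HS μ tm) : Sec K)
    (decode tm R.field w σ c + decode tm R.field w σ c') := by
  filter_upwards [ae_apart_const μ R.time σ, Lp.coeFn_add c c'] with ϰ h h1
  rw [Pi.add_apply, decode_apply _ _ _ h, decode_apply _ _ _ h, decode_apply _ _ _ h, h1,
    Pi.add_apply, smul_add, map_add]

theorem decode_smul (a : ℂ) (c : HS μ tm) : EqFock μ tm σ
    (decode tm R.field w σ (a • c : HS μ tm) : Sec K) (a • decode tm R.field w σ c) := by
  filter_upwards [ae_apart_const μ R.time σ, Lp.coeFn_smul a c] with ϰ h h1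
  rw [Pi.smul_apply, decode_apply _ _ _ h, decode_apply _ _ _ h, h1,
    Pi.smul_apply, smul_comm, map_smul]

end Fock

/-! ### Operators of the Fock scale as operators of one Hilbert space -/
section OperatorCodes

theorem EqFock.symm {f g : Sec K} (h : EqFock μ tm σ f g) : EqFock μ tm σ g f := by
  filter_upwards [h] with ϰ h using h.symm

theorem EqFock.trans {f g k : Sec K} (h : EqFock μ tm σ f g)
    (h' : EqFock μ tm σ g k) : EqFock μ tm σ f k := by
  filter_upwards [h, h'] with ϰ h h' using h.trans h'

theorem EqFock.refl (σ : Finset X) (f : Sec K) : EqFock μ tm σ f f := .of_forall fun _ => rfl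

theorem EqFock.pairing_eq {f f' h h' : Sec K} (H : EqFock μ tm σ f f')
    (H' : EqFock μ tm σ h h') : pairing μ tm σ f h = pairing μ tm σ f' h' := by
  refine integral_congr_ae ?_
  filter_upwards [H, H'] with ϰ h1 h2
  rw [h1, h2]

theorem EqFock.fockNorm_eq {f f' : Sec K} (H : EqFock μ tm σ f f') :
    fockNorm μ tm w σ f = fockNorm μ tm w σ f' := by
  rw [fockNorm, fockNorm]
  congr 1
  refine lintegral_congr_ae ?_
  filter_upwards [H] with ϰ h1
  rw [h1]

theorem EqFock.memFock {f f' : Sec K} (H : EqFock μ tm σ f f')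
    (hf : MemFock μ tm e w σ f) : MemFock μ tm e w σ f' := by
  refine ⟨fun k hk => (hf.1 k hk).congr ?_, H.fockNorm_eq (w := w) ▸ hf.2⟩
  filter_upwards [H] with ϰ h1
  rw [h1]

variable {σ τ : Finset X} {A : Sec K → Sec K}

theorem IsOperator.fockNorm_le (hA : IsOperator μ tm e w σ τ A) (hh : MemFock μ tm e w σ h) :
    fockNorm μ tm w⁻¹ τ (A h) ≤ opNorm μ tm e w σ τ A * fockNorm μ tm w σ h := by
  have h1 : fockNorm μ tm w⁻¹ τ (A h) / fockNorm μ tm w σ h ≤ opNorm μ tm e w σ τ A :=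
    le_iSup₂ (f := fun h (_ : MemFock μ tm e w σ h) =>
      fockNorm μ tm w⁻¹ τ (A h) / fockNorm μ tm w σ h) h hh
  exact (ENNReal.div_le_iff_le_mul (Or.inr hA.bounded.ne) (Or.inl hh.2.ne)).1 h1

theorem opNorm_le {C : ℝ≥0∞} (h : ∀ h, MemFock μ tm e w σ h →
    fockNorm μ tm w⁻¹ τ (A h) ≤ C * fockNorm μ tm w σ h) : opNorm μ tm e w σ τ A ≤ C :=
  iSup₂_le fun f hf => ENNReal.div_le_of_le_mul (h f hf)

variable (R : Regular μ tm e)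

theorem IsOperator.eqFock (R : Regular μ tm e) (hA : IsOperator μ tm e w σ τ A)
    (hw : IsWeight μ w) (hσ : Set.InjOn tm σ) (hτ : Set.InjOn tm τ)
    {f h : Sec K} (hf : MemFock μ tm e w σ f) (hh : MemFock μ tm e w σ h)
    (H : EqFock μ tm σ f h) : EqFock μ tm τ (A f) (A h) := by
  have hd : MemFock μ tm e w σ (f + (-1 : ℂ) • h) := hf.add R hw hσ (hh.smul R hw hσ _)
  have h0 : vec μ tm R.field w σ (f + (-1 : ℂ) • h) = 0 := by
    rw [vec_add R hw hσ hf (hh.smul R hw hσ _), vec_smul R hw hσ _ hh,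
      (vec_eq_iff R hw hσ hf hh).2 H]
    simp
  have h1 : fockNorm μ tm w⁻¹ τ (A (f + (-1 : ℂ) • h)) = 0 := by
    have := hA.fockNorm_le hd
    rw [← enorm_vec R hw hσ hd, h0, enorm_zero, mul_zero] at this
    exact nonpos_iff_eq_zero.1 this
  have h2 : EqFock μ tm τ (A (f + (-1 : ℂ) • h)) (A f + (-1 : ℂ) • A h) := by
    filter_upwards [hA.add _ _ hf (hh.smul R hw hσ (-1)), hA.smul (-1) _ hh] with ϰ h1 h2
    rw [h1, Pi.add_apply, h2, Pi.add_apply]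
  have h3 : vec μ tm R.field w⁻¹ τ (A f) = vec μ tm R.field w⁻¹ τ (A h) := by
    have h4 : vec μ tm R.field w⁻¹ τ (A (f + (-1 : ℂ) • h)) = 0 := by
      rw [← enorm_eq_zero, enorm_vec R hw.inv hτ (hA.maps _ hd), h1]
    rw [(vec_eq_iff R hw.inv hτ (hA.maps _ hd) ((hA.maps _ hf).add R hw.inv hτ
      ((hA.maps _ hh).smul R hw.inv hτ _))).2 h2, vec_add R hw.inv hτ (hA.maps _ hf)
      ((hA.maps _ hh).smul R hw.inv hτ _), vec_smul R hw.inv hτ _ (hA.maps _ hh)] at h4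
    simpa [← sub_eq_add_neg, sub_eq_zero] using h4
  exact (vec_eq_iff R hw.inv hτ (hA.maps _ hf) (hA.maps _ hh)).1 h3

/-- The operator of the Hilbert space that represents an operator of the Fock scale. -/
def opCode (μ : Measure X) (tm : X → ℝ≥0) (he : IsFundamental e) (w : X → ℝ≥0)
    (σ τ : Finset X) (A : Sec K → Sec K) : HS μ tm →L[ℂ] HS μ tm :=
  if H : ∃ L : HS μ tm →L[ℂ] HS μ tm, ∀ c,
    L c = vec μ tm he w⁻¹ τ (A (decode tm he w σ c)) then H.choose else 0

theorem opCode_apply (hA : IsOperator μ tm e w σ τ A) (hw : IsWeight μ w)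
    (hσ : Set.InjOn tm σ) (hτ : Set.InjOn tm τ) (c : HS μ tm) :
    opCode μ tm R.field w σ τ A c = vec μ tm R.field w⁻¹ τ (A (decode tm R.field w σ c)) := by
  have hm := fun c => memFock_decode R hw hσ c
  have H : ∃ L : HS μ tm →L[ℂ] HS μ tm, ∀ c,
      L c = vec μ tm R.field w⁻¹ τ (A (decode tm R.field w σ c)) := by
    refine ⟨LinearMap.mkContinuous
      { toFun := fun c => vec μ tm R.field w⁻¹ τ (A (decode tm R.field w σ c))
        map_add' := fun c c' => ?_
        map_smul' := fun a c => ?_ } (opNorm μ tm e w σ τ A).toReal fun c => ?_, fun c => rfl⟩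
    · rw [← vec_add R hw.inv hτ (hA.maps _ (hm c)) (hA.maps _ (hm c')),
        vec_eq_iff R hw.inv hτ (hA.maps _ (hm _))
          ((hA.maps _ (hm c)).add R hw.inv hτ (hA.maps _ (hm c')))]
      exact (hA.eqFock R hw hσ hτ (hm _) ((hm c).add R hw hσ (hm c')) (decode_add R c c')).trans
        (hA.add _ _ (hm c) (hm c'))
    · rw [RingHom.id_apply, ← vec_smul R hw.inv hτ _ (hA.maps _ (hm c)),
        vec_eq_iff R hw.inv hτ (hA.maps _ (hm _)) ((hA.maps _ (hm c)).smul R hw.inv hτ a)]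
      exact (hA.eqFock R hw hσ hτ (hm _) ((hm c).smul R hw hσ a) (decode_smul R a c)).trans
        (hA.smul _ _ (hm c))
    · have h1 := hA.fockNorm_le (hm c)
      rw [← enorm_vec R hw hσ (hm c), ← enorm_vec R hw.inv hτ (hA.maps _ (hm c))] at h1
      have h2 := ENNReal.toReal_mono (ENNReal.mul_ne_top hA.bounded.ne enorm_ne_top) h1
      rw [ENNReal.toReal_mul, toReal_enorm, toReal_enorm] at h2
      exact h2.trans (mul_le_mul_of_nonneg_left (norm_vec_decode_le R hw hσ c)
        ENNReal.toReal_nonneg)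
  rw [opCode, dif_pos H]
  exact H.choose_spec c

theorem opCode_vec (hA : IsOperator μ tm e w σ τ A) (hw : IsWeight μ w)
    (hσ : Set.InjOn tm σ) (hτ : Set.InjOn tm τ)
    (hh : MemFock μ tm e w σ h) : opCode μ tm R.field w σ τ A (vec μ tm R.field w σ h) =
      vec μ tm R.field w⁻¹ τ (A h) := by
  have hm := memFock_decode R hw hσ (vec μ tm R.field w σ h)
  rw [opCode_apply R hA hw hσ hτ, vec_eq_iff R hw.inv hτ (hA.maps _ hm) (hA.maps _ hh)]
  exact hA.eqFock R hw hσ hτ hm hh (decode_vec R hw hσ hh)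

theorem enorm_opCode (hA : IsOperator μ tm e w σ τ A) (hw : IsWeight μ w)
    (hσ : Set.InjOn tm σ) (hτ : Set.InjOn tm τ) :
    ‖opCode μ tm R.field w σ τ A‖ₑ = opNorm μ tm e w σ τ A := by
  refine le_antisymm ?_ (opNorm_le fun h hh => ?_)
  · rw [← ENNReal.ofReal_toReal hA.bounded.ne, ← ofReal_norm]
    refine ENNReal.ofReal_le_ofReal (ContinuousLinearMap.opNorm_le_bound _ ENNReal.toReal_nonneg
      fun c => ?_)
    have hm := memFock_decode R hw hσ c
    have h1 := hA.fockNorm_le hm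
    rw [← enorm_vec R hw hσ hm, ← enorm_vec R hw.inv hτ (hA.maps _ hm),
      ← opCode_apply R hA hw hσ hτ] at h1
    have h2 := ENNReal.toReal_mono (ENNReal.mul_ne_top hA.bounded.ne enorm_ne_top) h1
    rw [ENNReal.toReal_mul, toReal_enorm, toReal_enorm] at h2
    exact h2.trans (mul_le_mul_of_nonneg_left (norm_vec_decode_le R hw hσ c) ENNReal.toReal_nonneg)
  · rw [← enorm_vec R hw hσ hh, ← enorm_vec R hw.inv hτ (hA.maps _ hh),
      ← opCode_vec R hA hw hσ hτ hh]
    exact ContinuousLinearMap.le_opENorm _ _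

theorem pairing_opCode (hA : IsOperator μ tm e w σ τ A) (hw : IsWeight μ w)
    (hσ : Set.InjOn tm σ) (hτ : Set.InjOn tm τ) {f h : Sec K}
    (hf : MemFock μ tm e w τ f) (hh : MemFock μ tm e w σ h) : pairing μ tm τ f (A h) =
      inner ℂ (vec μ tm R.field w τ f) (opCode μ tm R.field w σ τ A (vec μ tm R.field w σ h)) := by
  rw [opCode_vec R hA hw hσ hτ hh, pairing_eq_inner' R hw hτ hf (hA.maps _ hh)]


/-- Elements of the Fock scale are determined by their pairings. -/
theorem eqFock_of_pairing (R : Regular μ tm e) (hw : IsWeight μ w)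
    (hσ : Set.InjOn tm σ) {g g' : Sec K} (hg : MemFock μ tm e w⁻¹ σ g)
    (hg' : MemFock μ tm e w⁻¹ σ g')
    (H : ∀ h, MemFock μ tm e w σ h → pairing μ tm σ g h = pairing μ tm σ g' h) :
    EqFock μ tm σ g g' := by
  rw [← vec_eq_iff R hw.inv hσ hg hg']
  set c := vec μ tm R.field w⁻¹ σ g - vec μ tm R.field w⁻¹ σ g' with hc
  have h1 := H _ (memFock_decode R hw hσ c)
  rw [pairing_eq_inner R hw hσ hg (memFock_decode R hw hσ c),
    pairing_eq_inner R hw hσ hg' (memFock_decode R hw hσ c), inner_vec_decode R hw hw.inv hσ _ hg,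
    inner_vec_decode R hw hw.inv hσ _ hg', ← sub_eq_zero, ← inner_sub_left, ← hc,
    inner_self_eq_zero] at h1
  exact sub_eq_zero.1 h1

theorem pairing_conj (σ : Finset X) (f g : Sec K) :
    starRingEnd ℂ (pairing μ tm σ f g) = pairing μ tm σ g f := by
  rw [pairing, pairing, ← integral_conj]
  simp only [inner_conj_symm]

theorem eqFock_of_pairing' (R : Regular μ tm e) (hw : IsWeight μ w)
    (hσ : Set.InjOn tm σ) {g g' : Sec K} (hg : MemFock μ tm e w⁻¹ σ g)
    (hg' : MemFock μ tm e w⁻¹ σ g')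
    (H : ∀ h, MemFock μ tm e w σ h → pairing μ tm σ h g = pairing μ tm σ h g') :
    EqFock μ tm σ g g' :=
  eqFock_of_pairing R hw hσ hg hg' fun h hh => by
    rw [← pairing_conj σ h g, ← pairing_conj σ h g', H h hh]

theorem opAdjoint_spec (R : Regular μ tm e) (hA : IsOperator μ tm e w σ τ A) (hw : IsWeight μ w)
    (hσ : Set.InjOn tm σ) (hτ : Set.InjOn tm τ) {f : Sec K}
    (hf : MemFock μ tm e w τ f) : MemFock μ tm e w⁻¹ σ (opAdjoint μ tm e w σ τ A f) ∧
      ∀ h, MemFock μ tm e w σ h →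
        pairing μ tm σ (opAdjoint μ tm e w σ τ A f) h = pairing μ tm τ f (A h) := by
  have H : ∃ g, MemFock μ tm e w⁻¹ σ g ∧
      ∀ h, MemFock μ tm e w σ h → pairing μ tm σ g h = pairing μ tm τ f (A h) := by
    let b := ContinuousLinearMap.adjoint (opCode μ tm R.field w σ τ A) (vec μ tm R.field w τ f)
    refine ⟨decode tm R.field w⁻¹ σ b, memFock_decode R hw.inv hσ b, fun h hh => ?_⟩
    rw [pairing_eq_inner R hw hσ (memFock_decode R hw.inv hσ b) hh, ← inner_conj_symm,
      inner_vec_decode R hw.inv hw hσ b hh, inner_conj_symm,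
      ContinuousLinearMap.adjoint_inner_left, pairing_opCode R hA hw hσ hτ hf hh]
  rw [opAdjoint, dif_pos H]
  exact H.choose_spec

theorem vec_opAdjoint (hA : IsOperator μ tm e w σ τ A) (hw : IsWeight μ w)
    (hσ : Set.InjOn tm σ) (hτ : Set.InjOn tm τ) {f : Sec K}
    (hf : MemFock μ tm e w τ f) : vec μ tm R.field w⁻¹ σ (opAdjoint μ tm e w σ τ A f) =
      ContinuousLinearMap.adjoint (opCode μ tm R.field w σ τ A) (vec μ tm R.field w τ f) := by
  obtain ⟨h1, h2⟩ := opAdjoint_spec R hA hw hσ hτ hf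
  refine ext_inner_right ℂ fun c => ?_
  have hm := memFock_decode R hw hσ c
  rw [ContinuousLinearMap.adjoint_inner_left, opCode_apply R hA hw hσ hτ,
    ← pairing_eq_inner' R hw hτ hf (hA.maps _ hm), ← h2 _ hm, pairing_eq_inner R hw hσ h1 hm,
    inner_vec_decode R hw hw.inv hσ c h1]

theorem isOperator_opAdjoint (R : Regular μ tm e) (hA : IsOperator μ tm e w σ τ A)
    (hw : IsWeight μ w) (hσ : Set.InjOn tm σ) (hτ : Set.InjOn tm τ) :
    IsOperator μ tm e w τ σ (opAdjoint μ tm e w σ τ A) where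
  maps f hf := (opAdjoint_spec R hA hw hσ hτ hf).1
  add f h hf hh := by
    have h1 := (opAdjoint_spec R hA hw hσ hτ hf).1
    have h2 := (opAdjoint_spec R hA hw hσ hτ hh).1
    rw [← vec_eq_iff R hw.inv hσ (opAdjoint_spec R hA hw hσ hτ (hf.add R hw hτ hh)).1
      (h1.add R hw.inv hσ h2), vec_add R hw.inv hσ h1 h2, vec_opAdjoint R hA hw hσ hτ hf,
      vec_opAdjoint R hA hw hσ hτ hh, vec_opAdjoint R hA hw hσ hτ (hf.add R hw hτ hh),
      vec_add R hw hτ hf hh, map_add]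
  smul c h hh := by
    have h2 := (opAdjoint_spec R hA hw hσ hτ hh).1
    rw [← vec_eq_iff R hw.inv hσ (opAdjoint_spec R hA hw hσ hτ (hh.smul R hw hτ c)).1
      (h2.smul R hw.inv hσ c), vec_smul R hw.inv hσ c h2,
      vec_opAdjoint R hA hw hσ hτ hh, vec_opAdjoint R hA hw hσ hτ (hh.smul R hw hτ c),
      vec_smul R hw hτ c hh, map_smul]
  bounded := by
    refine (opNorm_le (C := ‖ContinuousLinearMap.adjoint (opCode μ tm R.field w σ τ A)‖ₑ)
      fun h hh => ?_).trans_lt enorm_lt_top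
    rw [← enorm_vec R hw.inv hσ (opAdjoint_spec R hA hw hσ hτ hh).1, ← enorm_vec R hw hτ hh,
      vec_opAdjoint R hA hw hσ hτ hh]
    exact ContinuousLinearMap.le_opENorm _ _

/-- The adjoint in the Fock scale is represented by the adjoint in the Hilbert space. -/
theorem opCode_opAdjoint (hA : IsOperator μ tm e w σ τ A) (hw : IsWeight μ w)
    (hσ : Set.InjOn tm σ) (hτ : Set.InjOn tm τ) :
    opCode μ tm R.field w τ σ (opAdjoint μ tm e w σ τ A) =
      ContinuousLinearMap.adjoint (opCode μ tm R.field w σ τ A) := by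
  ext1 c'
  refine ext_inner_right ℂ fun c => ?_
  have hm' := memFock_decode R hw hτ c'
  have hm := memFock_decode R hw hσ c
  rw [opCode_apply R (isOperator_opAdjoint R hA hw hσ hτ) hw hτ hσ, vec_opAdjoint R hA hw hσ hτ hm',
    ContinuousLinearMap.adjoint_inner_left, ContinuousLinearMap.adjoint_inner_left,
    opCode_apply R hA hw hσ hτ, ← inner_conj_symm, inner_vec_decode R hw hw.inv hτ c'
      (hA.maps _ hm), inner_conj_symm]

theorem opNorm_opAdjoint (R : Regular μ tm e) (hA : IsOperator μ tm e w σ τ A) (hw : IsWeight μ w)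
    (hσ : Set.InjOn tm σ) (hτ : Set.InjOn tm τ) :
    opNorm μ tm e w τ σ (opAdjoint μ tm e w σ τ A) = opNorm μ tm e w σ τ A := by
  rw [← enorm_opCode R hA hw hσ hτ, ← enorm_opCode R (isOperator_opAdjoint R hA hw hσ hτ) hw hτ hσ,
    opCode_opAdjoint R hA hw hσ hτ, ← ofReal_norm, ← ofReal_norm, LinearIsometryEquiv.norm_map]

end OperatorCodes

/-! ### Measurable families of operators -/
section OperatorFields

variable {H : Type*} [NormedAddCommGroup H] [InnerProductSpace ℂ H] [CompleteSpace H]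
  [TopologicalSpace.SeparableSpace H] {Y : Type*} [MeasurableSpace Y] {ν : Measure Y}
  {L : Y → H →L[ℂ] H}

theorem aestronglyMeasurable_adjoint_apply (hL : ∀ c, AEStronglyMeasurable (fun y => L y c) ν)
    (c : H) : AEStronglyMeasurable (fun y => ContinuousLinearMap.adjoint (L y) c) ν := by
  refine aestronglyMeasurable_of_inner fun c' => ?_
  simp only [ContinuousLinearMap.adjoint_inner_right]
  exact ((hL c').inner aestronglyMeasurable_const).aemeasurable

theorem aestronglyMeasurable_clm_apply (hL : ∀ c, AEStronglyMeasurable (fun y => L y c) ν)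
    {G : Y → H} (hG : AEStronglyMeasurable G ν) : AEStronglyMeasurable (fun y => L y (G y)) ν := by
  refine aestronglyMeasurable_of_inner fun c' => ?_
  simp only [← ContinuousLinearMap.adjoint_inner_left]
  exact ((aestronglyMeasurable_adjoint_apply hL c').inner hG).aemeasurable

theorem aestronglyMeasurable_of_denseSeq
    (hL : ∀ n, AEStronglyMeasurable (fun y => L y (TopologicalSpace.denseSeq H n)) ν) (c : H) :
    AEStronglyMeasurable (fun y => L y c) ν := by
  have h := TopologicalSpace.denseRange_denseSeq H c
  obtain ⟨u, hu, hlim⟩ := mem_closure_iff_seq_limit.1 h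
  choose k hk using hu
  refine aestronglyMeasurable_of_tendsto_ae Filter.atTop (fun n => hL (k n))
    (.of_forall fun y => ?_)
  simp only [hk]
  exact ((L y).continuous.tendsto c).comp hlim

theorem enorm_clm_eq_iSup (L : H →L[ℂ] H) : ‖L‖ₑ = ⨆ n, ‖L (TopologicalSpace.denseSeq H n)‖ₑ /
    ‖TopologicalSpace.denseSeq H n‖ₑ := by
  refine le_antisymm ?_ (iSup_le fun n => ENNReal.div_le_of_le_mul (L.le_opENorm _))
  set M := ⨆ n, ‖L (TopologicalSpace.denseSeq H n)‖ₑ / ‖TopologicalSpace.denseSeq H n‖ₑ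
  by_cases hM : M = ∞
  · rw [hM]; exact le_top
  rw [← ENNReal.ofReal_toReal hM, ← ofReal_norm]
  refine ENNReal.ofReal_le_ofReal (ContinuousLinearMap.opNorm_le_bound _ ENNReal.toReal_nonneg
    fun c => ?_)
  refine (TopologicalSpace.denseRange_denseSeq H).induction_on (p := fun c =>
    ‖L c‖ ≤ M.toReal * ‖c‖) c (isClosed_le (by fun_prop) (by fun_prop)) fun n => ?_
  have h1 : ‖L (TopologicalSpace.denseSeq H n)‖ₑ ≤ M * ‖TopologicalSpace.denseSeq H n‖ₑ :=
    (ENNReal.div_le_iff_le_mul (Or.inr hM) (Or.inl enorm_ne_top)).1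
      (le_iSup (fun n => ‖L (TopologicalSpace.denseSeq H n)‖ₑ / ‖TopologicalSpace.denseSeq H n‖ₑ) n)
  have h2 := ENNReal.toReal_mono (ENNReal.mul_ne_top hM enorm_ne_top) h1
  rwa [ENNReal.toReal_mul, toReal_enorm, toReal_enorm] at h2

theorem aemeasurable_enorm_clm (hL : ∀ c, AEStronglyMeasurable (fun y => L y c) ν) :
    AEMeasurable (fun y => ‖L y‖ₑ) ν := by
  simp only [enorm_clm_eq_iSup]
  exact AEMeasurable.iSup fun n => (hL _).enorm.div_const _

end OperatorFields

/-! ### Measurable families of elements of the Fock scale -/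
section Families

variable {Y : Type*} [MeasurableSpace Y] {ν : Measure Y} {Z : Type*} [MeasurableSpace Z] {νZ : Measure Z}

instance [IsSeparable μ] : TopologicalSpace.SeparableSpace (HS μ tm) :=
  have : Fact ((2 : ℝ≥0∞) ≠ ∞) := ⟨by norm_num⟩
  inferInstanceAs (TopologicalSpace.SeparableSpace (Lp SeqSpace 2 𝔪))

theorem ChainLike.comp {ω : Y → Finset X} (h : ChainLike ν tm ω) {f : Z → Y}
    (hf : QuasiMeasurePreserving f νZ ν) : ChainLike νZ tm fun z => ω (f z) := by
  obtain ⟨χ, hχ, h⟩ := h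
  exact ⟨fun z => χ (f z), hχ.comp hf.measurable, hf.ae h⟩

theorem ChainLike.congr {ω ω' : Y → Finset X} (h : ChainLike ν tm ω) (h' : ∀ᵐ y ∂ν, ω y = ω' y) :
    ChainLike ν tm ω' := by
  obtain ⟨χ, hχ, h⟩ := h
  refine ⟨χ, hχ, ?_⟩
  filter_upwards [h, h'] with y h1 h2
  rw [← h2, h1]

theorem chainLike_const (σ : Finset X) (hσ : Set.InjOn tm σ) : ChainLike ν tm fun _ => σ :=
  ⟨fun _ => chainOf tm σ, measurable_const, .of_forall fun _ => (pts_chainOf hσ).symm⟩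

theorem ChainLike.ae_apart [SFinite ν] (ht : IsTime μ tm) {ω : Y → Finset X} (h : ChainLike ν tm ω) :
    ∀ᵐ z ∂ν.prod 𝔪, Apart tm (pts z.2) (ω z.1) := by
  obtain ⟨χ, hχ, h⟩ := h
  have h1 : ∀ᵐ z ∂ν.prod 𝔪, Apart tm (pts z.2) (pts (χ z.1)) := by
    have hms : MeasurableSet {z : Y × ℭ | Apart tm (pts z.2) (pts (χ z.1))} :=
      (measurable_snd.prodMk (hχ.comp measurable_fst)) (measurableSet_apart ht.measurable)
    rw [Measure.ae_prod_iff_ae_ae hms]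
    refine .of_forall fun y => ?_
    filter_upwards [ae_apart_const μ ht (pts (χ y))] with ϰ h
    exact h
  filter_upwards [h1, quasiMeasurePreserving_fst.ae h] with z h1 h2
  rwa [h2]

theorem ChainLike.union_prod [SFinite ν] (ht : IsTime μ tm) {ω : Y → Finset X} (h : ChainLike ν tm ω) :
    ChainLike (ν.prod 𝔪) tm fun z => pts z.2 ∪ ω z.1 := by
  have ha := h.ae_apart (μ := μ) ht
  obtain ⟨χ, hχ, h⟩ := h
  refine ⟨fun z => merge (z.2, χ z.1), (measurable_merge ht.measurable).comp
    (measurable_snd.prodMk (hχ.comp measurable_fst)), ?_⟩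
  filter_upwards [ha, quasiMeasurePreserving_fst.ae h] with z h1 h2
  rw [h2] at h1
  rw [pts_merge h1, h2]

variable (μ tm e) in
/-- Essential measurability of the values `Φ y (pts ϰ ∪ ω y)` jointly in `y` and `ϰ`. -/
def JointlyMeasurable (ν : Measure Y) (ω : Y → Finset X) (Φ : Y → Sec K) : Prop :=
  IsEssMeasurable e (ν.prod 𝔪) (fun z => pts z.2 ∪ ω z.1) fun z => Φ z.1 (pts z.2 ∪ ω z.1)

variable (R : Regular μ tm e) {ω : Y → Finset X}

theorem jointlyMeasurable_iff [SFinite ν] (R : Regular μ tm e) (hω : ChainLike ν tm ω)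
    {Φ : Y → Sec K} : JointlyMeasurable μ tm e ν ω Φ ↔ AEStronglyMeasurable
      (fun z : Y × ℭ => ef tm R.field (Φ z.1) (pts z.2 ∪ ω z.1)) (ν.prod 𝔪) :=
  isEssMeasurable_iff R.field R.time.measurable (hω.union_prod R.time)

/-- Jointly measurable families have measurable representing vectors. -/
theorem JointlyMeasurable.aestronglyMeasurable_vec [SFinite ν] [IsSeparable μ]
    (R : Regular μ tm e) (hw : IsWeight μ w) (hω : ChainLike ν tm ω) {Φ : Y → Sec K}
    (h : JointlyMeasurable μ tm e ν ω Φ) (hm : ∀ᵐ y ∂ν, MemFock μ tm e w (ω y) (Φ y)) :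
    AEStronglyMeasurable (fun y => vec μ tm R.field w (ω y) (Φ y)) ν := by
  refine aestronglyMeasurable_sections
    (F := fun z => rt w (pts z.2) • ef tm R.field (Φ z.1) (pts z.2 ∪ ω z.1)) ?_ ?_
  · exact ((aemeasurable_rt R.time.measurable hw.aemeasurable).aestronglyMeasurable.comp_snd).smul
      ((jointlyMeasurable_iff R hω).1 h)
  · filter_upwards [hm, hω.injOn] with y h1 h2
    exact coeFn_vec R hw h2 h1

/-- Conversely, measurable vectors represent jointly measurable families. -/
theorem exists_jointlyMeasurable_decode [SFinite ν] [IsSeparable μ]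
    (hw : IsWeight μ w) (hω : ChainLike ν tm ω) {G : Y → HS μ tm}
    (hG : AEStronglyMeasurable G ν) : ∃ Φ : Y → Sec K, JointlyMeasurable μ tm e ν ω Φ ∧
      ∀ᵐ y ∂ν, EqFock μ tm (ω y) (Φ y) (decode tm R.field w (ω y) (G y)) := by
  obtain ⟨F, hF, hFG⟩ := exists_jointly_measurable_version hG
  refine ⟨fun y => decode tm R.field w (ω y) fun ϰ => F (y, ϰ), ?_, ?_⟩
  · rw [jointlyMeasurable_iff R hω]
    have h1 : AEStronglyMeasurable (fun z : Y × ℭ => (rt w (pts z.2))⁻¹ • F z) (ν.prod 𝔪) :=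
      ((aemeasurable_rt R.time.measurable hw.aemeasurable).inv.aestronglyMeasurable.comp_snd).smul
        hF.aestronglyMeasurable
    refine (aestronglyMeasurable_enc_dec (K := K) R.field R.time.measurable
      (hω.union_prod R.time) h1).congr ?_
    filter_upwards [hω.ae_apart (μ := μ) R.time] with z hz
    rw [ef, decode_apply _ _ _ hz]
  · filter_upwards [hFG] with y hy
    filter_upwards [hy, ae_apart_const μ R.time (ω y)] with ϰ h1 h2
    rw [decode_apply _ _ _ h2, decode_apply _ _ _ h2, h1]

theorem jointlyMeasurable_decode_const [SFinite ν] (hw : IsWeight μ w)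
    (hω : ChainLike ν tm ω) (c : HS μ tm) : JointlyMeasurable μ tm e ν ω fun y =>
      (decode tm R.field w (ω y) c : Sec K) := by
  rw [jointlyMeasurable_iff R hω]
  have h1 : AEStronglyMeasurable (fun z : Y × ℭ => (rt w (pts z.2))⁻¹ • c z.2) (ν.prod 𝔪) :=
    ((aemeasurable_rt R.time.measurable hw.aemeasurable).inv.aestronglyMeasurable.smul
      (Lp.aestronglyMeasurable c)).comp_snd
  refine (aestronglyMeasurable_enc_dec (K := K) R.field R.time.measurable
    (hω.union_prod R.time) h1).congr ?_
  filter_upwards [hω.ae_apart (μ := μ) R.time] with z hz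
  rw [ef, decode_apply _ _ _ hz]

theorem jointlyMeasurable_congr {Φ Φ' : Y → Sec K} (h : JointlyMeasurable μ tm e ν ω Φ)
    {ω' : Y → Finset X} (H : ∀ y, ω y = ω' y) (H' : ∀ y, Φ y = Φ' y) :
    JointlyMeasurable μ tm e ν ω' Φ' := by
  obtain rfl : ω = ω' := funext H
  obtain rfl : Φ = Φ' := funext H'
  exact h

/-- Reading a measurable family along additional, independently distributed chains. -/
theorem JointlyMeasurable.union [SFinite ν] [SFinite νZ] (R : Regular μ tm e)
    (hω : ChainLike ν tm ω) {Φ : Y → Sec K} (h : JointlyMeasurable μ tm e ν ω Φ)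
    {χ : Z → ℭ} (hχ : QuasiMeasurePreserving χ νZ 𝔪)
    {ρ : Z → Finset X} (hρ : ∀ᵐ z ∂νZ, ρ z = pts (χ z)) :
    ChainLike (ν.prod νZ) tm (fun y : Y × Z => ρ y.2 ∪ ω y.1) ∧
    JointlyMeasurable μ tm e (ν.prod νZ) (fun y => ρ y.2 ∪ ω y.1) fun y => Φ y.1 := by
  have hq1 : QuasiMeasurePreserving (Prod.map id χ) (ν.prod νZ)
      (ν.prod 𝔪) := quasiMeasurePreserving_prodMap (.id ν) hχ
  have hcl : ChainLike (ν.prod νZ) tm (fun y : Y × Z => ρ y.2 ∪ ω y.1) := by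
    refine ((hω.union_prod (μ := μ) R.time).comp hq1).congr ?_
    filter_upwards [quasiMeasurePreserving_snd.ae hρ] with y hy
    simp [hy]
  refine ⟨hcl, ?_⟩
  rw [jointlyMeasurable_iff R hcl]
  rw [jointlyMeasurable_iff R hω] at h
  have hq2 : QuasiMeasurePreserving (fun z : Z × ℭ => merge (z.2, χ z.1))
      (νZ.prod 𝔪) 𝔪 :=
    (quasiMeasurePreserving_merge μ R.time).comp
      ((Measure.measurePreserving_swap.quasiMeasurePreserving).comp
        (quasiMeasurePreserving_prodMap hχ (.id _)))
  have hq : QuasiMeasurePreserving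
      (Prod.map id (fun z : Z × ℭ => merge (z.2, χ z.1)) ∘ MeasurableEquiv.prodAssoc)
      ((ν.prod νZ).prod 𝔪) (ν.prod 𝔪) :=
    (quasiMeasurePreserving_prodMap (.id ν) hq2).comp
      (measurePreserving_prodAssoc ν νZ 𝔪).quasiMeasurePreserving
  refine (h.comp_quasiMeasurePreserving hq).congr ?_
  have hap : ∀ᵐ z ∂(ν.prod νZ).prod 𝔪, Apart tm (pts z.2) (pts (χ z.1.2)) := by
    have h1 := (quasiMeasurePreserving_prodMap hχ (.id 𝔪)).ae (ae_apart μ R.time)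
    exact (quasiMeasurePreserving_prodMap (quasiMeasurePreserving_snd (μ := ν) (ν := νZ))
      (.id 𝔪)).ae (h1.mono fun z h => h.symm)
  have hρ' : ∀ᵐ z ∂(ν.prod νZ).prod 𝔪, ρ z.1.2 = pts (χ z.1.2) :=
    quasiMeasurePreserving_fst.ae (quasiMeasurePreserving_snd.ae hρ)
  filter_upwards [hap, hρ'] with z h1 h2
  simp only [Function.comp_apply, MeasurableEquiv.prodAssoc, MeasurableEquiv.coe_mk,
    Equiv.prodAssoc_apply, Prod.map_apply, id_eq]
  rw [pts_merge h1, h2, Finset.union_assoc]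

theorem jointlyMeasurable_union_const [SFinite νZ] (R : Regular μ tm e) (hσ : Set.InjOn tm σ)
    (hh : IsEssMeasurable e 𝔪 (fun ϰ => pts ϰ ∪ σ) (fun ϰ => h (pts ϰ ∪ σ)))
    {χ : Z → ℭ} (hχ : QuasiMeasurePreserving χ νZ 𝔪)
    {ρ : Z → Finset X} (hρ : ∀ᵐ z ∂νZ, ρ z = pts (χ z)) : ChainLike νZ tm (fun z => ρ z ∪ σ) ∧
    JointlyMeasurable μ tm e νZ (fun z => ρ z ∪ σ) fun _ => h := by
  have hcl : ChainLike νZ tm (fun z => ρ z ∪ σ) := by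
    refine ((chainLike_union_const R.time hσ).comp hχ).congr ?_
    filter_upwards [hρ] with y hy
    simp [hy]
  refine ⟨hcl, ?_⟩
  rw [jointlyMeasurable_iff R hcl]
  rw [isEssMeasurable_iff R.field R.time.measurable (chainLike_union_const R.time hσ)] at hh
  have hq2 : QuasiMeasurePreserving (fun z : Z × ℭ => merge (z.2, χ z.1))
      (νZ.prod 𝔪) 𝔪 :=
    (quasiMeasurePreserving_merge μ R.time).comp
      ((Measure.measurePreserving_swap.quasiMeasurePreserving).comp
        (quasiMeasurePreserving_prodMap hχ (.id _)))
  refine (hh.comp_quasiMeasurePreserving hq2).congr ?_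
  have h1 := (quasiMeasurePreserving_prodMap hχ (.id 𝔪)).ae (ae_apart μ R.time)
  filter_upwards [h1, quasiMeasurePreserving_fst.ae hρ] with z h1 h2
  replace h1 : Apart tm (pts (χ z.1)) (pts z.2) := h1
  simp only [Function.comp_apply, ef]
  rw [pts_merge h1.symm, h2, Finset.union_assoc]

/-! ### Measurable fields of operators -/

variable (μ tm) in
/-- A measurable field of operators `A y : F(w) ⊗ K^⊗(σ y) → F(w⁻¹) ⊗ K^⊗(τ y)`: the representing
operators are strongly measurable. -/
structure IsOpField (he : IsFundamental e) (ν : Measure Y) (w : X → ℝ≥0) (σ τ : Y → Finset X)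
    (A : Y → Sec K → Sec K) : Prop where
  left : ChainLike ν tm σ
  right : ChainLike ν tm τ
  isOperator : ∀ᵐ y ∂ν, IsOperator μ tm e w (σ y) (τ y) (A y)
  measurable : ∀ c, AEStronglyMeasurable (fun y => opCode μ tm he w (σ y) (τ y) (A y) c) ν

variable {he : IsFundamental e} {σ τ : Y → Finset X} {A : Y → Sec K → Sec K}

theorem IsOpField.comp (h : IsOpField μ tm he ν w σ τ A) {f : Z → Y}
    (hf : QuasiMeasurePreserving f νZ ν) :
    IsOpField μ tm he νZ w (fun z => σ (f z)) (fun z => τ (f z)) fun z => A (f z) where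
  left := h.left.comp hf
  right := h.right.comp hf
  isOperator := hf.ae h.isOperator
  measurable c := (h.measurable c).comp_quasiMeasurePreserving hf

theorem IsOpField.mono (h : IsOpField μ tm he ν w σ τ A) {ν' : Measure Y} (hν : ν' ≪ ν) :
    IsOpField μ tm he ν' w σ τ A :=
  h.comp (f := id) ⟨measurable_id, by rwa [Measure.map_id]⟩

theorem IsOpField.congr {σ' τ' : Y → Finset X} {A' : Y → Sec K → Sec K}
    (h : IsOpField μ tm he ν w σ τ A) (hσ : ∀ᵐ y ∂ν, σ y = σ' y) (hτ : ∀ᵐ y ∂ν, τ y = τ' y)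
    (hA : ∀ᵐ y ∂ν, A y = A' y) : IsOpField μ tm he ν w σ' τ' A' where
  left := h.left.congr hσ
  right := h.right.congr hτ
  isOperator := by
    filter_upwards [h.isOperator, hσ, hτ, hA] with y h1 h2 h3 h4
    rwa [← h2, ← h3, ← h4]
  measurable c := (h.measurable c).congr (by
    filter_upwards [hσ, hτ, hA] with y h2 h3 h4
    rw [h2, h3, h4])

theorem IsOpField.aemeasurable_opNorm [IsSeparable μ] (R : Regular μ tm e)
    (h : IsOpField μ tm R.field ν w σ τ A) (hw : IsWeight μ w) :
    AEMeasurable (fun y => opNorm μ tm e w (σ y) (τ y) (A y)) ν := by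
  refine (aemeasurable_enorm_clm h.measurable).congr ?_
  filter_upwards [h.isOperator, h.left.injOn, h.right.injOn] with y h1 h2 h3
  exact enorm_opCode R h1 hw h2 h3

/-- Almost all sections of a measurable field of operators on a product are measurable. -/
theorem IsOpField.ae_section [IsSeparable μ] [SFinite νZ] {σ τ : Y × Z → Finset X}
    {A : Y × Z → Sec K → Sec K} (h : IsOpField μ tm he (ν.prod νZ) w σ τ A) :
    ∀ᵐ y ∂ν, IsOpField μ tm he νZ w (fun z => σ (y, z)) (fun z => τ (y, z)) fun z => A (y, z) := by
  have hcl : ∀ {ρ : Y × Z → Finset X}, ChainLike (ν.prod νZ) tm ρ →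
      ∀ᵐ y ∂ν, ChainLike νZ tm fun z => ρ (y, z) := by
    rintro ρ ⟨χ, hχ, h⟩
    filter_upwards [ae_ae_of_ae_prod h] with y hy
    exact ⟨fun z => χ (y, z), hχ.comp measurable_prodMk_left, hy⟩
  have hm : ∀ᵐ y ∂ν, ∀ n, AEStronglyMeasurable (fun z => opCode μ tm he w (σ (y, z)) (τ (y, z))
      (A (y, z)) (TopologicalSpace.denseSeq (HS μ tm) n)) νZ :=
    ae_all_iff.2 fun n => (h.measurable _).prodMk_left
  filter_upwards [hcl h.left, hcl h.right, ae_ae_of_ae_prod h.isOperator, hm]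
    with y h1 h2 h3 h4
  exact ⟨h1, h2, h3, fun c => aestronglyMeasurable_of_denseSeq h4 c⟩

/-- The images of a measurable family under a measurable field of operators have a jointly
measurable version. -/
theorem IsOpField.exists_version [SFinite ν] [IsSeparable μ] (R : Regular μ tm e)
    (h : IsOpField μ tm R.field ν w σ τ A) (hw : IsWeight μ w) {H : Y → Sec K}
    (hH : JointlyMeasurable μ tm e ν σ H) (hm : ∀ᵐ y ∂ν, MemFock μ tm e w (σ y) (H y)) :
    ∃ Φ : Y → Sec K, JointlyMeasurable μ tm e ν τ Φ ∧
      ∀ᵐ y ∂ν, EqFock μ tm (τ y) (Φ y) (A y (H y)) := by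
  have h1 := aestronglyMeasurable_clm_apply h.measurable
    (hH.aestronglyMeasurable_vec R hw h.left hm)
  obtain ⟨Φ, hΦ, hΦ'⟩ := exists_jointlyMeasurable_decode R hw.inv h.right h1
  refine ⟨Φ, hΦ, ?_⟩
  filter_upwards [hΦ', h.isOperator, h.left.injOn, h.right.injOn, hm] with y h1 h2 h3 h4 h5
  rw [opCode_vec R h2 hw h3 h4 h5] at h1
  exact h1.trans (decode_vec R hw.inv h4 (h2.maps _ h5))

/-- A field is measurable if it sends jointly measurable families to families with jointly
measurable versions: it can be tested on the families with constant representing vector. -/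
theorem isOpField_of_versions [SFinite ν] [IsSeparable μ] (R : Regular μ tm e)
    (hw : IsWeight μ w) (hσ : ChainLike ν tm σ) (hτ : ChainLike ν tm τ)
    (hA : ∀ᵐ y ∂ν, IsOperator μ tm e w (σ y) (τ y) (A y))
    (h : ∀ H : Y → Sec K, JointlyMeasurable μ tm e ν σ H →
      (∀ᵐ y ∂ν, MemFock μ tm e w (σ y) (H y)) → ∃ Φ : Y → Sec K, JointlyMeasurable μ tm e ν τ Φ ∧
        ∀ᵐ y ∂ν, EqFock μ tm (τ y) (Φ y) (A y (H y))) : IsOpField μ tm R.field ν w σ τ A := by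
  refine ⟨hσ, hτ, hA, fun c => ?_⟩
  have hm : ∀ᵐ y ∂ν, MemFock μ tm e w (σ y) (decode tm R.field w (σ y) c : Sec K) := by
    filter_upwards [hσ.injOn] with y hy using memFock_decode R hw hy c
  obtain ⟨Φ, hΦ, hΦ'⟩ := h _ (jointlyMeasurable_decode_const R hw hσ c) hm
  have hmΦ : ∀ᵐ y ∂ν, MemFock μ tm e w⁻¹ (τ y) (Φ y) := by
    filter_upwards [hΦ', hm, hA] with y h1 h2 h3
    exact h1.symm.memFock (h3.maps _ h2)
  refine (hΦ.aestronglyMeasurable_vec R hw.inv hτ hmΦ).congr ?_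
  filter_upwards [hΦ', hm, hA, hmΦ, hσ.injOn, hτ.injOn] with y h1 h2 h3 h4 h5 h6
  rw [opCode_apply R h3 hw h5 h6, vec_eq_iff R hw.inv h6 h4 (h3.maps _ h2)]
  exact h1

theorem IsOpField.adjoint [IsSeparable μ] (R : Regular μ tm e)
    (h : IsOpField μ tm R.field ν w σ τ A) (hw : IsWeight μ w) :
    IsOpField μ tm R.field ν w τ σ fun y => opAdjoint μ tm e w (σ y) (τ y) (A y) := by
  refine ⟨h.right, h.left, ?_, fun c => ?_⟩
  · filter_upwards [h.isOperator, h.left.injOn, h.right.injOn] with y h1 h2 h3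
    exact isOperator_opAdjoint R h1 hw h2 h3
  · refine (aestronglyMeasurable_adjoint_apply h.measurable c).congr ?_
    filter_upwards [h.isOperator, h.left.injOn, h.right.injOn] with y h1 h2 h3
    rw [opCode_opAdjoint R h1 hw h2 h3]

end Families

/-! ### Tables of chains -/
section Tables

instance (m : Measure ℭ) [SigmaFinite m] : SigmaFinite (tableMeasure tm m) :=
  inferInstanceAs (SigmaFinite (m.prod (m.prod (m.prod m))))

theorem ofChains_injective : Function.Injective (ofChains : 𝕋 → Table X) := by
  rintro ⟨a, b, c, d⟩ ⟨a', b', c', d'⟩ h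
  simp only [ofChains, Table.mk.injEq] at h
  rw [pts_injective h.1, pts_injective h.2.1, pts_injective h.2.2.1, pts_injective h.2.2.2]

/-- The chain `ϑ_∘^- ⊔ ϑ_∘^∘` of a table. -/
def inpChain (z : 𝕋) : ℭ := merge (z.2.1, z.2.2.2)

/-- The chain `ϑ_+^∘ ⊔ ϑ_∘^∘` of a table. -/
def outChain (z : 𝕋) : ℭ := merge (z.2.2.1, z.2.2.2)

theorem quasiMeasurePreserving_inpPair (m : Measure ℭ) [SigmaFinite m] :
    QuasiMeasurePreserving (fun z : 𝕋 => (z.2.1, z.2.2.2)) (tableMeasure tm m) (m.prod m) :=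
  (quasiMeasurePreserving_prodMap (.id m) (quasiMeasurePreserving_snd (μ := m) (ν := m))).comp
    (quasiMeasurePreserving_snd (μ := m) (ν := m.prod (m.prod m)))

theorem quasiMeasurePreserving_outPair (m : Measure ℭ) [SigmaFinite m] :
    QuasiMeasurePreserving (fun z : 𝕋 => (z.2.2.1, z.2.2.2))
      (tableMeasure tm m) (m.prod m) :=
  (quasiMeasurePreserving_snd (μ := m) (ν := m.prod m)).comp
    (quasiMeasurePreserving_snd (μ := m) (ν := m.prod (m.prod m)))

theorem quasiMeasurePreserving_inpChain (ht : IsTime μ tm) : QuasiMeasurePreserving (inpChain (tm := tm))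
      𝔱 𝔪 :=
  (quasiMeasurePreserving_merge μ ht).comp (quasiMeasurePreserving_inpPair _)

theorem quasiMeasurePreserving_outChain (ht : IsTime μ tm) : QuasiMeasurePreserving (outChain (tm := tm))
      𝔱 𝔪 :=
  (quasiMeasurePreserving_merge μ ht).comp (quasiMeasurePreserving_outPair _)

theorem ae_inp_eq (ht : IsTime μ tm) : ∀ᵐ z ∂𝔱, (ofChains z).inp = pts (inpChain z) := by
  filter_upwards [(quasiMeasurePreserving_inpPair _).ae (ae_apart μ ht)] with z hz
  exact (pts_merge (z := (z.2.1, z.2.2.2)) hz).symm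

theorem ae_out_eq (ht : IsTime μ tm) : ∀ᵐ z ∂𝔱, (ofChains z).out = pts (outChain z) := by
  filter_upwards [(quasiMeasurePreserving_outPair _).ae (ae_apart μ ht)] with z hz
  exact (pts_merge (z := (z.2.2.1, z.2.2.2)) hz).symm

theorem chainLike_inp (ht : IsTime μ tm) : ChainLike 𝔱 tm fun z => (ofChains z).inp :=
  ⟨inpChain, (quasiMeasurePreserving_inpChain ht).measurable, ae_inp_eq ht⟩

theorem chainLike_out (ht : IsTime μ tm) : ChainLike 𝔱 tm fun z => (ofChains z).out :=
  ⟨outChain, (quasiMeasurePreserving_outChain ht).measurable, ae_out_eq ht⟩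

/-- A family indexed by quadruples of chains, as a family indexed by tables. -/
theorem exists_table_extension (Φ : 𝕋 → Sec K) :
    ∃ Φ' : Table X → Sec K, ∀ z, Φ' (ofChains z) = Φ z :=
  ⟨Function.extend ofChains Φ 0, fun z => ofChains_injective.extend_apply Φ 0 z⟩

theorem isJointlyMeasurable_iff (m : Measure ℭ) (ρ : Table X → Finset X)
    (Φ : Table X → Sec K) : IsJointlyMeasurable μ tm e m ρ Φ ↔ JointlyMeasurable μ tm e
      (tableMeasure tm m) (fun z => ρ (ofChains z)) fun z => Φ (ofChains z) :=
  Iff.rfl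

/-- The measurable kernels are the measurable fields of operators over the tables. -/
theorem isMeasurableKernel_iff [IsSeparable μ] (R : Regular μ tm e)
    (hw : IsWeight μ w) (B : Kernel K) : IsMeasurableKernel μ tm e w B ↔ IsOpField μ tm R.field 𝔱 w
        (fun z => (ofChains z).inp) (fun z => (ofChains z).out) fun z => B (ofChains z) := by
  refine ⟨fun h => ?_, fun h => ⟨h.isOperator, fun H hH hm => ?_⟩⟩
  · refine isOpField_of_versions R hw (chainLike_inp R.time)
      (chainLike_out R.time) h.isOperator fun H hH hm => ?_
    obtain ⟨H', hH'⟩ := exists_table_extension (K := K) H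
    have h1 : IsJointlyMeasurable μ tm e 𝔪 Table.inp H' := by
      rw [isJointlyMeasurable_iff]
      exact jointlyMeasurable_congr hH (fun _ => rfl) fun z => (hH' z).symm
    obtain ⟨Φ, hΦ, hΦ'⟩ := h.measurable H' h1 (by simpa only [hH'] using hm)
    rw [isJointlyMeasurable_iff] at hΦ
    refine ⟨fun z => Φ (ofChains z), hΦ, ?_⟩
    simpa only [hH'] using hΦ'
  · rw [isJointlyMeasurable_iff] at hH
    obtain ⟨Φ, hΦ, hΦ'⟩ := h.exists_version R hw hH hm
    obtain ⟨Φ', hE⟩ := exists_table_extension (K := K) Φ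
    refine ⟨Φ', ?_, by simpa only [hE] using hΦ'⟩
    rw [isJointlyMeasurable_iff]
    exact jointlyMeasurable_congr hΦ (fun _ => rfl) fun z => (hE z).symm

end Tables

/-! ### Integral inequalities -/
section Inequalities

variable {Ω : Type*} [MeasurableSpace Ω] {m : Measure Ω}

theorem sqrt_mul_sqrt_self (a : ℝ≥0∞) : a ^ (1 / 2 : ℝ) * a ^ (1 / 2 : ℝ) = a := by
  rw [← ENNReal.rpow_add_of_nonneg _ _ (by norm_num) (by norm_num)]
  norm_num

theorem sqrt_sq (a : ℝ≥0∞) : (a ^ (1 / 2 : ℝ)) ^ 2 = a := by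
  rw [sq, sqrt_mul_sqrt_self]

theorem sq_sqrt (a : ℝ≥0∞) : (a ^ 2) ^ (1 / 2 : ℝ) = a := by
  rw [← ENNReal.rpow_natCast, ← ENNReal.rpow_mul]; norm_num

theorem sqrt_mul (a b : ℝ≥0∞) : (a * b) ^ (1 / 2 : ℝ) = a ^ (1 / 2 : ℝ) * b ^ (1 / 2 : ℝ) :=
  ENNReal.mul_rpow_of_nonneg _ _ (by norm_num)

theorem sqrt_le_sqrt {a b : ℝ≥0∞} (h : a ≤ b) : a ^ (1 / 2 : ℝ) ≤ b ^ (1 / 2 : ℝ) :=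
  ENNReal.rpow_le_rpow h (by norm_num)

theorem sqrt_ne_top {a : ℝ≥0∞} (h : a ≠ ∞) : a ^ (1 / 2 : ℝ) ≠ ∞ :=
  ENNReal.rpow_ne_top_of_nonneg (by norm_num) h

theorem lintegral_mul_le_sqrt {f g : Ω → ℝ≥0∞} (hf : AEMeasurable f m) (hg : AEMeasurable g m) :
    ∫⁻ x, f x * g x ∂m ≤ (∫⁻ x, f x ^ 2 ∂m) ^ (1 / 2 : ℝ) * (∫⁻ x, g x ^ 2 ∂m) ^ (1 / 2 : ℝ) := by
  have h := ENNReal.lintegral_mul_le_Lp_mul_Lq m (p := 2) (q := 2)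
    (Real.holderConjugate_iff.2 ⟨by norm_num, by norm_num⟩) hf hg
  simpa using h

/-- The Cauchy-Schwarz inequality, in which only one of the factors need be measurable. -/
theorem lintegral_sqrt_mul_le (f : Ω → ℝ≥0∞) {g : Ω → ℝ≥0∞} (hg : AEMeasurable g m)
    (hfin : ∫⁻ x, g x ∂m ≠ ∞) : ∫⁻ x, f x ^ (1 / 2 : ℝ) * g x ^ (1 / 2 : ℝ) ∂m ≤
      (∫⁻ x, f x ∂m) ^ (1 / 2 : ℝ) * (∫⁻ x, g x ∂m) ^ (1 / 2 : ℝ) := by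
  obtain ⟨k, hk, hkf, hint⟩ :=
    exists_measurable_le_lintegral_eq m fun x => f x ^ (1 / 2 : ℝ) * g x ^ (1 / 2 : ℝ)
  have hk2 : ∀ x, k x ^ 2 ≤ f x * g x := fun x => by
    calc k x ^ 2 ≤ (f x ^ (1 / 2 : ℝ) * g x ^ (1 / 2 : ℝ)) ^ 2 := by gcongr; exact hkf x
      _ = f x * g x := by rw [mul_pow, sqrt_sq, sqrt_sq]
  have hF : AEMeasurable (fun x => k x ^ 2 / g x) m := (hk.pow_const 2).aemeasurable.div hg
  have hFf : ∀ x, k x ^ 2 / g x ≤ f x := fun x => ENNReal.div_le_of_le_mul (hk2 x)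
  rw [hint]
  calc ∫⁻ x, k x ∂m ≤ ∫⁻ x, (k x ^ 2 / g x) ^ (1 / 2 : ℝ) * g x ^ (1 / 2 : ℝ) ∂m := by
        refine lintegral_mono_ae ?_
        filter_upwards [ae_lt_top' hg hfin] with x hx
        by_cases h0 : g x = 0
        · have := hk2 x
          rw [h0, mul_zero, nonpos_iff_eq_zero] at this
          rw [pow_eq_zero_iff two_ne_zero] at this
          rw [this]; exact zero_le
        · rw [← sqrt_mul, ENNReal.div_mul_cancel h0 hx.ne, sq_sqrt]
    _ ≤ _ := lintegral_mul_le_sqrt (hF.pow_const _) (hg.pow_const _)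
    _ ≤ _ := by
        simp only [sqrt_sq]
        gcongr with x
        exact hFf x

/-- A function that is bounded as a functional on a weighted `L²` is square integrable. -/
theorem lintegral_sq_div_le_of_dual [SigmaFinite m] {G : Ω → ℝ≥0∞} (hG : AEMeasurable G m)
    {w : Ω → ℝ≥0} (hw : AEMeasurable w m) (hw0 : ∀ x, 0 < w x) {C : ℝ≥0∞}
    (h : ∀ f : Ω → ℝ≥0∞, AEMeasurable f m → ∫⁻ x, f x ^ 2 * w x ∂m ≠ ∞ →
      ∫⁻ x, G x * f x ∂m ≤ C * (∫⁻ x, f x ^ 2 * w x ∂m) ^ (1 / 2 : ℝ)) :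
    ∫⁻ x, G x ^ 2 * (w x : ℝ≥0∞)⁻¹ ∂m ≤ C ^ 2 := by
  classical
  -- on `S n` the truncation of `G` at `n` is square integrable
  let S : ℕ → Set Ω := fun n => spanningSets m n ∩ {x | (hw.mk w x)⁻¹ ≤ n}
  have hS : ∀ n, MeasurableSet (S n) := fun n => (measurableSet_spanningSets m n).inter
    (measurableSet_le hw.measurable_mk.inv measurable_const)
  let g : ℕ → Ω → ℝ≥0∞ := fun n => (S n).indicator fun x => min (hG.mk G x) n
  have hg : ∀ n, Measurable (g n) := fun n =>
    (hG.measurable_mk.min measurable_const).indicator (hS n)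
  have hwne : ∀ x, (w x : ℝ≥0∞) ≠ 0 := fun x => by exact_mod_cast (hw0 x).ne'
  have hinv : AEMeasurable (fun x => (w x : ℝ≥0∞)⁻¹) m := hw.coe_nnreal_ennreal.inv
  have hsq : ∀ n x, (g n x * (w x : ℝ≥0∞)⁻¹) ^ 2 * w x = g n x ^ 2 * (w x : ℝ≥0∞)⁻¹ := fun n x => by
    rw [mul_pow, mul_assoc, sq (w x : ℝ≥0∞)⁻¹, mul_assoc,
      ENNReal.inv_mul_cancel (hwne x) ENNReal.coe_ne_top, mul_one]
  have hfin : ∀ n, ∫⁻ x, g n x ^ 2 * (w x : ℝ≥0∞)⁻¹ ∂m ≠ ∞ := fun n => by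
    have h1 : ∫⁻ x, g n x ^ 2 * (w x : ℝ≥0∞)⁻¹ ∂m ≤
        ∫⁻ x, (S n).indicator (fun _ => (n : ℝ≥0∞) ^ 2 * n) x ∂m := by
      refine lintegral_mono_ae ?_
      filter_upwards [hw.ae_eq_mk] with x hx
      simp only [g, Set.indicator_apply]
      split_ifs with hxS
      · have h2 : (w x)⁻¹ ≤ n := by rw [hx]; exact hxS.2
        gcongr
        · exact min_le_right _ _
        · rw [← ENNReal.coe_inv (hw0 x).ne']
          exact_mod_cast h2
      · simp
    refine (h1.trans_lt ?_).ne
    rw [lintegral_indicator_const (hS n)]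
    exact ENNReal.mul_lt_top (by finiteness)
      ((measure_mono Set.inter_subset_left).trans_lt (measure_spanningSets_lt_top m n))
  have hbound : ∀ n, ∫⁻ x, g n x ^ 2 * (w x : ℝ≥0∞)⁻¹ ∂m ≤ C ^ 2 := fun n => by
    -- the functional is tested on the truncation of the extremal function `G / w`
    have h1 := h (fun x => g n x * (w x : ℝ≥0∞)⁻¹) ((hg n).aemeasurable.mul hinv)
      (by simp only [hsq]; exact hfin n)
    simp only [hsq] at h1
    have h2 : ∫⁻ x, g n x ^ 2 * (w x : ℝ≥0∞)⁻¹ ∂m ≤ ∫⁻ x, G x * (g n x * (w x : ℝ≥0∞)⁻¹) ∂m := by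
      refine lintegral_mono_ae ?_
      filter_upwards [hG.ae_eq_mk] with x hx
      rw [sq, mul_assoc]
      gcongr
      simp only [g, Set.indicator_apply]
      split_ifs
      · rw [hx]; exact min_le_left _ _
      · exact zero_le
    set I := ∫⁻ x, g n x ^ 2 * (w x : ℝ≥0∞)⁻¹ ∂m with hI
    have h3 := h2.trans h1
    by_cases h0 : I = 0
    · rw [h0]; exact zero_le
    have h4 : I ^ (1 / 2 : ℝ) ≤ C := by
      have h5 : I ^ (1 / 2 : ℝ) ≠ 0 := by
        rw [Ne, ENNReal.rpow_eq_zero_iff]; simp [h0]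
      rw [← ENNReal.mul_le_mul_iff_left h5 (sqrt_ne_top (hfin n)), sqrt_mul_sqrt_self]
      exact h3
    calc I = (I ^ (1 / 2 : ℝ)) ^ 2 := (sqrt_sq I).symm
      _ ≤ C ^ 2 := by gcongr
  have hmono : ∀ x, Monotone fun n => g n x := fun x i j hij => by
    simp only [g, Set.indicator_apply]
    split_ifs with h1 h2
    · exact min_le_min_left _ (by exact_mod_cast hij)
    · refine (h2 ⟨monotone_spanningSets m hij h1.1, ?_⟩).elim
      exact le_trans (show (hw.mk w x)⁻¹ ≤ (i : ℝ≥0) from h1.2) (by exact_mod_cast hij)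
    · exact zero_le
    · exact zero_le
  have hlim : ∫⁻ x, G x ^ 2 * (w x : ℝ≥0∞)⁻¹ ∂m ≤ ∫⁻ x, ⨆ n, g n x ^ 2 * (w x : ℝ≥0∞)⁻¹ ∂m := by
    refine lintegral_mono_ae ?_
    filter_upwards [hG.ae_eq_mk] with x hx
    have ht : Filter.Tendsto (fun n => g n x) Filter.atTop (nhds (G x)) := by
      have h1 : Filter.Tendsto (fun n : ℕ => min (G x) (n : ℝ≥0∞)) Filter.atTop (nhds (G x)) := by
        have := (tendsto_const_nhds (x := G x)).min ENNReal.tendsto_nat_nhds_top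
        simpa using this
      refine h1.congr' ?_
      have h2 : ∃ N : ℕ, (hw.mk w x)⁻¹ ≤ N := exists_nat_ge _
      obtain ⟨N, hN⟩ := h2
      filter_upwards [Filter.eventually_ge_atTop (max N (spanningSetsIndex m x))] with n hn
      have hxS : x ∈ S n := ⟨monotone_spanningSets m ((le_max_right _ _).trans hn)
        (mem_spanningSetsIndex m x), hN.trans (by exact_mod_cast (le_max_left _ _).trans hn)⟩
      simp only [g, Set.indicator_of_mem hxS, hx]
    have ht2 : Filter.Tendsto (fun n => g n x ^ 2 * (w x : ℝ≥0∞)⁻¹) Filter.atTop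
        (nhds (G x ^ 2 * (w x : ℝ≥0∞)⁻¹)) :=
      ENNReal.Tendsto.mul_const (ENNReal.Tendsto.pow ht) (Or.inr (ENNReal.inv_ne_top.2 (hwne x)))
    exact le_of_tendsto' ht2 fun n => le_iSup (fun n => g n x ^ 2 * (w x : ℝ≥0∞)⁻¹) n
  refine hlim.trans ?_
  rw [lintegral_iSup']
  · exact iSup_le hbound
  · exact fun n => ((hg n).pow_const 2).aemeasurable.mul hinv
  · exact .of_forall fun x i j hij => by
      dsimp only
      gcongr
      exact hmono x hij

/-- The iterated form of the basic estimate: an `L¹(L²(L∞))` kernel is integrated against two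
functions that are square integrable with weights. No measurability of the kernel is required. -/
theorem lintegral_kernel_le [SigmaFinite m] (k : Ω → Ω → Ω → Ω → ℝ≥0∞) {ρ ς : Ω → ℝ≥0}
    (hρ : AEMeasurable ρ m) (hς : AEMeasurable ς m) (hρ0 : ∀ x, 0 < ρ x) (hς0 : ∀ x, 0 < ς x)
    {H G : Ω → Ω → ℝ≥0∞} (hH : AEMeasurable (fun z : Ω × Ω => H z.1 z.2) (m.prod m))
    (hG : AEMeasurable (fun z : Ω × Ω => G z.1 z.2) (m.prod m))
    (hHf : ∫⁻ b, (∫⁻ d, H b d ^ 2 * (ς d : ℝ≥0∞)⁻¹ ∂m) * (ρ b : ℝ≥0∞)⁻¹ ∂m ≠ ∞)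
    (hGf : ∫⁻ b, (∫⁻ d, G b d ^ 2 * (ς d : ℝ≥0∞)⁻¹ ∂m) * (ρ b : ℝ≥0∞)⁻¹ ∂m ≠ ∞) :
    ∫⁻ a, ∫⁻ b, ∫⁻ c, ∫⁻ d, k a b c d * H b d * G c d ∂m ∂m ∂m ∂m ≤
      (∫⁻ a, (∫⁻ b, ∫⁻ c, essSup (fun d => (ς d * k a b c d) ^ 2) m * (ρ c * ρ b : ℝ≥0∞) ∂m ∂m) ^
        (1 / 2 : ℝ) ∂m) *
      (∫⁻ b, (∫⁻ d, H b d ^ 2 * (ς d : ℝ≥0∞)⁻¹ ∂m) * (ρ b : ℝ≥0∞)⁻¹ ∂m) ^ (1 / 2 : ℝ) *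
      (∫⁻ b, (∫⁻ d, G b d ^ 2 * (ς d : ℝ≥0∞)⁻¹ ∂m) * (ρ b : ℝ≥0∞)⁻¹ ∂m) ^ (1 / 2 : ℝ) := by
  set U : Ω → ℝ≥0∞ := fun b => ∫⁻ d, H b d ^ 2 * (ς d : ℝ≥0∞)⁻¹ ∂m with hU
  set V : Ω → ℝ≥0∞ := fun b => ∫⁻ d, G b d ^ 2 * (ς d : ℝ≥0∞)⁻¹ ∂m with hV
  have hςi : AEMeasurable (fun x => (ς x : ℝ≥0∞)⁻¹) m := hς.coe_nnreal_ennreal.inv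
  have hρi : AEMeasurable (fun x => (ρ x : ℝ≥0∞)⁻¹) m := hρ.coe_nnreal_ennreal.inv
  have hςne : ∀ x, (ς x : ℝ≥0∞) ≠ 0 := fun x => by exact_mod_cast (hς0 x).ne'
  have hρne : ∀ x, (ρ x : ℝ≥0∞) ≠ 0 := fun x => by exact_mod_cast (hρ0 x).ne'
  have hUm : AEMeasurable U m := ((hH.pow_const 2).mul hςi.comp_snd).lintegral_prod_right'
  have hVm : AEMeasurable V m := ((hG.pow_const 2).mul hςi.comp_snd).lintegral_prod_right'
  have hHs : ∀ᵐ b ∂m, AEMeasurable (fun d => H b d) m := by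
    filter_upwards [hH.aestronglyMeasurable.prodMk_left] with b hb using hb.aemeasurable
  have hGs : ∀ᵐ b ∂m, AEMeasurable (fun d => G b d) m := by
    filter_upwards [hG.aestronglyMeasurable.prodMk_left] with b hb using hb.aemeasurable
  set Q : Ω → Ω → Ω → ℝ≥0∞ := fun a b c => essSup (fun d => (ς d * k a b c d) ^ 2) m with hQ
  -- the essential supremum and the Cauchy-Schwarz inequality in `d`
  have hd : ∀ a, ∀ᵐ b ∂m, ∀ᵐ c ∂m, ∫⁻ d, k a b c d * H b d * G c d ∂m ≤
      Q a b c ^ (1 / 2 : ℝ) * (U b ^ (1 / 2 : ℝ) * V c ^ (1 / 2 : ℝ)) := fun a => by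
    filter_upwards [hHs] with b hb
    filter_upwards [hGs] with c hc
    have h1 : ∀ᵐ d ∂m, k a b c d * H b d * G c d ≤ Q a b c ^ (1 / 2 : ℝ) *
        ((H b d ^ 2 * (ς d : ℝ≥0∞)⁻¹) ^ (1 / 2 : ℝ) * (G c d ^ 2 * (ς d : ℝ≥0∞)⁻¹) ^ (1 / 2 : ℝ)) := by
      filter_upwards [ENNReal.ae_le_essSup fun d => (ς d * k a b c d) ^ 2] with d hd
      have h2 : ς d * k a b c d ≤ Q a b c ^ (1 / 2 : ℝ) := by
        have := sqrt_le_sqrt hd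
        rwa [sq_sqrt] at this
      rw [sqrt_mul, sqrt_mul, sq_sqrt, sq_sqrt]
      calc k a b c d * H b d * G c d
          = (ς d * k a b c d) * (H b d * G c d * (ς d : ℝ≥0∞)⁻¹) := by
            have : (ς d : ℝ≥0∞) * (ς d : ℝ≥0∞)⁻¹ = 1 :=
              ENNReal.mul_inv_cancel (hςne d) ENNReal.coe_ne_top
            calc k a b c d * H b d * G c d = k a b c d * H b d * G c d *
                  ((ς d : ℝ≥0∞) * (ς d : ℝ≥0∞)⁻¹) := by rw [this, mul_one]
              _ = _ := by ring
        _ ≤ Q a b c ^ (1 / 2 : ℝ) * (H b d * G c d * (ς d : ℝ≥0∞)⁻¹) := by gcongr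
        _ = Q a b c ^ (1 / 2 : ℝ) * (H b d * G c d *
            ((ς d : ℝ≥0∞)⁻¹ ^ (1 / 2 : ℝ) * (ς d : ℝ≥0∞)⁻¹ ^ (1 / 2 : ℝ))) := by
            rw [sqrt_mul_sqrt_self]
        _ = _ := by ring
    refine (lintegral_mono_ae h1).trans ?_
    have hb2 : AEMeasurable (fun d => (H b d ^ 2 * (ς d : ℝ≥0∞)⁻¹) ^ (1 / 2 : ℝ)) m :=
      ((hb.pow_const 2).mul hςi).pow_const _
    have hc2 : AEMeasurable (fun d => (G c d ^ 2 * (ς d : ℝ≥0∞)⁻¹) ^ (1 / 2 : ℝ)) m :=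
      ((hc.pow_const 2).mul hςi).pow_const _
    rw [lintegral_const_mul'' (f := fun d => (H b d ^ 2 * (ς d : ℝ≥0∞)⁻¹) ^ (1 / 2 : ℝ) *
      (G c d ^ 2 * (ς d : ℝ≥0∞)⁻¹) ^ (1 / 2 : ℝ)) _ (hb2.mul hc2)]
    gcongr
    refine (lintegral_mul_le_sqrt hb2 hc2).trans (le_of_eq ?_)
    simp only [sqrt_sq]
    rfl
  set VV := ∫⁻ b, V b * (ρ b : ℝ≥0∞)⁻¹ ∂m with hVV
  set UU := ∫⁻ b, U b * (ρ b : ℝ≥0∞)⁻¹ ∂m with hUU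
  have hsplit : ∀ (x : Ω) (q v : ℝ≥0∞), q ^ (1 / 2 : ℝ) * v ^ (1 / 2 : ℝ) =
      (q * ρ x) ^ (1 / 2 : ℝ) * (v * (ρ x : ℝ≥0∞)⁻¹) ^ (1 / 2 : ℝ) := fun x q v => by
    rw [← sqrt_mul, ← sqrt_mul]
    congr 1
    have : (ρ x : ℝ≥0∞) * (ρ x : ℝ≥0∞)⁻¹ = 1 := ENNReal.mul_inv_cancel (hρne x) ENNReal.coe_ne_top
    calc q * v = q * v * ((ρ x : ℝ≥0∞) * (ρ x : ℝ≥0∞)⁻¹) := by rw [this, mul_one]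
      _ = _ := by ring
  have hUfin : ∀ᵐ b ∂m, U b ≠ ∞ := by
    filter_upwards [ae_lt_top' (hUm.mul hρi) hHf] with b hb hb'
    rw [Pi.mul_apply, hb', ENNReal.top_mul (by simp)] at hb
    exact lt_irrefl _ hb
  -- the Cauchy-Schwarz inequality in `c`
  have hc : ∀ a, ∀ᵐ b ∂m, ∫⁻ c, ∫⁻ d, k a b c d * H b d * G c d ∂m ∂m ≤
      (∫⁻ c, Q a b c * (ρ c * ρ b : ℝ≥0∞) ∂m) ^ (1 / 2 : ℝ) *
        (U b * (ρ b : ℝ≥0∞)⁻¹) ^ (1 / 2 : ℝ) * VV ^ (1 / 2 : ℝ) := fun a => by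
    filter_upwards [hd a, hUfin] with b hb hUb
    refine (lintegral_mono_ae hb).trans ?_
    have h1 : ∀ c, Q a b c ^ (1 / 2 : ℝ) * (U b ^ (1 / 2 : ℝ) * V c ^ (1 / 2 : ℝ)) =
        ((Q a b c * ρ c) ^ (1 / 2 : ℝ) * (V c * (ρ c : ℝ≥0∞)⁻¹) ^ (1 / 2 : ℝ)) *
          U b ^ (1 / 2 : ℝ) := fun c => by
      rw [← hsplit]; ring
    simp only [h1]
    rw [lintegral_mul_const' _ _ (sqrt_ne_top hUb)]
    have h2 := lintegral_sqrt_mul_le (m := m) (fun c => Q a b c * ρ c) (hVm.mul hρi) hGf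
    calc _ ≤ (∫⁻ c, Q a b c * ρ c ∂m) ^ (1 / 2 : ℝ) * VV ^ (1 / 2 : ℝ) * U b ^ (1 / 2 : ℝ) := by
          gcongr; exact h2
      _ = (∫⁻ c, Q a b c * ρ c ∂m) ^ (1 / 2 : ℝ) * U b ^ (1 / 2 : ℝ) * VV ^ (1 / 2 : ℝ) := by ring
      _ = _ := by
          rw [hsplit b]
          congr 3
          rw [← lintegral_mul_const' _ _ ENNReal.coe_ne_top]
          simp only [mul_assoc]
  -- the Cauchy-Schwarz inequality in `b`
  have hb : ∀ a, ∫⁻ b, ∫⁻ c, ∫⁻ d, k a b c d * H b d * G c d ∂m ∂m ∂m ≤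
      (∫⁻ b, ∫⁻ c, Q a b c * (ρ c * ρ b : ℝ≥0∞) ∂m ∂m) ^ (1 / 2 : ℝ) *
        (UU ^ (1 / 2 : ℝ) * VV ^ (1 / 2 : ℝ)) := fun a => by
    refine (lintegral_mono_ae (hc a)).trans ?_
    rw [lintegral_mul_const' _ _ (sqrt_ne_top hGf), ← mul_assoc]
    gcongr
    exact lintegral_sqrt_mul_le (m := m) _ (hUm.mul hρi) hHf
  refine (lintegral_mono hb).trans ?_
  rw [lintegral_mul_const' _ _ (ENNReal.mul_ne_top (sqrt_ne_top hHf) (sqrt_ne_top hGf)), mul_assoc]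

end Inequalities

/-! ### Disjoint pairs of subchains -/
section Pairs

variable (tm) in
/-- The pairs of disjoint subsets of `ω`, contained in `X^T`. -/
def pairsBefore (T : ℝ≥0) (ω : Finset X) : Finset (Finset X × Finset X) :=
  ((ω.filter fun x => tm x < T).powerset ×ˢ (ω.filter fun x => tm x < T).powerset).filter
    fun cd => Disjoint cd.1 cd.2

theorem mem_pairsBefore {T : ℝ≥0} {ω c d : Finset X} : (c, d) ∈ pairsBefore tm T ω ↔
    (c ⊆ ω ∧ d ⊆ ω) ∧ ((∀ x ∈ c, tm x < T) ∧ ∀ x ∈ d, tm x < T) ∧ Disjoint c d := by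
  simp only [pairsBefore, Finset.mem_filter, Finset.mem_product, Finset.mem_powerset,
    Finset.subset_iff]
  constructor
  · rintro ⟨⟨h1, h2⟩, h3⟩
    exact ⟨⟨fun x hx => (h1 hx).1, fun x hx => (h2 hx).1⟩,
      ⟨fun x hx => (h1 hx).2, fun x hx => (h2 hx).2⟩, h3⟩
  · rintro ⟨⟨h1, h2⟩, ⟨h3, h4⟩, h5⟩
    exact ⟨⟨fun x hx => ⟨h1 hx, h3 x hx⟩, fun x hx => ⟨h2 hx, h4 x hx⟩⟩, h5⟩

theorem sum_pairsBefore {M : Type*} [AddCommMonoid M] (T : ℝ≥0) (ω : Finset X)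
    (g : Finset X → Finset X → M) : ∑ A ∈ ω.powerset, ∑ B ∈ (ω \ A).powerset,
      (if (∀ x ∈ A, tm x < T) ∧ ∀ x ∈ B, tm x < T then g A B else 0) =
    ∑ cd ∈ pairsBefore tm T ω, g cd.1 cd.2 := by
  rw [Finset.sum_sigma', ← Finset.sum_filter]
  refine Finset.sum_bij' (fun x _ => (x.1, x.2)) (fun x _ => ⟨x.1, x.2⟩) ?_ ?_ ?_ ?_ ?_
  · rintro ⟨A, B⟩ h
    simp only [Finset.mem_filter, Finset.mem_sigma, Finset.mem_powerset] at h
    refine mem_pairsBefore.2 ⟨⟨h.1.1, h.1.2.trans Finset.sdiff_subset⟩, h.2, ?_⟩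
    exact Finset.disjoint_left.2 fun x hx hx' => (Finset.mem_sdiff.1 (h.1.2 hx')).2 hx
  · rintro ⟨A, B⟩ h
    obtain ⟨h1, h2, h3⟩ := mem_pairsBefore.1 h
    simp only [Finset.mem_filter, Finset.mem_sigma, Finset.mem_powerset]
    exact ⟨⟨h1.1, fun x hx => Finset.mem_sdiff.2
      ⟨h1.2 hx, fun hx' => Finset.disjoint_left.1 h3 hx' hx⟩⟩, h2⟩
  · simp
  · simp
  · simp

/-- The truncation of a kernel to pairs in `X^T`. -/
def cutPair {M : Type*} [Zero M] (tm : X → ℝ≥0) (T : ℝ≥0)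
    (F : Finset X → Finset X → Finset X → M) (A B R : Finset X) : M :=
  if (∀ x ∈ A, tm x < T) ∧ ∀ x ∈ B, tm x < T then F A B R else 0

variable (μ tm) in
/-- The measure on triples of chains of which the first two are contained in `X^T`. -/
def tripleMeasure (T : ℝ≥0) : Measure (ℭ × ℭ × ℭ) := 𝔪[T].prod (𝔪[T].prod 𝔪)

theorem tripleMeasure_eq (T : ℝ≥0) : tripleMeasure μ tm T = ((𝔪).prod ((𝔪).prod 𝔪)).restrict
      (before tm T ×ˢ before tm T ×ˢ Set.univ) := by
  rw [tripleMeasure, chainMeasureBefore, ← Measure.prod_restrict, ← Measure.prod_restrict,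
    Measure.restrict_univ]

theorem measurableSet_cutPair (htm : Measurable tm) (T : ℝ≥0) :
    MeasurableSet (before tm T ×ˢ before tm T ×ˢ (Set.univ : Set (ℭ))) :=
  (measurableSet_before_const htm T).prod ((measurableSet_before_const htm T).prod .univ)

theorem cutPair_eq_indicator {M : Type*} [Zero M] (T : ℝ≥0)
    (F : Finset X → Finset X → Finset X → M) (z : ℭ × ℭ × ℭ) :
    cutPair tm T F (pts z.1) (pts z.2.1) (pts z.2.2) =
      (before tm T ×ˢ before tm T ×ˢ (Set.univ : Set (ℭ))).indicator
        (fun z => F (pts z.1) (pts z.2.1) (pts z.2.2)) z := by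
  simp only [cutPair, Set.indicator_apply, Set.mem_prod, Set.mem_univ, and_true, mem_before_union]

theorem sum_cutPair {M : Type*} [AddCommMonoid M] (T : ℝ≥0)
    (F : Finset X → Finset X → Finset X → M) (ω : Finset X) :
    ∑ A ∈ ω.powerset, ∑ B ∈ (ω \ A).powerset, cutPair tm T F A B ((ω \ A) \ B) =
      ∑ cd ∈ pairsBefore tm T ω, F cd.1 cd.2 ((ω \ cd.1) \ cd.2) :=
  sum_pairsBefore T ω fun A B => F A B ((ω \ A) \ B)

theorem aestronglyMeasurable_cutPair (htm : Measurable tm) (T : ℝ≥0) {E : Type*}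
    [TopologicalSpace E] [Zero E] {F : Finset X → Finset X → Finset X → E}
    (hF : AEStronglyMeasurable (fun z : ℭ × ℭ × ℭ =>
      F (pts z.1) (pts z.2.1) (pts z.2.2)) (tripleMeasure μ tm T)) :
    AEStronglyMeasurable (fun z : ℭ × ℭ × ℭ => cutPair tm T F (pts z.1) (pts z.2.1) (pts z.2.2))
      ((𝔪).prod ((𝔪).prod 𝔪)) := by
  simp only [cutPair_eq_indicator]
  rw [aestronglyMeasurable_indicator_iff (measurableSet_cutPair htm T), ← tripleMeasure_eq]
  exact hF

theorem aestronglyMeasurable_sum_pairs (ht : IsTime μ tm) (T : ℝ≥0) {E : Type*} [TopologicalSpace E]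
    [AddCommMonoid E] [ContinuousAdd E] [TopologicalSpace.PseudoMetrizableSpace E]
    {F : Finset X → Finset X → Finset X → E} (hF : AEStronglyMeasurable (fun z : ℭ × ℭ × ℭ =>
      F (pts z.1) (pts z.2.1) (pts z.2.2)) (tripleMeasure μ tm T)) :
    AEStronglyMeasurable (fun ϰ : ℭ => ∑ cd ∈ pairsBefore tm T (pts ϰ),
      F cd.1 cd.2 ((pts ϰ \ cd.1) \ cd.2)) 𝔪 := by
  have h1 := aestronglyMeasurable_sum_powerset μ 𝔪 ht
    (F := fun y B R => cutPair tm T F (pts y) B R) (aestronglyMeasurable_cutPair ht.measurable T hF)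
  have h2 := aestronglyMeasurable_sum_powerset' μ ht
    (F := fun A R => ∑ B ∈ R.powerset, cutPair tm T F A B (R \ B)) h1
  simpa only [sum_cutPair] using h2

/-- Integration over triples of chains, the first two of them contained in `X^T`, as integration
over their union. -/
theorem lintegral_sum_pairs (ht : IsTime μ tm) (T : ℝ≥0) {F : Finset X → Finset X → Finset X → ℝ≥0∞}
    (hF : AEMeasurable (fun z : ℭ × ℭ × ℭ =>
      F (pts z.1) (pts z.2.1) (pts z.2.2)) (tripleMeasure μ tm T)) :
    ∫⁻ z, F (pts z.1) (pts z.2.1) (pts z.2.2) ∂tripleMeasure μ tm T =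
      ∫⁻ ϰ, ∑ cd ∈ pairsBefore tm T (pts ϰ), F cd.1 cd.2 ((pts ϰ \ cd.1) \ cd.2) ∂𝔪 := by
  have h0 := aestronglyMeasurable_cutPair ht.measurable T hF.aestronglyMeasurable
  have h1 := lintegral_prod_chain μ 𝔪 ht
    (F := fun y B R => cutPair tm T F (pts y) B R) h0.aemeasurable
  have h2 := lintegral_prod_chain' μ ht
    (F := fun A R => ∑ B ∈ R.powerset, cutPair tm T F A B (R \ B))
    (aestronglyMeasurable_sum_powerset μ 𝔪 ht
      (F := fun y B R => cutPair tm T F (pts y) B R) h0).aemeasurable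
  simp only [sum_cutPair] at h2
  rw [← h2, ← h1, tripleMeasure_eq, ← lintegral_indicator (measurableSet_cutPair ht.measurable T)]
  simp only [cutPair_eq_indicator]

theorem integral_sum_pairs (ht : IsTime μ tm) (T : ℝ≥0) {E : Type*} [NormedAddCommGroup E]
    [NormedSpace ℝ E] [CompleteSpace E] {F : Finset X → Finset X → Finset X → E}
    (hF : Integrable (fun z : ℭ × ℭ × ℭ =>
      F (pts z.1) (pts z.2.1) (pts z.2.2)) (tripleMeasure μ tm T)) :
    ∫ z, F (pts z.1) (pts z.2.1) (pts z.2.2) ∂tripleMeasure μ tm T =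
      ∫ ϰ, ∑ cd ∈ pairsBefore tm T (pts ϰ), F cd.1 cd.2 ((pts ϰ \ cd.1) \ cd.2) ∂𝔪 := by
  have h0 : Integrable (fun z : ℭ × ℭ × ℭ =>
      cutPair tm T F (pts z.1) (pts z.2.1) (pts z.2.2))
      ((𝔪).prod ((𝔪).prod 𝔪)) := by
    simp only [cutPair_eq_indicator]
    rw [integrable_indicator_iff (measurableSet_cutPair ht.measurable T), IntegrableOn, ← tripleMeasure_eq]
    exact hF
  obtain ⟨hi, h1⟩ := integral_prod_chain μ 𝔪 ht (F := fun y B R => cutPair tm T F (pts y) B R) h0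
  obtain ⟨-, h2⟩ := integral_prod_chain' μ ht
    (F := fun A R => ∑ B ∈ R.powerset, cutPair tm T F A B (R \ B)) hi
  simp only [sum_cutPair] at h2
  rw [← h2, ← h1, tripleMeasure_eq, ← integral_indicator (measurableSet_cutPair ht.measurable T)]
  simp only [cutPair_eq_indicator]

theorem ae_sum_pairs (ht : IsTime μ tm) (T : ℝ≥0) {P : Finset X → Finset X → Finset X → Prop}
    (h : ∀ᵐ z ∂tripleMeasure μ tm T, P (pts z.1) (pts z.2.1) (pts z.2.2)) :
    ∀ᵐ ϰ ∂𝔪, ∀ cd ∈ pairsBefore tm T (pts ϰ), P cd.1 cd.2 ((pts ϰ \ cd.1) \ cd.2) := by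
  rw [tripleMeasure_eq, ae_restrict_iff' (measurableSet_cutPair ht.measurable T)] at h
  have h1 := ae_split μ 𝔪 ht (P := fun y B R =>
    (∀ x ∈ pts y, tm x < T) → (∀ x ∈ B, tm x < T) → P (pts y) B R)
    (h.mono fun z hz h1 h2 => hz ⟨h1, h2, trivial⟩)
  have h2 := ae_split' μ ht (P := fun A R => ∀ B ⊆ R,
    (∀ x ∈ A, tm x < T) → (∀ x ∈ B, tm x < T) → P A B (R \ B)) h1
  filter_upwards [h2] with ϰ hϰ cd hcd
  obtain ⟨c, d⟩ := cd
  obtain ⟨h3, h4, h5⟩ := mem_pairsBefore.1 hcd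
  exact hϰ c h3.1 d (fun x hx => Finset.mem_sdiff.2
    ⟨h3.2 hx, fun hx' => Finset.disjoint_left.1 h5 hx' hx⟩) h4.1 h4.2

theorem pairs_union {T : ℝ≥0} {ω : Finset X} {cd : Finset X × Finset X}
    (h : cd ∈ pairsBefore tm T ω) : ((ω \ cd.1) \ cd.2) ∪ (cd.1 ∪ cd.2) = ω := by
  obtain ⟨c, d⟩ := cd
  obtain ⟨h3, -, -⟩ := mem_pairsBefore.1 h
  ext x
  simp only [Finset.mem_union, Finset.mem_sdiff]
  constructor
  · rintro (h | h | h)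
    exacts [h.1.1, h3.1 h, h3.2 h]
  · intro hx
    tauto

/-! ### Sums of weights -/

theorem wt_add (u v : X → ℝ≥0) (ω : Finset X) :
    wt (u + v) ω = ∑ A ∈ ω.powerset, wt u A * wt v (ω \ A) := by
  simp only [wt, Pi.add_apply]
  exact Finset.prod_add _ _ _

theorem wt_mono {u v : X → ℝ≥0} (h : u ≤ v) (ω : Finset X) : wt u ω ≤ wt v ω :=
  Finset.prod_le_prod' fun x _ => h x

/-- The integral of a function of the union of three chains, with multiplicative weights. -/
theorem lintegral_three (ht : IsTime μ tm)
    {u v w : X → ℝ≥0} (hu : AEMeasurable u μ) (hv : AEMeasurable v μ) (hw : AEMeasurable w μ)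
    {F : Finset X → ℝ≥0∞} (hF : AEMeasurable (fun ϰ : ℭ => F (pts ϰ)) 𝔪) :
    AEMeasurable (fun z : ℭ × ℭ × ℭ => (wt u (pts z.1) : ℝ≥0∞) *
      (wt v (pts z.2.1) * (wt w (pts z.2.2) * F (pts z.2.2 ∪ (pts z.1 ∪ pts z.2.1)))))
      ((𝔪).prod ((𝔪).prod 𝔪)) ∧ ∫⁻ z : ℭ × ℭ × ℭ, (wt u (pts z.1) : ℝ≥0∞) * (wt v (pts z.2.1) *
      (wt w (pts z.2.2) * F (pts z.2.2 ∪ (pts z.1 ∪ pts z.2.1)))) ∂(𝔪).prod ((𝔪).prod 𝔪) =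
    ∫⁻ ϰ, F (pts ϰ) * (wt (u + v + w) (pts ϰ) : ℝ≥0∞) ∂𝔪 := by
  have hu' := (aemeasurable_wt ht.measurable hu).coe_nnreal_ennreal
  have hv' := (aemeasurable_wt ht.measurable hv).coe_nnreal_ennreal
  have hw' := (aemeasurable_wt ht.measurable hw).coe_nnreal_ennreal
  have hF3 : AEMeasurable (fun z : ℭ × ℭ × ℭ =>
      F (pts z.2.2 ∪ (pts z.1 ∪ pts z.2.1)))
      ((𝔪).prod ((𝔪).prod 𝔪)) := by
    have q1 := quasiMeasurePreserving_merge μ ht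
    have q2 := quasiMeasurePreserving_prodMap (.id 𝔪) q1
    have h1 := (aestronglyMeasurable_pts_union μ ht hF.aestronglyMeasurable).aemeasurable
    refine (h1.comp_quasiMeasurePreserving q2).congr ?_
    have hap := (quasiMeasurePreserving_snd (μ := 𝔪) (ν := (𝔪).prod 𝔪)).ae (ae_apart μ ht)
    filter_upwards [hap] with z hz
    simp only [Function.comp_apply, Prod.map, id_eq]
    rw [pts_merge hz, ← Finset.union_assoc, Finset.union_comm]
  have hm : AEMeasurable (fun z : ℭ × ℭ × ℭ => (wt u (pts z.1) : ℝ≥0∞) *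
      (wt v (pts z.2.1) * (wt w (pts z.2.2) * F (pts z.2.2 ∪ (pts z.1 ∪ pts z.2.1)))))
      ((𝔪).prod ((𝔪).prod 𝔪)) :=
    hu'.comp_fst.mul (hv'.comp_fst.comp_snd.mul (hw'.comp_snd.comp_snd.mul hF3))
  refine ⟨hm, ?_⟩
  have h1 := lintegral_prod_chain μ 𝔪 ht
    (F := fun y B R => (wt u (pts y) : ℝ≥0∞) * (wt v B * (wt w R * F (R ∪ (pts y ∪ B))))) hm
  have h2 := lintegral_prod_chain' μ ht (F := fun A R => ∑ B ∈ R.powerset,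
      (wt u A : ℝ≥0∞) * (wt v B * (wt w (R \ B) * F ((R \ B) ∪ (A ∪ B)))))
    (aestronglyMeasurable_sum_powerset μ 𝔪 ht
      (F := fun y B R => (wt u (pts y) : ℝ≥0∞) * (wt v B * (wt w R * F (R ∪ (pts y ∪ B)))))
      hm.aestronglyMeasurable).aemeasurable
  rw [h1, h2]
  refine lintegral_congr fun ϰ => ?_
  have h3 : ∀ A ∈ (pts ϰ).powerset, ∀ B ∈ (pts ϰ \ A).powerset,
      (wt u A : ℝ≥0∞) * (wt v B * (wt w ((pts ϰ \ A) \ B) * F (((pts ϰ \ A) \ B) ∪ (A ∪ B)))) =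
      F (pts ϰ) * ((wt u A * (wt v B * wt w ((pts ϰ \ A) \ B)) : ℝ≥0) : ℝ≥0∞) := by
    intro A hA B hB
    have hA := Finset.mem_powerset.1 hA
    have hB := Finset.mem_powerset.1 hB
    have : ((pts ϰ \ A) \ B) ∪ (A ∪ B) = pts ϰ := by
      ext x
      have h1 := @hA x
      have h2 := @hB x
      simp only [Finset.mem_union, Finset.mem_sdiff] at h2 ⊢
      tauto
    rw [this]
    push_cast
    ring
  rw [Finset.sum_congr rfl fun A hA => Finset.sum_congr rfl (h3 A hA), add_assoc, wt_add]
  simp only [← Finset.mul_sum]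
  congr 1
  push_cast
  refine Finset.sum_congr rfl fun A _ => ?_
  rw [← Finset.mul_sum, wt_add]
  push_cast
  rfl

/-- The rearrangement of tables `(a, b, c, d)` and chains `ϰ` into triples `(c, d, ϰ)` and
pairs `(a, b)`. -/
theorem measurePreserving_rearrange {α : Type*} [MeasurableSpace α] (m n : Measure α) [SFinite m]
    [SFinite n] : MeasurePreserving
      (fun w : (α × α × α) × α × α => ((w.2.1, w.2.2, w.1.1, w.1.2.1), w.1.2.2))
      ((m.prod (m.prod n)).prod (m.prod m)) ((m.prod (m.prod (m.prod m))).prod n) := by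
  have h1 : MeasurePreserving (Prod.map MeasurableEquiv.prodAssoc.symm id)
      ((m.prod (m.prod n)).prod (m.prod m)) (((m.prod m).prod n).prod (m.prod m)) :=
    (measurePreserving_prodAssoc m m n).symm.prod (.id _)
  have h2 : MeasurePreserving Prod.swap (((m.prod m).prod n).prod (m.prod m))
      ((m.prod m).prod ((m.prod m).prod n)) := Measure.measurePreserving_swap
  have h3 : MeasurePreserving MeasurableEquiv.prodAssoc.symm
      ((m.prod m).prod ((m.prod m).prod n)) (((m.prod m).prod (m.prod m)).prod n) :=
    (measurePreserving_prodAssoc (m.prod m) (m.prod m) n).symm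
  have h4 : MeasurePreserving (Prod.map MeasurableEquiv.prodAssoc id)
      (((m.prod m).prod (m.prod m)).prod n) ((m.prod (m.prod (m.prod m))).prod n) :=
    (measurePreserving_prodAssoc m m (m.prod m)).prod (.id n)
  exact h4.comp (h3.comp (h2.comp h1))

end Pairs

/-! ### The basic estimate -/
section BasicEstimate

variable (μ tm) in
/-- The norm in `F(p)` of the derivative at `β` of a scalar function of chains. -/
def scalarNorm (p : X → ℝ≥0) (φ : Finset X → ℝ≥0∞) (β : Finset X) : ℝ≥0∞ :=
  (∫⁻ ϰ, φ (pts ϰ ∪ β) ^ 2 * (wt p (pts ϰ) : ℝ≥0∞) ∂𝔪) ^ (1 / 2 : ℝ)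

theorem chainMeasureBefore_le (T : ℝ≥0) : 𝔪[T] ≤ 𝔪 := Measure.restrict_le_self

theorem quasiMeasurePreserving_before (T : ℝ≥0) : QuasiMeasurePreserving id 𝔪[T] 𝔪 :=
  ⟨measurable_id, by rw [Measure.map_id]; exact Measure.restrict_le_self.absolutelyContinuous⟩

theorem quasiMeasurePreserving_prod_before (T : ℝ≥0) : QuasiMeasurePreserving id
    (𝔪[T].prod 𝔪[T]) ((𝔪).prod 𝔪) :=
  quasiMeasurePreserving_prodMap (quasiMeasurePreserving_before T) (quasiMeasurePreserving_before T)

theorem quasiMeasurePreserving_table_before (T : ℝ≥0) : QuasiMeasurePreserving id 𝔱[T] 𝔱 :=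
  have q := quasiMeasurePreserving_before (μ := μ) (tm := tm) T
  quasiMeasurePreserving_prodMap q (quasiMeasurePreserving_prodMap q
    (quasiMeasurePreserving_prodMap q q))

/-- The derivatives of a function at two chains are square integrable with the weights `1/r` and
`1/s`. -/
theorem scalarNorm_sections (ht : IsTime μ tm)
    {p r s q : X → ℝ≥0} (hp : IsWeight μ p) (hr : IsWeight μ r) (hs : IsWeight μ s)
    (hq : r⁻¹ + p + s⁻¹ ≤ q) (T : ℝ≥0) {φ : Finset X → ℝ≥0∞}
    (hφ : AEMeasurable (fun ϰ : ℭ => φ (pts ϰ)) 𝔪) :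
    AEMeasurable (fun z : ℭ × ℭ => scalarNorm μ tm p φ (pts z.1 ∪ pts z.2)) (𝔪[T].prod 𝔪[T]) ∧
    ∫⁻ b, (∫⁻ d, scalarNorm μ tm p φ (pts b ∪ pts d) ^ 2 * (wt s (pts d) : ℝ≥0∞)⁻¹
      ∂𝔪[T]) * (wt r (pts b) : ℝ≥0∞)⁻¹ ∂𝔪[T] ≤ ∫⁻ ϰ, φ (pts ϰ) ^ 2 * (wt q (pts ϰ) : ℝ≥0∞) ∂𝔪 := by
  set m := 𝔪
  obtain ⟨-, h2⟩ := lintegral_three ht hr.inv.aemeasurable hs.inv.aemeasurable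
    hp.aemeasurable (F := fun ω => φ ω ^ 2) (hφ.pow_const 2)
  have hone : AEMeasurable (fun _ : X => (1 : ℝ≥0)) μ := aemeasurable_const
  obtain ⟨h1, -⟩ := lintegral_three ht hone hone
    hp.aemeasurable (F := fun ω => φ ω ^ 2) (hφ.pow_const 2)
  have hw1 : ∀ ω : Finset X, wt (fun _ : X => (1 : ℝ≥0)) ω = 1 := fun ω => by simp [wt]
  simp only [hw1, ENNReal.coe_one, one_mul] at h1
  have hp' : ∀ (u : X → ℝ≥0) (hu : IsWeight μ u) (ω : Finset X),
      ((wt u⁻¹ ω : ℝ≥0) : ℝ≥0∞) = (wt u ω : ℝ≥0∞)⁻¹ := fun u hu ω => by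
    rw [wt_inv, ENNReal.coe_inv (hu.wt_pos ω).ne']
  have hsq : ∀ β, scalarNorm μ tm p φ β ^ 2 =
      ∫⁻ ϰ, (wt p (pts ϰ) : ℝ≥0∞) * φ (pts ϰ ∪ β) ^ 2 ∂m := fun β => by
    rw [scalarNorm, sqrt_sq]
    exact lintegral_congr fun ϰ => mul_comm _ _
  have hN : AEMeasurable (fun z : ℭ × ℭ => scalarNorm μ tm p φ (pts z.1 ∪ pts z.2) ^ 2)
      (m.prod m) := by
    simp only [hsq]
    have h3 : AEMeasurable (fun w : (ℭ × ℭ) × ℭ => (wt p (pts w.2) : ℝ≥0∞) *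
        φ (pts w.2 ∪ (pts w.1.1 ∪ pts w.1.2)) ^ 2) ((m.prod m).prod m) := by
      have h4 := h1.comp_quasiMeasurePreserving
        (measurePreserving_prodAssoc m m m).quasiMeasurePreserving
      refine h4.congr (.of_forall fun w => ?_)
      simp only [Function.comp_apply, MeasurableEquiv.prodAssoc, MeasurableEquiv.coe_mk,
        Equiv.prodAssoc_apply]
    exact AEMeasurable.lintegral_prod_right' (f := fun w : (ℭ × ℭ) × ℭ =>
      (wt p (pts w.2) : ℝ≥0∞) * φ (pts w.2 ∪ (pts w.1.1 ∪ pts w.1.2)) ^ 2) h3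
  have hN' : AEMeasurable (fun z : ℭ × ℭ => scalarNorm μ tm p φ (pts z.1 ∪ pts z.2))
      (m.prod m) := by
    have := hN.pow_const (1 / 2 : ℝ)
    simpa only [sq_sqrt] using this
  refine ⟨hN'.comp_quasiMeasurePreserving (quasiMeasurePreserving_prod_before T), ?_⟩
  have hi1 := (aemeasurable_wt ht.measurable hr.aemeasurable).coe_nnreal_ennreal.inv
  have hi2 := (aemeasurable_wt ht.measurable hs.aemeasurable).coe_nnreal_ennreal.inv
  -- the three chains merge to one of weight `r⁻¹ + p + s⁻¹`
  calc _ ≤ ∫⁻ b, (∫⁻ d, scalarNorm μ tm p φ (pts b ∪ pts d) ^ 2 * (wt s (pts d) : ℝ≥0∞)⁻¹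
        ∂m) * (wt r (pts b) : ℝ≥0∞)⁻¹ ∂m := by
        refine lintegral_mono' (chainMeasureBefore_le T) fun b => ?_
        dsimp only
        gcongr
        exact chainMeasureBefore_le T
    _ = ∫⁻ b, ∫⁻ d, ∫⁻ ϰ, ((wt r⁻¹ (pts b) : ℝ≥0) : ℝ≥0∞) * (((wt s⁻¹ (pts d) : ℝ≥0) : ℝ≥0∞) *
          (wt p (pts ϰ) * φ (pts ϰ ∪ (pts b ∪ pts d)) ^ 2)) ∂m ∂m ∂m := by
        refine lintegral_congr fun b => ?_
        rw [mul_comm, ← lintegral_const_mul' _ _ (by rw [← hp' r hr]; exact ENNReal.coe_ne_top)]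
        refine lintegral_congr fun d => ?_
        rw [hsq, hp' r hr, hp' s hs, mul_comm (∫⁻ ϰ, _ ∂m),
          lintegral_const_mul' _ _ (by rw [← hp' r hr]; exact ENNReal.coe_ne_top),
          lintegral_const_mul' _ _ (by rw [← hp' s hs]; exact ENNReal.coe_ne_top)]
    _ = ∫⁻ z : ℭ × ℭ × ℭ, ((wt r⁻¹ (pts z.1) : ℝ≥0) : ℝ≥0∞) *
          (((wt s⁻¹ (pts z.2.1) : ℝ≥0) : ℝ≥0∞) *
          (wt p (pts z.2.2) * φ (pts z.2.2 ∪ (pts z.1 ∪ pts z.2.1)) ^ 2)) ∂m.prod (m.prod m) := by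
        have h3 := (lintegral_three ht hr.inv.aemeasurable hs.inv.aemeasurable
          hp.aemeasurable (F := fun ω => φ ω ^ 2) (hφ.pow_const 2)).1
        rw [lintegral_prod _ h3]
        refine lintegral_congr_ae ?_
        filter_upwards [h3.aestronglyMeasurable.prodMk_left] with b hb
        rw [lintegral_prod _ hb.aemeasurable]
    _ = _ := h2
    _ ≤ _ := by
        gcongr with ϰ
        refine wt_mono (le_trans (le_of_eq ?_) hq) _
        ring

theorem ae_scalarNorm_lt_top (ht : IsTime μ tm)
    {p r s q : X → ℝ≥0} (hp : IsWeight μ p) (hr : IsWeight μ r) (hs : IsWeight μ s)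
    (hq : r⁻¹ + p + s⁻¹ ≤ q) (T : ℝ≥0) {φ : Finset X → ℝ≥0∞}
    (hφ : AEMeasurable (fun ϰ : ℭ => φ (pts ϰ)) 𝔪)
    (hfin : ∫⁻ ϰ, φ (pts ϰ) ^ 2 * (wt q (pts ϰ) : ℝ≥0∞) ∂𝔪 ≠ ∞) :
    ∀ᵐ z ∂𝔪[T].prod 𝔪[T], scalarNorm μ tm p φ (pts z.1 ∪ pts z.2) < ∞ := by
  obtain ⟨h1, h2⟩ := scalarNorm_sections ht hp hr hs hq T hφ
  set n := 𝔪[T]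
  have hq1 := quasiMeasurePreserving_before (μ := μ) (tm := tm) T
  have hi1 : AEMeasurable (fun b : ℭ => (wt r (pts b) : ℝ≥0∞)⁻¹) n :=
    ((aemeasurable_wt ht.measurable hr.aemeasurable).coe_nnreal_ennreal.inv).comp_quasiMeasurePreserving hq1
  have hi2 : AEMeasurable (fun b : ℭ => (wt s (pts b) : ℝ≥0∞)⁻¹) n :=
    ((aemeasurable_wt ht.measurable hs.aemeasurable).coe_nnreal_ennreal.inv).comp_quasiMeasurePreserving hq1
  have h3 : AEMeasurable (fun z : ℭ × ℭ =>
      scalarNorm μ tm p φ (pts z.1 ∪ pts z.2) ^ 2 * (wt s (pts z.2) : ℝ≥0∞)⁻¹ *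
        (wt r (pts z.1) : ℝ≥0∞)⁻¹) (n.prod n) := ((h1.pow_const 2).mul hi2.comp_snd).mul hi1.comp_fst
  have h4 : ∫⁻ z : ℭ × ℭ,
      scalarNorm μ tm p φ (pts z.1 ∪ pts z.2) ^ 2 * (wt s (pts z.2) : ℝ≥0∞)⁻¹ *
        (wt r (pts z.1) : ℝ≥0∞)⁻¹ ∂n.prod n ≠ ∞ := by
    refine ((lintegral_prod_le _).trans_lt (lt_of_le_of_lt (le_of_eq ?_)
      (h2.trans_lt hfin.lt_top))).ne
    refine lintegral_congr fun b => ?_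
    have h0 : (wt r (pts b) : ℝ≥0∞) ≠ 0 := by exact_mod_cast (hr.wt_pos (pts b)).ne'
    exact lintegral_mul_const' _ _ (ENNReal.inv_ne_top.2 h0)
  filter_upwards [ae_lt_top' h3 h4] with z hz
  refine lt_top_iff_ne_top.2 fun h => ?_
  rw [h, ENNReal.top_pow two_ne_zero, ENNReal.top_mul (by simp), ENNReal.top_mul (by simp)] at hz
  exact lt_irrefl _ hz

end BasicEstimate

/-! ### Integration over tables and chains as integration over the union -/
section Rearrangement

variable {E : Type*}

/-- The values of a function of `ϑ_+^-`, `ϑ_∘^-`, `ϑ_+^∘`, `ϑ_∘^∘` and `ϰ ⊔ ϑ_+^∘ ⊔ ϑ_∘^∘`. -/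
def onTables (F : ℭ × ℭ → Finset X → Finset X → Finset X → E) (w : 𝕋 × ℭ) : E :=
  F (w.1.1, w.1.2.1) (pts w.1.2.2.1) (pts w.1.2.2.2) (pts w.2 ∪ (ofChains w.1).out)

variable {T : ℝ≥0} {F : Chain tm × Chain tm → Finset X → Finset X → Finset X → E}

theorem measurePreserving_rearrange_tables (T : ℝ≥0) : MeasurePreserving
    (fun w : (ℭ × ℭ × ℭ) × ℭ × ℭ => ((w.2.1, w.2.2, w.1.1, w.1.2.1), w.1.2.2))
    ((tripleMeasure μ tm T).prod (𝔪[T].prod 𝔪[T])) (𝔱[T].prod 𝔪) :=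
  measurePreserving_rearrange _ _

instance (T : ℝ≥0) : SigmaFinite (tripleMeasure μ tm T) := by
  rw [tripleMeasure]; infer_instance

section
variable [TopologicalSpace E]

theorem aestronglyMeasurable_rearranged (hF : AEStronglyMeasurable (onTables F) (𝔱[T].prod 𝔪)) :
    AEStronglyMeasurable (fun w : (ℭ × ℭ × ℭ) × ℭ × ℭ =>
      F w.2 (pts w.1.1) (pts w.1.2.1) (pts w.1.2.2 ∪ (pts w.1.1 ∪ pts w.1.2.1)))
    ((tripleMeasure μ tm T).prod (𝔪[T].prod 𝔪[T])) :=
  hF.comp_measurePreserving (measurePreserving_rearrange_tables T)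

theorem ae_pairs_aestronglyMeasurable (ht : IsTime μ tm) (hF : AEStronglyMeasurable (onTables F)
      (𝔱[T].prod 𝔪)) :
    ∀ᵐ ϰ ∂𝔪, ∀ cd ∈ pairsBefore tm T (pts ϰ), AEStronglyMeasurable (fun y => F y cd.1 cd.2 (pts ϰ))
        (𝔪[T].prod 𝔪[T]) := by
  have h := ae_sum_pairs ht T (P := fun c d R => AEStronglyMeasurable
    (fun y => F y c d (R ∪ (c ∪ d))) (𝔪[T].prod 𝔪[T]))
    (aestronglyMeasurable_rearranged hF).prodMk_left
  filter_upwards [h] with ϰ hϰ cd hcd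
  have := hϰ cd hcd
  rwa [pairs_union hcd] at this

end

/-- The outputs of the table are merged with the further chain, and only the other two entries
remain to be integrated. -/
theorem lintegral_onTables (ht : IsTime μ tm) {F : ℭ × ℭ → Finset X → Finset X → Finset X → ℝ≥0∞}
    (hF : AEMeasurable (onTables F) (𝔱[T].prod 𝔪)) :
    AEMeasurable (fun ϰ : ℭ => ∑ cd ∈ pairsBefore tm T (pts ϰ),
      ∫⁻ y, F y cd.1 cd.2 (pts ϰ) ∂𝔪[T].prod 𝔪[T]) 𝔪 ∧ ∫⁻ w, onTables F w ∂𝔱[T].prod 𝔪 =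
      ∫⁻ ϰ, ∑ cd ∈ pairsBefore tm T (pts ϰ), ∫⁻ y, F y cd.1 cd.2 (pts ϰ) ∂𝔪[T].prod 𝔪[T] ∂𝔪 := by
  have hmp := measurePreserving_rearrange_tables (μ := μ) (tm := tm) T
  have h1 := (aestronglyMeasurable_rearranged hF.aestronglyMeasurable).aemeasurable
  have h2 := h1.lintegral_prod_right'
  have hsum : ∀ ϰ : ℭ, ∑ cd ∈ pairsBefore tm T (pts ϰ), ∫⁻ y, F y cd.1 cd.2 (pts ϰ)
      ∂𝔪[T].prod 𝔪[T] =
      ∑ cd ∈ pairsBefore tm T (pts ϰ), ∫⁻ y, F y cd.1 cd.2 (((pts ϰ \ cd.1) \ cd.2) ∪ (cd.1 ∪ cd.2))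
      ∂𝔪[T].prod 𝔪[T] := fun ϰ =>
    Finset.sum_congr rfl fun cd hcd => by rw [pairs_union hcd]
  have h3 := (aestronglyMeasurable_sum_pairs ht T (F := fun c d R =>
    ∫⁻ y, F y c d (R ∪ (c ∪ d)) ∂𝔪[T].prod 𝔪[T])
    h2.aestronglyMeasurable).aemeasurable
  have h4 := lintegral_sum_pairs ht T (F := fun c d R =>
    ∫⁻ y, F y c d (R ∪ (c ∪ d)) ∂𝔪[T].prod 𝔪[T]) h2
  simp only [hsum]
  refine ⟨h3, ?_⟩
  rw [← h4, ← hmp.map_eq, lintegral_map' (f := onTables F) (by rwa [hmp.map_eq])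
      hmp.measurable.aemeasurable]
  exact lintegral_prod (f := fun w : (ℭ × ℭ × ℭ) × ℭ × ℭ =>
      F w.2 (pts w.1.1) (pts w.1.2.1) (pts w.1.2.2 ∪ (pts w.1.1 ∪ pts w.1.2.1))) h1

variable [NormedAddCommGroup E] [NormedSpace ℝ E] [CompleteSpace E]

theorem aestronglyMeasurable_integral_onTables (ht : IsTime μ tm) (hF : AEStronglyMeasurable (onTables F)
      (𝔱[T].prod 𝔪)) : AEStronglyMeasurable (fun ϰ : ℭ => ∑ cd ∈ pairsBefore tm T (pts ϰ),
      ∫ y, F y cd.1 cd.2 (pts ϰ) ∂𝔪[T].prod 𝔪[T]) 𝔪 := by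
  have h2 := (aestronglyMeasurable_rearranged hF).integral_prod_right'
  have h3 := aestronglyMeasurable_sum_pairs ht T (F := fun c d R =>
    ∫ y, F y c d (R ∪ (c ∪ d)) ∂𝔪[T].prod 𝔪[T]) h2
  refine h3.congr (.of_forall fun ϰ => ?_)
  exact Finset.sum_congr rfl fun cd hcd => by rw [pairs_union hcd]

theorem integral_onTables (ht : IsTime μ tm) (hF : Integrable (onTables F) (𝔱[T].prod 𝔪)) :
    ∫ w, onTables F w ∂𝔱[T].prod 𝔪 =
      ∫ ϰ, ∑ cd ∈ pairsBefore tm T (pts ϰ), ∫ y, F y cd.1 cd.2 (pts ϰ) ∂𝔪[T].prod 𝔪[T] ∂𝔪 := by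
  have hmp := measurePreserving_rearrange_tables (μ := μ) (tm := tm) T
  have h1 : Integrable (fun w : (ℭ × ℭ × ℭ) × ℭ × ℭ =>
      F w.2 (pts w.1.1) (pts w.1.2.1) (pts w.1.2.2 ∪ (pts w.1.1 ∪ pts w.1.2.1)))
      ((tripleMeasure μ tm T).prod (𝔪[T].prod 𝔪[T])) :=
    hmp.integrable_comp_of_integrable hF
  have h4 := integral_sum_pairs ht T (F := fun c d R => ∫ y, F y c d (R ∪ (c ∪ d)) ∂𝔪[T].prod 𝔪[T])
    h1.integral_prod_left
  rw [← hmp.map_eq, integral_map (f := onTables F) hmp.measurable.aemeasurable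
      (by rw [hmp.map_eq]; exact hF.aestronglyMeasurable)]
  refine (integral_prod (f := fun w : (ℭ × ℭ × ℭ) × ℭ × ℭ =>
      F w.2 (pts w.1.1) (pts w.1.2.1) (pts w.1.2.2 ∪ (pts w.1.1 ∪ pts w.1.2.1))) h1).trans
      (h4.trans (integral_congr_ae (.of_forall fun ϰ => ?_)))
  exact Finset.sum_congr rfl fun cd hcd => by rw [pairs_union hcd]

end Rearrangement

/-! ### Integrands of the multiple integral -/
section Integrands

variable (μ tm e) in
/-- The norm `‖A‖_{p,T}^s(r)` of a kernel with additional tensor factors `K^⊗(σ)` and `K^⊗(τ)`. -/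
def kernelNorm (p r s : X → ℝ≥0) (T : ℝ≥0) (σ τ : Finset X) (A : Kernel K) : ℝ≥0∞ :=
  ∫⁻ a, (∫⁻ b, ∫⁻ c, essSup (fun d => ((wt s (pts d) : ℝ≥0∞) *
        opNorm μ tm e p ((ofChains (a, b, c, d)).inp ∪ σ) ((ofChains (a, b, c, d)).out ∪ τ)
          (A (ofChains (a, b, c, d)))) ^ 2) 𝔪[T] *
        (wt r (pts c ∪ pts b) : ℝ≥0∞)
      ∂𝔪[T] ∂𝔪[T]) ^ (1 / 2 : ℝ)
    ∂𝔪[T]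

theorem kernelNorm_empty (p r s : X → ℝ≥0) (T : ℝ≥0) (A : Kernel K) :
    kernelNorm μ tm e p r s T ∅ ∅ A = multiNorm μ tm e p r s T A := by
  simp only [kernelNorm, multiNorm, Finset.union_empty]

variable (μ) in
/-- The positivity and measurability of the weights `p`, `r`, `s`. -/
structure AreWeights (p r s : X → ℝ≥0) : Prop where
  p : IsWeight μ p
  r : IsWeight μ r
  s : IsWeight μ s

/-- The kernels to which the construction of the multiple integral up to time `T` applies. -/
structure IsIntegrand (R : Regular μ tm e) (p r s : X → ℝ≥0) (T : ℝ≥0) (σ τ : Finset X)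
    (A : Kernel K) : Prop where
  left : Set.InjOn tm σ
  right : Set.InjOn tm τ
  field : IsOpField μ tm R.field 𝔱[T] p
    (fun z => (ofChains z).inp ∪ σ) (fun z => (ofChains z).out ∪ τ)
    fun z => A (ofChains z)
  finite : kernelNorm μ tm e p r s T σ τ A < ∞

/-- The Cauchy-Schwarz inequality for the duality of the weights `p⁻¹` and `p`. -/
theorem lintegral_enorm_mul_le (R : Regular μ tm e) {p : X → ℝ≥0} (hp : IsWeight μ p)
    {ρ : Finset X} (hρ : Set.InjOn tm ρ) {g : Sec K} (hg : MemFock μ tm e p⁻¹ ρ g)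
    (ψ : ℭ → ℝ≥0∞) : ∫⁻ ϰ, ‖g (pts ϰ ∪ ρ)‖ₑ * ψ ϰ ∂𝔪 ≤ fockNorm μ tm p⁻¹ ρ g *
        (∫⁻ ϰ, ψ ϰ ^ 2 * (wt p (pts ϰ) : ℝ≥0∞) ∂𝔪) ^ (1 / 2 : ℝ) := by
  have h1 : AEMeasurable (fun ϰ : ℭ => ‖g (pts ϰ ∪ ρ)‖ₑ) 𝔪 := by
    have := ((isEssMeasurable_iff R.field R.time.measurable
      (chainLike_union_const R.time hρ)).1 hg.1).enorm
    simpa only [LinearIsometry.enorm_map] using this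
  have h2 : AEMeasurable (fun ϰ : ℭ => ‖g (pts ϰ ∪ ρ)‖ₑ ^ 2 * (wt p⁻¹ (pts ϰ) : ℝ≥0∞))
      𝔪 := (h1.pow_const 2).mul
    (aemeasurable_wt R.time.measurable hp.inv.aemeasurable).coe_nnreal_ennreal
  have h3 := lintegral_sqrt_mul_le (m := 𝔪) (fun ϰ => ψ ϰ ^ 2 * (wt p (pts ϰ) : ℝ≥0∞)) h2 (by
      rw [← fockNorm_sq]; exact (ENNReal.pow_lt_top hg.2).ne)
  refine le_trans (le_of_eq (lintegral_congr fun ϰ => ?_)) (h3.trans (le_of_eq ?_))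
  · rw [sqrt_mul, sqrt_mul, sq_sqrt, sq_sqrt]
    have h4 : (wt p (pts ϰ) : ℝ≥0∞) ^ (1 / 2 : ℝ) * ((wt p⁻¹ (pts ϰ) : ℝ≥0) : ℝ≥0∞) ^ (1 / 2 : ℝ) = 1 := by
      rw [← sqrt_mul, wt_inv, ← ENNReal.coe_mul, mul_inv_cancel₀ (hp.wt_pos _).ne']
      simp
    calc ‖g (pts ϰ ∪ ρ)‖ₑ * ψ ϰ = ‖g (pts ϰ ∪ ρ)‖ₑ * ψ ϰ * 1 := (mul_one _).symm
      _ = _ := by rw [← h4]; ring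
  · rw [fockNorm, mul_comm]

theorem aemeasurable_enorm (R : Regular μ tm e) (hσ : Set.InjOn tm σ)
    (hh : IsEssMeasurable e 𝔪 (fun ϰ => pts ϰ ∪ σ) (fun ϰ => h (pts ϰ ∪ σ))) :
    AEMeasurable (fun ϰ : ℭ => ‖h (pts ϰ ∪ σ)‖ₑ) 𝔪 := by
  have := ((isEssMeasurable_iff R.field R.time.measurable
      (chainLike_union_const R.time hσ)).1 hh).enorm
  simpa only [LinearIsometry.enorm_map] using this

theorem scalarNorm_enorm (p : X → ℝ≥0) (σ β : Finset X) (h : Sec K) :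
    scalarNorm μ tm p (fun ω => ‖h (ω ∪ σ)‖ₑ) β = fockNorm μ tm p (β ∪ σ) h := by
  rw [scalarNorm, fockNorm]
  congr 1
  refine lintegral_congr fun ϰ => ?_
  rw [Finset.union_assoc]

variable {p r s q : X → ℝ≥0} {T : ℝ≥0} {σ τ : Finset X} {A : Kernel K}

theorem kernelNorm_eq (ht : IsTime μ tm)
    (p r s : X → ℝ≥0) (T : ℝ≥0) (σ τ : Finset X) (A : Kernel K) :
    kernelNorm μ tm e p r s T σ τ A = ∫⁻ a, (∫⁻ b, ∫⁻ c, essSup (fun d => ((wt s (pts d) : ℝ≥0∞) *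
        opNorm μ tm e p ((ofChains (a, b, c, d)).inp ∪ σ) ((ofChains (a, b, c, d)).out ∪ τ)
          (A (ofChains (a, b, c, d)))) ^ 2) 𝔪[T] * (wt r (pts c) * wt r (pts b) : ℝ≥0∞)
      ∂𝔪[T] ∂𝔪[T]) ^ (1 / 2 : ℝ) ∂𝔪[T] := by
  have h1 := ae_ae_of_ae_prod
    ((quasiMeasurePreserving_prod_before (μ := μ) (tm := tm) T).ae (ae_apart μ ht))
  refine lintegral_congr fun a => ?_
  congr 1
  refine lintegral_congr_ae ?_
  filter_upwards [h1] with b hb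
  refine lintegral_congr_ae ?_
  filter_upwards [hb] with c hc
  have h2 : Apart tm (pts b) (pts c) := hc
  rw [wt_union r h2.symm, ENNReal.coe_mul]

/-- Derivatives of elements of `F(q)` at almost all tables lie in `F(p)`. -/
theorem ae_memFock_inp (R : Regular μ tm e) (hw : AreWeights μ p r s)
    (hle : r⁻¹ + p + s⁻¹ ≤ q) (T : ℝ≥0) (hσ : Set.InjOn tm σ) (hh : MemFock μ tm e q σ h) :
    ChainLike 𝔱[T] tm (fun z => (ofChains z).inp ∪ σ) ∧
    JointlyMeasurable μ tm e 𝔱[T] (fun z => (ofChains z).inp ∪ σ) (fun _ => h) ∧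
    ∀ᵐ z ∂𝔱[T], MemFock μ tm e p ((ofChains z).inp ∪ σ) h := by
  have hT := quasiMeasurePreserving_table_before (μ := μ) (tm := tm) T
  obtain ⟨h1, h2⟩ := jointlyMeasurable_union_const R hσ hh.1
    ((quasiMeasurePreserving_inpChain R.time).comp hT)
    (hT.ae (ae_inp_eq R.time))
  refine ⟨h1, h2, ?_⟩
  have hfin : ∫⁻ ϰ, ‖h (pts ϰ ∪ σ)‖ₑ ^ 2 * (wt q (pts ϰ) : ℝ≥0∞) ∂𝔪 ≠ ∞ := by
    rw [← fockNorm_sq]; exact (ENNReal.pow_lt_top hh.2).ne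
  have h3 := (quasiMeasurePreserving_inpPair _).ae (ae_scalarNorm_lt_top R.time hw.p hw.r hw.s hle T (φ := fun ω => ‖h (ω ∪ σ)‖ₑ) (aemeasurable_enorm R hσ hh.1) hfin)
  have h4 := ((jointlyMeasurable_iff R h1).1 h2).prodMk_left
  filter_upwards [h3, h4, h1.injOn] with z h5 h6 h7
  refine ⟨?_, ?_⟩
  · exact (isEssMeasurable_iff R.field R.time.measurable
      (chainLike_union_const R.time h7)).2 h6
  · rw [scalarNorm_enorm] at h5
    exact h5

theorem chainLike_out_union (R : Regular μ tm e) (T : ℝ≥0) (hσ : Set.InjOn tm σ) :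
    ChainLike 𝔱[T] tm (fun z => (ofChains z).out ∪ σ) := by
  have hT := quasiMeasurePreserving_table_before (μ := μ) (tm := tm) T
  refine (((chainLike_union_const R.time hσ).comp
    (quasiMeasurePreserving_outChain R.time)).comp hT).congr ?_
  filter_upwards [hT.ae (ae_out_eq R.time)] with z hz
  simp only [id_eq] at hz ⊢
  rw [hz]

/-- `Φ` is a jointly measurable version of `ϑ ↦ A ϑ h`. -/
structure IsVersion (μ : Measure X) (tm : X → ℝ≥0) (e : ℕ → ∀ x, K x) (T : ℝ≥0) (τ : Finset X)
    (A : Kernel K) (h : Sec K) (Φ : Table X → Sec K) : Prop where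
  measurable : IsJointlyMeasurable μ tm e (chainMeasureBefore μ tm T) (fun ϑ => ϑ.out ∪ τ) Φ
  eqFock : ∀ᵐ z ∂tableMeasure tm (chainMeasureBefore μ tm T),
    EqFock μ tm ((ofChains z).out ∪ τ) (Φ (ofChains z)) (A (ofChains z) h)

theorem IsIntegrand.exists_version [IsSeparable μ] {R : Regular μ tm e} (hw : AreWeights μ p r s)
    (hle : r⁻¹ + p + s⁻¹ ≤ q) (hA : IsIntegrand R p r s T σ τ A)
    (hh : MemFock μ tm e q σ h) : ∃ Φ, IsVersion μ tm e T τ A h Φ := by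
  obtain ⟨-, h2, h3⟩ := ae_memFock_inp R hw hle T hA.left hh
  obtain ⟨Φ, h4, h5⟩ := hA.field.exists_version R hw.p h2 h3
  obtain ⟨Φ', hE⟩ := exists_table_extension (K := K) Φ
  refine ⟨Φ', ?_, by simpa only [hE] using h5⟩
  rw [isJointlyMeasurable_iff]
  exact jointlyMeasurable_congr h4 (fun _ => rfl) fun z => (hE z).symm

theorem memFock_version {R : Regular μ tm e} (hw : AreWeights μ p r s)
    (hle : r⁻¹ + p + s⁻¹ ≤ q) (hA : IsIntegrand R p r s T σ τ A)
    (hh : MemFock μ tm e q σ h) {Φ : Table X → Sec K} (hΦ : IsVersion μ tm e T τ A h Φ) :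
    ∀ᵐ z ∂𝔱[T], MemFock μ tm e p⁻¹ ((ofChains z).out ∪ τ) (Φ (ofChains z)) ∧
      fockNorm μ tm p⁻¹ ((ofChains z).out ∪ τ) (Φ (ofChains z)) ≤
        opNorm μ tm e p ((ofChains z).inp ∪ σ) ((ofChains z).out ∪ τ)
          (A (ofChains z)) * fockNorm μ tm p ((ofChains z).inp ∪ σ) h := by
  obtain ⟨-, -, h3⟩ := ae_memFock_inp R hw hle T hA.left hh
  filter_upwards [h3, hΦ.eqFock, hA.field.isOperator] with z h4 h5 h6
  refine ⟨h5.symm.memFock (h6.maps _ h4), ?_⟩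
  rw [h5.fockNorm_eq]
  exact h6.fockNorm_le h4

/-- The basic estimate of the integrand against a square integrable scalar function. -/
theorem lintegral_version_le {R : Regular μ tm e} (hw : AreWeights μ p r s)
    (hle : r⁻¹ + p + s⁻¹ ≤ q) (hA : IsIntegrand R p r s T σ τ A)
    (hh : MemFock μ tm e q σ h) {Φ : Table X → Sec K} (hΦ : IsVersion μ tm e T τ A h Φ)
    {φ : Finset X → ℝ≥0∞} (hφ : AEMeasurable (fun ϰ : ℭ => φ (pts ϰ)) 𝔪)
    (hfin : ∫⁻ ϰ, φ (pts ϰ) ^ 2 * (wt q (pts ϰ) : ℝ≥0∞) ∂𝔪 ≠ ∞) :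
    ∫⁻ z, ∫⁻ ϰ, ‖Φ (ofChains z) (pts ϰ ∪ ((ofChains z).out ∪ τ))‖ₑ * φ (pts ϰ ∪ (ofChains z).out) ∂𝔪
      ∂𝔱[T] ≤ kernelNorm μ tm e p r s T σ τ A * fockNorm μ tm q σ h *
        (∫⁻ ϰ, φ (pts ϰ) ^ 2 * (wt q (pts ϰ) : ℝ≥0∞) ∂𝔪) ^ (1 / 2 : ℝ) := by
  set m := 𝔪[T] with hm
  have hfinh : ∫⁻ ϰ, ‖h (pts ϰ ∪ σ)‖ₑ ^ 2 * (wt q (pts ϰ) : ℝ≥0∞) ∂𝔪 ≠ ∞ := by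
    rw [← fockNorm_sq]; exact (ENNReal.pow_lt_top hh.2).ne
  obtain ⟨hH1, hH2⟩ := scalarNorm_sections R.time hw.p hw.r hw.s hle T
    (φ := fun ω => ‖h (ω ∪ σ)‖ₑ) (aemeasurable_enorm R hA.left hh.1)
  obtain ⟨hG1, hG2⟩ := scalarNorm_sections R.time hw.p hw.r hw.s hle T hφ
  let k : ℭ → ℭ → ℭ → ℭ → ℝ≥0∞ := fun a b c d =>
    opNorm μ tm e p ((ofChains (a, b, c, d)).inp ∪ σ)
      ((ofChains (a, b, c, d)).out ∪ τ) (A (ofChains (a, b, c, d)))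
  let H : ℭ → ℭ → ℝ≥0∞ := fun b d =>
    scalarNorm μ tm p (fun ω => ‖h (ω ∪ σ)‖ₑ) (pts b ∪ pts d)
  let G : ℭ → ℭ → ℝ≥0∞ := fun c d => scalarNorm μ tm p φ (pts c ∪ pts d)
  have hT := quasiMeasurePreserving_before (μ := μ) (tm := tm) T
  -- the basic estimate for the norms of the derivatives of `h` at `b ⊔ d` and of `φ` at `c ⊔ d`
  have h1 := lintegral_kernel_le (m := m) k (ρ := fun c => wt r (pts c)) (ς := fun d => wt s (pts d))
    ((aemeasurable_wt R.time.measurable hw.r.aemeasurable).comp_quasiMeasurePreserving hT)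
    ((aemeasurable_wt R.time.measurable hw.s.aemeasurable).comp_quasiMeasurePreserving hT)
    (fun c => hw.r.wt_pos _) (fun c => hw.s.wt_pos _) (H := H) (G := G) hH1 hG1
    (hH2.trans_lt hfinh.lt_top).ne (hG2.trans_lt hfin.lt_top).ne
  have h2 : ∫⁻ z, ∫⁻ ϰ, ‖Φ (ofChains z) (pts ϰ ∪ ((ofChains z).out ∪ τ))‖ₑ *
        φ (pts ϰ ∪ (ofChains z).out) ∂𝔪 ∂tableMeasure tm m ≤
      ∫⁻ z : 𝕋, k z.1 z.2.1 z.2.2.1 z.2.2.2 *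
        H z.2.1 z.2.2.2 * G z.2.2.1 z.2.2.2 ∂tableMeasure tm m := by
    refine lintegral_mono_ae ?_
    filter_upwards [memFock_version hw hle hA hh hΦ, hA.field.right.injOn] with z hz hz'
    refine (lintegral_enorm_mul_le R hw.p hz' hz.1 (fun ϰ => φ (pts ϰ ∪ (ofChains z).out))).trans ?_
    refine mul_le_mul' (hz.2.trans (mul_le_mul' le_rfl ?_)) le_rfl
    rw [← scalarNorm_enorm]
    exact le_rfl
  have h3 : ∫⁻ z : 𝕋, k z.1 z.2.1 z.2.2.1 z.2.2.2 *
        H z.2.1 z.2.2.2 * G z.2.2.1 z.2.2.2 ∂tableMeasure tm m ≤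
      ∫⁻ a, ∫⁻ b, ∫⁻ c, ∫⁻ d, k a b c d * H b d * G c d ∂m ∂m ∂m ∂m := by
    refine (lintegral_prod_le _).trans (lintegral_mono fun a => ?_)
    refine (lintegral_prod_le _).trans (lintegral_mono fun b => ?_)
    exact lintegral_prod_le _
  refine h2.trans (h3.trans (h1.trans ?_))
  rw [kernelNorm_eq R.time, fockNorm]
  gcongr

end Integrands

/-! ### The multiple integral -/
section MultiIntegrals

variable {p r s q : X → ℝ≥0} {T : ℝ≥0} {σ τ : Finset X} {A : Kernel K}

theorem aestronglyMeasurable_pts_out (ht : IsTime μ tm) (T : ℝ≥0) {E : Type*} [TopologicalSpace E]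
    {k : Finset X → E} (hk : AEStronglyMeasurable (fun ϰ : ℭ => k (pts ϰ)) 𝔪) :
    AEStronglyMeasurable (fun w : 𝕋 × ℭ => k (pts w.2 ∪ (ofChains w.1).out)) (𝔱[T].prod 𝔪) := by
  have hT := quasiMeasurePreserving_table_before (μ := μ) (tm := tm) T
  have h1 := quasiMeasurePreserving_prodMap ((quasiMeasurePreserving_outChain ht).comp hT) (.id 𝔪)
  refine ((aestronglyMeasurable_pts_union μ ht hk).comp_quasiMeasurePreserving h1).congr ?_
  have h2 := quasiMeasurePreserving_fst.ae (μa := 𝔱[T].prod 𝔪)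
    (hT.ae (ae_out_eq ht))
  filter_upwards [h2] with w hw
  simp only [id_eq] at hw
  simp only [Function.comp_apply, Prod.map, id_eq]
  rw [hw, Finset.union_comm]

/-- The coordinates of the integrand, as a function on tables. -/
def efKernel (tm : X → ℝ≥0) (he : IsFundamental e) (τ : Finset X)
    (Φ : Table X → Sec K) (y : Chain tm × Chain tm) (c d ω : Finset X) : SeqSpace :=
  ef tm he (Φ ⟨pts y.1, pts y.2, c, d⟩) (ω ∪ τ)

theorem onTables_efKernel (he : IsFundamental e) (τ : Finset X) (Φ : Table X → Sec K) (w : 𝕋 × ℭ) :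
    onTables (efKernel tm he τ Φ) w =
      ef tm he (Φ (ofChains w.1)) (pts w.2 ∪ ((ofChains w.1).out ∪ τ)) := by
  rw [← Finset.union_assoc]
  rfl

theorem IsVersion.aestronglyMeasurable (R : Regular μ tm e) (hτ : Set.InjOn tm τ)
    {Φ : Table X → Sec K} (hΦ : IsVersion μ tm e T τ A h Φ) :
    AEStronglyMeasurable (onTables (efKernel tm R.field τ Φ)) (𝔱[T].prod 𝔪) := by
  have h1 := hΦ.measurable
  rw [isJointlyMeasurable_iff, jointlyMeasurable_iff R (chainLike_out_union R T hτ)] at h1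
  exact h1.congr (.of_forall fun w => (onTables_efKernel _ _ _ _).symm)

variable (μ tm) in
/-- The sum of the absolute values of the multiple integral. -/
def absSum (T : ℝ≥0) (τ : Finset X) (Φ : Table X → Sec K) (ω : Finset X) : ℝ≥0∞ :=
  ∑ cd ∈ pairsBefore tm T ω, ∫⁻ y : ℭ × ℭ, ‖Φ ⟨pts y.1, pts y.2, cd.1, cd.2⟩ (ω ∪ τ)‖ₑ
      ∂𝔪[T].prod 𝔪[T]

theorem aemeasurable_absSum (R : Regular μ tm e) (hτ : Set.InjOn tm τ)
    {Φ : Table X → Sec K} (hΦ : IsVersion μ tm e T τ A h Φ) :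
    AEMeasurable (fun ϰ : ℭ => absSum μ tm T τ Φ (pts ϰ)) 𝔪 := by
  have h1 := (lintegral_onTables R.time (T := T) (F := fun y c d ω =>
    ‖efKernel tm R.field τ Φ y c d ω‖ₑ) (hΦ.aestronglyMeasurable R hτ).enorm).1
  simpa only [efKernel, enorm_ef, absSum] using h1

theorem lintegral_absSum_mul_le {R : Regular μ tm e} (hw : AreWeights μ p r s)
    (hle : r⁻¹ + p + s⁻¹ ≤ q) (hA : IsIntegrand R p r s T σ τ A)
    (hh : MemFock μ tm e q σ h) {Φ : Table X → Sec K} (hΦ : IsVersion μ tm e T τ A h Φ)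
    {f : ℭ → ℝ≥0∞} (hf : AEMeasurable f 𝔪) (hfin : ∫⁻ ϰ, f ϰ ^ 2 * (wt q (pts ϰ) : ℝ≥0∞) ∂𝔪 ≠ ∞) :
    ∫⁻ ϰ, absSum μ tm T τ Φ (pts ϰ) * f ϰ ∂𝔪 ≤
      kernelNorm μ tm e p r s T σ τ A * fockNorm μ tm q σ h *
        (∫⁻ ϰ, f ϰ ^ 2 * (wt q (pts ϰ) : ℝ≥0∞) ∂𝔪) ^ (1 / 2 : ℝ) := by
  set φ : Finset X → ℝ≥0∞ := fun ω => f (chainOf tm ω) with hφ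
  have hφp : ∀ ϰ, φ (pts ϰ) = f ϰ := fun ϰ => by rw [hφ]; simp only [chainOf_pts]
  have hφm : AEMeasurable (fun ϰ : ℭ => φ (pts ϰ)) 𝔪 := by
    simpa only [hφp] using hf
  have h1 := lintegral_version_le hw hle hA hh hΦ hφm (by simpa only [hφp] using hfin)
  simp only [hφp] at h1
  refine le_trans (le_of_eq ?_) h1
  have hm : AEMeasurable (onTables fun (y : ℭ × ℭ) c d ω =>
      ‖efKernel tm R.field τ Φ y c d ω‖ₑ * φ ω)
      (𝔱[T].prod 𝔪) :=
    (hΦ.aestronglyMeasurable R hA.right).enorm.mul (aestronglyMeasurable_pts_out R.time T hφm.aestronglyMeasurable).aemeasurable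
  have h2 := (lintegral_onTables R.time hm).2
  rw [lintegral_prod _ hm] at h2
  have h3 : ∀ w : 𝕋 × ℭ, onTables (fun (y : ℭ × ℭ) c d ω =>
        ‖efKernel tm R.field τ Φ y c d ω‖ₑ * φ ω) w =
      ‖Φ (ofChains w.1) (pts w.2 ∪ ((ofChains w.1).out ∪ τ))‖ₑ *
        φ (pts w.2 ∪ (ofChains w.1).out) := fun w => by
    have := onTables_efKernel R.field τ Φ w
    rw [← enorm_ef R.field, ← this]
    rfl
  simp only [h3] at h2
  rw [h2]
  refine lintegral_congr_ae ?_
  filter_upwards [ae_pairs_aestronglyMeasurable R.time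
    (hΦ.aestronglyMeasurable R hA.right)] with ϰ hϰ
  rw [absSum, Finset.sum_mul]
  refine Finset.sum_congr rfl fun cd hcd => ?_
  have h4 := (hϰ cd hcd).enorm
  simp only [efKernel, enorm_ef] at h4 ⊢
  rw [hφp]
  exact (lintegral_mul_const'' _ h4).symm

/-- Absolute convergence of the multiple integral, by duality. -/
theorem lintegral_absSum_sq_le {R : Regular μ tm e} (hw : AreWeights μ p r s)
    (hq : IsWeight μ q) (hle : r⁻¹ + p + s⁻¹ ≤ q) (hA : IsIntegrand R p r s T σ τ A)
    (hh : MemFock μ tm e q σ h) {Φ : Table X → Sec K} (hΦ : IsVersion μ tm e T τ A h Φ) :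
    ∫⁻ ϰ, absSum μ tm T τ Φ (pts ϰ) ^ 2 * (wt q⁻¹ (pts ϰ) : ℝ≥0∞) ∂𝔪 ≤
      (kernelNorm μ tm e p r s T σ τ A * fockNorm μ tm q σ h) ^ 2 := by
  have h1 := lintegral_sq_div_le_of_dual (aemeasurable_absSum R hA.right hΦ)
    (aemeasurable_wt R.time.measurable hq.aemeasurable) (fun ϰ => hq.wt_pos (pts ϰ))
    fun f hf hfin => lintegral_absSum_mul_le hw hle hA hh hΦ hf hfin
  refine le_trans (le_of_eq (lintegral_congr fun ϰ => ?_)) h1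
  rw [wt_inv, ENNReal.coe_inv (hq.wt_pos _).ne']

theorem ae_absSum_lt_top {R : Regular μ tm e} (hw : AreWeights μ p r s)
    (hq : IsWeight μ q) (hle : r⁻¹ + p + s⁻¹ ≤ q) (hA : IsIntegrand R p r s T σ τ A)
    (hh : MemFock μ tm e q σ h) {Φ : Table X → Sec K} (hΦ : IsVersion μ tm e T τ A h Φ) :
    ∀ᵐ ϰ ∂𝔪, absSum μ tm T τ Φ (pts ϰ) < ∞ := by
  have h1 := lintegral_absSum_sq_le hw hq hle hA hh hΦ
  have h2 := ((aemeasurable_absSum R hA.right hΦ).pow_const 2).mul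
    (aemeasurable_wt R.time.measurable hq.inv.aemeasurable).coe_nnreal_ennreal
  filter_upwards [ae_lt_top' h2 (h1.trans_lt (ENNReal.pow_lt_top
    (ENNReal.mul_lt_top hA.finite hh.2))).ne] with ϰ hϰ
  refine lt_top_iff_ne_top.2 fun h => ?_
  have h0 : (wt q⁻¹ (pts ϰ) : ℝ≥0∞) ≠ 0 := by exact_mod_cast (hq.inv.wt_pos (pts ϰ)).ne'
  simp only [Pi.mul_apply, h, ENNReal.top_pow two_ne_zero, ENNReal.top_mul h0] at hϰ
  exact lt_irrefl _ hϰ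

theorem ae_integrable_version {R : Regular μ tm e} (hw : AreWeights μ p r s)
    (hq : IsWeight μ q) (hle : r⁻¹ + p + s⁻¹ ≤ q) (hA : IsIntegrand R p r s T σ τ A)
    (hh : MemFock μ tm e q σ h) {Φ : Table X → Sec K} (hΦ : IsVersion μ tm e T τ A h Φ) :
    ∀ᵐ ϰ ∂𝔪, ∀ cd ∈ pairsBefore tm T (pts ϰ),
      Integrable (fun y : ℭ × ℭ => Φ ⟨pts y.1, pts y.2, cd.1, cd.2⟩ (pts ϰ ∪ τ))
        (𝔪[T].prod 𝔪[T]) := by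
  filter_upwards [ae_pairs_aestronglyMeasurable R.time
    (hΦ.aestronglyMeasurable R hA.right), ae_absSum_lt_top hw hq hle hA hh hΦ] with ϰ h1 h2 cd hcd
  refine ⟨?_, ?_⟩
  · exact (enc tm R.field (pts ϰ ∪ τ)).isometry.isEmbedding.aestronglyMeasurable_comp_iff.1
      (h1 cd hcd)
  · rw [HasFiniteIntegral]
    exact lt_of_le_of_lt (Finset.single_le_sum (f := fun cd => ∫⁻ y : ℭ × ℭ,
      ‖Φ ⟨pts y.1, pts y.2, cd.1, cd.2⟩ (pts ϰ ∪ τ)‖ₑ ∂𝔪[T].prod 𝔪[T]) (fun _ _ => zero_le) hcd) h2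

variable (μ tm) in
/-- The value at `ω ⊔ τ` of the multiple integral of `Φ`. -/
def pairSum (T : ℝ≥0) (τ : Finset X) (Φ : Table X → Sec K) (ω : Finset X) :
    HilbertTensor fun x : (ω ∪ τ : Finset X) => K x :=
  ∑ cd ∈ pairsBefore tm T ω, ∫ y : ℭ × ℭ, Φ ⟨pts y.1, pts y.2, cd.1, cd.2⟩ (ω ∪ τ)
      ∂𝔪[T].prod 𝔪[T]

theorem hasMultiIntegral_iff {h g : Sec K} : HasMultiIntegral μ tm e T τ A h g ↔
    ∃ Φ, IsVersion μ tm e T τ A h Φ ∧ ∀ᵐ ϰ ∂𝔪, (∀ cd ∈ pairsBefore tm T (pts ϰ),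
        Integrable (fun y : ℭ × ℭ => Φ ⟨pts y.1, pts y.2, cd.1, cd.2⟩ (pts ϰ ∪ τ))
        (𝔪[T].prod 𝔪[T])) ∧ g (pts ϰ ∪ τ) = pairSum μ tm T τ Φ (pts ϰ) := by
  refine exists_congr fun Φ => ⟨fun ⟨h1, h2, h3⟩ => ⟨⟨h1, h2⟩, ?_⟩, fun ⟨⟨h1, h2⟩, h3⟩ =>
    ⟨h1, h2, ?_⟩⟩
  · filter_upwards [h3] with ϰ hϰ
    refine ⟨fun cd hcd => ?_, hϰ.2⟩
    obtain ⟨h4, h5, h6⟩ := mem_pairsBefore.1 (show (cd.1, cd.2) ∈ _ from hcd)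
    refine hϰ.1 _ _ h4.1 h4.2 (fun x hx => ?_) h6
    rcases Finset.mem_union.1 hx with hx | hx
    exacts [h5.1 x hx, h5.2 x hx]
  · filter_upwards [h3] with ϰ hϰ
    refine ⟨fun c d hc hd hT hcd => hϰ.1 (c, d) (mem_pairsBefore.2 ⟨⟨hc, hd⟩, ⟨fun x hx => ?_,
      fun x hx => ?_⟩, hcd⟩), hϰ.2⟩
    exacts [hT x (Finset.mem_union_left _ hx), hT x (Finset.mem_union_right _ hx)]

theorem exists_hasMultiIntegral [IsSeparable μ] {R : Regular μ tm e} (hw : AreWeights μ p r s)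
    (hq : IsWeight μ q) (hle : r⁻¹ + p + s⁻¹ ≤ q) (hA : IsIntegrand R p r s T σ τ A)
    (hh : MemFock μ tm e q σ h) : ∃ g, HasMultiIntegral μ tm e T τ A h g := by
  obtain ⟨Φ, hΦ⟩ := hA.exists_version hw hle hh
  refine ⟨fun ω => ∑ cd ∈ pairsBefore tm T (ω \ τ), ∫ y : ℭ × ℭ,
    Φ ⟨pts y.1, pts y.2, cd.1, cd.2⟩ ω ∂𝔪[T].prod 𝔪[T],
    hasMultiIntegral_iff.2 ⟨Φ, hΦ, ?_⟩⟩
  filter_upwards [ae_integrable_version hw hq hle hA hh hΦ, ae_apart_const μ R.time τ] with ϰ h1 h2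
  refine ⟨h1, ?_⟩
  have : (pts ϰ ∪ τ) \ τ = pts ϰ := by
    rw [Finset.union_sdiff_right, Finset.sdiff_eq_self_of_disjoint h2.disjoint]
  rw [this, pairSum]

theorem ef_pairSum (he : IsFundamental e) {Φ : Table X → Sec K} {ω : Finset X}
    (hi : ∀ cd ∈ pairsBefore tm T ω,
      Integrable (fun y : ℭ × ℭ => Φ ⟨pts y.1, pts y.2, cd.1, cd.2⟩ (ω ∪ τ)) (𝔪[T].prod 𝔪[T])) :
    enc tm he (ω ∪ τ) (pairSum μ tm T τ Φ ω) = ∑ cd ∈ pairsBefore tm T ω,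
      ∫ y, efKernel tm he τ Φ y cd.1 cd.2 ω ∂𝔪[T].prod 𝔪[T] := by
  rw [pairSum, map_sum]
  refine Finset.sum_congr rfl fun cd hcd => ?_
  exact ((enc tm he (ω ∪ τ)).toContinuousLinearMap.integral_comp_comm (hi cd hcd)).symm

theorem enorm_pairSum_le (Φ : Table X → Sec K) (ω : Finset X) :
    ‖pairSum μ tm T τ Φ ω‖ₑ ≤ absSum μ tm T τ Φ ω :=
  (enorm_sum_le _ _).trans (Finset.sum_le_sum fun _ _ => enorm_integral_le_lintegral_enorm _)

/-- The estimate of the multiple integral in the Fock scale. -/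
theorem HasMultiIntegral.memFock {R : Regular μ tm e} (hw : AreWeights μ p r s)
    (hq : IsWeight μ q) (hle : r⁻¹ + p + s⁻¹ ≤ q) (hA : IsIntegrand R p r s T σ τ A) {h g : Sec K}
    (hh : MemFock μ tm e q σ h) (hg : HasMultiIntegral μ tm e T τ A h g) :
    MemFock μ tm e q⁻¹ τ g ∧ fockNorm μ tm q⁻¹ τ g ≤
      kernelNorm μ tm e p r s T σ τ A * fockNorm μ tm q σ h := by
  obtain ⟨Φ, hΦ, H⟩ := hasMultiIntegral_iff.1 hg
  have hn : fockNorm μ tm q⁻¹ τ g ≤ kernelNorm μ tm e p r s T σ τ A * fockNorm μ tm q σ h := by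
    rw [← sq_sqrt (kernelNorm μ tm e p r s T σ τ A * fockNorm μ tm q σ h), fockNorm]
    refine sqrt_le_sqrt (le_trans (lintegral_mono_ae ?_) (lintegral_absSum_sq_le hw hq hle hA hh hΦ))
    filter_upwards [H] with ϰ hϰ
    rw [hϰ.2]
    gcongr
    exact enorm_pairSum_le _ _
  refine ⟨⟨?_, hn.trans_lt (ENNReal.mul_lt_top hA.finite hh.2)⟩, hn⟩
  rw [isEssMeasurable_iff R.field R.time.measurable (chainLike_union_const R.time hA.right)]
  refine (aestronglyMeasurable_integral_onTables R.time
    (hΦ.aestronglyMeasurable R hA.right)).congr ?_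
  filter_upwards [H] with ϰ hϰ
  rw [hϰ.2, ef_pairSum R.field hϰ.1]

/-- The matrix elements of the multiple integral are the integrals over all tables of the matrix
elements of the kernel. -/
theorem HasMultiIntegral.pairing_eq {R : Regular μ tm e} (hw : AreWeights μ p r s)
    (hle : r⁻¹ + p + s⁻¹ ≤ q) (hA : IsIntegrand R p r s T σ τ A) {f h g : Sec K}
    (hf : MemFock μ tm e q τ f) (hh : MemFock μ tm e q σ h)
    (hg : HasMultiIntegral μ tm e T τ A h g) :
    Integrable (fun z => pairing μ tm ((ofChains z).out ∪ τ) f (A (ofChains z) h)) 𝔱[T] ∧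
    pairing μ tm τ f g = ∫ z, pairing μ tm ((ofChains z).out ∪ τ) f (A (ofChains z) h) ∂𝔱[T] := by
  obtain ⟨Φ, hΦ, H⟩ := hasMultiIntegral_iff.1 hg
  let F : ℭ × ℭ → Finset X → Finset X → Finset X → ℂ := fun y c d ω =>
    inner ℂ (f (ω ∪ τ)) (Φ ⟨pts y.1, pts y.2, c, d⟩ (ω ∪ τ))
  have hfe := (isEssMeasurable_iff R.field R.time.measurable
    (chainLike_union_const R.time hA.right)).1 hf.1
  have hF1 : AEStronglyMeasurable (onTables F) (𝔱[T].prod 𝔪) := by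
    have h1 := (aestronglyMeasurable_pts_out R.time T
      (k := fun ω => ef tm R.field f (ω ∪ τ)) hfe).inner (𝕜 := ℂ)
      (hΦ.aestronglyMeasurable R hA.right)
    refine h1.congr (.of_forall fun w => ?_)
    exact inner_ef R.field _ _ _
  have hFw : ∀ w : 𝕋 × ℭ, onTables F w = inner ℂ (f (pts w.2 ∪ ((ofChains w.1).out ∪ τ)))
        (Φ (ofChains w.1) (pts w.2 ∪ ((ofChains w.1).out ∪ τ))) := fun w => by
    rw [← Finset.union_assoc]; rfl
  have hfin : ∫⁻ ϰ, ‖f (pts ϰ ∪ τ)‖ₑ ^ 2 * (wt q (pts ϰ) : ℝ≥0∞) ∂𝔪 ≠ ∞ := by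
    rw [← fockNorm_sq]; exact (ENNReal.pow_lt_top hf.2).ne
  have hF : Integrable (onTables F) (𝔱[T].prod 𝔪) := by
    refine ⟨hF1, ?_⟩
    have h2 := lintegral_version_le hw hle hA hh hΦ (φ := fun ω => ‖f (ω ∪ τ)‖ₑ)
      (aemeasurable_enorm R hA.right hf.1) hfin
    rw [HasFiniteIntegral, lintegral_prod _ hF1.enorm]
    refine lt_of_le_of_lt (lintegral_mono fun z => lintegral_mono fun ϰ => ?_)
      (h2.trans_lt (ENNReal.mul_lt_top (ENNReal.mul_lt_top hA.finite hh.2)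
        (sqrt_ne_top hfin).lt_top))
    simp only [hFw]
    rw [Finset.union_assoc, mul_comm]
    simp only [← ofReal_norm]
    rw [← ENNReal.ofReal_mul (norm_nonneg _)]
    exact ENNReal.ofReal_le_ofReal (norm_inner_le_norm _ _)
  have hz : ∀ᵐ z ∂𝔱[T], ∫ ϰ, onTables F (z, ϰ) ∂𝔪 =
        pairing μ tm ((ofChains z).out ∪ τ) f (A (ofChains z) h) := by
    filter_upwards [hΦ.eqFock] with z hz
    rw [← (EqFock.refl _ f).pairing_eq hz, pairing]
    exact integral_congr_ae (.of_forall fun ϰ => hFw (z, ϰ))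
  refine ⟨hF.integral_prod_left.congr hz, ?_⟩
  rw [← integral_congr_ae hz, ← integral_prod _ hF, integral_onTables R.time hF, pairing]
  refine integral_congr_ae ?_
  filter_upwards [H] with ϰ hϰ
  rw [hϰ.2, pairSum, inner_sum]
  exact Finset.sum_congr rfl fun cd hcd => (integral_inner (hϰ.1 cd hcd) _).symm

end MultiIntegrals

/-! ### The multiple integral as an operator in the Fock scale -/
section MultiIntegralOperator

variable {p r s q : X → ℝ≥0} {T : ℝ≥0} {σ τ : Finset X} {A : Kernel K}

/-- The transposition of tables of chains. -/
def swapTable (z : 𝕋) : 𝕋 := (z.1, z.2.2.1, z.2.1, z.2.2.2)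

theorem measurePreserving_swapTable (m : Measure ℭ) [SigmaFinite m] :
    MeasurePreserving swapTable (tableMeasure tm m) (tableMeasure tm m) := by
  have h1 : MeasurePreserving (MeasurableEquiv.prodAssoc (α := ℭ) (β := ℭ)
      (γ := ℭ)).symm (m.prod (m.prod m)) ((m.prod m).prod m) :=
    (measurePreserving_prodAssoc m m m).symm
  have h2 : MeasurePreserving (Prod.map Prod.swap id) ((m.prod m).prod m) ((m.prod m).prod m) :=
    Measure.measurePreserving_swap.prod (.id m)
  exact (MeasurePreserving.id m).prod ((measurePreserving_prodAssoc m m m).comp (h2.comp h1))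

theorem ae_swapTable {m : Measure ℭ} [SigmaFinite m]
    {P : 𝕋 → Prop} (h : ∀ᵐ z ∂tableMeasure tm m, P z) : ∀ᵐ z ∂tableMeasure tm m, P (swapTable z) :=
  (measurePreserving_swapTable m).quasiMeasurePreserving.ae h

theorem ae_memFock_out (R : Regular μ tm e) (hw : AreWeights μ p r s)
    (hle : r⁻¹ + p + s⁻¹ ≤ q) (T : ℝ≥0) (hτ : Set.InjOn tm τ) {f : Sec K}
    (hf : MemFock μ tm e q τ f) : ∀ᵐ z ∂𝔱[T], MemFock μ tm e p ((ofChains z).out ∪ τ) f :=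
  ae_swapTable (ae_memFock_inp R hw hle T hτ hf).2.2

theorem pairing_add (R : Regular μ tm e) (hq : IsWeight μ q) (hτ : Set.InjOn tm τ)
    {f g g' : Sec K} (hf : MemFock μ tm e q τ f) (hg : MemFock μ tm e q⁻¹ τ g)
    (hg' : MemFock μ tm e q⁻¹ τ g') :
    pairing μ tm τ f (g + g') = pairing μ tm τ f g + pairing μ tm τ f g' := by
  rw [pairing, pairing, pairing,
    ← integral_add (integrable_inner R hq hτ hf hg) (integrable_inner R hq hτ hf hg')]
  simp only [Pi.add_apply, inner_add_right]

theorem pairing_smul (f g : Sec K) (c : ℂ) : pairing μ tm τ f (c • g) = c * pairing μ tm τ f g := by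
  rw [pairing, pairing, ← integral_const_mul]
  simp only [Pi.smul_apply, inner_smul_right]

section
variable [IsSeparable μ]

theorem hasMultiIntegral_multiIntegral {R : Regular μ tm e} (hw : AreWeights μ p r s)
    (hq : IsWeight μ q) (hle : r⁻¹ + p + s⁻¹ ≤ q) (hA : IsIntegrand R p r s T σ τ A)
    (hh : MemFock μ tm e q σ h) :
    HasMultiIntegral μ tm e T τ A h (multiIntegral μ tm e T τ A h) := by
  have H := exists_hasMultiIntegral hw hq hle hA hh
  rw [multiIntegral, dif_pos H]
  exact H.choose_spec

/-- The multiple integral is a bounded operator. Jointly measurable versions of the integrand are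
not chosen linearly, so that linearity is inferred from the matrix elements. -/
theorem isOperator_multiIntegral {R : Regular μ tm e} (hw : AreWeights μ p r s)
    (hq : IsWeight μ q) (hle : r⁻¹ + p + s⁻¹ ≤ q) (hA : IsIntegrand R p r s T σ τ A) :
    IsOperator μ tm e q σ τ (multiIntegral μ tm e T τ A) ∧
    opNorm μ tm e q σ τ (multiIntegral μ tm e T τ A) ≤ kernelNorm μ tm e p r s T σ τ A := by
  have hI := fun {h : Sec K} (hh : MemFock μ tm e q σ h) =>
    hasMultiIntegral_multiIntegral hw hq hle hA hh
  have hM := fun {h : Sec K} (hh : MemFock μ tm e q σ h) => (hI hh).memFock hw hq hle hA hh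
  have hn : opNorm μ tm e q σ τ (multiIntegral μ tm e T τ A) ≤ kernelNorm μ tm e p r s T σ τ A :=
    opNorm_le fun h hh => (hM hh).2
  refine ⟨⟨fun h hh => (hM hh).1, fun h h' hh hh' => ?_, fun c h hh => ?_,
    hn.trans_lt hA.finite⟩, hn⟩
  · have hs := hh.add R hq hA.left hh'
    refine eqFock_of_pairing' R hq hA.right (hM hs).1
      ((hM hh).1.add R hq.inv hA.right (hM hh').1) fun f hf => ?_
    obtain ⟨i1, e1⟩ := (hI hh).pairing_eq hw hle hA hf hh
    obtain ⟨i2, e2⟩ := (hI hh').pairing_eq hw hle hA hf hh'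
    rw [pairing_add R hq hA.right hf (hM hh).1 (hM hh').1, e1, e2,
      ((hI hs).pairing_eq hw hle hA hf hs).2, ← integral_add i1 i2]
    refine integral_congr_ae ?_
    filter_upwards [(ae_memFock_inp R hw hle T hA.left hh).2.2,
      (ae_memFock_inp R hw hle T hA.left hh').2.2, ae_memFock_out R hw hle T hA.right hf,
      hA.field.isOperator, hA.field.right.injOn] with z h1 h2 h3 h4 h5
    rw [← pairing_add R hw.p h5 h3 (h4.maps _ h1) (h4.maps _ h2)]
    exact (EqFock.refl _ f).pairing_eq (h4.add _ _ h1 h2)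
  · have hs := hh.smul R hq hA.left c
    refine eqFock_of_pairing' R hq hA.right (hM hs).1
      ((hM hh).1.smul R hq.inv hA.right c) fun f hf => ?_
    rw [pairing_smul, ((hI hh).pairing_eq hw hle hA hf hh).2,
      ((hI hs).pairing_eq hw hle hA hf hs).2, ← integral_const_mul]
    refine integral_congr_ae ?_
    filter_upwards [(ae_memFock_inp R hw hle T hA.left hh).2.2, hA.field.isOperator] with z h1 h4
    rw [← pairing_smul]
    exact (EqFock.refl _ f).pairing_eq (h4.smul c _ h1)

theorem isContinuousOperator_multiIntegral {R : Regular μ tm e} (hw : AreWeights μ p r s)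
    (hq : IsWeight μ q) (hle : r⁻¹ + p + s⁻¹ ≤ q) (hA : IsIntegrand R p r s T ∅ ∅ A)
    {P0 : AddSubmonoid (X → ℝ≥0)} (hqP : q ∈ P1 P0) :
    IsContinuousOperator μ tm e P0 (multiIntegral μ tm e T ∅ A) := by
  obtain ⟨hO, hN⟩ := isOperator_multiIntegral hw hq hle hA
  refine ⟨fun h hh => ⟨q, hqP, hO.maps h (hh q hqP)⟩,
    fun f h hf hh => hO.add f h (hf q hqP) (hh q hqP), fun c h hh => hO.smul c h (hh q hqP),
    fun U hU => ?_⟩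
  obtain ⟨δ, hδ, hδU⟩ := hU q hqP
  set N := opNorm μ tm e q ∅ ∅ (multiIntegral μ tm e T ∅ A)
  have hN1 : N + 1 ≠ ∞ := ENNReal.add_ne_top.2 ⟨hO.bounded.ne, ENNReal.one_ne_top⟩
  refine ⟨q, hqP, δ / (N + 1), ENNReal.div_pos hδ.ne' hN1, fun h hh hlt =>
    hδU _ (hO.maps h (hh q hqP)) ?_⟩
  calc fockNorm μ tm q⁻¹ ∅ (multiIntegral μ tm e T ∅ A h) ≤ N * fockNorm μ tm q ∅ h :=
        hO.fockNorm_le (hh q hqP)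
    _ ≤ (N + 1) * fockNorm μ tm q ∅ h := by gcongr; exact le_self_add
    _ < δ := by
        rw [mul_comm]
        exact (ENNReal.lt_div_iff_mul_lt (Or.inl (by simp)) (Or.inl hN1)).1 hlt

end

theorem isIntegrand_of_isLocallyIntegrable [IsSeparable μ] (R : Regular μ tm e)
    (hw : AreWeights μ p r s) {B : Kernel K} (hB : IsLocallyIntegrable μ tm e p r s B) (T : ℝ≥0) :
    IsIntegrand R p r s T ∅ ∅ B where
  left := by simp
  right := by simp
  field := by
    have h1 := (((isMeasurableKernel_iff R hw.p B).1 hB.measurable).comp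
      (quasiMeasurePreserving_table_before T))
    simpa only [id_eq, Finset.union_empty] using h1
  finite := by rw [kernelNorm_empty]; exact hB.finite T

/-! ### The adjoint kernel -/

theorem essSup_le_iff {Z : Type*} [MeasurableSpace Z] {ν : Measure Z} {f : Z → ℝ≥0∞} {t : ℝ≥0∞} :
    essSup f ν ≤ t ↔ ∀ᵐ z ∂ν, f z ≤ t :=
  ⟨fun h => (ENNReal.ae_le_essSup f).mono fun _ hz => hz.trans h, fun h => essSup_le_of_ae_le t h⟩

theorem aemeasurable_essSup {Y Z : Type*} [MeasurableSpace Y] [MeasurableSpace Z] {ν : Measure Y}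
    {νZ : Measure Z} [SFinite νZ] {f : Y × Z → ℝ≥0∞} (hf : AEMeasurable f (ν.prod νZ)) :
    AEMeasurable (fun y => essSup (fun z => f (y, z)) νZ) ν := by
  refine ⟨fun y => essSup (fun z => hf.mk f (y, z)) νZ, measurable_of_Ioi fun t => ?_, ?_⟩
  · have h1 : Measurable fun y => νZ {z | t < hf.mk f (y, z)} :=
      measurable_measure_prodMk_left (measurableSet_lt measurable_const hf.measurable_mk)
    have h2 : (fun y => essSup (fun z => hf.mk f (y, z)) νZ) ⁻¹' Set.Ioi t =
        (fun y => νZ {z | t < hf.mk f (y, z)}) ⁻¹' {0}ᶜ := by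
      ext y
      simp only [Set.mem_preimage, Set.mem_Ioi, Set.mem_compl_iff, Set.mem_singleton_iff]
      rw [← not_le, not_iff_not, essSup_le_iff, ae_iff]
      simp only [not_le]
    rw [h2]
    exact h1 (measurableSet_singleton 0).compl
  · filter_upwards [ae_ae_of_ae_prod hf.ae_eq_mk] with y hy
    exact essSup_congr_ae hy

variable [IsSeparable μ] {B : Kernel K}

theorem isOpField_starKernel (R : Regular μ tm e) (hp : IsWeight μ p)
    (hB : IsMeasurableKernel μ tm e p B) : IsOpField μ tm R.field 𝔱 p
      (fun z => (ofChains z).inp) (fun z => (ofChains z).out)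
      fun z => starKernel μ tm e p B (ofChains z) :=
  (((isMeasurableKernel_iff R hp B).1 hB).comp
    (measurePreserving_swapTable 𝔪).quasiMeasurePreserving).adjoint R hp

theorem starKernel_spec (R : Regular μ tm e) (hp : IsWeight μ p)
    (hB : IsMeasurableKernel μ tm e p B) : ∀ᵐ z ∂𝔱, ∀ f h,
      MemFock μ tm e p (ofChains z).inp f → MemFock μ tm e p (ofChains z).out h →
      pairing μ tm (ofChains z).out (starKernel μ tm e p B (ofChains z) f) h =
        pairing μ tm (ofChains z).inp f (B (ofChains z).transpose h) := by
  have hF := ((isMeasurableKernel_iff R hp B).1 hB).comp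
    (measurePreserving_swapTable 𝔪).quasiMeasurePreserving
  filter_upwards [hF.isOperator, hF.left.injOn, hF.right.injOn] with z h1 h2 h3 f h hf hh
  exact (opAdjoint_spec R h1 hp h2 h3 hf).2 h hh

theorem opNorm_starKernel (R : Regular μ tm e) (hp : IsWeight μ p)
    (hB : IsMeasurableKernel μ tm e p B) :
    ∀ᵐ z ∂𝔱, opNorm μ tm e p (ofChains z).inp (ofChains z).out
        (starKernel μ tm e p B (ofChains z)) =
      opNorm μ tm e p (ofChains (swapTable z)).inp (ofChains (swapTable z)).out
        (B (ofChains (swapTable z))) := by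
  have hF := ((isMeasurableKernel_iff R hp B).1 hB).comp
    (measurePreserving_swapTable 𝔪).quasiMeasurePreserving
  filter_upwards [hF.isOperator, hF.left.injOn, hF.right.injOn] with z h1 h2 h3
  exact opNorm_opAdjoint R h1 hp h2 h3

variable (μ tm) in
/-- The norm `∫ dϑ_+^- (∫∫ ess sup_{ϑ_∘^∘} (s(ϑ_∘^∘) n(ϑ))² r(ϑ_+^∘ ⊔ ϑ_∘^-) dϑ_+^∘ dϑ_∘^-)^{1/2}` of
a function of tables. -/
def tableNorm (r s : X → ℝ≥0) (T : ℝ≥0) (n : Table X → ℝ≥0∞) : ℝ≥0∞ :=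
  ∫⁻ a, (∫⁻ b, ∫⁻ c, essSup (fun d => ((wt s (pts d) : ℝ≥0∞) * n (ofChains (a, b, c, d))) ^ 2)
      𝔪[T] * (wt r (pts c ∪ pts b) : ℝ≥0∞)
      ∂𝔪[T] ∂𝔪[T]) ^ (1 / 2 : ℝ)
    ∂𝔪[T]

theorem tableNorm_congr {n n' : Table X → ℝ≥0∞} (h : ∀ᵐ z ∂𝔱[T], n (ofChains z) = n' (ofChains z)) :
    tableNorm μ tm r s T n = tableNorm μ tm r s T n' := by
  refine lintegral_congr_ae ?_
  filter_upwards [ae_ae_of_ae_prod h] with a ha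
  congr 1
  refine lintegral_congr_ae ?_
  filter_upwards [ae_ae_of_ae_prod ha] with b hb
  refine lintegral_congr_ae ?_
  filter_upwards [ae_ae_of_ae_prod hb] with c hc
  congr 1
  refine essSup_congr_ae ?_
  filter_upwards [hc] with d hd
  rw [hd]

/-- The entries `ϑ_∘^-` and `ϑ_+^∘` enter the norm symmetrically. -/
theorem tableNorm_transpose (ht : IsTime μ tm)
    (hr : IsWeight μ r) (hs : IsWeight μ s) {n : Table X → ℝ≥0∞} (hn : AEMeasurable
      (fun z => n (ofChains z)) 𝔱[T]) :
    tableNorm μ tm r s T (fun ϑ => n ϑ.transpose) = tableNorm μ tm r s T n := by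
  set m := 𝔪[T] with hm
  have hT1 := quasiMeasurePreserving_before (μ := μ) (tm := tm) T
  have hN1 : ∀ᵐ a ∂m, AEMeasurable (fun z : ℭ × ℭ × ℭ =>
      n (ofChains (a, z.1, z.2.1, z.2.2))) (m.prod (m.prod m)) := by
    filter_upwards [hn.aestronglyMeasurable.prodMk_left] with a ha using ha.aemeasurable
  refine lintegral_congr_ae ?_
  filter_upwards [hN1] with a hNa
  congr 1
  have hs : AEMeasurable (fun d : ℭ => (wt s (pts d) : ℝ≥0∞)) m :=
    ((aemeasurable_wt ht.measurable hs.aemeasurable).coe_nnreal_ennreal).comp_quasiMeasurePreserving hT1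
  have hr : AEMeasurable (fun z : ℭ × ℭ => (wt r (pts z.2 ∪ pts z.1) : ℝ≥0∞))
      (m.prod m) := by
    have h2 := (aestronglyMeasurable_pts_union μ ht
      (k := fun ω => (wt r ω : ℝ≥0∞)) (aemeasurable_wt ht.measurable
        hr.aemeasurable).coe_nnreal_ennreal.aestronglyMeasurable).aemeasurable
    have h3 : AEMeasurable (fun z : ℭ × ℭ => (wt r (pts z.1 ∪ pts z.2) : ℝ≥0∞))
      (m.prod m) := h2.comp_quasiMeasurePreserving (quasiMeasurePreserving_prod_before T)
    simpa only [Finset.union_comm] using h3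
  let Q : ℭ → ℭ → ℝ≥0∞ := fun b c =>
    essSup (fun d => ((wt s (pts d) : ℝ≥0∞) * n (ofChains (a, b, c, d))) ^ 2) m *
      (wt r (pts c ∪ pts b) : ℝ≥0∞)
  have hQ : AEMeasurable (Function.uncurry Q) (m.prod m) := by
    refine AEMeasurable.mul ?_ hr
    have h2 : AEMeasurable (fun z : (ℭ × ℭ) × ℭ =>
        ((wt s (pts z.2) : ℝ≥0∞) * n (ofChains (a, z.1.1, z.1.2, z.2))) ^ 2)
        ((m.prod m).prod m) := by
      refine AEMeasurable.pow_const (AEMeasurable.mul hs.comp_snd ?_) 2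
      have h4 := hNa.comp_quasiMeasurePreserving
        (measurePreserving_prodAssoc m m m).quasiMeasurePreserving
      refine h4.congr (.of_forall fun w => ?_)
      simp only [Function.comp_apply, MeasurableEquiv.prodAssoc, MeasurableEquiv.coe_mk,
        Equiv.prodAssoc_apply]
    exact aemeasurable_essSup (f := fun z : (ℭ × ℭ) × ℭ =>
      ((wt s (pts z.2) : ℝ≥0∞) * n (ofChains (a, z.1.1, z.1.2, z.2))) ^ 2) h2
  calc _ = ∫⁻ b, ∫⁻ c, Q c b ∂m ∂m := by
        refine lintegral_congr fun b => lintegral_congr fun c => ?_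
        dsimp only [Q]
        rw [Finset.union_comm]
        rfl
    _ = ∫⁻ b, ∫⁻ c, Q b c ∂m ∂m := (lintegral_lintegral_swap hQ).symm

theorem multiNorm_eq_tableNorm (p r s : X → ℝ≥0) (T : ℝ≥0) (B : Kernel K) :
    multiNorm μ tm e p r s T B =
      tableNorm μ tm r s T fun ϑ => opNorm μ tm e p ϑ.inp ϑ.out (B ϑ) := rfl

theorem multiNorm_starKernel (R : Regular μ tm e) (hw : AreWeights μ p r s)
    (hB : IsMeasurableKernel μ tm e p B) (T : ℝ≥0) :
    multiNorm μ tm e p r s T (starKernel μ tm e p B) = multiNorm μ tm e p r s T B := by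
  have hT := quasiMeasurePreserving_table_before (μ := μ) (tm := tm) T
  have h1 := (((isMeasurableKernel_iff R hw.p B).1 hB).aemeasurable_opNorm R
    hw.p).comp_quasiMeasurePreserving hT
  rw [multiNorm_eq_tableNorm, multiNorm_eq_tableNorm, ← tableNorm_transpose
    R.time hw.r hw.s (n := fun ϑ => opNorm μ tm e p ϑ.inp ϑ.out (B ϑ)) h1]
  refine tableNorm_congr ?_
  filter_upwards [hT.ae (opNorm_starKernel R hw.p hB)] with z hz
  exact hz

theorem isLocallyIntegrable_starKernel (R : Regular μ tm e) (hw : AreWeights μ p r s)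
    (hB : IsLocallyIntegrable μ tm e p r s B) :
    IsLocallyIntegrable μ tm e p r s (starKernel μ tm e p B) where
  measurable := (isMeasurableKernel_iff R hw.p _).2 (isOpField_starKernel R hw.p hB.measurable)
  measurable_norm := (isOpField_starKernel R hw.p hB.measurable).aemeasurable_opNorm R hw.p
  finite T := by rw [multiNorm_starKernel R hw hB.measurable]; exact hB.finite T

/-- The multiple integral of the adjoint kernel is the adjoint of the multiple integral. -/
theorem pairing_multiIntegral_starKernel (R : Regular μ tm e) (hw : AreWeights μ p r s)
    (hq : IsWeight μ q) (hle : r⁻¹ + p + s⁻¹ ≤ q)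
    (hB : IsLocallyIntegrable μ tm e p r s B) (T : ℝ≥0) {f h : Sec K} (hf : MemFock μ tm e q ∅ f)
    (hh : MemFock μ tm e q ∅ h) :
    pairing μ tm ∅ (multiIntegral μ tm e T ∅ (starKernel μ tm e p B) f) h =
      pairing μ tm ∅ f (multiIntegral μ tm e T ∅ B h) := by
  have hA := isIntegrand_of_isLocallyIntegrable R hw hB T
  have hA' := isIntegrand_of_isLocallyIntegrable R hw (isLocallyIntegrable_starKernel R hw hB) T
  have e1 := ((hasMultiIntegral_multiIntegral hw hq hle hA hh).pairing_eq hw hle hA hf hh).2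
  obtain ⟨i2, e2⟩ := (hasMultiIntegral_multiIntegral hw hq hle hA' hf).pairing_eq hw hle hA' hh hf
  have hmp := measurePreserving_swapTable 𝔪[T]
  rw [e1, ← pairing_conj, e2, ← integral_conj]
  simp only [pairing_conj, Finset.union_empty]
  simp only [Finset.union_empty] at i2
  have i3 := i2.aestronglyMeasurable.star
  have h3 : ∀ᵐ z ∂𝔱[T],
      pairing μ tm (ofChains z).out (starKernel μ tm e p B (ofChains z) f) h =
        pairing μ tm (ofChains (swapTable z)).out f (B (ofChains (swapTable z)) h) := by
    have hT := quasiMeasurePreserving_table_before (μ := μ) (tm := tm) T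
    filter_upwards [hT.ae (starKernel_spec R hw.p hB.measurable),
      (ae_memFock_inp R hw hle T hA.left hf).2.2, ae_memFock_out R hw hle T hA.right hh] with z h1 h2 h3
    rw [Finset.union_empty] at h2 h3
    exact h1 f h h2 h3
  rw [integral_congr_ae h3]
  have i1 := ((hasMultiIntegral_multiIntegral hw hq hle hA hh).pairing_eq hw hle hA hf hh).1
  simp only [Finset.union_empty] at i1
  have h4 := integral_map (μ := 𝔱[T]) (φ := swapTable)
    hmp.measurable.aemeasurable (f := fun z => pairing μ tm (ofChains z).out f (B (ofChains z) h))
    (by rw [hmp.map_eq]; exact i1.aestronglyMeasurable)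
  rw [hmp.map_eq] at h4
  exact h4.symm

end MultiIntegralOperator

/-! ### Adjoining a point to a table -/
section Insertion

theorem quasiMeasurePreserving_first {Y α β : Type*} [MeasurableSpace Y] [MeasurableSpace α]
    [MeasurableSpace β] {ν : Measure Y} {m : Measure α} {n : Measure β} [SFinite ν] [SFinite m]
    [SFinite n] {f : Y × α → α} (hf : QuasiMeasurePreserving f (ν.prod m) m) :
    QuasiMeasurePreserving (fun w : Y × α × β => (f (w.1, w.2.1), w.2.2))
      (ν.prod (m.prod n)) (m.prod n) :=
  (quasiMeasurePreserving_prodMap hf (.id n)).comp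
    (measurePreserving_prodAssoc ν m n).symm.quasiMeasurePreserving

theorem quasiMeasurePreserving_second {Y α β : Type*} [MeasurableSpace Y] [MeasurableSpace α]
    [MeasurableSpace β] {ν : Measure Y} {m : Measure α} {n : Measure β} [SFinite ν] [SFinite m]
    [SFinite n] {g : Y × β → β} (hg : QuasiMeasurePreserving g (ν.prod n) n) :
    QuasiMeasurePreserving (fun w : Y × α × β => (w.2.1, g (w.1, w.2.2)))
      (ν.prod (m.prod n)) (m.prod n) :=
  Measure.measurePreserving_swap.quasiMeasurePreserving.comp
    ((quasiMeasurePreserving_first (n := m) hg).comp (quasiMeasurePreserving_prodMap (.id ν)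
      Measure.measurePreserving_swap.quasiMeasurePreserving))

variable (μ tm) in
/-- `a x` is the atomic table of `x` in one of the four positions; `σ x` and `τ x` are its
contributions to `ϑ_∘^- ⊔ ϑ_∘^∘` and to `ϑ_+^∘ ⊔ ϑ_∘^∘`. -/
structure IsAtom (a : X → Table X) (σ τ : X → Finset X) : Prop where
  inp : ∀ ϑ x, (Table.union ϑ (a x)).inp = ϑ.inp ∪ σ x
  out : ∀ ϑ x, (Table.union ϑ (a x)).out = ϑ.out ∪ τ x
  left : ChainLike μ tm σ
  right : ChainLike μ tm τ
  injOn_left : ∀ x, Set.InjOn tm (σ x : Set X)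
  injOn_right : ∀ x, Set.InjOn tm (τ x : Set X)
  insertion : ∃ f : X × 𝕋 → 𝕋, QuasiMeasurePreserving f (μ.prod 𝔱)
      𝔱 ∧
    ∀ᵐ w ∂μ.prod 𝔱, ofChains (f w) = (ofChains w.2).union (a w.1)

theorem chainLike_sing : ChainLike μ tm fun x => {x} :=
  ⟨sing tm, measurable_sing, .of_forall fun x => (pts_sing x).symm⟩

theorem chainLike_empty : ChainLike μ tm fun _ => ∅ := chainLike_const ∅ (by simp)

theorem isAtom_MP (ht : IsTime μ tm) : IsAtom μ tm Table.atomMP (fun _ => ∅) fun _ => ∅ where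
  inp ϑ x := by simp [Table.union, Table.inp, Table.atomMP]
  out ϑ x := by simp [Table.union, Table.out, Table.atomMP]
  left := chainLike_empty
  right := chainLike_empty
  injOn_left _ := by simp
  injOn_right _ := by simp
  insertion := by
    refine ⟨_, quasiMeasurePreserving_first (quasiMeasurePreserving_insertPt μ ht), ?_⟩
    have h1 := (quasiMeasurePreserving_prodMap (.id μ) (quasiMeasurePreserving_fst
      (μ := 𝔪) (ν := (𝔪).prod ((𝔪).prod 𝔪)))).ae (ae_apart_point μ ht)
    refine Filter.Eventually.mono h1 fun w hw => ?_
    simp only [ofChains, Table.union, Table.atomMP, Finset.union_empty]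
    rw [pts_insertPt (by simpa only [Prod.map, id_eq, Function.comp_apply] using hw)]

theorem isAtom_MO (ht : IsTime μ tm) : IsAtom μ tm Table.atomMO (fun x => {x}) fun _ => ∅ where
  inp ϑ x := by
    simp only [Table.union, Table.inp, Table.atomMO, Finset.union_empty]
    exact Finset.union_right_comm _ _ _
  out ϑ x := by simp [Table.union, Table.out, Table.atomMO]
  left := chainLike_sing
  right := chainLike_empty
  injOn_left _ := by simp
  injOn_right _ := by simp
  insertion := by
    refine ⟨_, quasiMeasurePreserving_second (quasiMeasurePreserving_first
      (quasiMeasurePreserving_insertPt μ ht)), ?_⟩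
    have h1 := (quasiMeasurePreserving_prodMap (.id μ) ((quasiMeasurePreserving_fst
      (μ := 𝔪) (ν := (𝔪).prod 𝔪)).comp
      (quasiMeasurePreserving_snd (μ := 𝔪)))).ae (ae_apart_point μ ht)
    refine Filter.Eventually.mono h1 fun w hw => ?_
    simp only [ofChains, Table.union, Table.atomMO, Finset.union_empty]
    rw [pts_insertPt (by simpa only [Prod.map, id_eq, Function.comp_apply] using hw)]

theorem isAtom_OP (ht : IsTime μ tm) : IsAtom μ tm Table.atomOP (fun _ => ∅) fun x => {x} where
  inp ϑ x := by simp [Table.union, Table.inp, Table.atomOP]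
  out ϑ x := by
    simp only [Table.union, Table.out, Table.atomOP, Finset.union_empty]
    exact Finset.union_right_comm _ _ _
  left := chainLike_empty
  right := chainLike_sing
  injOn_left _ := by simp
  injOn_right _ := by simp
  insertion := by
    refine ⟨_, quasiMeasurePreserving_second (quasiMeasurePreserving_second
      (quasiMeasurePreserving_first (quasiMeasurePreserving_insertPt μ ht))), ?_⟩
    have h1 := (quasiMeasurePreserving_prodMap (.id μ) ((quasiMeasurePreserving_fst
      (μ := 𝔪) (ν := 𝔪)).comp
      ((quasiMeasurePreserving_snd (μ := 𝔪)).comp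
      (quasiMeasurePreserving_snd (μ := 𝔪))))).ae (ae_apart_point μ ht)
    refine Filter.Eventually.mono h1 fun w hw => ?_
    simp only [ofChains, Table.union, Table.atomOP, Finset.union_empty]
    rw [pts_insertPt (by simpa only [Prod.map, id_eq, Function.comp_apply] using hw)]

theorem isAtom_OO (ht : IsTime μ tm) : IsAtom μ tm Table.atomOO (fun x => {x}) fun x => {x} where
  inp ϑ x := by
    simp only [Table.union, Table.inp, Table.atomOO, Finset.union_empty, Finset.union_assoc]
  out ϑ x := by
    simp only [Table.union, Table.out, Table.atomOO, Finset.union_empty, Finset.union_assoc]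
  left := chainLike_sing
  right := chainLike_sing
  injOn_left _ := by simp
  injOn_right _ := by simp
  insertion := by
    refine ⟨_, quasiMeasurePreserving_second (quasiMeasurePreserving_second
      (quasiMeasurePreserving_second (quasiMeasurePreserving_insertPt μ ht))), ?_⟩
    have h1 := (quasiMeasurePreserving_prodMap (.id μ) ((quasiMeasurePreserving_snd
      (μ := 𝔪) (ν := 𝔪)).comp
      ((quasiMeasurePreserving_snd (μ := 𝔪)).comp
      (quasiMeasurePreserving_snd (μ := 𝔪))))).ae (ae_apart_point μ ht)
    refine Filter.Eventually.mono h1 fun w hw => ?_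
    simp only [ofChains, Table.union, Table.atomOO, Finset.union_empty]
    rw [pts_insertPt (by simpa only [Prod.map, id_eq, Function.comp_apply] using hw)]

/-! ### The quantum stochastic derivatives -/

variable {p r s q : X → ℝ≥0} {a : X → Table X} {σ τ : X → Finset X} {B : Kernel K}
  [IsSeparable μ] {R : Regular μ tm e}

theorem isOpField_deriv (R : Regular μ tm e) (hp : IsWeight μ p)
    (hB : IsMeasurableKernel μ tm e p B) (ha : IsAtom μ tm a σ τ) :
    IsOpField μ tm R.field (μ.prod 𝔱) p
      (fun w => (ofChains w.2).inp ∪ σ w.1) (fun w => (ofChains w.2).out ∪ τ w.1)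
      fun w => derivKernel B (a w.1) (ofChains w.2) := by
  obtain ⟨f, hf, hfa⟩ := ha.insertion
  refine (((isMeasurableKernel_iff R hp B).1 hB).comp hf).congr ?_ ?_ ?_
  · filter_upwards [hfa] with w hw
    rw [hw, ha.inp]
  · filter_upwards [hfa] with w hw
    rw [hw, ha.out]
  · filter_upwards [hfa] with w hw
    rw [hw, derivKernel]

theorem ae_isIntegrand_deriv (R : Regular μ tm e) (hw : AreWeights μ p r s)
    (hB : IsMeasurableKernel μ tm e p B) (ha : IsAtom μ tm a σ τ)
    (hfin : ∀ᵐ x ∂μ, kernelNorm μ tm e p r s (tm x) (σ x) (τ x) (derivKernel B (a x)) < ∞) :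
    ∀ᵐ x ∂μ, IsIntegrand R p r s (tm x) (σ x) (τ x) (derivKernel B (a x)) := by
  filter_upwards [hfin, (isOpField_deriv R hw.p hB ha).ae_section] with x h1 h2
  exact ⟨ha.injOn_left x, ha.injOn_right x,
    h2.comp (quasiMeasurePreserving_table_before (tm x)), h1⟩

variable (tm) in
/-- The points `x` and tables of chains contained in `X^{tm x}`. -/
def beforePoint : Set (X × 𝕋) := {w | w.2.1 ∈ before tm (tm w.1) ∧ w.2.2.1 ∈ before tm (tm w.1) ∧
    w.2.2.2.1 ∈ before tm (tm w.1) ∧ w.2.2.2.2 ∈ before tm (tm w.1)}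

theorem measurableSet_beforePoint (htm : Measurable tm) : MeasurableSet (beforePoint tm) := by
  have h : ∀ f : X × 𝕋 → ℭ, Measurable f →
      MeasurableSet {w | f w ∈ before tm (tm w.1)} := fun f hf =>
    (hf.prodMk (htm.comp measurable_fst)) (measurableSet_before htm)
  exact (h _ (by fun_prop)).inter ((h _ (by fun_prop)).inter ((h _ (by fun_prop)).inter
    (h _ (by fun_prop))))

theorem tableMeasure_before (x : X) : 𝔱[tm x] = (𝔱).restrict {z | (x, z) ∈ beforePoint tm} := by
  have : {z | (x, z) ∈ beforePoint tm} = before tm (tm x) ×ˢ before tm (tm x) ×ˢ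
      before tm (tm x) ×ˢ before tm (tm x) := by
    ext z; rfl
  rw [this, tableMeasure, tableMeasure, chainMeasureBefore, Measure.prod_restrict,
    Measure.prod_restrict, Measure.prod_restrict]

variable (μ tm) in
/-- The distribution of points `x` and tables of chains contained in `X^{tm x}`. -/
def pointTableMeasure : Measure (X × 𝕋) := (μ.prod 𝔱).restrict (beforePoint tm)

instance : SFinite (pointTableMeasure μ tm) := by rw [pointTableMeasure]; infer_instance

theorem quasiMeasurePreserving_pointTable : QuasiMeasurePreserving id
    (pointTableMeasure μ tm) (μ.prod 𝔱) :=
  ⟨measurable_id, by rw [Measure.map_id]; exact Measure.restrict_le_self.absolutelyContinuous⟩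

theorem integral_pointTable (htm : Measurable tm) {E : Type*} [NormedAddCommGroup E]
    [NormedSpace ℝ E] {F : X × 𝕋 → E}
    (hF : AEStronglyMeasurable F (pointTableMeasure μ tm)) : AEStronglyMeasurable
      (fun x => ∫ z, F (x, z) ∂𝔱[tm x]) μ := by
  have hS := measurableSet_beforePoint (tm := tm) htm
  rw [pointTableMeasure, ← aestronglyMeasurable_indicator_iff hS] at hF
  refine hF.integral_prod_right'.congr (.of_forall fun x => ?_)
  have hx : MeasurableSet {z | (x, z) ∈ beforePoint tm} := measurable_prodMk_left hS
  dsimp only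
  rw [tableMeasure_before x, ← integral_indicator hx]
  rfl

theorem ae_pointTable_of_ae_ae (htm : Measurable tm) {F : X × 𝕋 → ℝ≥0∞}
    (hF : AEMeasurable F (pointTableMeasure μ tm)) (h : ∀ᵐ x ∂μ, ∀ᵐ z ∂𝔱[tm x], F (x, z) < ∞) :
    ∀ᵐ w ∂pointTableMeasure μ tm, F w < ∞ := by
  have hS := measurableSet_beforePoint (tm := tm) htm
  have hms : MeasurableSet {w | w ∈ beforePoint tm → hF.mk F w < ∞} := by
    have : {w | w ∈ beforePoint tm → hF.mk F w < ∞} = (beforePoint tm)ᶜ ∪ {w | hF.mk F w < ∞} := by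
      ext w; simp [imp_iff_not_or]
    rw [this]
    exact hS.compl.union (measurableSet_lt hF.measurable_mk measurable_const)
  have h1 : ∀ᵐ w ∂μ.prod 𝔱, w ∈ beforePoint tm →
      F w = hF.mk F w := (ae_restrict_iff' hS).1 hF.ae_eq_mk
  have h2 : ∀ᵐ w ∂pointTableMeasure μ tm, hF.mk F w < ∞ := by
    refine (ae_restrict_iff' hS).2 ((Measure.ae_prod_iff_ae_ae hms).2 ?_)
    filter_upwards [h, ae_ae_of_ae_prod h1] with x hx hx1
    have hx' : MeasurableSet {z | (x, z) ∈ beforePoint tm} := measurable_prodMk_left hS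
    rw [tableMeasure_before x, ae_restrict_iff' hx'] at hx
    filter_upwards [hx, hx1] with z h3 h4 h5
    rw [← h4 h5]
    exact h3 h5
  filter_upwards [h2, hF.ae_eq_mk] with w h3 h4
  rwa [h4]

/-- Up to the time of the point, derivatives of elements of `F(q) ⊗ K^⊗(σ x)` at almost all tables
are elements of the Fock scale. -/
theorem memFock_pointTable (hw : AreWeights μ p r s) (hle : r⁻¹ + p + s⁻¹ ≤ q)
    (R : Regular μ tm e) (ha : IsAtom μ tm a σ τ) {H : X → Sec K}
    (hH : JointlyMeasurable μ tm e μ σ H) (hm : ∀ᵐ x ∂μ, MemFock μ tm e q (σ x) (H x)) :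
    JointlyMeasurable μ tm e (pointTableMeasure μ tm)
      (fun w => (ofChains w.2).inp ∪ σ w.1) (fun w => H w.1) ∧
    ∀ᵐ w ∂pointTableMeasure μ tm, MemFock μ tm e p ((ofChains w.2).inp ∪ σ w.1) (H w.1) := by
  obtain ⟨h1, h2⟩ := hH.union R ha.left (quasiMeasurePreserving_inpChain R.time) (ae_inp_eq R.time)
  have hq := quasiMeasurePreserving_pointTable (μ := μ) (tm := tm)
  have hcl := h1.comp hq
  rw [jointlyMeasurable_iff R h1] at h2
  have h3 := h2.comp_quasiMeasurePreserving (quasiMeasurePreserving_prodMap hq (.id 𝔪))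
  refine ⟨(jointlyMeasurable_iff R hcl).2 h3, ?_⟩
  have h4 : AEMeasurable (fun w : X × 𝕋 =>
      fockNorm μ tm p ((ofChains w.2).inp ∪ σ w.1) (H w.1)) (pointTableMeasure μ tm) := by
    have hwp : AEMeasurable (fun z : (X × 𝕋) × ℭ =>
        (wt p (pts z.2) : ℝ≥0∞)) ((pointTableMeasure μ tm).prod 𝔪) :=
      (aemeasurable_wt R.time.measurable hw.p.aemeasurable).coe_nnreal_ennreal.comp_snd
    have h5 := ((h3.enorm.pow_const 2).mul hwp).lintegral_prod_right'.pow_const (1 / 2 : ℝ)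
    refine h5.congr (.of_forall fun w => ?_)
    simp only [fockNorm, Pi.mul_apply, Function.comp_apply, Prod.map, id_eq, enorm_ef]
  have h6 := ae_pointTable_of_ae_ae R.time.measurable h4 (by
    filter_upwards [hm] with x hx
    exact (ae_memFock_inp R hw hle (tm x) (ha.injOn_left x) hx).2.2.mono fun z hz => hz.2)
  filter_upwards [h6, h3.prodMk_left, hcl.injOn] with w h7 h8 h9
  exact ⟨(isEssMeasurable_iff R.field R.time.measurable (chainLike_union_const R.time h9)).2 h8, h7⟩

/-- The derivatives form a measurable field of operators in the Fock scale. -/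
theorem isOpField_multiIntegral_deriv (hw : AreWeights μ p r s) (hq : IsWeight μ q)
    (hle : r⁻¹ + p + s⁻¹ ≤ q) (hB : IsMeasurableKernel μ tm e p B) (ha : IsAtom μ tm a σ τ)
    (hA : ∀ᵐ x ∂μ, IsIntegrand R p r s (tm x) (σ x) (τ x) (derivKernel B (a x))) :
    IsOpField μ tm R.field μ q σ τ
      fun x => multiIntegral μ tm e (tm x) (τ x) (derivKernel B (a x)) := by
  refine ⟨ha.left, ha.right, ?_, fun c => aestronglyMeasurable_of_inner fun c' => ?_⟩
  · filter_upwards [hA] with x hx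
    exact (isOperator_multiIntegral hw hq hle hx).1
  · let H : X → Sec K := fun x => decode tm R.field q (σ x) c
    let G : X → Sec K := fun x => decode tm R.field q (τ x) c'
    have hHm : ∀ x, MemFock μ tm e q (σ x) (H x) := fun x => memFock_decode R hq (ha.injOn_left x) c
    have hGm : ∀ x, MemFock μ tm e q (τ x) (G x) := fun x =>
      memFock_decode R hq (ha.injOn_right x) c'
    obtain ⟨h1, h2⟩ := memFock_pointTable hw hle R ha (jointlyMeasurable_decode_const R hq ha.left c)
      (.of_forall hHm)
    have hq' := quasiMeasurePreserving_pointTable (μ := μ) (tm := tm)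
    have hF := (isOpField_deriv R hw.p hB ha).comp hq'
    obtain ⟨Φ, hΦ, hΦe⟩ := hF.exists_version R hw.p h1 h2
    obtain ⟨h3, h4⟩ := (jointlyMeasurable_decode_const (K := K) R hq ha.right c').union R ha.right
      (quasiMeasurePreserving_outChain R.time)
      (ae_out_eq R.time)
    rw [jointlyMeasurable_iff R h3] at h4
    have h5 := h4.comp_quasiMeasurePreserving (quasiMeasurePreserving_prodMap hq' (.id 𝔪))
    have h6 := (h5.inner (𝕜 := ℂ) ((jointlyMeasurable_iff R hF.right).1 hΦ)).integral_prod_right'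
    have h7 : AEStronglyMeasurable (fun w : X × 𝕋 =>
        pairing μ tm ((ofChains w.2).out ∪ τ w.1) (G w.1)
          (derivKernel B (a w.1) (ofChains w.2) (H w.1))) (pointTableMeasure μ tm) := by
      refine h6.congr ?_
      filter_upwards [hΦe] with w hw
      refine Eq.trans ?_ ((EqFock.refl _ (G w.1)).pairing_eq hw)
      simp only [pairing, Function.comp_apply, Prod.map, id_eq, inner_ef]
      rfl
    -- matrix elements of the derivative at `x` are integrals over the tables before `x`
    refine (integral_pointTable R.time.measurable h7).aemeasurable.congr ?_
    filter_upwards [hA] with x hx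
    have hI := hasMultiIntegral_multiIntegral hw hq hle hx (hHm x)
    have hO := (isOperator_multiIntegral hw hq hle hx).1
    have hO' := hO.maps _ (hHm x)
    rw [← (hI.pairing_eq hw hle hx (hGm x) (hHm x)).2,
      opCode_apply R hO hq (ha.injOn_left x) (ha.injOn_right x),
      pairing_eq_inner' R hq (ha.injOn_right x) (hGm x) hO', ← inner_conj_symm,
      inner_vec_decode R hq hq.inv (ha.injOn_right x) c' hO', inner_conj_symm]

theorem isDerivative_multiIntegral (R : Regular μ tm e) (hw : AreWeights μ p r s)
    (hq : IsWeight μ q)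
    (hle : r⁻¹ + p + s⁻¹ ≤ q) (hB : IsMeasurableKernel μ tm e p B) (ha : IsAtom μ tm a σ τ)
    (hfin : ∀ᵐ x ∂μ, kernelNorm μ tm e p r s (tm x) (σ x) (τ x) (derivKernel B (a x)) < ∞) :
    IsDerivative μ tm e q σ τ (fun x => derivKernel B (a x))
      fun x => multiIntegral μ tm e (tm x) (τ x) (derivKernel B (a x)) := by
  have hA := ae_isIntegrand_deriv R hw hB ha hfin
  have hF := isOpField_multiIntegral_deriv hw hq hle hB ha hA
  refine ⟨?_, hF.isOperator, hF.aemeasurable_opNorm R hq⟩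
  filter_upwards [hA] with x hx h hh
  exact hasMultiIntegral_multiIntegral hw hq hle hx hh

end Insertion

/-! ### The norms of the derivatives -/
section DerivNorms

/-- Measurability of an integral over the chains before the last point `x`, with a parameter. -/
theorem aemeasurable_lintegral_lastPoint (ht : IsTime μ tm) {Y : Type*} [MeasurableSpace Y] {ν : Measure Y}
    [SFinite ν] {k : Y → Finset X → ℝ≥0∞}
    (hk : AEMeasurable (fun z : Y × ℭ => k z.1 (pts z.2)) (ν.prod 𝔪)) :
    AEMeasurable (fun w : Y × X => ∫⁻ ϰ, k w.1 (pts ϰ ∪ {w.2}) ∂𝔪[tm w.2]) (ν.prod μ) := by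
  have hA := (measurePreserving_prodAssoc ν μ 𝔪).quasiMeasurePreserving
  have h1 := (hk.comp_quasiMeasurePreserving (quasiMeasurePreserving_prodMap (.id ν)
    (quasiMeasurePreserving_insertPt μ ht))).comp_quasiMeasurePreserving hA
  have h2 := hA.ae ((quasiMeasurePreserving_snd (μ := ν)).ae (ae_apart_point μ ht))
  have h3 : AEMeasurable (fun w : (Y × X) × ℭ => k w.1.1 (pts w.2 ∪ {w.1.2}))
      ((ν.prod μ).prod 𝔪) := by
    refine h1.congr ?_
    filter_upwards [h2] with w hw
    simp only [Function.comp_apply, MeasurableEquiv.prodAssoc, MeasurableEquiv.coe_mk,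
      Equiv.prodAssoc_apply, Prod.map, id_eq] at hw ⊢
    rw [pts_insertPt hw]
  have hS : MeasurableSet {w : (Y × X) × ℭ | w.2 ∈ before tm (tm w.1.2)} :=
    (measurable_snd.prodMk (ht.measurable.comp (measurable_snd.comp measurable_fst)))
      (measurableSet_before ht.measurable)
  refine (h3.indicator hS).lintegral_prod_right'.congr (.of_forall fun w => ?_)
  dsimp only
  rw [chainMeasureBefore, ← lintegral_indicator (measurableSet_before_const ht.measurable _)]
  rfl

theorem chainMeasureBefore_mono {T T' : ℝ≥0} (h : T ≤ T') : 𝔪[T] ≤ 𝔪[T'] :=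
  Measure.restrict_mono (fun _ hϰ x hx => (hϰ x hx).trans_le h) le_rfl

theorem ae_of_forall_restrict (htm : Measurable tm) {P : X → Prop}
    (h : ∀ T : ℝ≥0, ∀ᵐ x ∂μ.restrict {x | tm x < T}, P x) : ∀ᵐ x ∂μ, P x := by
  have h1 : ∀ n : ℕ, ∀ᵐ x ∂μ, tm x < n → P x := fun n =>
    (ae_restrict_iff' (measurableSet_lt htm measurable_const)).1 (h n)
  filter_upwards [ae_all_iff.2 h1] with x hx
  obtain ⟨n, hn⟩ := exists_nat_gt (tm x)
  exact hx n hn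

variable (μ tm) in
/-- The inner `ess sup_{ϑ_∘^∘} (s(ϑ_∘^∘) n(ϑ))²` of `tableNorm`. -/
def tableSup (s : X → ℝ≥0) (T : ℝ≥0) (n : Table X → ℝ≥0∞) (α β γ : Finset X) : ℝ≥0∞ :=
  essSup (fun d => ((wt s (pts d) : ℝ≥0∞) * n ⟨α, β, γ, pts d⟩) ^ 2) 𝔪[T]

theorem tableNorm_eq (r s : X → ℝ≥0) (T : ℝ≥0) (n : Table X → ℝ≥0∞) : tableNorm μ tm r s T n =
    ∫⁻ a, (∫⁻ b, ∫⁻ c, tableSup μ tm s T n (pts a) (pts b) (pts c) *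
      (wt r (pts c ∪ pts b) : ℝ≥0∞) ∂𝔪[T] ∂𝔪[T]) ^ (1 / 2 : ℝ) ∂𝔪[T] := rfl

variable {r s : X → ℝ≥0} {T : ℝ≥0} {n : Table X → ℝ≥0∞}

theorem tableSup_mono {T' : ℝ≥0} (h : T ≤ T') (α β γ : Finset X) :
    tableSup μ tm s T n α β γ ≤ tableSup μ tm s T' n α β γ :=
  essSup_mono_measure' (chainMeasureBefore_mono h)

variable (tm) in
/-- Reassociation of quadruples. -/
def assocTable : ((ℭ × ℭ × ℭ) × ℭ) ≃ᵐ 𝕋 :=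
  MeasurableEquiv.prodAssoc.trans ((MeasurableEquiv.refl _).prodCongr MeasurableEquiv.prodAssoc)

theorem measurePreserving_assocTable : MeasurePreserving (assocTable tm)
    (((𝔪).prod ((𝔪).prod 𝔪)).prod 𝔪) 𝔱 :=
  ((MeasurePreserving.id _).prod (measurePreserving_prodAssoc _ _ _)).comp
    (measurePreserving_prodAssoc _ _ _)

theorem aemeasurable_wt_mul (htm : Measurable tm) (hs : IsWeight μ s)
    (hn : AEMeasurable (fun z => n (ofChains z)) 𝔱) : AEMeasurable (fun w : (ℭ × ℭ × ℭ) × ℭ =>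
      ((wt s (pts w.2) : ℝ≥0∞) * n ⟨pts w.1.1, pts w.1.2.1, pts w.1.2.2, pts w.2⟩) ^ 2)
      (((𝔪).prod ((𝔪).prod 𝔪)).prod 𝔪) := by
  have h1 := hn.comp_quasiMeasurePreserving
    (measurePreserving_assocTable (μ := μ) (tm := tm)).quasiMeasurePreserving
  have h2 : AEMeasurable (fun w : (ℭ × ℭ × ℭ) × ℭ =>
      (wt s (pts w.2) : ℝ≥0∞)) (((𝔪).prod ((𝔪).prod 𝔪)).prod 𝔪) :=
    (aemeasurable_wt htm hs.aemeasurable).coe_nnreal_ennreal.comp_snd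
  exact (h2.mul h1).pow_const 2

theorem aemeasurable_tableSup (htm : Measurable tm) (hs : IsWeight μ s)
    (hn : AEMeasurable (fun z => n (ofChains z)) 𝔱) : AEMeasurable (fun z : ℭ × ℭ × ℭ =>
      tableSup μ tm s T n (pts z.1) (pts z.2.1) (pts z.2.2)) ((𝔪).prod ((𝔪).prod 𝔪)) := by
  have h := (aemeasurable_wt_mul htm hs hn).mono_ac (Measure.AbsolutelyContinuous.prod (.refl
    ((𝔪).prod ((𝔪).prod 𝔪)))
    (chainMeasureBefore_le T).absolutelyContinuous)
  simp only [tableSup]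
  exact aemeasurable_essSup (f := fun w : (ℭ × ℭ × ℭ) × ℭ =>
      ((wt s (pts w.2) : ℝ≥0∞) * n ⟨pts w.1.1, pts w.1.2.1, pts w.1.2.2, pts w.2⟩) ^ 2) h

variable (μ tm) in
/-- The integral `∫ ess sup_{ϑ_∘^∘} (s(ϑ_∘^∘) n(ϑ))² r(ϑ_+^∘ ⊔ ϑ_∘^-) dϑ_+^∘`. -/
def tableInner (r s : X → ℝ≥0) (T : ℝ≥0) (n : Table X → ℝ≥0∞) (α β : Finset X) : ℝ≥0∞ :=
  ∫⁻ c, tableSup μ tm s T n α β (pts c) * (wt r (pts c ∪ β) : ℝ≥0∞) ∂𝔪[T]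

theorem aemeasurable_tableInner (ht : IsTime μ tm) (hr : IsWeight μ r) (hs : IsWeight μ s)
    (hn : AEMeasurable (fun z => n (ofChains z)) 𝔱) :
    AEMeasurable (fun z : ℭ × ℭ => tableInner μ tm r s T n (pts z.1) (pts z.2)) ((𝔪).prod 𝔪) := by
  have h2 := (aestronglyMeasurable_pts_union μ ht (k := fun ω => (wt r ω : ℝ≥0∞))
    (aemeasurable_wt ht.measurable hr.aemeasurable).coe_nnreal_ennreal.aestronglyMeasurable).aemeasurable
  have h3 := ((aemeasurable_tableSup (T := T) ht.measurable hs hn).comp_quasiMeasurePreserving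
    (measurePreserving_prodAssoc _ _ _).quasiMeasurePreserving).mul
    (h2.comp_quasiMeasurePreserving (Measure.measurePreserving_swap.quasiMeasurePreserving.comp
      (quasiMeasurePreserving_prodMap (quasiMeasurePreserving_snd (μ := 𝔪)) (.id 𝔪))))
  exact (h3.comp_quasiMeasurePreserving (quasiMeasurePreserving_prodMap (.id _)
    (quasiMeasurePreserving_before T))).lintegral_prod_right'

/-- The estimate for the derivative in position `ϑ_+^-`. -/
theorem exists_bound_MP (ht : IsTime μ tm) (hr : IsWeight μ r) (hs : IsWeight μ s)
    (hn : AEMeasurable (fun z => n (ofChains z)) 𝔱) (T : ℝ≥0) :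
    ∃ u : X → ℝ≥0∞, AEMeasurable u μ ∧ (∀ x, tm x < T →
      tableNorm μ tm r s (tm x) (fun ϑ => n (ϑ.union (Table.atomMP x))) ≤ u x) ∧
      ∫⁻ x in {x | tm x < T}, u x ∂μ ≤ tableNorm μ tm r s T n := by
  let k : Finset X → ℝ≥0∞ := fun α => (∫⁻ b, tableInner μ tm r s T n α (pts b) ∂𝔪[T]) ^ (1 / 2 : ℝ)
  have hk : AEMeasurable (fun ϰ : ℭ => k (pts ϰ)) 𝔪 :=
    ((aemeasurable_tableInner ht hr hs hn).comp_quasiMeasurePreserving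
      (quasiMeasurePreserving_prodMap (.id _)
        (quasiMeasurePreserving_before T))).lintegral_prod_right'.pow_const _
  refine ⟨fun x => ∫⁻ ϰ, k (pts ϰ ∪ {x}) ∂𝔪[tm x], ?_, fun x hx => ?_,
    lintegral_lastPoint μ ht T hk⟩
  · have h1 : AEMeasurable (fun z : Unit × ℭ => k (pts z.2))
        ((Measure.dirac ()).prod 𝔪) := hk.comp_snd
    have h2 := (aemeasurable_lintegral_lastPoint (k := fun _ => k) ht
      h1).aestronglyMeasurable.prodMk_left
    rw [ae_dirac_eq] at h2
    exact (Filter.eventually_pure.1 h2).aemeasurable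
  · have hle := chainMeasureBefore_mono (μ := μ) (tm := tm) hx.le
    rw [tableNorm_eq]
    refine lintegral_mono fun a => sqrt_le_sqrt (lintegral_mono' hle fun b =>
      lintegral_mono' hle fun c => mul_le_mul_left ?_ _)
    refine le_trans (le_of_eq ?_) (tableSup_mono hx.le _ _ _)
    simp only [tableSup, Table.union, Table.atomMP, Finset.union_empty]

/-- The estimate for the derivative in position `ϑ_∘^-`: Minkowski's inequality. -/
theorem exists_bound_MO (ht : IsTime μ tm) (hr : IsWeight μ r) (hs : IsWeight μ s)
    (hn : AEMeasurable (fun z => n (ofChains z)) 𝔱) (T : ℝ≥0) :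
    ∃ u : X → ℝ≥0∞, AEMeasurable u μ ∧ (∀ᵐ x ∂μ, tm x < T →
      tableNorm μ tm r s (tm x) (fun ϑ => n (ϑ.union (Table.atomMO x))) ^ 2 * r x ≤ u x) ∧
      ∫⁻ x in {x | tm x < T}, u x ∂μ ≤ tableNorm μ tm r s T n ^ 2 := by
  let q := tableInner μ tm r s T n
  have hq : AEMeasurable (fun z : ℭ × ℭ => q (pts z.1) (pts z.2)) (𝔪[T].prod 𝔪) :=
    (aemeasurable_tableInner ht hr hs hn).comp_quasiMeasurePreserving
      (quasiMeasurePreserving_prodMap (quasiMeasurePreserving_before T) (.id _))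
  let v : ℭ → X → ℝ≥0∞ := fun a x => ∫⁻ b, q (pts a) (pts b ∪ {x}) ∂𝔪[tm x]
  have hv : AEMeasurable (fun w : ℭ × X => v w.1 w.2) (𝔪[T].prod μ) :=
    aemeasurable_lintegral_lastPoint (k := fun a : ℭ => q (pts a)) ht hq
  let u : X → ℝ≥0∞ := fun x => ∫⁻ a, v a x ^ (1 / 2 : ℝ) ∂𝔪[T]
  have hvs := hv.pow_const (1 / 2 : ℝ)
  have hu : AEMeasurable u μ := hvs.lintegral_prod_left'
  -- chains with a last point `x` make up a part of the chains before `T`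
  have hsub : ∀ᵐ a ∂𝔪[T], ∫⁻ x in {x | tm x < T}, v a x ∂μ ≤ ∫⁻ b, q (pts a) (pts b) ∂𝔪[T] := by
    filter_upwards [hq.aestronglyMeasurable.prodMk_left] with a ha
    exact lintegral_lastPoint μ ht T (k := q (pts a)) ha.aemeasurable
  refine ⟨fun x => u x ^ 2, hu.pow_const 2, ?_, ?_⟩
  · have hap := ae_ae_of_ae_prod (ae_apart_point μ ht)
    filter_upwards [hap] with x hap hx
    have hle := chainMeasureBefore_mono (μ := μ) (tm := tm) hx.le
    have hap' : ∀ᵐ b ∂𝔪[tm x], Apart tm (pts b) {x} := ae_mono (chainMeasureBefore_le _) hap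
    have hr0 : (r x : ℝ≥0∞) ≠ ∞ := ENNReal.coe_ne_top
    suffices h : tableNorm μ tm r s (tm x) (fun ϑ => n (ϑ.union (Table.atomMO x))) *
        (r x : ℝ≥0∞) ^ (1 / 2 : ℝ) ≤ u x by
      calc _ = (tableNorm μ tm r s (tm x) (fun ϑ => n (ϑ.union (Table.atomMO x))) *
          (r x : ℝ≥0∞) ^ (1 / 2 : ℝ)) ^ 2 := by rw [mul_pow, sqrt_sq]
        _ ≤ _ := pow_le_pow_left' h 2
    rw [tableNorm_eq, ← lintegral_mul_const' _ _ (sqrt_ne_top hr0)]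
    refine lintegral_mono' hle fun a => ?_
    rw [← sqrt_mul, ← lintegral_mul_const' _ _ hr0]
    refine sqrt_le_sqrt (lintegral_mono_ae ?_)
    filter_upwards [hap'] with b hb
    rw [← lintegral_mul_const' _ _ hr0]
    refine (lintegral_mono_ae ?_).trans (lintegral_mono' hle le_rfl)
    filter_upwards [hap'] with c hc
    have hd : Disjoint (pts c ∪ pts b) {x} :=
      Finset.disjoint_union_left.2 ⟨hc.disjoint, hb.disjoint⟩
    rw [mul_assoc, ← Finset.union_assoc, show wt r (pts c ∪ pts b ∪ {x}) =
      wt r (pts c ∪ pts b) * r x by rw [wt, Finset.prod_union hd, Finset.prod_singleton]; rfl,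
      ENNReal.coe_mul]
    refine mul_le_mul_left (le_trans (le_of_eq ?_) (tableSup_mono hx.le _ _ _)) _
    simp only [tableSup, Table.union, Table.atomMO, Finset.union_empty]
  · have hTm := hvs.mono_ac (Measure.AbsolutelyContinuous.prod (.refl 𝔪[T])
      (Measure.restrict_le_self (μ := μ) (s := {x | tm x < T})).absolutelyContinuous)
    -- the norm of the integral `u = ∫ v(a)^{1/2} da` in `L²` is estimated by duality
    have h1 := lintegral_sq_div_le_of_dual (m := μ.restrict {x | tm x < T}) (G := u)
      hu.restrict (w := fun _ => 1) aemeasurable_const (fun _ => one_pos)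
      (C := tableNorm μ tm r s T n) fun f hf _ => ?_
    · simpa using h1
    · have h2 : ∀ᵐ a ∂𝔪[T],
          AEMeasurable (fun x => v a x ^ (1 / 2 : ℝ)) (μ.restrict {x | tm x < T}) := by
        filter_upwards [hTm.aestronglyMeasurable.prodMk_left] with a ha using ha.aemeasurable
      have h3 : ∀ᵐ x ∂μ.restrict {x | tm x < T},
          AEMeasurable (fun a => v a x ^ (1 / 2 : ℝ)) 𝔪[T] := by
        filter_upwards [hTm.prod_swap.aestronglyMeasurable.prodMk_left] with a ha using
          ha.aemeasurable
      simp only [ENNReal.coe_one, mul_one]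
      calc ∫⁻ x in {x | tm x < T}, u x * f x ∂μ
          = ∫⁻ x in {x | tm x < T}, ∫⁻ a, v a x ^ (1 / 2 : ℝ) * f x ∂𝔪[T] ∂μ := by
            refine lintegral_congr_ae ?_
            filter_upwards [h3] with x hx
            exact (lintegral_mul_const'' _ hx).symm
        _ = ∫⁻ a, ∫⁻ x in {x | tm x < T}, v a x ^ (1 / 2 : ℝ) * f x ∂μ
              ∂𝔪[T] :=
            (lintegral_lintegral_swap (f := fun a x => v a x ^ (1 / 2 : ℝ) * f x)
              (hTm.mul hf.comp_snd)).symm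
        _ ≤ ∫⁻ a, (∫⁻ b, q (pts a) (pts b) ∂𝔪[T]) ^ (1 / 2 : ℝ) *
              (∫⁻ x in {x | tm x < T}, f x ^ 2 ∂μ) ^ (1 / 2 : ℝ) ∂𝔪[T] := by
            refine lintegral_mono_ae ?_
            filter_upwards [h2, hsub] with a ha hsa
            refine (lintegral_mul_le_sqrt ha hf).trans (mul_le_mul_left (sqrt_le_sqrt ?_) _)
            simpa only [sqrt_sq] using hsa
        _ = _ := lintegral_mul_const'' _ (((hq.comp_quasiMeasurePreserving
              (quasiMeasurePreserving_prodMap (.id _)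
              (quasiMeasurePreserving_before T))).lintegral_prod_right').pow_const _)

variable [IsSeparable μ]

/-- The estimate for the derivative in position `ϑ_+^∘`, by transposition. -/
theorem exists_bound_OP (ht : IsTime μ tm) (hr : IsWeight μ r) (hs : IsWeight μ s)
    (hn : AEMeasurable (fun z => n (ofChains z)) 𝔱) (T : ℝ≥0) :
    ∃ u : X → ℝ≥0∞, AEMeasurable u μ ∧ (∀ᵐ x ∂μ, tm x < T →
      tableNorm μ tm r s (tm x) (fun ϑ => n (ϑ.union (Table.atomOP x))) ^ 2 * r x ≤ u x) ∧
      ∫⁻ x in {x | tm x < T}, u x ∂μ ≤ tableNorm μ tm r s T n ^ 2 := by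
  have hn' : AEMeasurable (fun z => n (ofChains z).transpose)
      𝔱 := hn.comp_quasiMeasurePreserving
    (measurePreserving_swapTable 𝔪).quasiMeasurePreserving
  obtain ⟨u, h1, h2, h3⟩ := exists_bound_MO ht hr hs (n := fun ϑ => n ϑ.transpose) hn' T
  refine ⟨u, h1, ?_, ?_⟩
  · obtain ⟨f, hf, hfa⟩ := (isAtom_MO ht).insertion
    have h4 := (hn'.comp_quasiMeasurePreserving hf).aestronglyMeasurable.prodMk_left
    filter_upwards [h2, h4, ae_ae_of_ae_prod hfa] with x hx h5 h6 hxT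
    have h7 : AEMeasurable (fun z : 𝕋 => n ((ofChains z).union (Table.atomMO x)).transpose)
        𝔱 := by
      refine h5.aemeasurable.congr ?_
      filter_upwards [h6] with z hz
      rw [Function.comp_apply, hz]
    have h8 := tableNorm_transpose (T := tm x) ht hr hs
      (n := fun ϑ => n (ϑ.union (Table.atomMO x)).transpose)
      (h7.comp_quasiMeasurePreserving (quasiMeasurePreserving_table_before (tm x)))
    refine le_trans (le_of_eq ?_) (hx hxT)
    rw [← h8]
    rfl
  · rwa [tableNorm_transpose ht hr hs
      (hn.comp_quasiMeasurePreserving (quasiMeasurePreserving_table_before T))] at h3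

/-- The estimate for the derivative in position `ϑ_∘^∘`. -/
theorem bound_OO (ht : IsTime μ tm) (hs : IsWeight μ s)
    (hn : AEMeasurable (fun z => n (ofChains z)) 𝔱) (T : ℝ≥0) : ∀ᵐ x ∂μ, tm x < T →
      s x * tableNorm μ tm r s (tm x) (fun ϑ => n (ϑ.union (Table.atomOO x))) ≤
        tableNorm μ tm r s T n := by
  have hF := aemeasurable_wt_mul ht.measurable hs hn
  have hG : AEMeasurable (fun w : (ℭ × ℭ × ℭ) × ℭ =>
      tableSup μ tm s T n (pts w.1.1) (pts w.1.2.1) (pts w.1.2.2))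
      (((𝔪).prod ((𝔪).prod 𝔪)).prod 𝔪) := (aemeasurable_tableSup ht.measurable hs hn).comp_fst
  have h1 : ∀ᵐ w ∂((𝔪).prod ((𝔪).prod 𝔪)).prod 𝔪, w.2 ∈ before tm T →
      ((wt s (pts w.2) : ℝ≥0∞) * n ⟨pts w.1.1, pts w.1.2.1, pts w.1.2.2, pts w.2⟩) ^ 2 ≤
        tableSup μ tm s T n (pts w.1.1) (pts w.1.2.1) (pts w.1.2.2) := by
    have hS : MeasurableSet {w : (ℭ × ℭ × ℭ) × ℭ |
        w.2 ∈ before tm T} := measurable_snd (measurableSet_before_const ht.measurable T)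
    have hms : MeasurableSet {w : (ℭ × ℭ × ℭ) × ℭ |
        w.2 ∈ before tm T → hF.mk _ w ≤ hG.mk _ w} := by
      simp only [imp_iff_not_or]
      exact hS.compl.union (measurableSet_le hF.measurable_mk hG.measurable_mk)
    have h2 : ∀ᵐ w ∂((𝔪).prod ((𝔪).prod 𝔪)).prod 𝔪, w.2 ∈ before tm T → hF.mk _ w ≤ hG.mk _ w := by
      refine (Measure.ae_prod_iff_ae_ae hms).2 ?_
      filter_upwards [ae_ae_of_ae_prod hF.ae_eq_mk,
        ae_ae_of_ae_prod hG.ae_eq_mk] with w hw hw'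
      filter_upwards [hw, hw', (ae_restrict_iff' (measurableSet_before_const ht.measurable T)).1
        (ENNReal.ae_le_essSup (μ := 𝔪[T]) fun d : ℭ =>
          ((wt s (pts d) : ℝ≥0∞) * n ⟨pts w.1, pts w.2.1, pts w.2.2, pts d⟩) ^ 2)]
        with d h3 h4 h5 h6
      rw [← h3, ← h4]
      exact h5 h6
    filter_upwards [h2, hF.ae_eq_mk, hG.ae_eq_mk] with w h3 h4 h5 h6
    rw [h4, h5]
    exact h3 h6
  have h2 : ∀ᵐ z ∂𝔱, (∀ y ∈ (ofChains z).oo, tm y < T) →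
      ((wt s (ofChains z).oo : ℝ≥0∞) * n (ofChains z)) ^ 2 ≤
        tableSup μ tm s T n (ofChains z).mp (ofChains z).mo (ofChains z).op :=
    (measurePreserving_assocTable (μ := μ) (tm := tm)).symm.quasiMeasurePreserving.ae h1
  -- almost everywhere, the chains with the point `x` adjoined obey the bound by the supremum
  obtain ⟨f, hf, hfa⟩ := (isAtom_OO (μ := μ) ht).insertion
  have h3 := ae_ae_of_ae_prod ((hf.ae h2).and hfa)
  have hap := ae_ae_of_ae_prod (ae_apart_point μ ht)
  filter_upwards [h3, hap] with x hx hxa hxT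
  have hle := chainMeasureBefore_mono (μ := μ) (tm := tm) hxT.le
  have hab := (chainMeasureBefore_le (μ := μ) (tm := tm) (tm x))
  have hr0 : (s x : ℝ≥0∞) ≠ ∞ := ENNReal.coe_ne_top
  rw [tableNorm_eq, tableNorm_eq, mul_comm, ← lintegral_mul_const' _ _ hr0]
  refine le_trans ?_ (lintegral_mono' hle le_rfl)
  refine lintegral_mono_ae ?_
  filter_upwards [ae_mono hab (ae_ae_of_ae_prod hx)] with a ha
  rw [← sq_sqrt (s x : ℝ≥0∞), ← sqrt_mul, ← lintegral_mul_const' _ _ (ENNReal.pow_ne_top hr0)]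
  refine sqrt_le_sqrt (le_trans ?_ (lintegral_mono' hle le_rfl))
  refine lintegral_mono_ae ?_
  filter_upwards [ae_mono hab (ae_ae_of_ae_prod ha)] with b hb
  rw [← lintegral_mul_const' _ _ (ENNReal.pow_ne_top hr0)]
  refine le_trans ?_ (lintegral_mono' hle le_rfl)
  refine lintegral_mono_ae ?_
  filter_upwards [ae_mono hab (ae_ae_of_ae_prod hb)] with c hc
  rw [mul_right_comm]
  refine mul_le_mul_left ?_ _
  rw [tableSup, mul_comm, ← ENNReal.essSup_const_mul, essSup_le_iff, chainMeasureBefore,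
    ae_restrict_iff' (measurableSet_before_const ht.measurable _)]
  filter_upwards [hc, hxa] with d hd had hdb
  rw [hd.2] at hd
  have hd1 := hd.1
  simp only [ofChains, Table.union, Table.atomOO, Finset.union_empty] at hd1 ⊢
  refine le_trans (le_of_eq ?_) (hd1 ?_)
  · rw [show wt s (pts d ∪ {x}) = wt s (pts d) * s x by
      rw [wt, Finset.prod_union had.disjoint, Finset.prod_singleton]; rfl, ENNReal.coe_mul]
    ring
  · intro y hy
    rcases Finset.mem_union.1 hy with hy | hy
    · exact (hdb y hy).trans hxT
    · rw [Finset.mem_singleton.1 hy]; exact hxT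

end DerivNorms

section DerivBounds

variable [IsSeparable μ]
  {p r s q : X → ℝ≥0} {a : X → Table X} {σ τ : X → Finset X} {B : Kernel K}

theorem kernelNorm_derivKernel (ha : IsAtom μ tm a σ τ) (T : ℝ≥0) (x : X) :
    kernelNorm μ tm e p r s T (σ x) (τ x) (derivKernel B (a x)) =
      tableNorm μ tm r s T fun ϑ => (fun ϑ => opNorm μ tm e p ϑ.inp ϑ.out (B ϑ)) (ϑ.union (a x)) := by
  simp only [ha.inp, ha.out]
  rfl

theorem ae_kernelNorm_MP (R : Regular μ tm e) (hw : AreWeights μ p r s)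
    (hB : IsLocallyIntegrable μ tm e p r s B) : ∀ᵐ x ∂μ,
      kernelNorm μ tm e p r s (tm x) ∅ ∅ (derivKernel B (Table.atomMP x)) < ∞ := by
  refine ae_of_forall_restrict R.time.measurable fun T => ?_
  obtain ⟨u, h1, h2, h3⟩ := exists_bound_MP R.time hw.r hw.s
    (n := fun ϑ => opNorm μ tm e p ϑ.inp ϑ.out (B ϑ)) hB.measurable_norm T
  filter_upwards [ae_lt_top' h1.restrict (h3.trans_lt (hB.finite T)).ne,
    ae_restrict_mem (measurableSet_lt R.time.measurable measurable_const)] with x h4 h5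
  rw [kernelNorm_derivKernel (isAtom_MP R.time)]
  exact (h2 x h5).trans_lt h4

theorem lt_top_of_sq_mul_lt_top {t : ℝ≥0∞} {c : ℝ≥0} (hc : 0 < c) (h : t ^ 2 * c < ∞) : t < ∞ := by
  by_contra h1
  rw [not_lt_top_iff.1 h1, ENNReal.top_pow two_ne_zero,
    ENNReal.top_mul (ENNReal.coe_pos.2 hc).ne'] at h
  exact h.ne rfl

theorem ae_kernelNorm_MO (R : Regular μ tm e) (hw : AreWeights μ p r s)
    (hB : IsLocallyIntegrable μ tm e p r s B) : ∀ᵐ x ∂μ,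
      kernelNorm μ tm e p r s (tm x) {x} ∅ (derivKernel B (Table.atomMO x)) < ∞ := by
  refine ae_of_forall_restrict R.time.measurable fun T => ?_
  obtain ⟨u, h1, h2, h3⟩ := exists_bound_MO R.time hw.r hw.s
    (n := fun ϑ => opNorm μ tm e p ϑ.inp ϑ.out (B ϑ)) hB.measurable_norm T
  filter_upwards [ae_lt_top' h1.restrict (h3.trans_lt (ENNReal.pow_lt_top (hB.finite T))).ne,
    ae_restrict_mem (measurableSet_lt R.time.measurable measurable_const),
    ae_restrict_of_ae h2] with x h4 h5 h6
  have h7 := kernelNorm_derivKernel (e := e) (p := p) (r := r) (s := s) (B := B)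
    (isAtom_MO R.time) (tm x) x
  rw [h7]
  exact lt_top_of_sq_mul_lt_top (hw.r.pos x) ((h6 h5).trans_lt h4)

theorem ae_kernelNorm_OP (R : Regular μ tm e) (hw : AreWeights μ p r s)
    (hB : IsLocallyIntegrable μ tm e p r s B) : ∀ᵐ x ∂μ,
      kernelNorm μ tm e p r s (tm x) ∅ {x} (derivKernel B (Table.atomOP x)) < ∞ := by
  refine ae_of_forall_restrict R.time.measurable fun T => ?_
  obtain ⟨u, h1, h2, h3⟩ := exists_bound_OP R.time hw.r hw.s
    (n := fun ϑ => opNorm μ tm e p ϑ.inp ϑ.out (B ϑ)) hB.measurable_norm T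
  filter_upwards [ae_lt_top' h1.restrict (h3.trans_lt (ENNReal.pow_lt_top (hB.finite T))).ne,
    ae_restrict_mem (measurableSet_lt R.time.measurable measurable_const),
    ae_restrict_of_ae h2] with x h4 h5 h6
  have h7 := kernelNorm_derivKernel (e := e) (p := p) (r := r) (s := s) (B := B)
    (isAtom_OP R.time) (tm x) x
  rw [h7]
  exact lt_top_of_sq_mul_lt_top (hw.r.pos x) ((h6 h5).trans_lt h4)

theorem ae_kernelNorm_OO (R : Regular μ tm e) (hw : AreWeights μ p r s)
    (hB : IsLocallyIntegrable μ tm e p r s B) : ∀ᵐ x ∂μ,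
      kernelNorm μ tm e p r s (tm x) {x} {x} (derivKernel B (Table.atomOO x)) < ∞ := by
  refine ae_of_forall_restrict R.time.measurable fun T => ?_
  filter_upwards [ae_restrict_mem (measurableSet_lt R.time.measurable measurable_const),
    ae_restrict_of_ae (bound_OO R.time (r := r) hw.s
    (n := fun ϑ => opNorm μ tm e p ϑ.inp ϑ.out (B ϑ)) hB.measurable_norm T)] with x h5 h6
  have h7 := kernelNorm_derivKernel (e := e) (p := p) (r := r) (s := s) (B := B)
    (isAtom_OO R.time) (tm x) x
  rw [h7]
  refine (ENNReal.lt_top_of_mul_ne_top_right ((h6 h5).trans_lt (hB.finite T)).ne ?_)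
  exact (ENNReal.coe_pos.2 (hw.s.pos x)).ne'

theorem ae_opNorm_deriv_le (R : Regular μ tm e) (hw : AreWeights μ p r s) (hq : IsWeight μ q)
    (hle : r⁻¹ + p + s⁻¹ ≤ q) (hB : IsMeasurableKernel μ tm e p B) (ha : IsAtom μ tm a σ τ)
    (hfin : ∀ᵐ x ∂μ, kernelNorm μ tm e p r s (tm x) (σ x) (τ x) (derivKernel B (a x)) < ∞) :
    ∀ᵐ x ∂μ, opNorm μ tm e q (σ x) (τ x) (multiIntegral μ tm e (tm x) (τ x)
      (derivKernel B (a x))) ≤ tableNorm μ tm r s (tm x) fun ϑ =>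
        (fun ϑ => opNorm μ tm e p ϑ.inp ϑ.out (B ϑ)) (ϑ.union (a x)) := by
  filter_upwards [ae_isIntegrand_deriv R hw hB ha hfin] with x hx
  rw [← kernelNorm_derivKernel ha]
  exact (isOperator_multiIntegral hw hq hle hx).2

theorem isDerivative_qsDeriv (R : Regular μ tm e) (hw : AreWeights μ p r s) (hq : IsWeight μ q)
    (hle : r⁻¹ + p + s⁻¹ ≤ q) (hB : IsLocallyIntegrable μ tm e p r s B) :
    IsDerivative μ tm e q (fun _ => ∅) (fun _ => ∅)
      (fun x => derivKernel B (Table.atomMP x)) (qsDeriv μ tm e B).mp ∧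
    IsDerivative μ tm e q (fun x => {x}) (fun _ => ∅)
      (fun x => derivKernel B (Table.atomMO x)) (qsDeriv μ tm e B).mo ∧
    IsDerivative μ tm e q (fun _ => ∅) (fun x => {x})
      (fun x => derivKernel B (Table.atomOP x)) (qsDeriv μ tm e B).op ∧
    IsDerivative μ tm e q (fun x => {x}) (fun x => {x})
      (fun x => derivKernel B (Table.atomOO x)) (qsDeriv μ tm e B).oo :=
  ⟨isDerivative_multiIntegral R hw hq hle hB.measurable (isAtom_MP R.time) (ae_kernelNorm_MP R hw hB),
    isDerivative_multiIntegral R hw hq hle hB.measurable (isAtom_MO R.time) (ae_kernelNorm_MO R hw hB),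
    isDerivative_multiIntegral R hw hq hle hB.measurable (isAtom_OP R.time) (ae_kernelNorm_OP R hw hB),
    isDerivative_multiIntegral R hw hq hle hB.measurable (isAtom_OO R.time)
      (ae_kernelNorm_OO R hw hB)⟩

theorem normOne_qsDeriv_mp_le (R : Regular μ tm e) (hw : AreWeights μ p r s) (hq : IsWeight μ q)
    (hle : r⁻¹ + p + s⁻¹ ≤ q) (hB : IsLocallyIntegrable μ tm e p r s B) (T : ℝ≥0) :
    normOne μ tm e q T (fun _ => ∅) (fun _ => ∅) (qsDeriv μ tm e B).mp
      ≤ multiNorm μ tm e p r s T B := by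
  obtain ⟨u, h1, h2, h3⟩ := exists_bound_MP R.time hw.r hw.s
    (n := fun ϑ => opNorm μ tm e p ϑ.inp ϑ.out (B ϑ)) hB.measurable_norm T
  refine le_trans (lintegral_mono_ae ?_) h3
  filter_upwards [ae_restrict_mem (measurableSet_lt R.time.measurable measurable_const),
    ae_restrict_of_ae (ae_opNorm_deriv_le R hw hq hle hB.measurable
      (isAtom_MP R.time) (ae_kernelNorm_MP R hw hB))] with x h5 h6
  exact h6.trans (h2 x h5)

theorem normTwo_le_of_bound (htm : Measurable tm) {D : X → Sec K → Sec K} {T : ℝ≥0}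
    {N : X → ℝ≥0∞} {C : ℝ≥0∞} (hN : ∀ᵐ x ∂μ, opNorm μ tm e q (σ x) (τ x) (D x) ≤ N x)
    (h : ∃ u : X → ℝ≥0∞, AEMeasurable u μ ∧ (∀ᵐ x ∂μ, tm x < T → N x ^ 2 * r x ≤ u x) ∧
      ∫⁻ x in {x | tm x < T}, u x ∂μ ≤ C ^ 2) : normTwo μ tm e q r T σ τ D ≤ C := by
  obtain ⟨u, -, h2, h3⟩ := h
  rw [normTwo, ← sq_sqrt C]
  refine sqrt_le_sqrt (le_trans (lintegral_mono_ae ?_) h3)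
  filter_upwards [ae_restrict_mem (measurableSet_lt htm measurable_const),
    ae_restrict_of_ae h2, ae_restrict_of_ae hN] with x h5 h6 h7
  exact (mul_le_mul_left (pow_le_pow_left' h7 2) _).trans (h6 h5)

theorem normTwo_qsDeriv_mo_le (R : Regular μ tm e) (hw : AreWeights μ p r s) (hq : IsWeight μ q)
    (hle : r⁻¹ + p + s⁻¹ ≤ q) (hB : IsLocallyIntegrable μ tm e p r s B) (T : ℝ≥0) :
    normTwo μ tm e q r T (fun x => {x}) (fun _ => ∅) (qsDeriv μ tm e B).mo
      ≤ multiNorm μ tm e p r s T B :=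
  normTwo_le_of_bound R.time.measurable (ae_opNorm_deriv_le R hw hq hle hB.measurable
      (isAtom_MO R.time) (ae_kernelNorm_MO R hw hB))
    (exists_bound_MO R.time hw.r hw.s
      (n := fun ϑ => opNorm μ tm e p ϑ.inp ϑ.out (B ϑ)) hB.measurable_norm T)

theorem normTwo_qsDeriv_op_le (R : Regular μ tm e) (hw : AreWeights μ p r s) (hq : IsWeight μ q)
    (hle : r⁻¹ + p + s⁻¹ ≤ q) (hB : IsLocallyIntegrable μ tm e p r s B) (T : ℝ≥0) :
    normTwo μ tm e q r T (fun _ => ∅) (fun x => {x}) (qsDeriv μ tm e B).op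
      ≤ multiNorm μ tm e p r s T B :=
  normTwo_le_of_bound R.time.measurable (ae_opNorm_deriv_le R hw hq hle hB.measurable
      (isAtom_OP R.time) (ae_kernelNorm_OP R hw hB))
    (exists_bound_OP R.time hw.r hw.s
      (n := fun ϑ => opNorm μ tm e p ϑ.inp ϑ.out (B ϑ)) hB.measurable_norm T)

theorem normInf_qsDeriv_oo_le (R : Regular μ tm e) (hw : AreWeights μ p r s) (hq : IsWeight μ q)
    (hle : r⁻¹ + p + s⁻¹ ≤ q) (hB : IsLocallyIntegrable μ tm e p r s B) (T : ℝ≥0) :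
    normInf μ tm e q s T (fun x => {x}) (fun x => {x}) (qsDeriv μ tm e B).oo
      ≤ multiNorm μ tm e p r s T B := by
  refine essSup_le_iff.2 ?_
  filter_upwards [ae_restrict_mem (measurableSet_lt R.time.measurable measurable_const),
    ae_restrict_of_ae (bound_OO R.time (r := r) hw.s
    (n := fun ϑ => opNorm μ tm e p ϑ.inp ϑ.out (B ϑ)) hB.measurable_norm T),
    ae_restrict_of_ae (ae_opNorm_deriv_le R hw hq hle hB.measurable
      (isAtom_OO R.time) (ae_kernelNorm_OO R hw hB))] with x h5 h6 h7
  exact (mul_le_mul_right h7 _).trans (h6 h5)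

end DerivBounds

/-! ### The last point of a table -/
section LastPointTable


/-- The sum of `ψ` over all tables whose entries form a partition of `ω`. -/
def sumTables {M : Type*} [AddCommMonoid M] (ψ : Table X → M) (ω : Finset X) : M :=
  ∑ A ∈ ω.powerset, ∑ B ∈ (ω \ A).powerset, ∑ C ∈ ((ω \ A) \ B).powerset,
    ψ ⟨A, B, C, ((ω \ A) \ B) \ C⟩

theorem sum_powerset_union_singleton {M : Type*} [AddCommMonoid M] {x : X} {ω : Finset X}
    (h : x ∉ ω) (F : Finset X → Finset X → M) : ∑ A ∈ (ω ∪ {x}).powerset, F A ((ω ∪ {x}) \ A) =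
      ∑ A ∈ ω.powerset, F (A ∪ {x}) (ω \ A) + ∑ A ∈ ω.powerset, F A ((ω \ A) ∪ {x}) := by
  have h1 : ω ∪ {x} = insert x ω := by rw [Finset.union_comm, Finset.insert_eq]
  rw [h1, Finset.sum_powerset_insert h, add_comm]
  congr 1
  · refine Finset.sum_congr rfl fun A hA => ?_
    have hx : x ∉ A := fun hx => h (Finset.mem_powerset.1 hA hx)
    congr 1
    · rw [Finset.union_comm, Finset.insert_eq]
    · rw [Finset.insert_sdiff_insert, Finset.sdiff_insert_of_notMem h]
  · refine Finset.sum_congr rfl fun A hA => ?_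
    have hx : x ∉ A := fun hx => h (Finset.mem_powerset.1 hA hx)
    rw [Finset.insert_sdiff_of_notMem _ hx, Finset.union_comm, Finset.insert_eq]

/-- The point `x` may belong to any of the four entries. -/
theorem sumTables_union_singleton {M : Type*} [AddCommMonoid M] {x : X} {ω : Finset X} (h : x ∉ ω)
    (ψ : Table X → M) : sumTables ψ (ω ∪ {x}) =
      sumTables (fun ϑ => ψ (ϑ.union (Table.atomMP x))) ω +
      sumTables (fun ϑ => ψ (ϑ.union (Table.atomMO x))) ω +
      sumTables (fun ϑ => ψ (ϑ.union (Table.atomOP x))) ω +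
      sumTables (fun ϑ => ψ (ϑ.union (Table.atomOO x))) ω := by
  have hx : ∀ A : Finset X, x ∉ ω \ A := fun A hx => h (Finset.mem_sdiff.1 hx).1
  have hx' : ∀ A B : Finset X, x ∉ (ω \ A) \ B := fun A B hx' => hx A (Finset.mem_sdiff.1 hx').1
  simp only [sumTables, Table.union, Table.atomMP, Table.atomMO, Table.atomOP, Table.atomOO,
    Finset.union_empty]
  rw [sum_powerset_union_singleton h (fun A R => ∑ B ∈ R.powerset, ∑ C ∈ (R \ B).powerset,
    ψ ⟨A, B, C, (R \ B) \ C⟩)]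
  simp only [add_assoc]
  congr 1
  simp only [← Finset.sum_add_distrib]
  refine Finset.sum_congr rfl fun A _ => ?_
  rw [sum_powerset_union_singleton (hx A) (fun B R => ∑ C ∈ R.powerset, ψ ⟨A, B, C, R \ C⟩)]
  simp only [← Finset.sum_add_distrib]
  refine Finset.sum_congr rfl fun B _ => ?_
  rw [sum_powerset_union_singleton (hx' A B) (fun C R => ψ ⟨A, B, C, R⟩)]
  simp only [← Finset.sum_add_distrib]

/-- Restriction of a function of tables to the tables of points `x` with `tm x < T`. -/
def cutTable {M : Type*} [Zero M] (tm : X → ℝ≥0) (T : ℝ≥0) (ψ : Table X → M) (ϑ : Table X) : M :=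
  if ∀ x, (x ∈ ϑ.mp ∨ x ∈ ϑ.mo ∨ x ∈ ϑ.op ∨ x ∈ ϑ.oo) → tm x < T then ψ ϑ else 0

theorem sumTables_cutTable {M : Type*} [AddCommMonoid M] (tm : X → ℝ≥0) (T : ℝ≥0)
    (ψ : Table X → M) (ω : Finset X) :
    sumTables (cutTable tm T ψ) ω = if ∀ x ∈ ω, tm x < T then sumTables ψ ω else 0 := by
  have h : ∀ A ∈ ω.powerset, ∀ B ∈ (ω \ A).powerset, ∀ C ∈ ((ω \ A) \ B).powerset,
      cutTable tm T ψ ⟨A, B, C, ((ω \ A) \ B) \ C⟩ =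
        if ∀ x ∈ ω, tm x < T then ψ ⟨A, B, C, ((ω \ A) \ B) \ C⟩ else 0 := by
    intro A hA B hB C hC
    rw [cutTable]
    refine if_congr (forall_congr' fun x => imp_congr_left ?_) rfl rfl
    rw [Finset.mem_powerset] at hA hB hC
    have h1 := @hA x
    have h2 := @hB x
    have h3 := @hC x
    simp only [Finset.mem_sdiff] at h2 h3 ⊢
    tauto
  have h' : sumTables (cutTable tm T ψ) ω = ∑ A ∈ ω.powerset, ∑ B ∈ (ω \ A).powerset,
      ∑ C ∈ ((ω \ A) \ B).powerset,
        if ∀ x ∈ ω, tm x < T then ψ ⟨A, B, C, ((ω \ A) \ B) \ C⟩ else 0 :=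
    Finset.sum_congr rfl fun A hA => Finset.sum_congr rfl fun B hB =>
      Finset.sum_congr rfl fun C hC => h A hA B hB C hC
  rw [h']
  split_ifs
  · rfl
  · simp

variable {E : Type*} [NormedAddCommGroup E] [NormedSpace ℝ E] [CompleteSpace E]

/-- Integration over tables of chains as integration over the union of the entries. -/
theorem integral_sumTables (ht : IsTime μ tm) {ψ : Table X → E} (hψ : Integrable (fun z : 𝕋 =>
      ψ (ofChains z)) 𝔱) : Integrable (fun ϰ : ℭ => sumTables ψ (pts ϰ)) 𝔪 ∧
    ∫ z, ψ (ofChains z) ∂𝔱 = ∫ ϰ : ℭ, sumTables ψ (pts ϰ) ∂𝔪 := by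
  have m1 := measurePreserving_prodAssoc 𝔪 𝔪 ((𝔪).prod 𝔪)
  have m2 := measurePreserving_prodAssoc 𝔪 𝔪 𝔪
  -- the entries are merged one after another, beginning with the last two
  obtain ⟨i1, e1⟩ := integral_prod_chain μ ((𝔪).prod 𝔪) ht
    (F := fun y C D => ψ ⟨pts y.1, pts y.2, C, D⟩) (m1.integrable_comp_of_integrable hψ)
  have i1' := m2.symm.integrable_comp_of_integrable i1
  obtain ⟨i2, e2⟩ := integral_prod_chain μ 𝔪 ht
    (F := fun y B R => ∑ C ∈ R.powerset, ψ ⟨pts y, B, C, R \ C⟩) i1'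
  obtain ⟨i3, e3⟩ := integral_prod_chain' μ ht
    (F := fun A R => ∑ B ∈ R.powerset, ∑ C ∈ (R \ B).powerset, ψ ⟨A, B, C, (R \ B) \ C⟩) i2
  refine ⟨i3, ?_⟩
  have e0 := m1.integral_comp' (fun z => ψ (ofChains z))
  have e12 := m2.integral_comp' (fun w : ℭ × ℭ × ℭ =>
    ∑ C ∈ (pts w.2.2).powerset, ψ ⟨pts w.1, pts w.2.1, C, pts w.2.2 \ C⟩)
  exact e0.symm.trans (e1.trans (e12.trans (e2.trans e3)))

theorem tableMeasure_chainMeasureBefore (T : ℝ≥0) : 𝔱[T] =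
    (𝔱).restrict (before tm T ×ˢ before tm T ×ˢ before tm T ×ˢ before tm T) := by
  rw [tableMeasure, tableMeasure, chainMeasureBefore, Measure.prod_restrict,
    Measure.prod_restrict, Measure.prod_restrict]

theorem cutTable_ofChains (T : ℝ≥0) (ψ : Table X → E) (z : 𝕋) : cutTable tm T ψ (ofChains z) =
      (before tm T ×ˢ before tm T ×ˢ before tm T ×ˢ before tm T).indicator
        (fun z => ψ (ofChains z)) z := by
  rw [cutTable, Set.indicator_apply]
  refine if_congr ?_ rfl rfl
  simp only [Set.mem_prod, before, Set.mem_ofPred_eq, ofChains]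
  exact ⟨fun h => ⟨fun x hx => h x (.inl hx), fun x hx => h x (.inr (.inl hx)),
    fun x hx => h x (.inr (.inr (.inl hx))), fun x hx => h x (.inr (.inr (.inr hx)))⟩,
    fun h x hx => hx.elim (h.1 x) fun hx => hx.elim (h.2.1 x) fun hx =>
      hx.elim (h.2.2.1 x) (h.2.2.2 x)⟩

theorem integrable_cutTable (htm : Measurable tm) {T : ℝ≥0}
    {ψ : Table X → E} (hψ : Integrable (fun z => ψ (ofChains z)) 𝔱[T]) :
    Integrable (fun z => cutTable tm T ψ (ofChains z)) 𝔱 ∧ ∫ z, ψ (ofChains z) ∂𝔱[T] =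
      ∫ z, cutTable tm T ψ (ofChains z) ∂𝔱 := by
  have hB := measurableSet_before_const htm T
  have hS := hB.prod (hB.prod (hB.prod hB))
  simp only [cutTable_ofChains]
  rw [tableMeasure_chainMeasureBefore] at hψ ⊢
  exact ⟨(integrable_indicator_iff hS).2 hψ, (integral_indicator hS).symm⟩

theorem integral_sumTables_before (ht : IsTime μ tm)
    {T : ℝ≥0} {ψ : Table X → E} (hψ : Integrable (fun z => ψ (ofChains z)) 𝔱[T]) :
    Integrable (fun ϰ : ℭ => sumTables ψ (pts ϰ)) 𝔪[T] ∧
    ∫ z, ψ (ofChains z) ∂𝔱[T] = ∫ ϰ : ℭ, sumTables ψ (pts ϰ) ∂𝔪[T] := by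
  have hB := measurableSet_before_const ht.measurable T
  obtain ⟨h1, e1⟩ := integrable_cutTable ht.measurable hψ
  obtain ⟨h2, e2⟩ := integral_sumTables ht h1
  have h3 : (fun ϰ : ℭ => sumTables (cutTable tm T ψ) (pts ϰ)) =
      (before tm T).indicator fun ϰ => sumTables ψ (pts ϰ) := by
    ext ϰ
    rw [sumTables_cutTable, Set.indicator_apply]
    exact if_congr Iff.rfl rfl rfl
  rw [h3] at h2 e2
  rw [e1, e2, integral_indicator hB]
  exact ⟨(integrable_indicator_iff hB).1 h2, rfl⟩

/-- Integration over tables of chains in `X^T` in terms of the last point, which may belong to any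
of the four entries. -/
theorem integral_lastPoint_table (ht : IsTime μ tm)
    {T : ℝ≥0} {ψ : Table X → E} (hψ : Integrable (fun z => ψ (ofChains z)) 𝔱[T])
    (h : ∀ a ∈ [Table.atomMP (X := X), Table.atomMO, Table.atomOP, Table.atomOO],
      ∀ᵐ x ∂μ.restrict {x | tm x < T}, Integrable (fun z => ψ ((ofChains z).union (a x)))
        𝔱[tm x]) :
    ∫ z, ψ (ofChains z) ∂𝔱[T] = ψ Table.empty + ∫ x in {x | tm x < T},
        (∫ z, ψ ((ofChains z).union (Table.atomMP x)) ∂𝔱[tm x] +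
        ∫ z, ψ ((ofChains z).union (Table.atomMO x)) ∂𝔱[tm x] +
        ∫ z, ψ ((ofChains z).union (Table.atomOP x)) ∂𝔱[tm x] +
        ∫ z, ψ ((ofChains z).union (Table.atomOO x)) ∂𝔱[tm x]) ∂μ := by
  obtain ⟨h1, e1⟩ := integrable_cutTable ht.measurable hψ
  obtain ⟨h2, e2⟩ := integral_sumTables ht h1
  have hB := measurableSet_before_const ht.measurable T
  have e3 : ∫ ϰ : ℭ, sumTables (cutTable tm T ψ) (pts ϰ) ∂𝔪 =
      ∫ ϰ : ℭ, sumTables (cutTable tm T ψ) (pts ϰ) ∂𝔪[T] := by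
    rw [chainMeasureBefore, ← integral_indicator hB]
    refine integral_congr_ae (.of_forall fun ϰ => ?_)
    simp only [Set.indicator_apply]
    split_ifs with hϰ
    · rfl
    · rw [sumTables_cutTable]
      exact if_neg hϰ
  obtain ⟨-, e4⟩ := integral_lastPoint μ ht T (k := sumTables (cutTable tm T ψ)) h2.1 h2.restrict
  rw [e1, e2, e3, e4]
  congr 1
  · simp [sumTables, cutTable, Table.empty]
  refine setIntegral_congr_ae (measurableSet_lt ht.measurable measurable_const) ?_
  have hr : ∀ a ∈ [Table.atomMP (X := X), Table.atomMO, Table.atomOP, Table.atomOO],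
      ∀ᵐ x ∂μ, x ∈ {x | tm x < T} → Integrable (fun z => ψ ((ofChains z).union (a x)))
        𝔱[tm x] := fun a ha =>
    (ae_restrict_iff' (measurableSet_lt ht.measurable measurable_const)).1 (h a ha)
  filter_upwards [hr Table.atomMP (by simp), hr Table.atomMO (by simp), hr Table.atomOP (by simp),
    hr Table.atomOO (by simp)] with x p1 p2 p3 p4 hx
  obtain ⟨i1, j1⟩ := integral_sumTables_before ht
    (ψ := fun ϑ => ψ (ϑ.union (Table.atomMP x))) (p1 hx)
  obtain ⟨i2, j2⟩ := integral_sumTables_before ht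
    (ψ := fun ϑ => ψ (ϑ.union (Table.atomMO x))) (p2 hx)
  obtain ⟨i3, j3⟩ := integral_sumTables_before ht
    (ψ := fun ϑ => ψ (ϑ.union (Table.atomOP x))) (p3 hx)
  obtain ⟨i4, j4⟩ := integral_sumTables_before ht
    (ψ := fun ϑ => ψ (ϑ.union (Table.atomOO x))) (p4 hx)
  have e5 := integral_add' ((i1.add i2).add i3) i4
  rw [integral_add' (i1.add i2) i3, integral_add' i1 i2] at e5
  rw [j1, j2, j3, j4, ← e5]
  refine setIntegral_congr_fun (measurableSet_before_const ht.measurable _) fun ϰ hϰ => ?_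
  have hx' : x ∉ pts ϰ := fun hx' => lt_irrefl _ (hϰ x hx')
  rw [sumTables_cutTable, if_pos, sumTables_union_singleton hx']
  · rfl
  · intro y hy
    rcases Finset.mem_union.1 hy with hy | hy
    · exact (hϰ y hy).trans hx
    · rw [Finset.mem_singleton.1 hy]; exact hx

end LastPointTable

/-! ### Sums over the points of a chain -/
section PointSums

theorem measurableEmbedding_sing : MeasurableEmbedding (sing tm) := by
  refine ⟨fun x y h => ?_, measurable_sing, fun {s} hs => measurableSet_chain.2 fun n => ?_⟩
  · have := congrArg pts h
    rwa [pts_sing, pts_sing, Finset.singleton_inj] at this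
  · by_cases hn : n = 1
    · subst hn
      have : Sigma.mk 1 ⁻¹' (sing tm '' s) = {x : Incr tm 1 | x.1 0 ∈ s} := by
        ext x
        constructor
        · rintro ⟨y, hy, e⟩
          have e1 := congrArg pts e
          have h0 : y ∈ pts (tm := tm) ⟨1, x⟩ := by rw [← e1, pts_sing]; simp
          obtain ⟨i, hi⟩ := mem_pts.1 h0
          rw [Subsingleton.elim i 0] at hi
          have hi' : x.1 0 = y := hi
          rw [Set.mem_ofPred_eq, hi']
          exact hy
        · intro hx
          refine ⟨_, hx, pts_injective ?_⟩
          ext y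
          simp [mem_pts, pts_sing, eq_comm]
      rw [this]
      exact (measurable_pi_apply 0).comp measurable_subtype_coe hs
    · have : Sigma.mk n ⁻¹' (sing tm '' s) = (∅ : Set (Incr tm n)) := by
        ext x
        simp only [Set.mem_preimage, Set.mem_image, Set.mem_empty_iff_false, iff_false]
        rintro ⟨y, -, e⟩
        exact hn (congrArg Sigma.fst e).symm
      rw [this]
      exact MeasurableSet.empty

/-- The function of pairs of chains which is `F x (R ∪ {x})` on the pairs `({x}, R)`. -/
def pointKernel {M : Type*} [AddCommMonoid M] (F : X → Finset X → M) (A R : Finset X) : M :=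
  if A.card = 1 then ∑ x ∈ A, F x (R ∪ A) else 0

theorem pointKernel_sing {M : Type*} [AddCommMonoid M] (F : X → Finset X → M) (x : X)
    (R : Finset X) : pointKernel F (pts (sing tm x)) R = F x (R ∪ {x}) := by
  rw [pointKernel, pts_sing, if_pos (Finset.card_singleton x), Finset.sum_singleton]

theorem sum_pointKernel {M : Type*} [AddCommMonoid M] (F : X → Finset X → M) (ω : Finset X) :
    ∑ A ∈ ω.powerset, pointKernel F A (ω \ A) = ∑ x ∈ ω, F x ω := by
  simp only [pointKernel]
  rw [← Finset.sum_filter, ← Finset.powersetCard_eq_filter, Finset.powersetCard_one, Finset.sum_map]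
  refine Finset.sum_congr rfl fun x hx => ?_
  simp only [Function.Embedding.coeFn_mk, Finset.sum_singleton]
  rw [Finset.sdiff_union_of_subset (Finset.singleton_subset_iff.2 hx)]

theorem measurePreserving_sing_prod (htm : Measurable tm) :
    MeasurePreserving (Prod.map (sing tm) id : X × ℭ → ℭ × ℭ) (μ.prod 𝔪)
      (((𝔪).prod 𝔪).restrict ({ϰ : ℭ | ϰ.1 = 1} ×ˢ Set.univ)) := by
  rw [← Measure.prod_restrict, Measure.restrict_univ, ← map_sing μ htm]
  have h : SFinite (μ.map (sing tm)) := by rw [map_sing μ htm]; infer_instance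
  exact (show MeasurePreserving (sing tm) μ (μ.map (sing tm)) from ⟨measurable_sing, rfl⟩).prod (.id _)

theorem measurableEmbedding_sing_prod :
    MeasurableEmbedding (Prod.map (sing tm) id : X × ℭ → ℭ × ℭ) :=
  measurableEmbedding_sing.prodMap .id

theorem measurableSet_card_one_prod : MeasurableSet ({ϰ : ℭ | ϰ.1 = 1} ×ˢ (Set.univ : Set (ℭ))) :=
  measurableSet_card_one.prod MeasurableSet.univ

theorem pointKernel_eq_indicator {M : Type*} [AddCommMonoid M] (F : X → Finset X → M) :
    (fun z : ℭ × ℭ => pointKernel F (pts z.1) (pts z.2)) =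
      ({ϰ : ℭ | ϰ.1 = 1} ×ˢ (Set.univ : Set (ℭ))).indicator
        fun z => pointKernel F (pts z.1) (pts z.2) := by
  rw [setOf_pts_card_one]
  ext z
  rw [Set.indicator_apply]
  split_ifs with h
  · rfl
  · rw [pointKernel, if_neg]
    exact fun h' => h ⟨h', Set.mem_univ _⟩

theorem aestronglyMeasurable_pointKernel (htm : Measurable tm) {E : Type*} [TopologicalSpace E]
    [AddCommMonoid E] {F : X → Finset X → E}
    (hF : AEStronglyMeasurable (fun z : X × ℭ => F z.1 (pts z.2 ∪ {z.1})) (μ.prod 𝔪)) :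
    AEStronglyMeasurable (fun z : ℭ × ℭ => pointKernel F (pts z.1) (pts z.2)) ((𝔪).prod 𝔪) := by
  rw [pointKernel_eq_indicator, aestronglyMeasurable_indicator_iff measurableSet_card_one_prod,
    ← (measurePreserving_sing_prod htm).aestronglyMeasurable_comp_iff measurableEmbedding_sing_prod]
  refine hF.congr (.of_forall fun z => ?_)
  exact (pointKernel_sing F z.1 (pts z.2)).symm

theorem aestronglyMeasurable_sum_points (ht : IsTime μ tm) {E : Type*} [TopologicalSpace E] [AddCommMonoid E]
    [ContinuousAdd E] [TopologicalSpace.PseudoMetrizableSpace E] {F : X → Finset X → E}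
    (hF : AEStronglyMeasurable (fun z : X × ℭ => F z.1 (pts z.2 ∪ {z.1})) (μ.prod 𝔪)) :
    AEStronglyMeasurable (fun ϰ : ℭ => ∑ x ∈ pts ϰ, F x (pts ϰ)) 𝔪 := by
  simpa only [sum_pointKernel] using
    aestronglyMeasurable_sum_powerset' μ ht (aestronglyMeasurable_pointKernel ht.measurable hF)

theorem lintegral_sum_points (ht : IsTime μ tm)
    {F : X → Finset X → ℝ≥0∞} (hF : AEMeasurable (fun z : X × ℭ => F z.1 (pts z.2 ∪ {z.1}))
      (μ.prod 𝔪)) :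
    ∫⁻ z, F z.1 (pts z.2 ∪ {z.1}) ∂μ.prod 𝔪 = ∫⁻ ϰ : ℭ, ∑ x ∈ pts ϰ, F x (pts ϰ) ∂𝔪 := by
  have h := lintegral_prod_chain' μ ht
    (aestronglyMeasurable_pointKernel ht.measurable hF.aestronglyMeasurable).aemeasurable
  simp only [sum_pointKernel] at h
  rw [← h, pointKernel_eq_indicator, lintegral_indicator measurableSet_card_one_prod,
    ← (measurePreserving_sing_prod ht.measurable).lintegral_comp_emb measurableEmbedding_sing_prod]
  exact lintegral_congr fun z => (pointKernel_sing F z.1 (pts z.2)).symm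

/-- Integration of a sum over the points of a chain. -/
theorem integral_sum_points (ht : IsTime μ tm)
    {E : Type*} [NormedAddCommGroup E] [NormedSpace ℝ E] [CompleteSpace E] {F : X → Finset X → E}
    (hF : Integrable (fun z : X × ℭ => F z.1 (pts z.2 ∪ {z.1})) (μ.prod 𝔪)) :
    Integrable (fun ϰ : ℭ => ∑ x ∈ pts ϰ, F x (pts ϰ)) 𝔪 ∧
    ∫ z, F z.1 (pts z.2 ∪ {z.1}) ∂μ.prod 𝔪 = ∫ ϰ : ℭ, ∑ x ∈ pts ϰ, F x (pts ϰ) ∂𝔪 := by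
  have e1 : (fun z : X × ℭ => F z.1 (pts z.2 ∪ {z.1})) =
      (fun z : ℭ × ℭ => pointKernel F (pts z.1) (pts z.2)) ∘
        Prod.map (sing tm) id := by
    ext z; exact (pointKernel_sing F z.1 (pts z.2)).symm
  have hi : Integrable (fun z : ℭ × ℭ => pointKernel F (pts z.1) (pts z.2))
      ((𝔪).prod 𝔪) := by
    rw [pointKernel_eq_indicator, integrable_indicator_iff measurableSet_card_one_prod, IntegrableOn,
      ← (measurePreserving_sing_prod ht.measurable).integrable_comp_emb measurableEmbedding_sing_prod, ← e1]
    exact hF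
  have h := integral_prod_chain' μ ht hi
  simp only [sum_pointKernel] at h
  refine ⟨h.1, ?_⟩
  rw [← h.2, pointKernel_eq_indicator, integral_indicator measurableSet_card_one_prod,
    ← (measurePreserving_sing_prod ht.measurable).integral_comp measurableEmbedding_sing_prod, e1]
  rfl

end PointSums

/-! ### Single integrals -/
section SingleIntegrals

theorem restrict_prod_chainMeasure (Δ : Set X) : (μ.restrict Δ).prod 𝔪 =
    (μ.prod 𝔪).restrict (Δ ×ˢ Set.univ) := by
  rw [← Measure.prod_restrict, Measure.restrict_univ]

theorem indicator_point {M : Type*} [Zero M] (Δ : Set X) (F : X → Finset X → M) :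
    (fun z : X × ℭ => if z.1 ∈ Δ then F z.1 (pts z.2 ∪ {z.1}) else 0) =
      (Δ ×ˢ (Set.univ : Set (ℭ))).indicator fun z => F z.1 (pts z.2 ∪ {z.1}) := by
  ext z
  simp [Set.indicator_apply]

theorem aestronglyMeasurable_sum_points_on (ht : IsTime μ tm) {Δ : Set X} (hΔ : MeasurableSet Δ) {E : Type*}
    [TopologicalSpace E] [AddCommMonoid E] [ContinuousAdd E]
    [TopologicalSpace.PseudoMetrizableSpace E] {F : X → Finset X → E}
    (hF : AEStronglyMeasurable (fun z : X × ℭ => F z.1 (pts z.2 ∪ {z.1})) ((μ.restrict Δ).prod 𝔪)) :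
    AEStronglyMeasurable (fun ϰ : ℭ => ∑ x ∈ (pts ϰ).filter (fun x => x ∈ Δ), F x (pts ϰ)) 𝔪 := by
  simp only [Finset.sum_filter]
  refine aestronglyMeasurable_sum_points ht (F := fun x ω => if x ∈ Δ then F x ω else 0) ?_
  rw [indicator_point, aestronglyMeasurable_indicator_iff (hΔ.prod MeasurableSet.univ),
    ← restrict_prod_chainMeasure]
  exact hF

theorem lintegral_sum_points_on (ht : IsTime μ tm)
    {Δ : Set X} (hΔ : MeasurableSet Δ) {F : X → Finset X → ℝ≥0∞}
    (hF : AEMeasurable (fun z : X × ℭ => F z.1 (pts z.2 ∪ {z.1})) ((μ.restrict Δ).prod 𝔪)) :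
    ∫⁻ z, F z.1 (pts z.2 ∪ {z.1}) ∂(μ.restrict Δ).prod 𝔪 =
      ∫⁻ ϰ : ℭ, ∑ x ∈ (pts ϰ).filter (fun x => x ∈ Δ), F x (pts ϰ) ∂𝔪 := by
  have h := lintegral_sum_points ht (F := fun x ω => if x ∈ Δ then F x ω else 0) (μ := μ) (by
    rw [indicator_point, aemeasurable_indicator_iff (hΔ.prod MeasurableSet.univ),
      ← restrict_prod_chainMeasure]
    exact hF)
  simp only [Finset.sum_filter]
  rw [← h, indicator_point, lintegral_indicator (hΔ.prod MeasurableSet.univ),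
    ← restrict_prod_chainMeasure]

theorem integral_sum_points_on (ht : IsTime μ tm) {Δ : Set X} (hΔ : MeasurableSet Δ)
    {E : Type*} [NormedAddCommGroup E] [NormedSpace ℝ E] [CompleteSpace E] {F : X → Finset X → E}
    (hF : Integrable (fun z : X × ℭ => F z.1 (pts z.2 ∪ {z.1})) ((μ.restrict Δ).prod 𝔪)) :
    ∫ z, F z.1 (pts z.2 ∪ {z.1}) ∂(μ.restrict Δ).prod 𝔪 =
      ∫ ϰ : ℭ, ∑ x ∈ (pts ϰ).filter (fun x => x ∈ Δ), F x (pts ϰ) ∂𝔪 := by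
  have h := integral_sum_points ht (F := fun x ω => if x ∈ Δ then F x ω else 0) (μ := μ) (by
    rw [indicator_point, integrable_indicator_iff (hΔ.prod MeasurableSet.univ), IntegrableOn,
      ← restrict_prod_chainMeasure]
    exact hF)
  simp only [Finset.sum_filter]
  rw [← h.2, indicator_point, integral_indicator (hΔ.prod MeasurableSet.univ),
    ← restrict_prod_chainMeasure]

variable {q : X → ℝ≥0} {Δ : Set X} {C : ℝ≥0∞}

theorem lintegral_sq_inv_le_of_dual (htm : Measurable tm) (hq : IsWeight μ q)
    {G : Finset X → ℝ≥0∞} (hG : AEMeasurable (fun ϰ : ℭ => G (pts ϰ)) 𝔪)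
    (h : ∀ φ : Finset X → ℝ≥0∞, AEMeasurable (fun ϰ : ℭ => φ (pts ϰ)) 𝔪 →
      ∫⁻ ϰ, φ (pts ϰ) ^ 2 * (wt q (pts ϰ) : ℝ≥0∞) ∂𝔪 ≠ ∞ → ∫⁻ ϰ, φ (pts ϰ) * G (pts ϰ) ∂𝔪 ≤
        C * (∫⁻ ϰ, φ (pts ϰ) ^ 2 * (wt q (pts ϰ) : ℝ≥0∞) ∂𝔪) ^ (1 / 2 : ℝ)) :
    ∫⁻ ϰ, G (pts ϰ) ^ 2 * (wt q⁻¹ (pts ϰ) : ℝ≥0∞) ∂𝔪 ≤ C ^ 2 := by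
  have h1 := lintegral_sq_div_le_of_dual hG (aemeasurable_wt htm hq.aemeasurable)
    (fun ϰ => hq.wt_pos (pts ϰ)) (C := C) fun f hf hfin => by
      have h2 := h (fun ω => f (chainOf tm ω))
      simp only [chainOf_pts] at h2
      simpa only [mul_comm] using h2 hf hfin
  refine le_trans (le_of_eq (lintegral_congr fun ϰ => ?_)) h1
  rw [wt_inv, ENNReal.coe_inv (hq.wt_pos _).ne']

theorem ae_lt_top_of_lintegral_sq_inv_le (htm : Measurable tm) (hq : IsWeight μ q) (hC : C < ∞)
    {G : Finset X → ℝ≥0∞} (hG : AEMeasurable (fun ϰ : ℭ => G (pts ϰ)) 𝔪)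
    (h : ∫⁻ ϰ, G (pts ϰ) ^ 2 * (wt q⁻¹ (pts ϰ) : ℝ≥0∞) ∂𝔪 ≤ C ^ 2) : ∀ᵐ ϰ ∂𝔪, G (pts ϰ) < ∞ := by
  have h2 := (hG.pow_const 2).mul (aemeasurable_wt htm hq.inv.aemeasurable).coe_nnreal_ennreal
  filter_upwards [ae_lt_top' h2 (h.trans_lt (ENNReal.pow_lt_top hC)).ne] with ϰ hϰ
  exact lt_top_of_sq_mul_lt_top (hq.inv.wt_pos (pts ϰ)) hϰ

theorem pairing_empty (f g : Sec K) : pairing μ tm ∅ f g =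
    ∫ ϰ : ℭ, (inner ℂ (f (pts ϰ)) (g (pts ϰ)) : ℂ) ∂𝔪 :=
  integral_congr_ae (.of_forall fun ϰ => by dsimp only; rw [Finset.union_empty])

theorem memFock_empty_iff (R : Regular μ tm e) (f : Sec K) : MemFock μ tm e q ∅ f ↔
    AEStronglyMeasurable (fun ϰ : ℭ => ef tm R.field f (pts ϰ)) 𝔪 ∧
    ∫⁻ ϰ, ‖f (pts ϰ)‖ₑ ^ 2 * (wt q (pts ϰ) : ℝ≥0∞) ∂𝔪 < ∞ := by
  have h1 : fockNorm μ tm q ∅ f ^ 2 = ∫⁻ ϰ, ‖f (pts ϰ)‖ₑ ^ 2 * (wt q (pts ϰ) : ℝ≥0∞) ∂𝔪 := by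
    rw [fockNorm_sq]
    exact lintegral_congr fun ϰ => by rw [Finset.union_empty]
  rw [MemFock, isEssMeasurable_iff R.field R.time.measurable
    (chainLike_union_const R.time (by simp)), ← h1]
  have h2 : (fun ϰ : ℭ => enc tm R.field (pts ϰ ∪ ∅) (f (pts ϰ ∪ ∅))) =
      fun ϰ => ef tm R.field f (pts ϰ) := by
    ext1 ϰ
    rw [Finset.union_empty]
    rfl
  rw [h2]
  exact and_congr_right fun _ => ⟨fun h => ENNReal.pow_lt_top h, fun h =>
    (ENNReal.pow_lt_top_iff.1 h).resolve_right two_ne_zero⟩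

variable (μ tm) in
/-- The estimate which makes the single integral over `Δ` of the family `G x ∈ F₋ ⊗ K^⊗(τ x)`
an element of the dual of `F(q)`. -/
def SingleBound (q : X → ℝ≥0) (Δ : Set X) (τ : X → Finset X) (G : X → Sec K) (C : ℝ≥0∞) : Prop :=
  ∀ φ : Finset X → ℝ≥0∞, AEMeasurable (fun ϰ : ℭ => φ (pts ϰ)) 𝔪 →
    ∫⁻ ϰ, φ (pts ϰ) ^ 2 * (wt q (pts ϰ) : ℝ≥0∞) ∂𝔪 ≠ ∞ →
    ∫⁻ x in Δ, ∫⁻ ϰ, φ (pts ϰ ∪ τ x) * ‖G x (pts ϰ ∪ τ x)‖ₑ ∂𝔪 ∂μ ≤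
      C * (∫⁻ ϰ, φ (pts ϰ) ^ 2 * (wt q (pts ϰ) : ℝ≥0∞) ∂𝔪) ^ (1 / 2 : ℝ)

theorem SingleBound.congr {τ : X → Finset X} {G G' : X → Sec K} (h : SingleBound μ tm q Δ τ G C)
    (hG : ∀ᵐ x ∂μ.restrict Δ, EqFock μ tm (τ x) (G' x) (G x)) : SingleBound μ tm q Δ τ G' C := by
  intro φ hφ hfin
  refine le_trans (le_of_eq (lintegral_congr_ae ?_)) (h φ hφ hfin)
  filter_upwards [hG] with x hx
  refine lintegral_congr_ae ?_
  filter_upwards [hx] with ϰ hϰ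
  rw [hϰ]

theorem chainLike_snd {Y : Type*} [MeasurableSpace Y] {ν : Measure Y} :
    ChainLike (ν.prod 𝔪) tm fun z => pts z.2 :=
  ⟨Prod.snd, measurable_snd, .of_forall fun _ => rfl⟩

/-! #### Time integrals -/

section Time

variable {Φ : X → Sec K}

theorem lintegral_time_sq_le (R : Regular μ tm e) (hq : IsWeight μ q)
    (hΦ : AEStronglyMeasurable (fun z : X × ℭ => ef tm R.field (Φ z.1) (pts z.2))
      ((μ.restrict Δ).prod 𝔪)) (hb : SingleBound μ tm q Δ (fun _ => ∅) Φ C) :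
    AEMeasurable (fun ϰ : ℭ => ∫⁻ x in Δ, ‖Φ x (pts ϰ)‖ₑ ∂μ) 𝔪 ∧
    ∫⁻ ϰ, (∫⁻ x in Δ, ‖Φ x (pts ϰ)‖ₑ ∂μ) ^ 2 * (wt q⁻¹ (pts ϰ) : ℝ≥0∞) ∂𝔪 ≤ C ^ 2 := by
  have h1 : AEMeasurable (fun z : X × ℭ => ‖Φ z.1 (pts z.2)‖ₑ) ((μ.restrict Δ).prod 𝔪) := by
    simpa only [enorm_ef] using hΦ.enorm
  refine ⟨h1.lintegral_prod_left', lintegral_sq_inv_le_of_dual R.time.measurable hq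
    (G := fun ω => ∫⁻ x in Δ, ‖Φ x ω‖ₑ ∂μ) h1.lintegral_prod_left' fun φ hφ hfin => ?_⟩
  refine le_trans (le_of_eq ?_) (hb φ hφ hfin)
  have h2 : AEMeasurable (fun z : X × ℭ => φ (pts z.2) * ‖Φ z.1 (pts z.2)‖ₑ)
      ((μ.restrict Δ).prod 𝔪) := hφ.comp_snd.mul h1
  have h3 : ∀ᵐ ϰ ∂𝔪, AEMeasurable (fun x => ‖Φ x (pts ϰ)‖ₑ) (μ.restrict Δ) := by
    filter_upwards [h1.prod_swap.aestronglyMeasurable.prodMk_left] with ϰ hϰ using hϰ.aemeasurable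
  calc _ = ∫⁻ ϰ : ℭ, ∫⁻ x in Δ, φ (pts ϰ) * ‖Φ x (pts ϰ)‖ₑ ∂μ ∂𝔪 := by
        refine lintegral_congr_ae ?_
        filter_upwards [h3] with ϰ hϰ
        exact (lintegral_const_mul'' _ hϰ).symm
    _ = ∫⁻ x in Δ, ∫⁻ ϰ : ℭ, φ (pts ϰ) * ‖Φ x (pts ϰ)‖ₑ ∂𝔪 ∂μ :=
        (lintegral_lintegral_swap h2).symm
    _ = _ := lintegral_congr fun x => lintegral_congr fun ϰ => by rw [Finset.union_empty]

theorem ae_integrableOn_time (R : Regular μ tm e) (hq : IsWeight μ q) (hC : C < ∞)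
    (hΦ : AEStronglyMeasurable (fun z : X × ℭ => ef tm R.field (Φ z.1) (pts z.2))
      ((μ.restrict Δ).prod 𝔪)) (hb : SingleBound μ tm q Δ (fun _ => ∅) Φ C) :
    ∀ᵐ ϰ ∂𝔪, IntegrableOn (fun x => Φ x (pts ϰ)) Δ μ := by
  obtain ⟨h1, h2⟩ := lintegral_time_sq_le R hq hΦ hb
  filter_upwards [ae_lt_top_of_lintegral_sq_inv_le R.time.measurable hq hC
    (G := fun ω => ∫⁻ x in Δ, ‖Φ x ω‖ₑ ∂μ) h1 h2, hΦ.prod_swap.prodMk_left] with ϰ h3 h4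
  exact ⟨(enc tm R.field (pts ϰ)).isometry.isEmbedding.aestronglyMeasurable_comp_iff.1 h4, h3⟩

theorem exists_hasTimeIntegral (R : Regular μ tm e) (hq : IsWeight μ q) (hC : C < ∞)
    {D : X → Sec K → Sec K} (hΦ : JointlyMeasurable μ tm e (μ.restrict Δ) (fun _ => ∅) Φ)
    (hD : ∀ᵐ x ∂μ.restrict Δ, EqFock μ tm ∅ (Φ x) (D x h))
    (hb : SingleBound μ tm q Δ (fun _ => ∅) (fun x => D x h) C) :
    ∃ g, HasTimeIntegral μ tm e Δ D h g := by
  have h1 : AEStronglyMeasurable (fun z : X × ℭ => ef tm R.field (Φ z.1) (pts z.2))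
      ((μ.restrict Δ).prod 𝔪) := by
    refine ((jointlyMeasurable_iff R (chainLike_const ∅ (by simp))).1 hΦ).congr
      (.of_forall fun z => ?_)
    dsimp only
    rw [Finset.union_empty]
  refine ⟨fun ω => ∫ x in Δ, Φ x ω ∂μ, Φ,
    (isEssMeasurable_iff R.field R.time.measurable chainLike_snd).2 h1, hD, ?_⟩
  filter_upwards [ae_integrableOn_time R hq hC h1 (hb.congr hD)] with ϰ hϰ using ⟨hϰ, rfl⟩

/-- The matrix elements of the time integral are the integrals of the matrix elements. -/
theorem HasTimeIntegral.weak (R : Regular μ tm e) (hq : IsWeight μ q) (hC : C < ∞)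
    {D : X → Sec K → Sec K} {h g : Sec K} (hg : HasTimeIntegral μ tm e Δ D h g)
    (hb : SingleBound μ tm q Δ (fun _ => ∅) (fun x => D x h) C) : MemFock μ tm e q⁻¹ ∅ g ∧
      ∀ f, MemFock μ tm e q ∅ f → Integrable (fun x => pairing μ tm ∅ f (D x h)) (μ.restrict Δ) ∧
        pairing μ tm ∅ f g = ∫ x in Δ, pairing μ tm ∅ f (D x h) ∂μ := by
  obtain ⟨Φ, hΦ, hD, H⟩ := hg
  have hΦ' := (isEssMeasurable_iff R.field R.time.measurable chainLike_snd).1 hΦ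
  obtain ⟨h1, h2⟩ := lintegral_time_sq_le R hq hΦ' (hb.congr hD)
  refine ⟨(memFock_empty_iff R g).2 ⟨?_, ?_⟩, fun f hf => ?_⟩
  · refine (AEStronglyMeasurable.integral_prod_right' hΦ'.prod_swap).congr ?_
    filter_upwards [H] with ϰ hϰ
    rw [ef, hϰ.2]
    exact (enc tm R.field (pts ϰ)).toContinuousLinearMap.integral_comp_comm hϰ.1
  · refine lt_of_le_of_lt (lintegral_mono_ae ?_) (h2.trans_lt (ENNReal.pow_lt_top hC))
    filter_upwards [H] with ϰ hϰ
    rw [hϰ.2]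
    gcongr
    exact enorm_integral_le_lintegral_enorm _
  · obtain ⟨hf1, hf2⟩ := (memFock_empty_iff R f).1 hf
    have hm : AEStronglyMeasurable (fun z : X × ℭ =>
        (inner ℂ (f (pts z.2)) (Φ z.1 (pts z.2)) : ℂ))
        ((μ.restrict Δ).prod 𝔪) := by
      refine (hf1.comp_snd.inner (𝕜 := ℂ) hΦ').congr (.of_forall fun z => ?_)
      exact inner_ef R.field _ _ _
    have hi : Integrable (fun z : X × ℭ => (inner ℂ (f (pts z.2)) (Φ z.1 (pts z.2)) : ℂ))
        ((μ.restrict Δ).prod 𝔪) := by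
      refine ⟨hm, ?_⟩
      have h3 := (hb.congr hD) (fun ω => ‖f ω‖ₑ) (by simpa only [enorm_ef] using hf1.enorm) hf2.ne
      rw [HasFiniteIntegral, lintegral_prod _ hm.enorm]
      refine lt_of_le_of_lt (lintegral_mono fun x => lintegral_mono fun ϰ => ?_)
        (h3.trans_lt (ENNReal.mul_lt_top hC (sqrt_ne_top hf2.ne).lt_top))
      dsimp only
      rw [Finset.union_empty]
      simp only [← ofReal_norm]
      rw [← ENNReal.ofReal_mul (norm_nonneg _)]
      exact ENNReal.ofReal_le_ofReal (norm_inner_le_norm _ _)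
    have hp : ∀ᵐ x ∂μ.restrict Δ, ∫ ϰ : ℭ, (inner ℂ (f (pts ϰ)) (Φ x (pts ϰ)) : ℂ)
        ∂𝔪 = pairing μ tm ∅ f (D x h) := by
      filter_upwards [hD] with x hx
      rw [← pairing_empty]
      exact (EqFock.refl _ f).pairing_eq hx
    refine ⟨hi.integral_prod_left.congr hp, ?_⟩
    rw [← integral_congr_ae hp, integral_integral_swap hi, pairing_empty]
    refine integral_congr_ae ?_
    filter_upwards [H] with ϰ hϰ
    rw [hϰ.2]
    exact (integral_inner hϰ.1 _).symm

end Time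

/-! #### Point sums -/

section Point

variable {Φ : X → Sec K}

theorem lintegral_point_sq_le (R : Regular μ tm e) (hq : IsWeight μ q) (hΔ : MeasurableSet Δ)
    (hΦ : AEStronglyMeasurable (fun z : X × ℭ => ef tm R.field (Φ z.1) (pts z.2 ∪ {z.1}))
      ((μ.restrict Δ).prod 𝔪)) (hb : SingleBound μ tm q Δ (fun x => {x}) Φ C) :
    ∫⁻ ϰ, (∑ x ∈ (pts ϰ).filter (fun x => x ∈ Δ), ‖Φ x (pts ϰ)‖ₑ) ^ 2 *
      (wt q⁻¹ (pts ϰ) : ℝ≥0∞) ∂𝔪 ≤ C ^ 2 := by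
  have h1 : AEMeasurable (fun z : X × ℭ => ‖Φ z.1 (pts z.2 ∪ {z.1})‖ₑ)
      ((μ.restrict Δ).prod 𝔪) := by
    simpa only [enorm_ef] using hΦ.enorm
  refine lintegral_sq_inv_le_of_dual R.time.measurable hq
    (G := fun ω => ∑ x ∈ ω.filter (fun x => x ∈ Δ), ‖Φ x ω‖ₑ)
    (aestronglyMeasurable_sum_points_on R.time hΔ (F := fun x ω => ‖Φ x ω‖ₑ)
      h1.aestronglyMeasurable).aemeasurable fun φ hφ hfin => ?_
  refine le_trans (le_of_eq ?_) (hb φ hφ hfin)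
  have h0 : AEMeasurable (fun z : X × ℭ => φ (pts z.2 ∪ {z.1})) ((μ.restrict Δ).prod 𝔪) := by
    have h3 := (quasiMeasurePreserving_insertPt μ R.time)
    refine ((hφ.comp_quasiMeasurePreserving h3).congr ?_).mono_ac
      (Measure.AbsolutelyContinuous.prod Measure.restrict_le_self.absolutelyContinuous (.refl _))
    filter_upwards [ae_apart_point μ R.time] with z hz
    rw [Function.comp_apply, pts_insertPt hz]
  have h2 : AEMeasurable (fun z : X × ℭ => φ (pts z.2 ∪ {z.1}) * ‖Φ z.1 (pts z.2 ∪ {z.1})‖ₑ)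
      ((μ.restrict Δ).prod 𝔪) := h0.mul h1
  rw [← lintegral_prod _ h2, lintegral_sum_points_on R.time hΔ (F := fun x ω => φ ω * ‖Φ x ω‖ₑ) h2]
  simp only [Finset.mul_sum]

theorem exists_hasPointSum {D : X → Sec K → Sec K}
    (hΦ : JointlyMeasurable μ tm e (μ.restrict Δ) (fun x => {x}) Φ)
    (hD : ∀ᵐ x ∂μ.restrict Δ, EqFock μ tm {x} (Φ x) (D x h)) : ∃ g, HasPointSum μ tm e Δ D h g :=
  ⟨fun ω => ∑ x ∈ ω.filter (fun x => x ∈ Δ), Φ x ω, Φ, hΦ, hD, .of_forall fun _ => rfl⟩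

/-- The matrix elements of the sum over the points are the integrals of the matrix elements, in
which the points are split off from the chain. -/
theorem HasPointSum.weak (R : Regular μ tm e) (hq : IsWeight μ q) (hC : C < ∞)
    (hΔ : MeasurableSet Δ) {D : X → Sec K → Sec K} {h g : Sec K} (hg : HasPointSum μ tm e Δ D h g)
    (hb : SingleBound μ tm q Δ (fun x => {x}) (fun x => D x h) C) : MemFock μ tm e q⁻¹ ∅ g ∧
      ∀ f, MemFock μ tm e q ∅ f → Integrable (fun x => pairing μ tm {x} f (D x h)) (μ.restrict Δ) ∧
        pairing μ tm ∅ f g = ∫ x in Δ, pairing μ tm {x} f (D x h) ∂μ := by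
  obtain ⟨Φ, hΦ, hD, H⟩ := hg
  have hcl : ChainLike (μ.restrict Δ) tm fun x : X => {x} := chainLike_sing
  have hΦ' := (jointlyMeasurable_iff R hcl).1 hΦ
  have h2 := lintegral_point_sq_le R hq hΔ hΦ' (hb.congr hD)
  refine ⟨(memFock_empty_iff R g).2 ⟨?_, ?_⟩, fun f hf => ?_⟩
  · refine (aestronglyMeasurable_sum_points_on R.time hΔ
      (F := fun x ω => ef tm R.field (Φ x) ω) hΦ').congr ?_
    filter_upwards [H] with ϰ hϰ
    rw [ef, hϰ, map_sum]
    rfl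
  · refine lt_of_le_of_lt (lintegral_mono_ae ?_) (h2.trans_lt (ENNReal.pow_lt_top hC))
    filter_upwards [H] with ϰ hϰ
    rw [hϰ]
    gcongr
    exact enorm_sum_le _ _
  · obtain ⟨hf1, hf2⟩ := (memFock_empty_iff R f).1 hf
    have hf3 : AEStronglyMeasurable (fun z : X × ℭ => ef tm R.field f (pts z.2 ∪ {z.1}))
        ((μ.restrict Δ).prod 𝔪) := by
      have h3 := (quasiMeasurePreserving_insertPt μ R.time)
      refine ((hf1.comp_quasiMeasurePreserving h3).congr ?_).mono_ac
        (Measure.AbsolutelyContinuous.prod Measure.restrict_le_self.absolutelyContinuous (.refl _))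
      filter_upwards [ae_apart_point μ R.time] with z hz
      rw [Function.comp_apply, pts_insertPt hz]
    have hm : AEStronglyMeasurable (fun z : X × ℭ =>
        (inner ℂ (f (pts z.2 ∪ {z.1})) (Φ z.1 (pts z.2 ∪ {z.1})) : ℂ))
        ((μ.restrict Δ).prod 𝔪) := by
      refine (hf3.inner (𝕜 := ℂ) hΦ').congr (.of_forall fun z => ?_)
      exact inner_ef R.field _ _ _
    have hi : Integrable (fun z : X × ℭ =>
        (inner ℂ (f (pts z.2 ∪ {z.1})) (Φ z.1 (pts z.2 ∪ {z.1})) : ℂ))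
        ((μ.restrict Δ).prod 𝔪) := by
      refine ⟨hm, ?_⟩
      have h3 := (hb.congr hD) (fun ω => ‖f ω‖ₑ) (by simpa only [enorm_ef] using hf1.enorm) hf2.ne
      rw [HasFiniteIntegral, lintegral_prod _ hm.enorm]
      refine lt_of_le_of_lt (lintegral_mono fun x => lintegral_mono fun ϰ => ?_)
        (h3.trans_lt (ENNReal.mul_lt_top hC (sqrt_ne_top hf2.ne).lt_top))
      simp only [← ofReal_norm]
      rw [← ENNReal.ofReal_mul (norm_nonneg _)]
      exact ENNReal.ofReal_le_ofReal (norm_inner_le_norm _ _)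
    have hp : ∀ᵐ x ∂μ.restrict Δ, ∫ ϰ : ℭ,
        (inner ℂ (f (pts ϰ ∪ {x})) (Φ x (pts ϰ ∪ {x})) : ℂ) ∂𝔪 = pairing μ tm {x} f (D x h) := by
      filter_upwards [hD] with x hx
      exact (EqFock.refl _ f).pairing_eq hx
    refine ⟨hi.integral_prod_left.congr hp, ?_⟩
    rw [← integral_congr_ae hp, ← integral_prod _ hi, integral_sum_points_on R.time hΔ (F := fun x ω => (inner ℂ (f ω) (Φ x ω) : ℂ)) hi, pairing_empty]
    refine integral_congr_ae ?_
    filter_upwards [H] with ϰ hϰ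
    rw [hϰ, inner_sum]

end Point

end SingleIntegrals

/-! ### The estimates for the single integrals -/
section SingleBounds

variable {p r s q q' u : X → ℝ≥0}

/-- Splitting off a point is a special case of the splittings of `wt_add`. -/
theorem sum_wt_point_le (u w : X → ℝ≥0) (ω : Finset X) :
    ∑ x ∈ ω, u x * wt w (ω \ {x}) ≤ wt (u + w) ω := by
  have h : ∑ x ∈ ω, u x * wt w (ω \ {x}) = ∑ A ∈ ω.powersetCard 1, wt u A * wt w (ω \ A) := by
    rw [Finset.powersetCard_one, Finset.sum_map]
    refine Finset.sum_congr rfl fun x _ => ?_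
    simp [wt]
  rw [h, wt_add]
  refine Finset.sum_le_sum_of_subset fun A hA => ?_
  exact Finset.mem_powerset.2 (Finset.mem_powersetCard.1 hA).1

/-- The norms of the derivatives at points. -/
theorem scalarNorm_point (ht : IsTime μ tm)
    (hu : IsWeight μ u) (hw : IsWeight μ w) (hle : u + w ≤ q') {φ : Finset X → ℝ≥0∞}
    (hφ : AEMeasurable (fun ϰ : ℭ => φ (pts ϰ)) 𝔪) :
    AEMeasurable (fun x => scalarNorm μ tm w φ {x}) μ ∧
    ∫⁻ x, scalarNorm μ tm w φ {x} ^ 2 * (u x : ℝ≥0∞) ∂μ ≤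
      ∫⁻ ϰ, φ (pts ϰ) ^ 2 * (wt q' (pts ϰ) : ℝ≥0∞) ∂𝔪 := by
  have h1 : AEMeasurable (fun z : X × ℭ => φ (pts z.2 ∪ {z.1})) (μ.prod 𝔪) := by
    refine (hφ.comp_quasiMeasurePreserving (quasiMeasurePreserving_insertPt μ ht)).congr ?_
    filter_upwards [ae_apart_point μ ht] with z hz
    rw [Function.comp_apply, pts_insertPt hz]
  have h2 : AEMeasurable (fun z : X × ℭ =>
      φ (pts z.2 ∪ {z.1}) ^ 2 * (wt w (pts z.2) : ℝ≥0∞)) (μ.prod 𝔪) :=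
    (h1.pow_const 2).mul (aemeasurable_wt ht.measurable hw.aemeasurable).coe_nnreal_ennreal.comp_snd
  refine ⟨h2.lintegral_prod_right'.pow_const _, ?_⟩
  have h3 : AEMeasurable (fun z : X × ℭ =>
      φ (pts z.2 ∪ {z.1}) ^ 2 * (wt w (pts z.2) : ℝ≥0∞) * (u z.1 : ℝ≥0∞))
      (μ.prod 𝔪) := h2.mul hu.aemeasurable.coe_nnreal_ennreal.comp_fst
  let F : X → Finset X → ℝ≥0∞ := fun x ω => φ ω ^ 2 * (wt w (ω \ {x}) : ℝ≥0∞) * (u x : ℝ≥0∞)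
  have h4 : (fun z : X × ℭ => φ (pts z.2 ∪ {z.1}) ^ 2 * (wt w (pts z.2) : ℝ≥0∞) *
      (u z.1 : ℝ≥0∞)) =ᵐ[μ.prod 𝔪] fun z => F z.1 (pts z.2 ∪ {z.1}) := by
    filter_upwards [ae_apart_point μ ht] with z hz
    have : (pts z.2 ∪ {z.1}) \ {z.1} = pts z.2 := by
      rw [Finset.union_sdiff_right, Finset.sdiff_eq_self_of_disjoint hz.disjoint]
    simp only [F, this]
  calc ∫⁻ x, scalarNorm μ tm w φ {x} ^ 2 * (u x : ℝ≥0∞) ∂μ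
      = ∫⁻ x, ∫⁻ ϰ : ℭ, φ (pts ϰ ∪ {x}) ^ 2 * (wt w (pts ϰ) : ℝ≥0∞) * (u x : ℝ≥0∞)
          ∂𝔪 ∂μ := by
        refine lintegral_congr fun x => ?_
        rw [scalarNorm, sqrt_sq, lintegral_mul_const' _ _ ENNReal.coe_ne_top]
    _ = ∫⁻ z, F z.1 (pts z.2 ∪ {z.1}) ∂μ.prod 𝔪 := by
        rw [← lintegral_prod _ h3, lintegral_congr_ae h4]
    _ = ∫⁻ ϰ : ℭ, ∑ x ∈ pts ϰ, F x (pts ϰ) ∂𝔪 :=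
        lintegral_sum_points ht (h3.congr h4)
    _ ≤ _ := by
        refine lintegral_mono fun ϰ => ?_
        simp only [F, mul_assoc, ← Finset.mul_sum]
        gcongr
        have h5 := (sum_wt_point_le u w (pts ϰ)).trans (wt_mono hle _)
        simp only [mul_comm (wt w _ : ℝ≥0∞)]
        exact_mod_cast h5

theorem lintegral_mul_le_weight {Ω : Type*} [MeasurableSpace Ω] {m : Measure Ω} {f g : Ω → ℝ≥0∞}
    (hf : AEMeasurable f m) (hg : AEMeasurable g m) {ρ : Ω → ℝ≥0} (hρ : AEMeasurable ρ m)
    (hρ0 : ∀ x, 0 < ρ x) : ∫⁻ x, f x * g x ∂m ≤ (∫⁻ x, f x ^ 2 * (ρ x : ℝ≥0∞) ∂m) ^ (1 / 2 : ℝ) *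
      (∫⁻ x, g x ^ 2 * ((ρ⁻¹ x : ℝ≥0) : ℝ≥0∞) ∂m) ^ (1 / 2 : ℝ) := by
  have h1 := lintegral_mul_le_sqrt (hf.mul (hρ.coe_nnreal_ennreal.pow_const (1 / 2 : ℝ)))
    (hg.mul (hρ.inv.coe_nnreal_ennreal.pow_const (1 / 2 : ℝ)))
  simp only [Pi.mul_apply, mul_pow, sqrt_sq] at h1
  refine le_trans (le_of_eq (lintegral_congr fun x => ?_)) h1
  have h2 : (ρ x : ℝ≥0∞) ^ (1 / 2 : ℝ) * ((ρ⁻¹ x : ℝ≥0) : ℝ≥0∞) ^ (1 / 2 : ℝ) = 1 := by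
    rw [← sqrt_mul, ← ENNReal.coe_mul, Pi.inv_apply, mul_inv_cancel₀ (hρ0 x).ne', ENNReal.coe_one,
      ENNReal.one_rpow]
  rw [mul_mul_mul_comm, h2, mul_one]

theorem fockNorm_mono (h : w ≤ q) (f : Sec K) : fockNorm μ tm w σ f ≤ fockNorm μ tm q σ f := by
  refine sqrt_le_sqrt (lintegral_mono fun ϰ => ?_)
  gcongr
  exact wt_mono h _

theorem MemFock.mono {f : Sec K} (hf : MemFock μ tm e q σ f) (h : w ≤ q) : MemFock μ tm e w σ f :=
  ⟨hf.1, (fockNorm_mono h f).trans_lt hf.2⟩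

theorem scalarNorm_empty_le (h : w ≤ q) (φ : Finset X → ℝ≥0∞) : scalarNorm μ tm w φ ∅ ≤
    (∫⁻ ϰ, φ (pts ϰ) ^ 2 * (wt q (pts ϰ) : ℝ≥0∞) ∂𝔪) ^ (1 / 2 : ℝ) := by
  refine sqrt_le_sqrt (lintegral_mono fun ϰ => ?_)
  rw [Finset.union_empty]
  gcongr
  exact wt_mono h _

theorem fockNorm_empty_eq (f : Sec K) : fockNorm μ tm q ∅ f =
    (∫⁻ ϰ, ‖f (pts ϰ)‖ₑ ^ 2 * (wt q (pts ϰ) : ℝ≥0∞) ∂𝔪) ^ (1 / 2 : ℝ) := by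
  rw [fockNorm]
  congr 1
  exact lintegral_congr fun ϰ => by rw [Finset.union_empty]

theorem jointlyMeasurable_const (R : Regular μ tm e) {Y : Type*} [MeasurableSpace Y]
    {ν : Measure Y} [SFinite ν] (hh : MemFock μ tm e q ∅ h) :
    JointlyMeasurable μ tm e ν (fun _ => ∅) fun _ => h := by
  rw [jointlyMeasurable_iff R (chainLike_const ∅ (by simp))]
  refine (((memFock_empty_iff R h).1 hh).1.comp_snd).congr (.of_forall fun z => ?_)
  dsimp only
  rw [Finset.union_empty]

theorem jointlyMeasurable_point (R : Regular μ tm e) (hh : MemFock μ tm e q ∅ h) :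
    JointlyMeasurable μ tm e μ (fun x => {x}) fun _ => h := by
  have h1 := (jointlyMeasurable_union_const R (σ := ∅) (by simp) hh.1
    (quasiMeasurePreserving_sing μ R.time.measurable) (ρ := fun x => {x})
    (.of_forall fun x => (pts_sing x).symm)).2
  exact jointlyMeasurable_congr h1 (fun x => Finset.union_empty _) fun _ => rfl

theorem ae_memFock_point (R : Regular μ tm e) (hu : IsWeight μ u) (hw : IsWeight μ w)
    (hle : u + w ≤ q') (hh : MemFock μ tm e q' ∅ h) : ∀ᵐ x ∂μ, MemFock μ tm e w {x} h := by
  obtain ⟨h1, h2⟩ := (memFock_empty_iff R h).1 hh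
  obtain ⟨h3, h4⟩ := scalarNorm_point R.time hu hw hle
    (φ := fun ω => ‖h ω‖ₑ) (by simpa only [enorm_ef] using h1.enorm)
  have h5 := (jointlyMeasurable_iff R chainLike_sing).1 (jointlyMeasurable_point R hh)
  filter_upwards [ae_lt_top' ((h3.pow_const 2).mul hu.aemeasurable.coe_nnreal_ennreal)
    (h4.trans_lt h2).ne, h5.prodMk_left] with x h6 h7
  exact ⟨(isEssMeasurable_iff R.field R.time.measurable
      (chainLike_union_const R.time (by simp))).2 h7,
    lt_top_of_sq_mul_lt_top (hu.pos x) h6⟩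

variable {σ τ : X → Finset X} {D : X → Sec K → Sec K} {T : ℝ≥0} {Δ : Set X}

theorem lintegral_operator_le (R : Regular μ tm e) (hq : IsWeight μ q)
    (hτ : ∀ x, Set.InjOn tm (τ x : Set X))
    (hD : ∀ᵐ x ∂μ.restrict Δ, IsOperator μ tm e q (σ x) (τ x) (D x))
    (hh : ∀ᵐ x ∂μ.restrict Δ, MemFock μ tm e q (σ x) h) (φ : Finset X → ℝ≥0∞) :
    ∫⁻ x in Δ, ∫⁻ ϰ, φ (pts ϰ ∪ τ x) * ‖D x h (pts ϰ ∪ τ x)‖ₑ ∂𝔪 ∂μ ≤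
      ∫⁻ x in Δ, opNorm μ tm e q (σ x) (τ x) (D x) * fockNorm μ tm q (σ x) h *
        scalarNorm μ tm q φ (τ x) ∂μ := by
  refine lintegral_mono_ae ?_
  filter_upwards [hD, hh] with x h1 h2
  have h3 := lintegral_enorm_mul_le R hq (hτ x) (h1.maps _ h2) fun ϰ => φ (pts ϰ ∪ τ x)
  simp only [mul_comm ‖_‖ₑ] at h3
  exact h3.trans (mul_le_mul_left (h1.fockNorm_le h2) _)

/-- `F(q) → F(q⁻¹)` with integrable norm. -/
theorem singleBound_MP (R : Regular μ tm e) (hq : IsWeight μ q) (hqq : q ≤ q')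
    (hD : IsOpField μ tm R.field μ q (fun _ => ∅) (fun _ => ∅) D)
    [IsSeparable μ] (hh : MemFock μ tm e q' ∅ h) :
    SingleBound μ tm q' {x | tm x < T} (fun _ => ∅) (fun x => D x h)
      (normOne μ tm e q T (fun _ => ∅) (fun _ => ∅) D * fockNorm μ tm q' ∅ h) := by
  intro φ hφ hfin
  have hN := (hD.aemeasurable_opNorm R hq).restrict (s := {x | tm x < T})
  refine (lintegral_operator_le R hq (fun _ => by simp) (ae_restrict_of_ae hD.isOperator)
    (.of_forall fun _ => hh.mono hqq) φ).trans ?_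
  simp only [mul_assoc]
  rw [lintegral_mul_const'' _ hN]
  exact mul_le_mul_right (mul_le_mul' (fockNorm_mono hqq h) (scalarNorm_empty_le hqq φ)) _

/-- `F(q) ⊗ K x → F(q⁻¹)` with square integrable norm. -/
theorem singleBound_MO (R : Regular μ tm e) (hq : IsWeight μ q) (hqq : q ≤ q')
    (hr : IsWeight μ r) (hle : r⁻¹ + q ≤ q')
    (hD : IsOpField μ tm R.field μ q (fun x => {x}) (fun _ => ∅) D)
    [IsSeparable μ] (hh : MemFock μ tm e q' ∅ h) :
    SingleBound μ tm q' {x | tm x < T} (fun _ => ∅) (fun x => D x h)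
      (normTwo μ tm e q r T (fun x => {x}) (fun _ => ∅) D * fockNorm μ tm q' ∅ h) := by
  intro φ hφ hfin
  obtain ⟨h1, -⟩ := (memFock_empty_iff R h).1 hh
  obtain ⟨h3, h4⟩ := scalarNorm_point R.time hr.inv hq hle
    (φ := fun ω => ‖h ω‖ₑ) (by simpa only [enorm_ef] using h1.enorm)
  have hN := (hD.aemeasurable_opNorm R hq).restrict (s := {x | tm x < T})
  refine (lintegral_operator_le R hq (fun _ => by simp) (ae_restrict_of_ae hD.isOperator)
    (ae_restrict_of_ae (ae_memFock_point R hr.inv hq hle hh)) φ).trans ?_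
  have hm : AEMeasurable (fun x => opNorm μ tm e q {x} ∅ (D x) * fockNorm μ tm q {x} h)
      (μ.restrict {x | tm x < T}) := hN.mul h3.restrict
  rw [lintegral_mul_const'' _ hm]
  refine mul_le_mul' ((lintegral_mul_le_weight hN h3.restrict hr.aemeasurable.restrict hr.pos).trans
    (mul_le_mul_right ?_ _)) (scalarNorm_empty_le hqq φ)
  rw [fockNorm_empty_eq]
  exact sqrt_le_sqrt ((setLIntegral_le_lintegral _ _).trans h4)

/-- `F(q) → F(q⁻¹) ⊗ K x` with square integrable norm. -/
theorem singleBound_OP (R : Regular μ tm e) (hq : IsWeight μ q) (hqq : q ≤ q')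
    (hr : IsWeight μ r) (hle : r⁻¹ + q ≤ q')
    (hD : IsOpField μ tm R.field μ q (fun _ => ∅) (fun x => {x}) D)
    [IsSeparable μ] (hh : MemFock μ tm e q' ∅ h) :
    SingleBound μ tm q' {x | tm x < T} (fun x => {x}) (fun x => D x h)
      (normTwo μ tm e q r T (fun _ => ∅) (fun x => {x}) D * fockNorm μ tm q' ∅ h) := by
  intro φ hφ hfin
  obtain ⟨h3, h4⟩ := scalarNorm_point R.time hr.inv hq hle hφ
  have hN := (hD.aemeasurable_opNorm R hq).restrict (s := {x | tm x < T})
  refine (lintegral_operator_le R hq (fun _ => by simp) (ae_restrict_of_ae hD.isOperator)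
    (.of_forall fun _ => hh.mono hqq) φ).trans ?_
  simp only [mul_right_comm _ (fockNorm μ tm q ∅ h)]
  have hm : AEMeasurable (fun x => opNorm μ tm e q ∅ {x} (D x) * scalarNorm μ tm q φ {x})
      (μ.restrict {x | tm x < T}) := hN.mul h3.restrict
  rw [lintegral_mul_const'' _ hm, mul_right_comm]
  refine mul_le_mul' ((lintegral_mul_le_weight hN h3.restrict hr.aemeasurable.restrict hr.pos).trans
    (mul_le_mul_right ?_ _)) (fockNorm_mono hqq h)
  exact sqrt_le_sqrt ((setLIntegral_le_lintegral _ _).trans h4)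

/-- `F(q) ⊗ K x → F(q⁻¹) ⊗ K x` with essentially bounded norm. -/
theorem singleBound_OO (R : Regular μ tm e) (hq : IsWeight μ q)
    (hs : IsWeight μ s) (hle : s⁻¹ + q ≤ q')
    (hD : IsOpField μ tm R.field μ q (fun x => {x}) (fun x => {x}) D)
    [IsSeparable μ] (hh : MemFock μ tm e q' ∅ h) :
    SingleBound μ tm q' {x | tm x < T} (fun x => {x}) (fun x => D x h)
      (normInf μ tm e q s T (fun x => {x}) (fun x => {x}) D * fockNorm μ tm q' ∅ h) := by
  intro φ hφ hfin
  obtain ⟨h1, -⟩ := (memFock_empty_iff R h).1 hh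
  obtain ⟨h3, h4⟩ := scalarNorm_point R.time hs.inv hq hle
    (φ := fun ω => ‖h ω‖ₑ) (by simpa only [enorm_ef] using h1.enorm)
  obtain ⟨h5, h6⟩ := scalarNorm_point R.time hs.inv hq hle hφ
  have hi := hs.inv.aemeasurable.coe_nnreal_ennreal
  refine (lintegral_operator_le R hq (fun _ => by simp) (ae_restrict_of_ae hD.isOperator)
    (ae_restrict_of_ae (ae_memFock_point R hs.inv hq hle hh)) φ).trans ?_
  set N := normInf μ tm e q s T (fun x => {x}) (fun x => {x}) D
  have hN : ∀ᵐ x ∂μ.restrict {x | tm x < T}, opNorm μ tm e q {x} {x} (D x) ≤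
      N * ((s⁻¹ x : ℝ≥0) : ℝ≥0∞) := by
    filter_upwards [ENNReal.ae_le_essSup (μ := μ.restrict {x | tm x < T})
      fun x => (s x : ℝ≥0∞) * opNorm μ tm e q {x} {x} (D x)] with x hx
    calc opNorm μ tm e q {x} {x} (D x) = (s x : ℝ≥0∞) * opNorm μ tm e q {x} {x} (D x) *
          ((s⁻¹ x : ℝ≥0) : ℝ≥0∞) := by
          rw [mul_right_comm, ← ENNReal.coe_mul, Pi.inv_apply, mul_inv_cancel₀ (hs.pos x).ne',
            ENNReal.coe_one, one_mul]
      _ ≤ _ := mul_le_mul_left hx _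
  let f : X → ℝ≥0∞ := fun x => fockNorm μ tm q {x} h * ((s⁻¹ x : ℝ≥0) : ℝ≥0∞)
  have hf : AEMeasurable f (μ.restrict {x | tm x < T}) := (h3.mul hi).restrict
  have hE : ∀ x, f x ^ 2 * (s x : ℝ≥0∞) =
      fockNorm μ tm q {x} h ^ 2 * ((s⁻¹ x : ℝ≥0) : ℝ≥0∞) := fun x => by
    have : ((s⁻¹ x : ℝ≥0) : ℝ≥0∞) * (s x : ℝ≥0∞) = 1 := by
      rw [← ENNReal.coe_mul, Pi.inv_apply, inv_mul_cancel₀ (hs.pos x).ne', ENNReal.coe_one]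
    simp only [f]
    rw [mul_pow, sq ((s⁻¹ x : ℝ≥0) : ℝ≥0∞), mul_assoc, mul_assoc, this, mul_one]
  calc _ ≤ ∫⁻ x in {x | tm x < T}, N * (f x * scalarNorm μ tm q φ {x}) ∂μ := by
        refine lintegral_mono_ae ?_
        filter_upwards [hN] with x hx
        calc _ ≤ N * ((s⁻¹ x : ℝ≥0) : ℝ≥0∞) * fockNorm μ tm q {x} h * scalarNorm μ tm q φ {x} := by
              gcongr
          _ = _ := by simp only [f]; ring
    _ = N * ∫⁻ x in {x | tm x < T}, f x * scalarNorm μ tm q φ {x} ∂μ :=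
        lintegral_const_mul'' _ (hf.mul h5.restrict)
    _ ≤ N * (fockNorm μ tm q' ∅ h * _) := by
        refine mul_le_mul_right ((lintegral_mul_le_weight hf h5.restrict hs.aemeasurable.restrict
          hs.pos).trans (mul_le_mul' ?_ (sqrt_le_sqrt
            ((setLIntegral_le_lintegral _ _).trans h6)))) _
        simp only [hE]
        rw [fockNorm_empty_eq]
        exact sqrt_le_sqrt ((setLIntegral_le_lintegral _ _).trans h4)
    _ = _ := (mul_assoc _ _ _).symm

end SingleBounds

/-! ### The differential of the multiple integral -/
section Differential

variable {p r s q q' : X → ℝ≥0} {a : X → Table X} {σ τ : X → Finset X} {B : Kernel K} {f h : Sec K}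

/-- The weak form of the derivatives: a matrix element of the derivative at `x` is the integral of
the matrix elements of `B` over the tables which are obtained by adjoining `x` as last point. -/
theorem ae_pairing_derivative {R : Regular μ tm e} (hw : AreWeights μ p r s)
    (hle : r⁻¹ + p + s⁻¹ ≤ q) (ha : IsAtom μ tm a σ τ) {D : X → Sec K → Sec K}
    (hA : ∀ᵐ x ∂μ, IsIntegrand R p r s (tm x) (σ x) (τ x) (derivKernel B (a x)))
    (hD : IsDerivative μ tm e q σ τ (fun x => derivKernel B (a x)) D)
    (hf : ∀ᵐ x ∂μ, MemFock μ tm e q (τ x) f) (hh : ∀ᵐ x ∂μ, MemFock μ tm e q (σ x) h) :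
    ∀ᵐ x ∂μ, Integrable (fun z => pairing μ tm ((ofChains z).union (a x)).out f
        (B ((ofChains z).union (a x)) h)) 𝔱[tm x] ∧
      pairing μ tm (τ x) f (D x h) = ∫ z, pairing μ tm ((ofChains z).union (a x)).out f
        (B ((ofChains z).union (a x)) h) ∂𝔱[tm x] := by
  filter_upwards [hA, hD.converges, hf, hh] with x h1 h2 h3 h4
  have h5 := (h2 h h4).pairing_eq hw hle h1 h3 h4
  simp only [ha.out]
  exact h5

theorem isOperator_table_empty (hB : IsMeasurableKernel μ tm e w B) :
    IsOperator μ tm e w ∅ ∅ (B Table.empty) := by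
  have h1 := ae_emptyChain μ (ae_ae_of_ae_prod (ae_emptyChain μ
    (ae_ae_of_ae_prod (ae_emptyChain μ (ae_ae_of_ae_prod hB.isOperator)))))
  have h2 := ae_emptyChain μ h1
  have h3 : ofChains (emptyChain tm, emptyChain tm, emptyChain tm, emptyChain tm) =
      Table.empty := by simp [ofChains, Table.empty, pts_emptyChain]
  have h4 : (Table.empty : Table X).inp = ∅ := by simp [Table.empty, Table.inp]
  have h5 : (Table.empty : Table X).out = ∅ := by simp [Table.empty, Table.out]
  rwa [h3, h4, h5] at h2

variable [IsSeparable μ]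

/-- The single integrals of the derivatives exist, and in the sense of matrix elements they are the
integrals over the tables whose last point lies in the corresponding position. -/
theorem multiIntegral_eq_add_singleIntegral (R : Regular μ tm e) (hw : AreWeights μ p r s)
    (hq : IsWeight μ q) (hle : r⁻¹ + p + s⁻¹ ≤ q) (hq' : IsWeight μ q') (hqq : q ≤ q')
    (hrq : r⁻¹ + q ≤ q') (hsq : s⁻¹ + q ≤ q')
    (hB : IsLocallyIntegrable μ tm e p r s B) (T : ℝ≥0) (hh : MemFock μ tm e q' ∅ h) :
    HasSingleIntegral μ tm e T (qsDeriv μ tm e B) h ∧ EqFock μ tm ∅ (multiIntegral μ tm e T ∅ B h)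
        (B Table.empty h + singleIntegral μ tm e T (qsDeriv μ tm e B) h) := by
  have ht := R.time
  have hΔ : MeasurableSet {x | tm x < T} := measurableSet_lt ht.measurable measurable_const
  have hac : μ.restrict {x | tm x < T} ≪ μ := Measure.restrict_le_self.absolutelyContinuous
  have aMP := isAtom_MP ht
  have aMO := isAtom_MO ht
  have aOP := isAtom_OP ht
  have aOO := isAtom_OO ht
  have iMP := ae_isIntegrand_deriv R hw hB.measurable aMP (ae_kernelNorm_MP R hw hB)
  have iMO := ae_isIntegrand_deriv R hw hB.measurable aMO (ae_kernelNorm_MO R hw hB)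
  have iOP := ae_isIntegrand_deriv R hw hB.measurable aOP (ae_kernelNorm_OP R hw hB)
  have iOO := ae_isIntegrand_deriv R hw hB.measurable aOO (ae_kernelNorm_OO R hw hB)
  have fMP : IsOpField μ tm R.field μ q (fun _ => ∅) (fun _ => ∅) (qsDeriv μ tm e B).mp :=
    isOpField_multiIntegral_deriv hw hq hle hB.measurable aMP iMP
  have fMO : IsOpField μ tm R.field μ q (fun x => {x}) (fun _ => ∅) (qsDeriv μ tm e B).mo :=
    isOpField_multiIntegral_deriv hw hq hle hB.measurable aMO iMO
  have fOP : IsOpField μ tm R.field μ q (fun _ => ∅) (fun x => {x}) (qsDeriv μ tm e B).op :=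
    isOpField_multiIntegral_deriv hw hq hle hB.measurable aOP iOP
  have fOO : IsOpField μ tm R.field μ q (fun x => {x}) (fun x => {x}) (qsDeriv μ tm e B).oo :=
    isOpField_multiIntegral_deriv hw hq hle hB.measurable aOO iOO
  have hC : ∀ {N : ℝ≥0∞}, N ≤ multiNorm μ tm e p r s T B → N * fockNorm μ tm q' ∅ h < ∞ :=
    fun hN => ENNReal.mul_lt_top (hN.trans_lt (hB.finite T)) hh.2
  have cMP := hC (normOne_qsDeriv_mp_le R hw hq hle hB T)
  have cMO := hC (normTwo_qsDeriv_mo_le R hw hq hle hB T)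
  have cOP := hC (normTwo_qsDeriv_op_le R hw hq hle hB T)
  have cOO := hC (normInf_qsDeriv_oo_le R hw hq hle hB T)
  have bMP := singleBound_MP (T := T) R hq hqq fMP hh
  have bMO := singleBound_MO (T := T) R hq hqq hw.r hrq fMO hh
  have bOP := singleBound_OP (T := T) R hq hqq hw.r hrq fOP hh
  have bOO := singleBound_OO (T := T) R hq hw.s hsq fOO hh
  have mE : ∀ {g : Sec K}, MemFock μ tm e q' ∅ g → ∀ᵐ _ ∂μ, MemFock μ tm e q ∅ g := fun hg =>
    .of_forall fun _ => hg.mono hqq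
  have mX : ∀ {g : Sec K}, MemFock μ tm e q' ∅ g → ∀ᵐ x ∂μ, MemFock μ tm e q {x} g := fun hg =>
    ae_memFock_point R hw.r.inv hq hrq hg
  have jE : JointlyMeasurable μ tm e (μ.restrict {x | tm x < T}) (fun _ => ∅) fun _ => h :=
    jointlyMeasurable_const R hh
  have jX : JointlyMeasurable μ tm e (μ.restrict {x | tm x < T}) (fun x => {x}) fun _ => h :=
    (jointlyMeasurable_iff R chainLike_sing).2
      (((jointlyMeasurable_iff R chainLike_sing).1 (jointlyMeasurable_point R hh)).mono_ac
        (hac.prod (.refl _)))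
  -- the families of derivatives have jointly measurable versions, which can be integrated
  have H : HasSingleIntegral μ tm e T (qsDeriv μ tm e B) h := by
    refine ⟨?_, ?_, ?_, ?_⟩
    · obtain ⟨Φ, h1, h2⟩ := (fMP.mono hac).exists_version R hq jE (hac.ae_le (mE hh))
      exact exists_hasTimeIntegral R hq' cMP h1 h2 bMP
    · obtain ⟨Φ, h1, h2⟩ := (fMO.mono hac).exists_version R hq jX (hac.ae_le (mX hh))
      exact exists_hasTimeIntegral R hq' cMO h1 h2 bMO
    · obtain ⟨Φ, h1, h2⟩ := (fOP.mono hac).exists_version R hq jE (hac.ae_le (mE hh))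
      exact exists_hasPointSum h1 h2
    · obtain ⟨Φ, h1, h2⟩ := (fOO.mono hac).exists_version R hq jX (hac.ae_le (mX hh))
      exact exists_hasPointSum h1 h2
  refine ⟨H, ?_⟩
  have gMP : HasTimeIntegral μ tm e {x | tm x < T} (qsDeriv μ tm e B).mp h
      (timeIntegral μ tm e {x | tm x < T} (qsDeriv μ tm e B).mp h) := by
    rw [timeIntegral, dif_pos H.mp]; exact H.mp.choose_spec
  have gMO : HasTimeIntegral μ tm e {x | tm x < T} (qsDeriv μ tm e B).mo h
      (timeIntegral μ tm e {x | tm x < T} (qsDeriv μ tm e B).mo h) := by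
    rw [timeIntegral, dif_pos H.mo]; exact H.mo.choose_spec
  have gOP : HasPointSum μ tm e {x | tm x < T} (qsDeriv μ tm e B).op h
      (pointSum μ tm e {x | tm x < T} (qsDeriv μ tm e B).op h) := by
    rw [pointSum, dif_pos H.op]; exact H.op.choose_spec
  have gOO : HasPointSum μ tm e {x | tm x < T} (qsDeriv μ tm e B).oo h
      (pointSum μ tm e {x | tm x < T} (qsDeriv μ tm e B).oo h) := by
    rw [pointSum, dif_pos H.oo]; exact H.oo.choose_spec
  obtain ⟨kMP, wMP⟩ := gMP.weak R hq' cMP bMP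
  obtain ⟨kMO, wMO⟩ := gMO.weak R hq' cMO bMO
  obtain ⟨kOP, wOP⟩ := gOP.weak R hq' cOP hΔ bOP
  obtain ⟨kOO, wOO⟩ := gOO.weak R hq' cOO hΔ bOO
  have hE : Set.InjOn tm ((∅ : Finset X) : Set X) := by simp
  have hpq' : p ≤ q' := (le_trans (le_trans le_add_self le_self_add) hle).trans hqq
  have k0 : MemFock μ tm e q'⁻¹ ∅ (B Table.empty h) :=
    ((isOperator_table_empty hB.measurable).maps h (hh.mono hpq')).mono fun x =>
      inv_anti₀ (hw.p.pos x) (hpq' x)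
  have hI := isIntegrand_of_isLocallyIntegrable R hw hB T
  have hle' := hle.trans hqq
  have kI := (isOperator_multiIntegral hw hq' hle' hI).1.maps h hh
  have k1 := kMP.add R hq'.inv hE kOP
  have k2 := k1.add R hq'.inv hE kMO
  have k3 := k2.add R hq'.inv hE kOO
  -- both sides are compared by their matrix elements
  refine eqFock_of_pairing' R hq' hE kI (k0.add R hq'.inv hE k3) fun f hf => ?_
  rw [singleIntegral, pairing_add R hq' hE hf k0 k3, pairing_add R hq' hE hf k2 kOO,
    pairing_add R hq' hE hf k1 kMO, pairing_add R hq' hE hf kMP kOP,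
    (wMP f hf).2, (wMO f hf).2, (wOP f hf).2, (wOO f hf).2]
  obtain ⟨dMP, dMO, dOP, dOO⟩ := isDerivative_qsDeriv R hw hq hle hB
  have pMP := ae_pairing_derivative hw hle aMP iMP dMP (mE hf) (mE hh)
  have pMO := ae_pairing_derivative hw hle aMO iMO dMO (mE hf) (mX hh)
  have pOP := ae_pairing_derivative hw hle aOP iOP dOP (mX hf) (mE hh)
  have pOO := ae_pairing_derivative hw hle aOO iOO dOO (mX hf) (mX hh)
  obtain ⟨iI, eI⟩ := (hasMultiIntegral_multiIntegral hw hq' hle' hI hh).pairing_eq hw hle' hI hf hh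
  simp only [Finset.union_empty] at iI eI
  -- the tables are sorted by the position of their last point
  rw [eI, integral_lastPoint_table (ψ := fun ϑ => pairing μ tm ϑ.out f (B ϑ h)) ht iI]
  · have h0 : (Table.empty : Table X).out = ∅ := by simp [Table.empty, Table.out]
    rw [h0]
    congr 1
    have hsum : ∀ {f₁ f₂ f₃ f₄ : X → ℂ} {ν : Measure X}, Integrable f₁ ν → Integrable f₂ ν →
        Integrable f₃ ν → Integrable f₄ ν → ∫ x, f₁ x ∂ν + ∫ x, f₂ x ∂ν + ∫ x, f₃ x ∂ν + ∫ x, f₄ x ∂ν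
          = ∫ x, (f₁ x + f₂ x + f₃ x + f₄ x) ∂ν := fun {f₁ f₂ f₃ f₄ ν} h₁ h₂ h₃ h₄ => by
      have h₁₂ : Integrable (fun x => f₁ x + f₂ x) ν := h₁.add h₂
      have h₁₂₃ : Integrable (fun x => f₁ x + f₂ x + f₃ x) ν := h₁₂.add h₃
      rw [← integral_add h₁ h₂, ← integral_add h₁₂ h₃, ← integral_add h₁₂₃ h₄]
    rw [hsum (wMP f hf).1 (wOP f hf).1 (wMO f hf).1 (wOO f hf).1]
    refine integral_congr_ae ?_
    filter_upwards [hac.ae_le pMP, hac.ae_le pMO, hac.ae_le pOP, hac.ae_le pOO] with x h1 h2 h3 h4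
    rw [h1.2, h2.2, h3.2, h4.2]
    ring
  · simp only [List.mem_cons, List.not_mem_nil, or_false, forall_eq_or_imp, forall_eq]
    exact ⟨hac.ae_le (pMP.mono fun _ h => h.1), hac.ae_le (pMO.mono fun _ h => h.1),
      hac.ae_le (pOP.mono fun _ h => h.1), hac.ae_le (pOO.mono fun _ h => h.1)⟩

end Differential

/-! ### Weights -/
section Weights

variable {X : Type*} [MeasurableSpace X] {μ : Measure X} {P0 : AddSubmonoid (X → ℝ≥0)} {w : X → ℝ≥0}

theorem isWeight_of_mem_P1 (hP0 : ∀ u ∈ P0, AEMeasurable u μ) (hw : w ∈ P1 P0) : IsWeight μ w := by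
  obtain ⟨u, hu, rfl⟩ := hw
  exact ⟨aemeasurable_const.add (hP0 u hu), fun x => add_pos_of_pos_of_nonneg one_pos (zero_le)⟩

theorem isWeight_of_inv_mem (hP0 : ∀ u ∈ P0, AEMeasurable u μ)
    (hpos : ∀ x, 0 < w x) (hw : w⁻¹ ∈ P0) : IsWeight μ w :=
  ⟨by simpa using (hP0 _ hw).inv, hpos⟩

theorem add_mem_P1 {u v : X → ℝ≥0} (hw : w ∈ P1 P0) (hu : u ∈ P0) (hv : v ∈ P0) :
    u + w + v ∈ P1 P0 := by
  obtain ⟨w', hw', rfl⟩ := hw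
  exact ⟨u + w' + v, add_mem (add_mem hu hw') hv, by abel⟩

end Weights

end FockSections

end FockScale

open FockScale

theorem mainTheorem4 {X : Type*} [MeasurableSpace X] (μ : Measure X) [SigmaFinite μ]
    [IsSeparable μ]
    (tm : X → ℝ≥0) (htm : Measurable tm) (htm0 : ∀ c : ℝ≥0, μ {x | tm x = c} = 0)
    {K : X → Type*} [∀ x, NormedAddCommGroup (K x)] [∀ x, InnerProductSpace ℂ (K x)]
    [∀ x, CompleteSpace (K x)] (e : ℕ → ∀ x, K x) (he : IsFundamental e)
    (P0 : AddSubmonoid (X → ℝ≥0)) (hP0 : ∀ u ∈ P0, AEMeasurable u μ)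
    (p r s : X → ℝ≥0) (hp : p ∈ P1 P0)
    (hr : ∀ x, 0 < r x) (hr' : r⁻¹ ∈ P0) (hs : ∀ x, 0 < s x) (hs' : s⁻¹ ∈ P0)
    (B : Kernel K) (hB : IsLocallyIntegrable μ tm e p r s B) :
    -- the integral is a continuous operator from the projective to the inductive limit
    (∀ T, IsContinuousOperator μ tm e P0 (multiIntegral μ tm e T ∅ B)) ∧
    -- it converges on `F(q)` and satisfies the estimate
    (∀ T, ∀ q ∈ P1 P0, r⁻¹ + p + s⁻¹ ≤ q →
      (∀ h, MemFock μ tm e q ∅ h →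
        HasMultiIntegral μ tm e T ∅ B h (multiIntegral μ tm e T ∅ B h)) ∧
      IsOperator μ tm e q ∅ ∅ (multiIntegral μ tm e T ∅ B) ∧
      opNorm μ tm e q ∅ ∅ (multiIntegral μ tm e T ∅ B) ≤ multiNorm μ tm e p r s T B) ∧
    -- the values of the kernel `B^⋆` are indeed the adjoint operators
    (∀ᵐ z ∂tableMeasure tm (chainMeasure μ tm), ∀ f h,
      MemFock μ tm e p (Table.ofChains z).inp f → MemFock μ tm e p (Table.ofChains z).out h →
      pairing μ tm (Table.ofChains z).out (starKernel μ tm e p B (Table.ofChains z) f) h =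
        pairing μ tm (Table.ofChains z).inp f (B (Table.ofChains z).transpose h)) ∧
    IsLocallyIntegrable μ tm e p r s (starKernel μ tm e p B) ∧
    (∀ T, multiNorm μ tm e p r s T (starKernel μ tm e p B) = multiNorm μ tm e p r s T B) ∧
    -- the integral of `B^⋆` is continuous and is the adjoint of the integral of `B`
    (∀ T, IsContinuousOperator μ tm e P0 (multiIntegral μ tm e T ∅ (starKernel μ tm e p B))) ∧
    (∀ T, ∀ q ∈ P1 P0, r⁻¹ + p + s⁻¹ ≤ q →
      (∀ f, MemFock μ tm e q ∅ f → HasMultiIntegral μ tm e T ∅ (starKernel μ tm e p B) f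
        (multiIntegral μ tm e T ∅ (starKernel μ tm e p B) f)) ∧
      ∀ f h, MemFock μ tm e q ∅ f → MemFock μ tm e q ∅ h →
        pairing μ tm ∅ (multiIntegral μ tm e T ∅ (starKernel μ tm e p B) f) h =
          pairing μ tm ∅ f (multiIntegral μ tm e T ∅ B h)) ∧
    -- the quantum stochastic derivatives are operators in the Fock scale
    (∀ q ∈ P1 P0, r⁻¹ + p + s⁻¹ ≤ q →
      IsDerivative μ tm e q (fun _ => ∅) (fun _ => ∅)
        (fun x => derivKernel B (Table.atomMP x)) (qsDeriv μ tm e B).mp ∧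
      IsDerivative μ tm e q (fun x => {x}) (fun _ => ∅)
        (fun x => derivKernel B (Table.atomMO x)) (qsDeriv μ tm e B).mo ∧
      IsDerivative μ tm e q (fun _ => ∅) (fun x => {x})
        (fun x => derivKernel B (Table.atomOP x)) (qsDeriv μ tm e B).op ∧
      IsDerivative μ tm e q (fun x => {x}) (fun x => {x})
        (fun x => derivKernel B (Table.atomOO x)) (qsDeriv μ tm e B).oo) ∧
    -- with the bounds
    (∀ T, ∀ q ∈ P1 P0, r⁻¹ + p + s⁻¹ ≤ q →
      normOne μ tm e q T (fun _ => ∅) (fun _ => ∅) (qsDeriv μ tm e B).mp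
        ≤ multiNorm μ tm e p r s T B ∧
      normTwo μ tm e q r T (fun x => {x}) (fun _ => ∅) (qsDeriv μ tm e B).mo
        ≤ multiNorm μ tm e p r s T B ∧
      normTwo μ tm e q r T (fun _ => ∅) (fun x => {x}) (qsDeriv μ tm e B).op
        ≤ multiNorm μ tm e p r s T B ∧
      normInf μ tm e q s T (fun x => {x}) (fun x => {x}) (qsDeriv μ tm e B).oo
        ≤ multiNorm μ tm e p r s T B) ∧
    -- and they give the quantum stochastic differential
    (∀ T h, MemPlus μ tm e P0 h →
      HasSingleIntegral μ tm e T (qsDeriv μ tm e B) h ∧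
      EqFock μ tm ∅ (multiIntegral μ tm e T ∅ B h)
        (B Table.empty h + singleIntegral μ tm e T (qsDeriv μ tm e B) h)) := by
  have R : Regular μ tm e := ⟨⟨htm, htm0⟩, he⟩
  have hw : AreWeights μ p r s := ⟨isWeight_of_mem_P1 hP0 hp, isWeight_of_inv_mem hP0 hr hr',
    isWeight_of_inv_mem hP0 hs hs'⟩
  have hB' := isLocallyIntegrable_starKernel R hw hB
  have hq₀ := add_mem_P1 hp hr' hs'
  have hI := isIntegrand_of_isLocallyIntegrable R hw hB
  have hI' := isIntegrand_of_isLocallyIntegrable R hw hB'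
  refine ⟨fun T => isContinuousOperator_multiIntegral hw (isWeight_of_mem_P1 hP0 hq₀) le_rfl
      (hI T) hq₀, fun T q hq hle => ?_, starKernel_spec R hw.p hB.measurable, hB',
    multiNorm_starKernel R hw hB.measurable,
    fun T => isContinuousOperator_multiIntegral hw (isWeight_of_mem_P1 hP0 hq₀) le_rfl
      (hI' T) hq₀, fun T q hq hle => ?_, fun q hq hle => ?_, fun T q hq hle => ?_,
    fun T h hh => ?_⟩
  · have hq' := isWeight_of_mem_P1 hP0 hq
    obtain ⟨h1, h2⟩ := isOperator_multiIntegral hw hq' hle (hI T)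
    exact ⟨fun h hh => hasMultiIntegral_multiIntegral hw hq' hle (hI T) hh, h1,
      h2.trans_eq (kernelNorm_empty p r s T B)⟩
  · have hq' := isWeight_of_mem_P1 hP0 hq
    exact ⟨fun f hf => hasMultiIntegral_multiIntegral hw hq' hle (hI' T) hf,
      fun f h hf hh => pairing_multiIntegral_starKernel R hw hq' hle hB T hf hh⟩
  · exact isDerivative_qsDeriv R hw (isWeight_of_mem_P1 hP0 hq) hle hB
  · have hq' := isWeight_of_mem_P1 hP0 hq
    exact ⟨normOne_qsDeriv_mp_le R hw hq' hle hB T, normTwo_qsDeriv_mo_le R hw hq' hle hB T,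
      normTwo_qsDeriv_op_le R hw hq' hle hB T, normInf_qsDeriv_oo_le R hw hq' hle hB T⟩
  · -- one more step up the scale makes room for the point which is split off
    have hq₁ := add_mem_P1 hq₀ hr' hs'
    exact multiIntegral_eq_add_singleIntegral R hw (isWeight_of_mem_P1 hP0 hq₀) le_rfl
      (isWeight_of_mem_P1 hP0 hq₁) (le_add_self.trans le_self_add) le_self_add
      (le_trans (by rw [add_comm]) (add_le_add_left le_add_self _)) hB T (hh _ hq₁)
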